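/- Conventions. A monoid is a commutative monoid $A$ with $1$ and with an absorbing element $0$; an $A$-set is a pointed set with an action of $A$ such that $0$ acts as the constant map to the base point and every $a\in A$ fixes the base point. $\operatorname{spec}A$ is the space of prime ideals of $A$ with its structure sheaf, $D_f\mapsto A_f$; an $\mathcal M_0$-scheme is a space with a sheaf of monoids that is locally isomorphic to such spectra. Its base extension $\widetilde X_{\mathbb Z}$ is the scheme glued from $\operatorname{Spec}\Gamma(U)_{\mathbb Z}$, $U\subseteq\widetilde X$ affine open, where $A_{\mathbb Z}=\mathbb Z[A]/(1\cdot 0_A)$; it comes with the continuous map $\beta:\widetilde X_{\mathbb Z}\to\widetilde X$. For an $\mathcal O_{\widetilde X}$-module $\widetilde M$ (a sheaf of pointed sets with an action of $\mathcal O_{\widetilde X}$), $\widetilde M_{\mathbb Z}$ is the $\mathcal O_{\widetilde X_{\mathbb Z}}$-module $\beta^{-1}\widetilde M\otimes_{\beta^{-1}\mathcal O_{\widetilde X}}\mathcal O_{\widetilde X_{\mathbb Z}}$ (base points become $0$). An $\mathbb F_1$-scheme is a triple $\mathcal X=(\widetilde X,X,e_X)$ of an $\mathcal M_0$-scheme $\widetilde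 X$, a scheme $X$ and a morphism $e_X:\widetilde X_{\mathbb Z}\to X$ that is bijective on $k$-points for every field $k$. An $\mathcal O_{\mathcal X}$-module is a triple $(\widetilde M,M,\epsilon_M)$ of an $\mathcal O_{\widetilde X}$-module, an $\mathcal O_X$-module and an isomorphism $\epsilon_M:\widetilde M_{\mathbb Z}\to e_X^*M$; morphisms are pairs $(\widetilde f,f)$ compatible with the $\epsilon$'s. It is (quasi-)coherent if both components are: $\widetilde M$ is quasi-coherent (coherent) if it is locally, on affine opens $U$, the sheaf associated with a (finitely generated) $\Gamma(U)$-set; coherent on $X$ means quasi-coherent of finite type. $\operatorname{QCoh}\mathcal X$ is the category of quasi-coherent $\mathcal O_{\mathcal X}$-modules, and $\operatorname{Bun}\mathcal X$ its full subcategory of coherent modules such that $\widetilde M$ is locally projective (quasi-coherent, with $\widetilde M(U_i)$ a projective $\Gamma(U_i)$-set for an affine cover $\{U_i\}$) and $M$ is locally free. Let $\mathbf 0$ be the zero module; kernels are equalizers with the zero morphism in the category of $\mathcal O_{\mathcal X}$-modules. The morphism $(\widetilde f,f)$ is normal if on every stalk of $\widetilde X$ all fibres of $\widetilde f$ except the one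 over the base point have at most one element, and $0\to e_X^*\ker f\to e_X^*M\to e_X^*N$ is exact. A sequence $\mathcal M_1\xrightarrow{\varphi}\mathcal M_2\xrightarrow{\psi}\mathcal M_3$ is exact at $\mathcal M_2$ if $\ker\psi$ exists and equals the (componentwise) image of $\varphi$. A morphism $\varphi$ of $\operatorname{Bun}\mathcal X$ is a $K$-admissible monomorphism if there is a sequence $\mathbf 0\to\mathcal M_1\xrightarrow{\varphi}\mathcal M_2\xrightarrow{\psi}\mathcal M_3\to\mathbf 0$ that is exact at all three $\mathcal M_i$, with $\mathcal M_i\in\operatorname{Bun}\mathcal X$ and $\varphi,\psi$ normal. Proposition. Let $\mathcal X=(\widetilde X,X,e_X)$ be an $\mathbb F_1$-scheme. The componentwise tensor product $$(\widetilde M,M,\epsilon_M)\otimes(\widetilde N,N,\epsilon_N)=(\widetilde M\otimes\widetilde N,\;M\otimes N,\;\epsilon_M\otimes\epsilon_N)$$ (where $\widetilde M\otimes\widetilde N$ is the sheaf associated with $U\mapsto \widetilde M(U)\times\widetilde N(U)/((am,n)\sim(m,an))$, and $\epsilon_M\otimes\epsilon_N$ is read through the canonical isomorphisms $(\widetilde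 M\otimes\widetilde N)_{\mathbb Z}\cong\widetilde M_{\mathbb Z}\otimes\widetilde N_{\mathbb Z}$ and $e_X^*M\otimes e_X^*N\cong e_X^*(M\otimes N)$), together with the unit $(\mathcal O_{\widetilde X},\mathcal O_X,\epsilon)$, $\epsilon(1)=1$, and the usual associativity, unit and symmetry isomorphisms, makes $\operatorname{QCoh}\mathcal X$ a symmetric monoidal category. The subcategory $\operatorname{Bun}\mathcal X$ contains the unit and is closed under $\otimes$. Moreover $\otimes$ is bi-exact on $\operatorname{Bun}\mathcal X$: (1) $\mathbf 0\otimes\mathcal M\cong\mathbf 0\cong\mathcal M\otimes\mathbf 0$ for every $\mathcal M\in\operatorname{Bun}\mathcal X$; (2) for every $\mathcal M\in\operatorname{Bun}\mathcal X$ the functors $\mathcal M\otimes-$ and $-\otimes\mathcal M$ on $\operatorname{Bun}\mathcal X$ send isomorphisms to isomorphisms, $K$-admissible monomorphisms to $K$-admissible monomorphisms, and push-outs in $\operatorname{Bun}\mathcal X$ along $K$-admissible monomorphisms to push-outs along $K$-admissible monomorphisms; (3) for all $K$-admissible monomorphisms $f:\mathcal M\to\mathcal M'$ and $g:\mathcal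 N\to\mathcal N'$ the push-out $(\mathcal M'\otimes\mathcal N)\cup_{\mathcal M\otimes\mathcal N}(\mathcal M\otimes\mathcal N')$ exists in $\operatorname{Bun}\mathcal X$, and the natural map from it to $\mathcal M'\otimes\mathcal N'$ is a $K$-admissible monomorphism. -/

import Mathlib

open CategoryTheory TopologicalSpace Opposite AlgebraicGeometry

universe u

noncomputable section

namespace F1

/-! ## Monoids with zero and their spectra -/

/-- A prime ideal of a commutative monoid with zero. -/
@[ext]
structure PrimeIdl (A : Type u) [CommMonoidWithZero A] where
  carrier : Set A
  zero_mem' : (0 : A) ∈ carrier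
  mul_mem' : ∀ (a : A) {b : A}, b ∈ carrier → a * b ∈ carrier
  one_notMem : (1 : A) ∉ carrier
  mem_or_mem : ∀ {a b : A}, a * b ∈ carrier → a ∈ carrier ∨ b ∈ carrier

/-- The basic open set `D_f` of the spectrum. -/
def basicSet {A : Type u} [CommMonoidWithZero A] (f : A) : Set (PrimeIdl A) :=
  {p | f ∉ p.carrier}

instance (A : Type u) [CommMonoidWithZero A] : TopologicalSpace (PrimeIdl A) :=
  TopologicalSpace.generateFrom (Set.range basicSet)

/-! ## Spaces with a sheaf of monoids -/

/-- A topological space with a sheaf of (commutative) monoids (with zero). -/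
structure MonoidalSpace where
  carrier : TopCat.{u}
  presheaf : TopCat.Presheaf (Type u) carrier
  [monoid : ∀ U : Opens carrier, CommMonoidWithZero (presheaf.obj (op U))]
  map_zero' : ∀ {U V : Opens carrier} (i : V ⟶ U), presheaf.map i.op 0 = 0
  map_one' : ∀ {U V : Opens carrier} (i : V ⟶ U), presheaf.map i.op 1 = 1
  map_mul' : ∀ {U V : Opens carrier} (i : V ⟶ U) (a b : presheaf.obj (op U)),
    presheaf.map i.op (a * b) = presheaf.map i.op a * presheaf.map i.op b
  isSheaf : presheaf.IsSheaf

namespace MonoidalSpace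

attribute [instance] MonoidalSpace.monoid

variable (X : MonoidalSpace.{u})

/-- The open subsets of `X`. -/
abbrev Opn : Type u := Opens X.carrier

/-- The monoid of sections over `U`. -/
abbrev Γ (U : X.Opn) : Type u := X.presheaf.obj (op U)

/-- Restriction of sections. -/
def res {U V : X.Opn} (h : V ≤ U) : X.Γ U →*₀ X.Γ V where
  toFun a := X.presheaf.map (homOfLE h).op a
  map_zero' := X.map_zero' _
  map_one' := X.map_one' _
  map_mul' := X.map_mul' _

lemma res_res {U V W : X.Opn} (h : V ≤ U) (k : W ≤ V) (a : X.Γ U) :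
    X.res k (X.res h a) = X.res (k.trans h) a := by
  change X.presheaf.map (homOfLE k).op (X.presheaf.map (homOfLE h).op a) = _
  rw [← types_comp_apply, ← X.presheaf.map_comp]
  rfl

@[simp] lemma res_rfl {U : X.Opn} (a : X.Γ U) : X.res (le_refl U) a = a := by
  change X.presheaf.map (𝟙 (op U)) a = a
  simp

variable {X}

/-- The homeomorphism `φ` of `U` with the spectrum of `A = Γ(U)` identifies the sheaf on `U` with
the structure sheaf of the spectrum: the restriction to the preimage of `D_f` is, for every `f`,
the localization `A → A_f = A[f⁻¹]`. -/
def IsChart (U : X.Opn) (φ : U ≃ₜ PrimeIdl (X.Γ U)) : Prop :=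
  ∀ (f : X.Γ U) (V : X.Opn) (h : V ≤ U),
    (∀ x : U, (x : X.carrier) ∈ V ↔ φ x ∈ basicSet f) →
      (Submonoid.powers f).IsLocalizationMap (X.res h)

/-- The open set `U` is affine: with the restricted sheaf it is isomorphic to the spectrum of a
monoid (which is then isomorphic to `Γ(U)`) with its structure sheaf. -/
def IsAffineOpn (U : X.Opn) : Prop := ∃ φ : U ≃ₜ PrimeIdl (X.Γ U), IsChart U φ

end MonoidalSpace

namespace PrimeIdl

variable {A B : Type u} [CommMonoidWithZero A] [CommMonoidWithZero B]

lemma notMem_of_isUnit (p : PrimeIdl A) {a : A} (h : IsUnit a) : a ∉ p.carrier := by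
  obtain ⟨b, hb⟩ := h.exists_left_inv
  intro ha
  exact p.one_notMem (hb ▸ p.mul_mem' b ha)

lemma mul_mem_iff (p : PrimeIdl A) {a b : A} :
    a * b ∈ p.carrier ↔ a ∈ p.carrier ∨ b ∈ p.carrier :=
  ⟨p.mem_or_mem, fun h => h.elim (fun h => mul_comm b a ▸ p.mul_mem' b h) (p.mul_mem' a)⟩

lemma mem_of_pow_mem (p : PrimeIdl A) {a : A} (n : ℕ) (h : a ^ n ∈ p.carrier) :
    a ∈ p.carrier := by
  induction n with
  | zero => exact absurd (pow_zero a ▸ h) p.one_notMem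
  | succ n ih =>
    rw [pow_succ] at h
    exact (p.mem_or_mem h).elim ih id

/-- The preimage of a prime ideal. -/
def comap (l : A →*₀ B) (q : PrimeIdl B) : PrimeIdl A where
  carrier := l ⁻¹' q.carrier
  zero_mem' := by simpa using q.zero_mem'
  mul_mem' a b h := by simpa using q.mul_mem' (l a) h
  one_notMem := by simpa using q.one_notMem
  mem_or_mem h := q.mem_or_mem (by simpa using h)

variable {l : A →*₀ B} {f : A}

lemma range_comap (hl : (Submonoid.powers f).IsLocalizationMap l) :
    Set.range (comap l) = basicSet f := by
  ext p
  constructor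
  · rintro ⟨q, rfl⟩
    exact q.notMem_of_isUnit (hl.map_units ⟨f, Submonoid.mem_powers f⟩)
  · intro hp
    have hs : ∀ s ∈ Submonoid.powers f, s ∉ p.carrier := by
      rintro _ ⟨n, rfl⟩ h
      exact hp (p.mem_of_pow_mem n h)
    have key : ∀ {a a' : A} {s : A}, s ∈ Submonoid.powers f → l a * l s = l a' →
        a' ∈ p.carrier → a ∈ p.carrier := by
      intro a a' s hs' h ha'
      rw [← map_mul] at h
      obtain ⟨c, hc⟩ := hl.exists_of_eq h
      have := p.mul_mem' c ha'
      rw [← hc] at this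
      exact ((p.mem_or_mem ((p.mem_or_mem this).resolve_left (hs _ c.2))).resolve_right
        (hs _ hs'))
    refine ⟨⟨{b | ∃ a ∈ p.carrier, ∃ s ∈ Submonoid.powers f, b * l s = l a}, ?_, ?_, ?_, ?_⟩, ?_⟩
    · exact ⟨0, p.zero_mem', 1, one_mem _, by simp⟩
    · rintro b c ⟨a, ha, s, hs', h⟩
      obtain ⟨⟨x, t⟩, hx⟩ := hl.surj b
      refine ⟨x * a, p.mul_mem' x ha, t * s, mul_mem t.2 hs', ?_⟩
      simp only at hx
      rw [map_mul, map_mul, ← hx, ← h]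
      exact mul_mul_mul_comm _ _ _ _
    · rintro ⟨a, ha, s, hs', h⟩
      have := key (a := 1) hs' (by simpa using h) ha
      exact p.one_notMem this
    · rintro b c ⟨a, ha, s, hs', h⟩
      obtain ⟨⟨x, t⟩, hx⟩ := hl.surj b
      obtain ⟨⟨y, w⟩, hy⟩ := hl.surj c
      simp only at hx hy
      have h2 : l (x * y) * l s = l (a * (t * w)) := by
        rw [map_mul, map_mul, map_mul, ← hx, ← hy, ← h]
        simp only [mul_assoc, mul_left_comm, mul_comm]
      have hxy := key hs' h2 (mul_comm a _ ▸ p.mul_mem' _ ha)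
      rcases p.mem_or_mem hxy with h3 | h3
      · exact Or.inl ⟨x, h3, t, t.2, hx⟩
      · exact Or.inr ⟨y, h3, w, w.2, hy⟩
    · ext a
      constructor
      · rintro ⟨a', ha', s, hs', h⟩
        exact key hs' h ha'
      · intro ha
        exact ⟨a, ha, 1, one_mem _, by simp⟩

lemma comap_injective (hl : (Submonoid.powers f).IsLocalizationMap l) :
    Function.Injective (comap l) := by
  intro q q' h
  have h' : ∀ a, l a ∈ q.carrier ↔ l a ∈ q'.carrier := fun a =>
    Set.ext_iff.1 (congrArg PrimeIdl.carrier h) a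
  ext b
  obtain ⟨⟨x, t⟩, hx⟩ := hl.surj b
  have hu := hl.map_units t
  have e : ∀ r : PrimeIdl B, b ∈ r.carrier ↔ l x ∈ r.carrier := fun r => by
    rw [← hx, r.mul_mem_iff]
    exact ⟨Or.inl, fun h => h.resolve_right (r.notMem_of_isUnit hu)⟩
  rw [e, e, h']

lemma isInducing_comap (hl : (Submonoid.powers f).IsLocalizationMap l) :
    Topology.IsInducing (comap l) := by
  constructor
  change TopologicalSpace.generateFrom _ =
    TopologicalSpace.induced _ (TopologicalSpace.generateFrom _)
  rw [induced_generateFrom_eq]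
  congr 1
  ext S
  constructor
  · rintro ⟨b, rfl⟩
    obtain ⟨⟨x, t⟩, hx⟩ := hl.surj b
    have hu := hl.map_units t
    refine ⟨_, ⟨x, rfl⟩, ?_⟩
    ext q
    change ¬ (l x ∈ q.carrier) ↔ ¬ (b ∈ q.carrier)
    rw [← hx, q.mul_mem_iff]
    exact not_congr ⟨fun h => h.resolve_right (q.notMem_of_isUnit hu), Or.inl⟩
  · rintro ⟨_, ⟨a, rfl⟩, rfl⟩
    exact ⟨l a, rfl⟩

lemma isOpen_basicSet (f : A) : IsOpen (basicSet f) :=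
  TopologicalSpace.isOpen_generateFrom_of_mem ⟨f, rfl⟩

lemma basicSet_inter (f g : A) : basicSet f ∩ basicSet g = basicSet (f * g) := by
  ext p
  change ¬ _ ∧ ¬ _ ↔ ¬ _
  rw [p.mul_mem_iff, not_or]

lemma exists_basicSet {U : Set (PrimeIdl A)} (hU : IsOpen U) {p : PrimeIdl A} (hp : p ∈ U) :
    ∃ f : A, p ∈ basicSet f ∧ basicSet f ⊆ U := by
  have : TopologicalSpace.IsTopologicalBasis (Set.range (basicSet (A := A))) :=
    { exists_subset_inter := by
        rintro _ ⟨f, rfl⟩ _ ⟨g, rfl⟩ x hx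
        exact ⟨_, ⟨f * g, rfl⟩, by rwa [← basicSet_inter], by rw [← basicSet_inter]⟩
      sUnion_eq := Set.eq_univ_of_forall fun p =>
        ⟨_, ⟨1, rfl⟩, p.one_notMem⟩
      eq_generateFrom := rfl }
  obtain ⟨_, ⟨f, rfl⟩, h⟩ := this.exists_subset_of_mem_open hp hU
  exact ⟨f, h⟩

end PrimeIdl

namespace MonoidalSpace

variable {X : MonoidalSpace.{u}}

/-- Basic open subsets of affine open sets are affine. -/
lemma isAffineOpn_basic {U : X.Opn} (φ : U ≃ₜ PrimeIdl (X.Γ U))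
    (hφ : IsChart U φ)
    (f : X.Γ U) (V : X.Opn) (h : V ≤ U)
    (hV : ∀ x : U, (x : X.carrier) ∈ V ↔ φ x ∈ basicSet f) : IsAffineOpn V := by
  have hl := hφ f V h hV
  let j : V → PrimeIdl (X.Γ U) := fun x => φ ⟨x, h x.2⟩
  have hj : Topology.IsEmbedding j :=
    φ.isEmbedding.comp (Topology.IsEmbedding.inclusion h)
  have hjr : Set.range j = basicSet f := by
    ext p
    constructor
    · rintro ⟨x, rfl⟩
      exact (hV _).1 x.2
    · intro hp
      refine ⟨⟨(φ.symm p : X.carrier), (hV _).2 (by simpa using hp)⟩, ?_⟩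
      simp [j]
  have hc : Topology.IsEmbedding (PrimeIdl.comap (X.res h)) :=
    ⟨PrimeIdl.isInducing_comap hl, PrimeIdl.comap_injective hl⟩
  have hcr := PrimeIdl.range_comap hl
  let ψ : V ≃ₜ PrimeIdl (X.Γ V) :=
    hj.toHomeomorph.trans ((Homeomorph.setCongr (hjr.trans hcr.symm)).trans hc.toHomeomorph.symm)
  have hψ : ∀ x : V, PrimeIdl.comap (X.res h) (ψ x) = j x := fun x => by
    have := hc.toHomeomorph.apply_symm_apply
      (Homeomorph.setCongr (hjr.trans hcr.symm) (hj.toHomeomorph x))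
    exact congrArg Subtype.val this
  refine ⟨ψ, fun g W hW hgW => ?_⟩
  obtain ⟨⟨a, s, n, hn⟩, hx⟩ := hl.surj g
  simp only at hx
  have hWU := hφ (a * f) W (hW.trans h) (fun x => by
    rw [← PrimeIdl.basicSet_inter]
    constructor
    · intro hxW
      have hxV := hW hxW
      refine ⟨?_, (hV _).1 hxV⟩
      have h1 := (hgW ⟨x, hxV⟩).1 hxW
      intro h2
      apply h1
      have h3 : X.res h a ∈ (ψ ⟨x, hxV⟩).carrier := by
        have : a ∈ (PrimeIdl.comap (X.res h) (ψ ⟨x, hxV⟩)).carrier := by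
          rw [hψ]; exact h2
        exact this
      rw [← hx, PrimeIdl.mul_mem_iff] at h3
      exact h3.resolve_right (PrimeIdl.notMem_of_isUnit _ (hl.map_units ⟨s, n, hn⟩))
    · rintro ⟨h1, h2⟩
      have hxV := (hV _).2 h2
      refine (hgW ⟨x, hxV⟩).2 fun h3 => h1 ?_
      have h4 : X.res h a ∈ (ψ ⟨x, hxV⟩).carrier := by
        rw [← hx, PrimeIdl.mul_mem_iff]
        exact Or.inl h3
      have : a ∈ (PrimeIdl.comap (X.res h) (ψ ⟨x, hxV⟩)).carrier := h4
      rw [hψ] at this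
      exact this)
  have hrr := X.res_res h hW
  have hu : IsUnit (X.res (hW.trans h) (a * f)) := hWU.map_units ⟨_, Submonoid.mem_powers _⟩
  rw [map_mul, IsUnit.mul_iff] at hu
  have hgu : IsUnit (X.res hW g) := by
    have : X.res hW g * X.res hW (X.res h s) = X.res (hW.trans h) a := by
      rw [← map_mul, hx, hrr]
    rw [← this] at hu
    exact (IsUnit.mul_iff.1 hu.1).1
  refine ⟨?_, ?_, ?_⟩
  · rintro ⟨_, m, rfl⟩
    rw [map_pow]
    exact hgu.pow m
  · intro z
    obtain ⟨⟨y, _, m, rfl⟩, hy⟩ := hWU.surj z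
    simp only at hy
    have hs : s ∈ Submonoid.powers f := ⟨n, hn⟩
    have hsm : s ^ m * f ^ m ∈ Submonoid.powers f :=
      mul_mem (pow_mem hs m) (pow_mem (Submonoid.mem_powers f) m)
    refine ⟨⟨X.res h y * (hl.map_units ⟨_, hsm⟩).unit⁻¹, g ^ m, m, rfl⟩, ?_⟩
    set e := (hl.map_units ⟨_, hsm⟩).unit with he
    have he' : (e : X.Γ V) = X.res h (s ^ m * f ^ m) := IsUnit.unit_spec _
    have hem : IsUnit (X.res hW (e : X.Γ V)) := (Units.isUnit e).map _
    apply hem.mul_left_injective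
    simp only
    rw [← map_mul, mul_assoc, mul_assoc, Units.inv_mul, mul_one, ← map_mul, hrr, ← hy, mul_pow,
      he', map_mul, map_mul, map_mul, hrr, hrr, map_mul, map_pow (X.res hW)]
    have h5 : X.res hW g ^ m * X.res (hW.trans h) (s ^ m) = X.res (hW.trans h) (a ^ m) := by
      rw [map_pow, map_pow, ← mul_pow, ← hrr (a := a), ← hx, map_mul, hrr]
    rw [← h5]
    simp only [mul_assoc]
  · intro x y hxy
    obtain ⟨⟨x', s1⟩, hx1⟩ := hl.surj x
    obtain ⟨⟨y', s2⟩, hy1⟩ := hl.surj y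
    simp only at hx1 hy1
    have h6 : X.res (hW.trans h) (x' * s2) = X.res (hW.trans h) (y' * s1) := by
      rw [← hrr, ← hrr, map_mul (X.res h), map_mul (X.res h), ← hx1, ← hy1]
      simp only [map_mul, hxy]
      simp only [mul_left_comm, mul_comm]
    obtain ⟨⟨_, m, rfl⟩, hc⟩ := hWU.exists_of_eq h6
    simp only at hc
    refine ⟨⟨g ^ m, m, rfl⟩, ?_⟩
    have h7 := congrArg (X.res h) hc
    simp only [mul_pow, map_mul, map_pow, ← hx, ← hx1, ← hy1] at h7
    have hsu : IsUnit (X.res h s ^ m * X.res h f ^ m * X.res h s1 * X.res h s2) :=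
      ((((hl.map_units ⟨s, n, hn⟩).pow m).mul
        ((hl.map_units ⟨f, Submonoid.mem_powers f⟩).pow m)).mul (hl.map_units s1)).mul
        (hl.map_units s2)
    apply hsu.mul_left_injective
    simp only
    calc _ = _ := by simp only [mul_assoc, mul_left_comm, mul_comm]
      _ = _ := h7
      _ = _ := by simp only [mul_assoc, mul_left_comm, mul_comm]

end MonoidalSpace

namespace MonoidalSpace

variable {X : MonoidalSpace.{u}}

/-- An affine open set contained in an affine open set is a basic open set. -/
lemma exists_basic_of_le {U V : X.Opn} (φ : U ≃ₜ PrimeIdl (X.Γ U)) (hV : IsAffineOpn V)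
    (h : V ≤ U) : ∃ f : X.Γ U, ∀ x : U, (x : X.carrier) ∈ V ↔ φ x ∈ basicSet f := by
  obtain ⟨ψ, -⟩ := hV
  by_cases h0 : IsUnit (0 : X.Γ V)
  · refine ⟨0, fun x => ⟨fun hx => ?_, fun hx => ?_⟩⟩
    · exact absurd (ψ ⟨x, hx⟩).zero_mem' ((ψ ⟨x, hx⟩).notMem_of_isUnit h0)
    · exact absurd (φ x).zero_mem' hx
  · let m : PrimeIdl (X.Γ V) :=
      { carrier := {a | ¬ IsUnit a}
        zero_mem' := h0
        mul_mem' := fun a b hb hab => hb (IsUnit.mul_iff.1 hab).2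
        one_notMem := fun h => h isUnit_one
        mem_or_mem := fun {a b} hab => by
          by_contra! hc
          exact hab (IsUnit.mul_iff.2 ⟨not_not.1 hc.1, not_not.1 hc.2⟩) }
    have hm : ∀ S : Set (PrimeIdl (X.Γ V)), IsOpen S → m ∈ S → S = Set.univ := by
      intro S hS hmS
      obtain ⟨a, ha, haS⟩ := PrimeIdl.exists_basicSet hS hmS
      have hau : IsUnit a := not_not.1 ha
      exact Set.eq_univ_of_forall fun p => haS (p.notMem_of_isUnit hau)
    let v : V := ψ.symm m
    have hvU : IsOpen {p : PrimeIdl (X.Γ U) | ((φ.symm p : U) : X.carrier) ∈ V} :=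
      V.isOpen.preimage (continuous_subtype_val.comp φ.symm.continuous)
    obtain ⟨f, hf, hfV⟩ := PrimeIdl.exists_basicSet hvU
      (p := φ ⟨v, h v.2⟩) (by simp)
    refine ⟨f, fun x => ⟨fun hx => ?_, fun hx => by simpa using hfV hx⟩⟩
    have hS : IsOpen {p : PrimeIdl (X.Γ V) | φ ⟨(ψ.symm p : V), h (ψ.symm p).2⟩ ∈ basicSet f} :=
      (PrimeIdl.isOpen_basicSet f).preimage (by fun_prop)
    have := hm _ hS hf
    have hx' := Set.eq_univ_iff_forall.1 this (ψ ⟨x, hx⟩)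
    simpa using hx'

lemma exists_localization_of_le {U V : X.Opn} (hU : IsAffineOpn U) (hV : IsAffineOpn V)
    (h : V ≤ U) : ∃ f : X.Γ U, (Submonoid.powers f).IsLocalizationMap (X.res h) := by
  obtain ⟨φ, hφ⟩ := hU
  obtain ⟨f, hf⟩ := exists_basic_of_le φ hV h
  exact ⟨f, hφ f V h hf⟩

/-- Two affine open subsets of an affine open set meet in an affine open set; with the localizing
elements. -/
lemma exists_inf {U V W : X.Opn} (hU : IsAffineOpn U) (hV : IsAffineOpn V) (hW : IsAffineOpn W)
    (h : V ≤ U) (k : W ≤ U) : IsAffineOpn (V ⊓ W) ∧ ∃ f g : X.Γ U,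
      (Submonoid.powers f).IsLocalizationMap (X.res h) ∧
      (Submonoid.powers g).IsLocalizationMap (X.res k) ∧
      (Submonoid.powers (f * g)).IsLocalizationMap (X.res (inf_le_left.trans h : V ⊓ W ≤ U)) := by
  obtain ⟨φ, hφ⟩ := hU
  obtain ⟨f, hf⟩ := exists_basic_of_le φ hV h
  obtain ⟨g, hg⟩ := exists_basic_of_le φ hW k
  have hfg : ∀ x : U, (x : X.carrier) ∈ V ⊓ W ↔ φ x ∈ basicSet (f * g) := fun x => by
    rw [← PrimeIdl.basicSet_inter]
    exact and_congr (hf x) (hg x)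
  exact ⟨isAffineOpn_basic φ hφ _ _ (inf_le_left.trans h) hfg, f, g, hφ _ _ _ hf, hφ _ _ _ hg,
    hφ _ _ _ hfg⟩

end MonoidalSpace

/-- An `M₀`-scheme: a space with a sheaf of monoids that is locally affine. -/
structure MZScheme extends MonoidalSpace.{u} where
  exists_affine : ∀ x : carrier, ∃ U : Opens carrier,
    MonoidalSpace.IsAffineOpn (X := toMonoidalSpace) U ∧ x ∈ U

/-! ## The ring of a monoid -/

section ZRing

variable (A : Type u) [CommMonoidWithZero A]

/-- The ring `A_ℤ = ℤ[A]/(1·0_A)`. -/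
def ZRing : Type u := MonoidAlgebra ℤ A ⧸ Ideal.span {MonoidAlgebra.of ℤ A 0}

instance : CommRing (ZRing A) :=
  inferInstanceAs (CommRing (MonoidAlgebra ℤ A ⧸ Ideal.span {MonoidAlgebra.of ℤ A 0}))

variable {A}

/-- The canonical map `A → A_ℤ`. -/
def zof : A →*₀ ZRing A where
  toFun a := Ideal.Quotient.mk _ (MonoidAlgebra.of ℤ A a)
  map_zero' := Ideal.Quotient.eq_zero_iff_mem.2 (Ideal.subset_span rfl)
  map_one' := by rw [map_one, map_one]; rfl
  map_mul' a b := by rw [map_mul, map_mul]; rfl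

/-- The universal property of `A_ℤ`. -/
def ZRing.lift {R : Type u} [CommRing R] (g : A →*₀ R) : ZRing A →+* R :=
  Ideal.Quotient.lift _ (MonoidAlgebra.lift ℤ R A (g : A →* R)).toRingHom (by
    intro a ha
    have : Ideal.span {MonoidAlgebra.of ℤ A 0} ≤
        RingHom.ker (MonoidAlgebra.lift ℤ R A (g : A →* R)).toRingHom := by
      rw [Ideal.span_le, Set.singleton_subset_iff]
      change MonoidAlgebra.lift ℤ R A (g : A →* R) (MonoidAlgebra.of ℤ A 0) = 0
      rw [MonoidAlgebra.lift_of]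
      exact map_zero g
    exact this ha)

@[simp] lemma ZRing.lift_zof {R : Type u} [CommRing R] (g : A →*₀ R) (a : A) :
    ZRing.lift g (zof a) = g a :=
  MonoidAlgebra.lift_of (R := ℤ) (g : A →* R) a

lemma ZRing.hom_ext {R : Type u} [CommRing R] {g h : ZRing A →+* R}
    (e : ∀ a, g (zof a) = h (zof a)) : g = h := by
  refine Ideal.Quotient.ringHom_ext ?_
  refine MonoidAlgebra.ringHom_ext (fun r => ?_) (fun a => e a)
  have : ∀ k : MonoidAlgebra ℤ A →+* R, k (MonoidAlgebra.single 1 r) = (r : R) := fun k => by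
    have h2 := RingHom.ext_int (k.comp MonoidAlgebra.singleOneRingHom) (Int.castRingHom R)
    exact congrArg (fun t : ℤ →+* R => t r) h2
  rw [this, this]

variable {B : Type u} [CommMonoidWithZero B] {C : Type u} [CommMonoidWithZero C]

/-- Functoriality of `A ↦ A_ℤ`. -/
def ZRing.map (g : A →*₀ B) : ZRing A →+* ZRing B := ZRing.lift (zof.comp g)

@[simp] lemma ZRing.map_zof (g : A →*₀ B) (a : A) : ZRing.map g (zof a) = zof (g a) :=
  ZRing.lift_zof _ _

lemma ZRing.isLocalization {l : A →*₀ B} {f : A}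
    (hl : (Submonoid.powers f).IsLocalizationMap l) :
    letI := (ZRing.map l).toAlgebra
    IsLocalization.Away (zof f) (ZRing B) := by
  let _ := (ZRing.map l).toAlgebra
  let L := Localization.Away (zof f)
  let q : A →*₀ L := (algebraMap (ZRing A) L).toMonoidWithZeroHom.comp zof
  have hq : ∀ y : Submonoid.powers f, IsUnit (q y) := by
    rintro ⟨_, n, rfl⟩
    change IsUnit (q (f ^ n))
    rw [map_pow]
    exact (IsLocalization.Away.algebraMap_isUnit (S := L) (zof f)).pow n
  let ll : Submonoid.LocalizationMap (Submonoid.powers f) B :=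
    { toFun := l
      map_mul' := map_mul l
      isLocalizationMap := hl }
  let q' : B →* L := ll.lift (g := (q : A →* L)) hq
  have hq' : ∀ a, q' (l a) = q a := fun a => ll.lift_eq hq a
  have hq0 : q' 0 = 0 := by
    have := hq' 0
    rw [map_zero l, map_zero q] at this
    exact this
  let q0 : B →*₀ L := { q' with map_zero' := hq0 }
  let F : ZRing B →+* L := ZRing.lift q0
  have hF : ∀ a, F (ZRing.map l a) = algebraMap _ L a := by
    have : F.comp (ZRing.map l) = algebraMap _ L := ZRing.hom_ext fun a => by
      change F (ZRing.map l (zof a)) = _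
      rw [ZRing.map_zof, ZRing.lift_zof]
      exact hq' a
    exact fun a => congrArg (fun t : ZRing A →+* L => t a) this
  have hu : IsUnit (algebraMap (ZRing A) (ZRing B) (zof f)) := by
    change IsUnit (ZRing.map l (zof f))
    rw [ZRing.map_zof]
    exact (hl.map_units ⟨f, Submonoid.mem_powers f⟩).map zof
  let G : L →+* ZRing B := IsLocalization.Away.lift (zof f) hu
  have hG : ∀ a, G (algebraMap _ L a) = ZRing.map l a :=
    fun a => IsLocalization.Away.lift_eq (zof f) hu a
  have hFG : F.comp G = RingHom.id L := by
    apply IsLocalization.ringHom_ext (Submonoid.powers (zof f))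
    ext a
    change F (G (algebraMap _ L a)) = algebraMap _ L a
    rw [hG, hF]
  have hGF : G.comp F = RingHom.id _ := by
    apply ZRing.hom_ext
    intro b
    change G (F (zof b)) = zof b
    obtain ⟨⟨x, t⟩, hx⟩ := hl.surj b
    have ht : IsUnit (zof (l t)) := (hl.map_units t).map zof
    have h1 : ∀ a, G (F (zof (l a))) = zof (l a) := fun a => by
      have := hF (zof a)
      rw [ZRing.map_zof] at this
      rw [this, hG, ZRing.map_zof]
    apply ht.mul_left_injective
    change G (F (zof b)) * zof (l t) = zof b * zof (l t)
    nth_rewrite 1 [← h1 t]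
    rw [← map_mul, ← map_mul, ← map_mul]
    simp only at hx
    rw [hx, h1, ← hx, map_mul]
  let e : L ≃ₐ[ZRing A] ZRing B :=
    AlgEquiv.ofRingEquiv (f := RingEquiv.ofRingHom G F hGF hFG) (fun a => hG a)
  exact IsLocalization.isLocalization_of_algEquiv _ e

end ZRing

/-! ## The base extension `X_ℤ` -/

namespace MZScheme

variable (X : MZScheme.{u})

/-- The affine open subsets of `X`, ordered by inclusion. -/
abbrev AffOpn : Type u := {U : X.Opn // MonoidalSpace.IsAffineOpn U}

/-- The diagram `U ↦ Spec Γ(U)_ℤ`. -/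
def zDiagram : X.AffOpn ⥤ Scheme.{u} where
  obj U := Spec (.of (ZRing (X.Γ U.1)))
  map {V U} i := Spec.map (CommRingCat.ofHom (ZRing.map (X.res (leOfHom i))))
  map_id U := by
    rw [← Spec.map_id]
    congr 1
    ext1
    exact ZRing.hom_ext fun a => by simp
  map_comp {W V U} i j := by
    rw [← Spec.map_comp]
    congr 1
    ext1
    exact ZRing.hom_ext fun a => by simp [MonoidalSpace.res_res]

lemma isOpenImmersion_of_loc {A B : Type u} [CommMonoidWithZero A] [CommMonoidWithZero B]
    {l : A →*₀ B} {f : A} (hl : (Submonoid.powers f).IsLocalizationMap l) :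
    IsOpenImmersion (Spec.map (CommRingCat.ofHom (ZRing.map l))) ∧
    Set.range (Spec.map (CommRingCat.ofHom (ZRing.map l))) =
      (PrimeSpectrum.basicOpen (zof f) : Set (PrimeSpectrum (ZRing A))) := by
  let _ := (ZRing.map l).toAlgebra
  have : IsLocalization.Away (zof f) (ZRing B) := ZRing.isLocalization hl
  exact ⟨IsOpenImmersion.of_isLocalization (zof f),
    PrimeSpectrum.localization_away_comap_range (ZRing B) (zof f)⟩

instance {V U : X.AffOpn} (i : V ⟶ U) : IsOpenImmersion (X.zDiagram.map i) := by
  obtain ⟨f, hf⟩ := MonoidalSpace.exists_localization_of_le U.2 V.2 (leOfHom i)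
  exact (isOpenImmersion_of_loc hf).1

instance : (X.zDiagram ⋙ Scheme.forget).IsLocallyDirected where
  cond {V W U} i j x y hxy := by
    obtain ⟨h1, f, g, hf, hg, hfg⟩ :=
      MonoidalSpace.exists_inf U.2 V.2 W.2 (leOfHom i) (leOfHom j)
    let T : X.AffOpn := ⟨V.1 ⊓ W.1, h1⟩
    let a : T ⟶ V := homOfLE (inf_le_left : V.1 ⊓ W.1 ≤ V.1)
    let b : T ⟶ W := homOfLE (inf_le_right : V.1 ⊓ W.1 ≤ W.1)
    have hxf : X.zDiagram.map i x ∈ Set.range (X.zDiagram.map i) := ⟨x, rfl⟩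
    have hxg : X.zDiagram.map j y ∈ Set.range (X.zDiagram.map j) := ⟨y, rfl⟩
    have hxy' : X.zDiagram.map i x = X.zDiagram.map j y := hxy
    have e1 : Set.range (X.zDiagram.map i) = _ := (isOpenImmersion_of_loc hf).2
    have e2 : Set.range (X.zDiagram.map j) = _ := (isOpenImmersion_of_loc hg).2
    have e3 : Set.range (X.zDiagram.map (a ≫ i)) = _ := (isOpenImmersion_of_loc hfg).2
    rw [← hxy', e2] at hxg
    rw [e1] at hxf
    have : X.zDiagram.map i x ∈ Set.range (X.zDiagram.map (a ≫ i)) := by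
      rw [e3, map_mul, PrimeSpectrum.basicOpen_mul]
      exact ⟨hxf, hxg⟩
    obtain ⟨t, ht⟩ := this
    refine ⟨T, a, b, t, ?_, ?_⟩
    · apply (X.zDiagram.map i).isOpenEmbedding.injective
      rw [← ht, X.zDiagram.map_comp]
      rfl
    · apply (X.zDiagram.map j).isOpenEmbedding.injective
      rw [← hxy', ← ht, show a ≫ i = b ≫ j from rfl, X.zDiagram.map_comp]
      rfl

/-- The scheme `X_ℤ`: the colimit of the open subschemes `Spec Γ(U)_ℤ` over the affine open
subsets `U` of `X`. -/
def zScheme : Scheme.{u} := Limits.colimit X.zDiagram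

/-- The open immersion `Spec Γ(U)_ℤ → X_ℤ`. -/
def zι (U : X.AffOpn) : Spec (.of (ZRing (X.Γ U.1))) ⟶ X.zScheme :=
  Limits.colimit.ι X.zDiagram U

instance (U : X.AffOpn) : IsOpenImmersion (X.zι U) :=
  inferInstanceAs (IsOpenImmersion (Limits.colimit.ι X.zDiagram U))

/-- The open subscheme `U_ℤ` of `X_ℤ`, which is the preimage of `U` in `X_ℤ`. -/
def zOpen (U : X.AffOpn) : X.zScheme.Opens := (X.zι U).opensRange

/-- The map `Γ(U) → Γ(U)_ℤ = Γ(X_ℤ, U_ℤ)`. -/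
def zMap (U : X.AffOpn) : X.Γ U.1 →*₀ Γ(X.zScheme, X.zOpen U) :=
  (((Scheme.ΓSpecIso (.of (ZRing (X.Γ U.1)))).inv ≫
    ((X.zι U).appIso ⊤).inv ≫ X.zScheme.presheaf.map
      (eqToHom (X.zι U).image_top_eq_opensRange.symm).op).hom.toMonoidWithZeroHom).comp zof

end MZScheme

/-! ## Modules over the sheaf of monoids -/

/-- A presheaf of pointed sets with a compatible action of the structure sheaf. -/
structure PreMod (X : MonoidalSpace.{u}) where
  presheaf : TopCat.Presheaf (Type u) X.carrier
  [zero : ∀ U : X.Opn, Zero (presheaf.obj (op U))]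
  [act : ∀ U : X.Opn, MulActionWithZero (X.Γ U) (presheaf.obj (op U))]
  map_smul' : ∀ {U V : X.Opn} (h : V ≤ U) (a : X.Γ U) (m : presheaf.obj (op U)),
    presheaf.map (homOfLE h).op (a • m) = X.res h a • presheaf.map (homOfLE h).op m

namespace PreMod

attribute [instance] PreMod.zero PreMod.act

variable {X : MonoidalSpace.{u}}

/-- The sections over `U`. -/
abbrev Γ (M : PreMod X) (U : X.Opn) : Type u := M.presheaf.obj (op U)

/-- Restriction of sections. -/
def res (M : PreMod X) {U V : X.Opn} (h : V ≤ U) (m : M.Γ U) : M.Γ V :=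
  M.presheaf.map (homOfLE h).op m

lemma res_smul (M : PreMod X) {U V : X.Opn} (h : V ≤ U) (a : X.Γ U) (m : M.Γ U) :
    M.res h (a • m) = X.res h a • M.res h m := M.map_smul' h a m

@[simp] lemma res_zero (M : PreMod X) {U V : X.Opn} (h : V ≤ U) : M.res h (0 : M.Γ U) = 0 := by
  rw [← zero_smul (X.Γ U) (0 : M.Γ U), res_smul, map_zero, zero_smul]

lemma res_res (M : PreMod X) {U V W : X.Opn} (h : V ≤ U) (k : W ≤ V) (m : M.Γ U) :
    M.res k (M.res h m) = M.res (k.trans h) m := by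
  change M.presheaf.map (homOfLE k).op (M.presheaf.map (homOfLE h).op m) = _
  rw [← types_comp_apply, ← M.presheaf.map_comp]
  rfl

@[simp] lemma res_rfl (M : PreMod X) {U : X.Opn} (m : M.Γ U) : M.res (le_refl U) m = m := by
  change M.presheaf.map (𝟙 (op U)) m = m
  simp

/-- A morphism: a compatible family of equivariant maps (which preserve the base points). -/
@[ext]
structure Hom (M N : PreMod X) where
  app : ∀ U : X.Opn, M.Γ U → N.Γ U
  map_smul : ∀ (U : X.Opn) (a : X.Γ U) (m : M.Γ U), app U (a • m) = a • app U m
  map_res : ∀ {U V : X.Opn} (h : V ≤ U) (m : M.Γ U), app V (M.res h m) = N.res h (app U m)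

attribute [simp] Hom.map_smul

@[simp] lemma Hom.map_zero {M N : PreMod X} (f : Hom M N) (U : X.Opn) :
    f.app U (0 : M.Γ U) = 0 := by
  rw [← zero_smul (X.Γ U) (0 : M.Γ U), f.map_smul, zero_smul]

/-- The underlying morphism of presheaves. -/
def Hom.nat {M N : PreMod X} (f : Hom M N) : M.presheaf ⟶ N.presheaf where
  app U := ↾(f.app U.unop)
  naturality U V i := by
    ext m
    exact f.map_res (leOfHom i.unop) m

/-- The stalk at `x`. -/
abbrev stalk (M : PreMod X) (x : X.carrier) : Type u := M.presheaf.stalk x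

/-- The germ of a section at `x`. -/
def germ (M : PreMod X) {U : X.Opn} (x : X.carrier) (hx : x ∈ U) (m : M.Γ U) : M.stalk x :=
  M.presheaf.germ U x hx m

lemma germ_res (M : PreMod X) {U V : X.Opn} (h : V ≤ U) (x : X.carrier) (hx : x ∈ V) (m : M.Γ U) :
    M.germ x hx (M.res h m) = M.germ x (h hx) m :=
  M.presheaf.germ_res_apply (homOfLE h) x hx m

lemma germ_eq_iff (M : PreMod X) {U V : X.Opn} {x : X.carrier} (hU : x ∈ U) (hV : x ∈ V)
    {m : M.Γ U} {n : M.Γ V} : M.germ x hU m = M.germ x hV n ↔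
      ∃ (W : X.Opn) (_ : x ∈ W) (h : W ≤ U) (k : W ≤ V), M.res h m = M.res k n := by
  constructor
  · intro e
    obtain ⟨W, hW, i, j, e⟩ := M.presheaf.germ_eq x hU hV m n e
    exact ⟨W, hW, leOfHom i, leOfHom j, e⟩
  · rintro ⟨W, hW, h, k, e⟩
    rw [← M.germ_res h x hW, e, M.germ_res]

lemma exists_germ (M : PreMod X) {x : X.carrier} (t : M.stalk x) {U : X.Opn} (hU : x ∈ U) :
    ∃ p : (V : X.Opn) ×' (_ : V ≤ U) ×' (_ : x ∈ V) ×' M.Γ V,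
      M.germ x p.2.2.1 p.2.2.2 = t := by
  obtain ⟨V, h, hV, m, e⟩ := M.presheaf.exists_le_germ_eq t hU
  exact ⟨⟨V, h, hV, m⟩, e⟩

/-- The action of `Γ(U)` on the stalk at a point of `U`, with `a · [m] = [a m]`. -/
def stalkSmul (M : PreMod X) {U : X.Opn} (a : X.Γ U) {x : X.carrier} (hx : x ∈ U)
    (t : M.stalk x) : M.stalk x :=
  let p := (M.exists_germ t hx).choose
  M.germ x p.2.2.1 (X.res p.2.1 a • p.2.2.2)

lemma stalkSmul_germ (M : PreMod X) {U V : X.Opn} (a : X.Γ U) {x : X.carrier} (hx : x ∈ U)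
    (h : V ≤ U) (hV : x ∈ V) (m : M.Γ V) :
    M.stalkSmul a hx (M.germ x hV m) = M.germ x hV (X.res h a • m) := by
  have e := (M.exists_germ (M.germ x hV m) hx).choose_spec
  obtain ⟨W, hW, h1, h2, e⟩ := (M.germ_eq_iff _ _).1 e
  refine (M.germ_eq_iff _ _).2 ⟨W, hW, h1, h2, ?_⟩
  rw [M.res_smul, M.res_smul, X.res_res, X.res_res, e]

/-- The map on stalks. -/
def Hom.stalkMap {M N : PreMod X} (f : Hom M N) (x : X.carrier) : M.stalk x → N.stalk x :=
  fun t => (TopCat.Presheaf.stalkFunctor (Type u) x).map f.nat t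

lemma Hom.stalkMap_germ {M N : PreMod X} (f : Hom M N) {U : X.Opn} (x : X.carrier) (hx : x ∈ U)
    (m : M.Γ U) : f.stalkMap x (M.germ x hx m) = N.germ x hx (f.app U m) :=
  TopCat.Presheaf.stalkFunctor_map_germ_apply U x hx f.nat m

lemma Hom.stalkMap_smul {M N : PreMod X} (f : Hom M N) {U : X.Opn} (x : X.carrier) (hx : x ∈ U)
    (a : X.Γ U) (t : M.stalk x) :
    f.stalkMap x (M.stalkSmul a hx t) = N.stalkSmul a hx (f.stalkMap x t) := by
  obtain ⟨⟨V, h, hV, m⟩, rfl⟩ := M.exists_germ t hx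
  simp only
  rw [M.stalkSmul_germ a hx h, f.stalkMap_germ, f.stalkMap_germ, N.stalkSmul_germ a hx h,
    f.map_smul]

instance : Category (PreMod X) where
  Hom := Hom
  id M := ⟨fun _ m => m, fun _ _ _ => rfl, fun _ _ => rfl⟩
  comp f g := ⟨fun U m => g.app U (f.app U m), fun U a m => by simp,
    fun h m => by rw [f.map_res, g.map_res]⟩

/-- The sections over `U` of the sheafification: families of germs that are locally given by
sections. -/
abbrev ShΓ (M : PreMod X) (U : X.Opn) : Type u := M.presheaf.sheafify.obj.obj (op U)

lemma ShΓ.ext {M : PreMod X} {U : X.Opn} {s t : M.ShΓ U} (h : ∀ x : U, s.1 x = t.1 x) : s = t :=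
  Subtype.ext (funext h)

instance (M : PreMod X) (U : X.Opn) : Zero (M.ShΓ U) :=
  ⟨⟨fun x => M.germ x x.2 (0 : M.Γ U), fun x => ⟨U, x.2, 𝟙 U, 0, fun _ => rfl⟩⟩⟩

instance (M : PreMod X) (U : X.Opn) : SMul (X.Γ U) (M.ShΓ U) where
  smul a s := ⟨fun x => M.stalkSmul a x.2 (s.1 x), fun x => by
    obtain ⟨V, hV, i, m, hm⟩ := s.2 x
    refine ⟨V, hV, i, X.res (leOfHom i) a • (m : M.Γ V), fun y => ?_⟩
    exact (congrArg (M.stalkSmul a (leOfHom i y.2)) (hm y)).trans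
      (M.stalkSmul_germ a _ (leOfHom i) _ _)⟩

lemma ShΓ.smul_val {M : PreMod X} {U : X.Opn} (a : X.Γ U) (s : M.ShΓ U) (x : U) :
    (a • s).1 x = M.stalkSmul a x.2 (s.1 x) := rfl

lemma ShΓ.zero_val {M : PreMod X} {U : X.Opn} (x : U) :
    (0 : M.ShΓ U).1 x = M.germ x x.2 (0 : M.Γ U) := rfl

instance (M : PreMod X) (U : X.Opn) : MulActionWithZero (X.Γ U) (M.ShΓ U) where
  one_smul s := ShΓ.ext fun x => by
    rw [ShΓ.smul_val]
    obtain ⟨⟨V, h, hV, m⟩, hm⟩ := M.exists_germ (s.1 x) x.2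
    rw [← hm]
    simp only
    rw [M.stalkSmul_germ _ _ h, map_one, one_smul]
  mul_smul a b s := ShΓ.ext fun x => by
    rw [ShΓ.smul_val, ShΓ.smul_val, ShΓ.smul_val]
    obtain ⟨⟨V, h, hV, m⟩, hm⟩ := M.exists_germ (s.1 x) x.2
    rw [← hm]
    simp only
    rw [M.stalkSmul_germ _ _ h, M.stalkSmul_germ _ _ h, M.stalkSmul_germ _ _ h, map_mul, mul_smul]
  smul_zero a := ShΓ.ext fun x => by
    rw [ShΓ.smul_val, ShΓ.zero_val, M.stalkSmul_germ _ _ le_rfl, smul_zero]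
  zero_smul s := ShΓ.ext fun x => by
    rw [ShΓ.smul_val, ShΓ.zero_val]
    obtain ⟨⟨V, h, hV, m⟩, hm⟩ := M.exists_germ (s.1 x) x.2
    rw [← hm]
    simp only
    rw [M.stalkSmul_germ _ _ h, map_zero, zero_smul, ← M.germ_res h (m := 0), M.res_zero]

/-- The sheafification, as a presheaf with action. -/
def shPre (M : PreMod X) : PreMod X where
  presheaf := M.presheaf.sheafify.obj
  zero U := inferInstanceAs (Zero (M.ShΓ U))
  act U := inferInstanceAs (MulActionWithZero (X.Γ U) (M.ShΓ U))
  map_smul' {U V} h a s := ShΓ.ext fun x => by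
    change M.stalkSmul a (h x.2) (s.1 ⟨x, h x.2⟩) = M.stalkSmul (X.res h a) x.2 (s.1 ⟨x, h x.2⟩)
    obtain ⟨⟨W, k, hW, m⟩, hm⟩ := M.exists_germ (s.1 ⟨x, h x.2⟩) x.2
    rw [← hm]
    simp only
    rw [M.stalkSmul_germ _ _ k, M.stalkSmul_germ _ _ (k.trans h), X.res_res]

/-- The canonical map to the sheafification. -/
def toSh (M : PreMod X) : M ⟶ M.shPre where
  app U m := ⟨fun x => M.germ x x.2 m, fun x => ⟨U, x.2, 𝟙 U, m, fun _ => rfl⟩⟩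
  map_smul U a m := ShΓ.ext fun x => by
    change M.germ x x.2 (a • m) = M.stalkSmul a x.2 (M.germ x x.2 m)
    rw [M.stalkSmul_germ _ _ le_rfl, X.res_rfl]
  map_res h m := ShΓ.ext fun x => M.germ_res h x x.2 m

/-- Functoriality of the sheafification. -/
def shMap {M N : PreMod X} (f : M ⟶ N) : M.shPre ⟶ N.shPre where
  app U s := ⟨fun x => f.stalkMap x (s.1 x), fun x => by
    obtain ⟨V, hV, i, m, hm⟩ := s.2 x
    refine ⟨V, hV, i, f.app V m, fun y => ?_⟩
    have := hm y
    change f.stalkMap _ (s.1 _) = N.germ _ _ _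
    exact (congrArg _ this).trans (f.stalkMap_germ _ _ _)⟩
  map_smul U a s := ShΓ.ext fun x => f.stalkMap_smul _ x.2 _ _
  map_res h m := rfl

end PreMod

/-- An `𝒪_X`-module: a sheaf of pointed sets with an action of the structure sheaf. -/
structure OMod (X : MonoidalSpace.{u}) extends PreMod X where
  isSheaf : presheaf.IsSheaf

namespace OMod

variable {X : MonoidalSpace.{u}}

instance : Category (OMod X) where
  Hom M N := PreMod.Hom M.toPreMod N.toPreMod
  id M := 𝟙 M.toPreMod
  comp f g := CategoryStruct.comp (obj := PreMod X) f g

/-- The sheafification of a presheaf with action. -/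
def sheafify (M : PreMod X) : OMod X := { M.shPre with isSheaf := M.presheaf.sheafify.property }

/-- The structure sheaf as a module over itself. -/
def unit (X : MonoidalSpace.{u}) : OMod X where
  presheaf := X.presheaf
  zero U := inferInstanceAs (Zero (X.Γ U))
  act U := inferInstanceAs (MulActionWithZero (X.Γ U) (X.Γ U))
  map_smul' h a m := map_mul (X.res h) a m
  isSheaf := X.isSheaf

/-! ### The tensor product -/

/-- The relation `(a m, n) ~ (m, a n)`. -/
inductive TensRel (A M N : Type u) [SMul A M] [SMul A N] : M × N → M × N → Prop
  | intro (a : A) (m : M) (n : N) : TensRel A M N (a • m, n) (m, a • n)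

/-- The tensor product of two `A`-sets. -/
def Tens (A M N : Type u) [SMul A M] [SMul A N] : Type u := Quot (TensRel A M N)

section Tens

variable {A M N : Type u} [CommMonoidWithZero A] [Zero M] [Zero N] [MulActionWithZero A M]
  [MulActionWithZero A N]

instance : Zero (Tens A M N) := ⟨Quot.mk _ (0, 0)⟩

lemma Tens.smul_mk (a : A) (m : M) (n : N) :
    (Quot.mk _ (a • m, n) : Tens A M N) = Quot.mk _ (m, a • n) := Quot.sound ⟨a, m, n⟩

instance : SMul A (Tens A M N) where
  smul a := Quot.map (fun p => (a • p.1, p.2)) (by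
    rintro _ _ ⟨b, m, n⟩
    have := TensRel.intro b (a • m) n
    rwa [smul_smul, mul_comm, ← smul_smul] at this)

instance : MulActionWithZero A (Tens A M N) where
  one_smul := by
    rintro ⟨m, n⟩
    change Quot.mk _ ((1 : A) • m, n) = _
    rw [one_smul]
  mul_smul a b := by
    rintro ⟨m, n⟩
    change Quot.mk _ ((a * b) • m, n) = Quot.mk _ (a • b • m, n)
    rw [mul_smul]
  smul_zero a := by
    change Quot.mk _ (a • (0 : M), (0 : N)) = Quot.mk _ (0, 0)
    rw [smul_zero]
  zero_smul := by
    rintro ⟨m, n⟩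
    change Quot.mk _ ((0 : A) • m, n) = Quot.mk _ (0, 0)
    rw [zero_smul, ← zero_smul A (0 : M), Tens.smul_mk, zero_smul, zero_smul]

end Tens

/-- The presheaf `U ↦ M(U) ⊗ N(U)` of sets. -/
def tensPresheaf (M N : PreMod X) : TopCat.Presheaf (Type u) X.carrier where
  obj U := Tens (X.Γ U.unop) (M.Γ U.unop) (N.Γ U.unop)
  map {U V} i := ↾(Quot.map (fun p => (M.res (leOfHom i.unop) p.1,
    N.res (leOfHom i.unop) p.2)) (by
      rintro _ _ ⟨a, m, n⟩
      rw [M.res_smul, N.res_smul]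
      exact ⟨_, _, _⟩))
  map_id U := by
    ext ⟨m, n⟩
    change Quot.mk _ (M.res le_rfl m, N.res le_rfl n) = Quot.mk _ (m, n)
    rw [M.res_rfl, N.res_rfl]
  map_comp {U V W} i j := by
    ext ⟨m, n⟩
    change Quot.mk _ _ = Quot.mk _ (M.res _ (M.res _ m), N.res _ (N.res _ n))
    rw [M.res_res, N.res_res]

/-- The presheaf `U ↦ M(U) ⊗ N(U)`. -/
def preTens (M N : PreMod X) : PreMod X where
  presheaf := tensPresheaf M N
  zero U := inferInstanceAs (Zero (Tens (X.Γ U) (M.Γ U) (N.Γ U)))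
  act U := inferInstanceAs (MulActionWithZero (X.Γ U) (Tens (X.Γ U) (M.Γ U) (N.Γ U)))
  map_smul' {U V} h a := by
    rintro ⟨m, n⟩
    change Quot.mk _ (M.res h (a • m), N.res h n) = Quot.mk _ (X.res h a • M.res h m, N.res h n)
    rw [M.res_smul]

/-- Functoriality of the presheaf tensor product. -/
def preTensMap {M M' N N' : PreMod X} (f : M ⟶ M') (g : N ⟶ N') : preTens M N ⟶ preTens M' N' where
  app U := Quot.map (fun p => (f.app U p.1, g.app U p.2)) (by
    rintro _ _ ⟨a, m, n⟩
    rw [f.map_smul, g.map_smul]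
    exact ⟨_, _, _⟩)
  map_smul U a := by
    rintro ⟨m, n⟩
    change Quot.mk _ (f.app U (a • m), g.app U n) = Quot.mk _ (a • f.app U m, g.app U n)
    rw [f.map_smul]
  map_res {U V} h := by
    rintro ⟨m, n⟩
    change Quot.mk _ (f.app V (M.res h m), g.app V (N.res h n)) =
      Quot.mk _ (M'.res h (f.app U m), N'.res h (g.app U n))
    rw [f.map_res, g.map_res]

/-- The tensor product of two `𝒪_X`-modules: the sheaf associated with `U ↦ M(U) ⊗ N(U)`. -/
def tens (M N : OMod X) : OMod X := sheafify (preTens M.toPreMod N.toPreMod)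

/-- The section `m ⊗ n` of `M ⊗ N`. -/
def tmul {M N : OMod X} {U : X.Opn} (m : M.Γ U) (n : N.Γ U) : (tens M N).Γ U :=
  (preTens M.toPreMod N.toPreMod).toSh.app U (Quot.mk _ (m, n))

/-- The tensor product of two morphisms. -/
def tensMap {M M' N N' : OMod X} (f : M ⟶ M') (g : N ⟶ N') : tens M N ⟶ tens M' N' :=
  PreMod.shMap (preTensMap (X := X) (M := M.toPreMod) (M' := M'.toPreMod) f g)

/-! ### Properties of modules and morphisms -/

/-- A morphism is normal if the induced maps on stalks are injective outside the preimage of the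
base point. -/
def IsNormal {M N : OMod X} (f : M ⟶ N) : Prop :=
  ∀ (x : X.carrier) (s t : M.stalk x), PreMod.Hom.stalkMap f x s = PreMod.Hom.stalkMap f x t →
    s = t ∨ PreMod.Hom.stalkMap f x s = N.germ x (U := ⊤) trivial 0

/-- The restriction `M(U) → M(V)` is the localization of the `Γ(U)`-set `M(U)` at the powers
of `f`. -/
structure IsLocAt (M : OMod X) {U V : X.Opn} (h : V ≤ U) (f : X.Γ U) : Prop where
  bij : Function.Bijective (fun n : M.Γ V => X.res h f • n)
  surj : ∀ n : M.Γ V, ∃ (k : ℕ) (m : M.Γ U), X.res h f ^ k • n = M.res h m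
  eq : ∀ m m' : M.Γ U, M.res h m = M.res h m' → ∃ k : ℕ, f ^ k • m = f ^ k • m'

/-- `U` is affine, and the restriction of `M` to `U` is the sheaf associated with the `Γ(U)`-set
`M(U)`. -/
def IsTilde (M : OMod X) (U : X.Opn) : Prop :=
  ∃ φ : U ≃ₜ PrimeIdl (X.Γ U), MonoidalSpace.IsChart U φ ∧
    ∀ (f : X.Γ U) (V : X.Opn) (h : V ≤ U),
      (∀ x : U, (x : X.carrier) ∈ V ↔ φ x ∈ basicSet f) → M.IsLocAt h f

/-- Quasi-coherent modules. -/
def IsQCoh (M : OMod X) : Prop := ∀ x : X.carrier, ∃ U : X.Opn, x ∈ U ∧ M.IsTilde U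

/-- Coherent modules: locally associated with finitely generated sets. -/
def IsCoh (M : OMod X) : Prop :=
  ∀ x : X.carrier, ∃ U : X.Opn, x ∈ U ∧ M.IsTilde U ∧
    ∃ s : Finset (M.Γ U), ∀ m : M.Γ U, ∃ n ∈ s, ∃ a : X.Γ U, m = a • n

/-- A projective `A`-set: equivariant maps lift along surjective equivariant maps. -/
def IsProjectiveSet (A P : Type u) [CommMonoidWithZero A] [Zero P] [MulActionWithZero A P] :
    Prop :=
  ∀ (M N : Type u) [Zero M] [Zero N] [MulActionWithZero A M] [MulActionWithZero A N]
    (p : M →[A] N) (g : P →[A] N), Function.Surjective p → ∃ h : P →[A] M, p.comp h = g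

/-- Locally projective modules. -/
def IsLocProj (M : OMod X) : Prop :=
  M.IsQCoh ∧ ∀ x : X.carrier, ∃ U : X.Opn, x ∈ U ∧ MonoidalSpace.IsAffineOpn U ∧
    IsProjectiveSet (X.Γ U) (M.Γ U)

end OMod

/-! ## Modules over schemes -/

section SchemeModules

variable {Y : Scheme.{u}}

/-- The sheaf of modules associated with a presheaf of modules. -/
def shMod (P : Y.PresheafOfModules) : Y.Modules :=
  (PresheafOfModules.sheafification (𝟙 Y.ringCatSheaf.obj)).obj P

/-- The canonical map from a presheaf of modules to the associated sheaf, on sections. -/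
def toShMod (P : Y.PresheafOfModules) (W : Y.Opens) (m : P.obj (op W)) : Γ(shMod P, W) :=
  (CategoryTheory.toSheafify (Opens.grothendieckTopology Y) P.presheaf).app (op W) m

/-- Functoriality of the associated sheaf. -/
def shModMap {P Q : Y.PresheafOfModules} (f : P ⟶ Q) : shMod P ⟶ shMod Q :=
  (PresheafOfModules.sheafification (𝟙 Y.ringCatSheaf.obj)).map f

/-- The presheaf `U ↦ M(U) ⊗ N(U)`. -/
def preTensMod (M N : Y.Modules) : Y.PresheafOfModules :=
  MonoidalCategory.tensorObj
    (C := PresheafOfModules.{u} (Y.presheaf ⋙ forget₂ CommRingCat RingCat)) M.val N.val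

/-- The tensor product of two `𝒪_Y`-modules. -/
def tensMod (M N : Y.Modules) : Y.Modules := shMod (preTensMod M N)

/-- The section `m ⊗ n` of `M ⊗ N`. -/
def tmulMod {M N : Y.Modules} {U : Y.Opens} (m : Γ(M, U)) (n : Γ(N, U)) : Γ(tensMod M N, U) :=
  toShMod (preTensMod M N) U
    (TensorProduct.tmul Γ(Y, U) m n : TensorProduct Γ(Y, U) Γ(M, U) Γ(N, U))

/-- The tensor product of two morphisms. -/
def tensModMap {M M' N N' : Y.Modules} (f : M ⟶ M') (g : N ⟶ N') :
    tensMod M N ⟶ tensMod M' N' :=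
  shModMap (MonoidalCategory.tensorHom
    (C := PresheafOfModules.{u} (Y.presheaf ⋙ forget₂ CommRingCat RingCat)) f.val g.val)

/-- The structure sheaf as a module over itself. -/
def unitMod (Y : Scheme.{u}) : Y.Modules := SheafOfModules.unit Y.ringCatSheaf

/-- The global section `1` of the structure sheaf, restricted to `U`. -/
def oneMod (U : Y.Opens) : Γ(unitMod Y, U) := (1 : Γ(Y, U))

end SchemeModules

/-! ## The base extension `M_ℤ` of an `𝒪_X`-module -/

namespace MZScheme

variable {X : MZScheme.{u}}

/-- Restriction of functions on `X_ℤ`. -/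
def zres {W W' : X.zScheme.Opens} (h : W' ≤ W) : Γ(X.zScheme, W) →+* Γ(X.zScheme, W') :=
  (X.zScheme.presheaf.map (homOfLE h).op).hom

lemma zres_zres {W W' W'' : X.zScheme.Opens} (h : W' ≤ W) (k : W'' ≤ W')
    (r : Γ(X.zScheme, W)) : zres k (zres h r) = zres (k.trans h) r := by
  change (X.zScheme.presheaf.map (homOfLE h).op ≫ X.zScheme.presheaf.map (homOfLE k).op).hom r = _
  rw [← X.zScheme.presheaf.map_comp]
  rfl

lemma zres_rfl {W : X.zScheme.Opens} (r : Γ(X.zScheme, W)) : zres le_rfl r = r := by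
  change (X.zScheme.presheaf.map (𝟙 (op W))).hom r = r
  simp

variable (M N : OMod X.toMonoidalSpace)

/-- The generators over `W` of `M_ℤ`: sections of `M` over affine open subsets `V` with
`W ⊆ V_ℤ`. -/
@[ext]
structure ZGen (W : X.zScheme.Opens) : Type u where
  V : X.AffOpn
  le : W ≤ X.zOpen V
  m : M.Γ V.1

/-- The relations between the generators: the relation `(V, 0) = 0`, the relation
`(V, a m) = [a] (V, m)` and compatibility with the restriction maps of `M`. -/
inductive ZRel (W : X.zScheme.Opens) : (ZGen M W →₀ Γ(X.zScheme, W)) → Prop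
  | zero (V : X.AffOpn) (h : W ≤ X.zOpen V) : ZRel W (Finsupp.single ⟨V, h, 0⟩ 1)
  | smul (V : X.AffOpn) (h : W ≤ X.zOpen V) (a : X.Γ V.1) (m : M.Γ V.1) :
      ZRel W (Finsupp.single ⟨V, h, a • m⟩ 1 - Finsupp.single ⟨V, h, m⟩ (zres h (X.zMap V a)))
  | res (V V' : X.AffOpn) (h : W ≤ X.zOpen V) (h' : W ≤ X.zOpen V') (k : V'.1 ≤ V.1)
      (m : M.Γ V.1) :
      ZRel W (Finsupp.single ⟨V, h, m⟩ 1 - Finsupp.single ⟨V', h', M.res k m⟩ 1)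

variable {M N}

/-- A map between the free modules on the generators, linear over a ring map. -/
def zFreeMap {W W' : X.zScheme.Opens} (h : W' ≤ W) (φ : ZGen M W → ZGen N W') :
    (ZGen M W →₀ Γ(X.zScheme, W)) →ₛₗ[zres h] (ZGen N W' →₀ Γ(X.zScheme, W')) where
  toFun s := Finsupp.liftAddHom (fun g =>
    (Finsupp.singleAddHom (φ g)).comp (zres h).toAddMonoidHom) s
  map_add' s t := map_add _ s t
  map_smul' r s := by
    induction s using Finsupp.induction_linear with
    | zero => simp
    | add s t hs ht => rw [smul_add, map_add, map_add, smul_add, hs, ht]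
    | single g c =>
      rw [Finsupp.smul_single, Finsupp.liftAddHom_apply_single, Finsupp.liftAddHom_apply_single]
      simp only [AddMonoidHom.comp_apply, Finsupp.singleAddHom_apply, Finsupp.smul_single]
      congr 1
      exact map_mul (zres h) r c

@[simp] lemma zFreeMap_single {W W' : X.zScheme.Opens} (h : W' ≤ W) (φ : ZGen M W → ZGen N W')
    (g : ZGen M W) (r : Γ(X.zScheme, W)) :
    zFreeMap h φ (Finsupp.single g r) = Finsupp.single (φ g) (zres h r) := by
  change Finsupp.liftAddHom _ _ = _
  simp

variable (M) in
/-- The sections over `W` of the presheaf underlying `M_ℤ`. -/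
abbrev ZPre (W : X.zScheme.Opens) : Type u :=
  (ZGen M W →₀ Γ(X.zScheme, W)) ⧸ Submodule.span Γ(X.zScheme, W) {s | ZRel M W s}

/-- The map on generators induced by a morphism and an inclusion of open sets. -/
def ZGen.map (f : M ⟶ N) {W W' : X.zScheme.Opens} (h : W' ≤ W) (g : ZGen M W) : ZGen N W' :=
  ⟨g.V, h.trans g.le, f.app _ g.m⟩

/-- The map on sections induced by a morphism and an inclusion of open sets. -/
def zPreMap (f : M ⟶ N) {W W' : X.zScheme.Opens} (h : W' ≤ W) : ZPre M W →ₛₗ[zres h] ZPre N W' :=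
  Submodule.mapQ _ _ (zFreeMap h (ZGen.map f h)) (by
    rw [Submodule.span_le]
    intro s hs
    refine Submodule.subset_span ?_
    induction hs with
    | zero V k =>
      have := ZRel.zero (M := N) V (h.trans k)
      simpa [ZGen.map] using this
    | smul V k a m =>
      have := ZRel.smul (M := N) V (h.trans k) a (f.app _ m)
      simpa [ZGen.map, zres_zres] using this
    | res V V' k k' l m =>
      have := ZRel.res (M := N) V V' (h.trans k) (h.trans k') l (f.app _ m)
      simpa [ZGen.map, f.map_res] using this)

/-- The class of a generator. -/
def zMk {W : X.zScheme.Opens} (g : ZGen M W) : ZPre M W :=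
  Submodule.Quotient.mk (Finsupp.single g 1)

@[simp] lemma zPreMap_zMk (f : M ⟶ N) {W W' : X.zScheme.Opens} (h : W' ≤ W) (g : ZGen M W) :
    zPreMap f h (zMk g) = zMk (g.map f h) := by
  change Submodule.Quotient.mk (zFreeMap h (ZGen.map f h) (Finsupp.single g 1)) = _
  rw [zFreeMap_single, map_one]
  rfl

lemma zPre_hom_ext {W W' : X.zScheme.Opens} {h : W' ≤ W} {P : Type u} [AddCommGroup P]
    [Module Γ(X.zScheme, W') P] {f g : ZPre M W →ₛₗ[zres h] P}
    (e : ∀ x : ZGen M W, f (zMk x) = g (zMk x)) (s : ZPre M W) : f s = g s := by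
  obtain ⟨s, rfl⟩ := Submodule.Quotient.mk_surjective _ s
  induction s using Finsupp.induction_linear with
  | zero => simp
  | add s t hs ht => rw [Submodule.Quotient.mk_add, map_add, map_add, hs, ht]
  | single x c =>
    have : (Submodule.Quotient.mk (Finsupp.single x c) : ZPre M W) = c • zMk x := by
      rw [zMk, ← Submodule.Quotient.mk_smul, Finsupp.smul_single, smul_eq_mul, mul_one]
    rw [this, map_smulₛₗ, map_smulₛₗ, e]

lemma zPreMap_id {W : X.zScheme.Opens} (s : ZPre M W) : zPreMap (𝟙 M) le_rfl s = s :=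
  zPre_hom_ext (h := le_rfl) (f := zPreMap (𝟙 M) le_rfl)
    (g := { LinearMap.id (R := Γ(X.zScheme, W)) (M := ZPre M W) with
      map_smul' := fun r s => by rw [zres_rfl]; rfl }) (fun x => zPreMap_zMk _ _ _) s

lemma zPreMap_comp {P : OMod X.toMonoidalSpace} (f : M ⟶ N) (g : N ⟶ P)
    {W W' W'' : X.zScheme.Opens} (h : W' ≤ W) (k : W'' ≤ W') (s : ZPre M W) :
    zPreMap g k (zPreMap f h s) = zPreMap (f ≫ g) (k.trans h) s := by
  refine zPre_hom_ext (h := k.trans h) (g := zPreMap (f ≫ g) (k.trans h))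
    (f :=
    { toFun := fun s => zPreMap g k (zPreMap f h s)
      map_add' := fun s t => by rw [map_add, map_add]
      map_smul' := fun r s => by rw [map_smulₛₗ, map_smulₛₗ, zres_zres] }) (fun x => ?_) s
  change zPreMap g k (zPreMap f h (zMk x)) = zPreMap (f ≫ g) _ (zMk x)
  rw [zPreMap_zMk, zPreMap_zMk, zPreMap_zMk]
  rfl

variable (M) in
/-- The presheaf of abelian groups underlying the presheaf `ZPre`. -/
def zPresheaf : X.zScheme.Opensᵒᵖ ⥤ Ab.{u} where
  obj W := AddCommGrpCat.of (ZPre M W.unop)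
  map i := AddCommGrpCat.ofHom (zPreMap (𝟙 M) (leOfHom i.unop)).toAddMonoidHom
  map_id W := by
    ext s
    exact zPreMap_id s
  map_comp {W₁ W₂ W₃} i j := by
    ext s
    exact (zPreMap_comp (𝟙 M) (𝟙 M) (leOfHom i.unop) (leOfHom j.unop) s).symm

instance (W : X.zScheme.Opensᵒᵖ) : Module (X.zScheme.ringCatSheaf.obj.obj W)
    ((zPresheaf M).obj W) :=
  inferInstanceAs (Module Γ(X.zScheme, W.unop) (ZPre M W.unop))

variable (M) in
/-- The presheaf of modules `W ↦ ZPre M W`. -/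
def zPresheafMod : X.zScheme.PresheafOfModules :=
  PresheafOfModules.ofPresheaf (zPresheaf M) (fun _ _ i r s =>
    (zPreMap (𝟙 M) (leOfHom i.unop)).map_smulₛₗ r s)

/-- Functoriality of the presheaf of modules. -/
def zPresheafModMap (f : M ⟶ N) : zPresheafMod M ⟶ zPresheafMod N :=
  PresheafOfModules.homMk (M₁ := zPresheafMod M) (M₂ := zPresheafMod N)
    { app := fun W => AddCommGrpCat.ofHom (zPreMap f (le_refl W.unop)).toAddMonoidHom
      naturality := fun {W W'} i => by
        ext s
        exact (zPreMap_comp (𝟙 M) f (leOfHom i.unop) le_rfl s).trans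
          (zPreMap_comp f (𝟙 N) le_rfl (leOfHom i.unop) s).symm }
    (fun W r s => by
      exact ((zPreMap f (le_refl W.unop)).map_smulₛₗ r s).trans
        (congrArg (fun t : Γ(X.zScheme, W.unop) => t • zPreMap f (le_refl W.unop) s)
          (zres_rfl (W := W.unop) r)))

lemma zPresheafModMap_id : zPresheafModMap (𝟙 M) = 𝟙 _ := by
  ext W s
  exact zPreMap_id s

lemma zPresheafModMap_comp {P : OMod X.toMonoidalSpace} (f : M ⟶ N) (g : N ⟶ P) :
    zPresheafModMap (f ≫ g) = zPresheafModMap f ≫ zPresheafModMap g := by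
  ext W s
  exact (zPreMap_comp f g le_rfl le_rfl s).symm

variable (X) in
/-- The base extension `M ↦ M_ℤ = β⁻¹M ⊗ 𝒪_{X_ℤ}`, where `β : X_ℤ → X` is the continuous map
with `β⁻¹(V) = V_ℤ` for affine `V`.  Since the affine open subsets of `X` form a basis, `M_ℤ` is
the sheaf associated with the presheaf of modules that is generated over `W` by the sections of
`M` over the affine open subsets `V` with `W ⊆ V_ℤ`, subject to the relations `ZRel`. -/
def zMod : OMod X.toMonoidalSpace ⥤ X.zScheme.Modules where
  obj M := shMod (zPresheafMod M)
  map f := shModMap (zPresheafModMap f)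
  map_id M := by
    rw [zPresheafModMap_id]
    exact (PresheafOfModules.sheafification (𝟙 X.zScheme.ringCatSheaf.obj)).map_id _
  map_comp f g := by
    rw [zPresheafModMap_comp]
    exact (PresheafOfModules.sheafification (𝟙 X.zScheme.ringCatSheaf.obj)).map_comp _ _

/-- The section of `M_ℤ` over `V_ℤ` defined by a section of `M` over an affine open set `V`. -/
def zsec {M : OMod X.toMonoidalSpace} (V : X.AffOpn) (m : M.Γ V.1) :
    Γ(X.zMod.obj M, X.zOpen V) :=
  toShMod (zPresheafMod M) (X.zOpen V) (zMk ⟨V, le_rfl, m⟩)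

end MZScheme

/-! ## `𝔽₁`-schemes and their modules -/

/-- An `𝔽₁`-scheme `(X̃, X, e_X)`: the evaluation map `e_X : X̃_ℤ → X` is bijective on `k`-valued
points for every field `k`. -/
structure F1Scheme where
  tilde : MZScheme.{u}
  base : Scheme.{u}
  e : tilde.zScheme ⟶ base
  bijective_points : ∀ (k : Type u) [Field k],
    Function.Bijective (fun p : Spec (.of k) ⟶ tilde.zScheme => p ≫ e)

/-- An `𝒪_𝒳`-module `(M̃, M, ε_M)`. -/
structure F1Module (𝒳 : F1Scheme.{u}) where
  fst : OMod 𝒳.tilde.toMonoidalSpace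
  snd : 𝒳.base.Modules
  ε : 𝒳.tilde.zMod.obj fst ≅ (Scheme.Modules.pullback 𝒳.e).obj snd

namespace F1Module

variable {𝒳 : F1Scheme.{u}}

/-- A morphism of `𝒪_𝒳`-modules. -/
@[ext]
structure Hom (M N : F1Module 𝒳) where
  fst : M.fst ⟶ N.fst
  snd : M.snd ⟶ N.snd
  comm : 𝒳.tilde.zMod.map fst ≫ N.ε.hom =
    M.ε.hom ≫ (Scheme.Modules.pullback 𝒳.e).map snd

instance : Category (F1Module 𝒳) where
  Hom := Hom
  id M := ⟨𝟙 _, 𝟙 _, by simp⟩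
  comp f g := ⟨f.fst ≫ g.fst, f.snd ≫ g.snd, by
    rw [Functor.map_comp, Functor.map_comp, Category.assoc, g.comm, ← Category.assoc, f.comm,
      Category.assoc]⟩

/-- The zero morphism: both components are zero. -/
def IsZeroHom {M N : F1Module 𝒳} (f : M ⟶ N) : Prop :=
  (∀ (U : 𝒳.tilde.Opn) (m : M.fst.Γ U), f.fst.app U m = 0) ∧ f.snd = 0

/-- A morphism of modules over a scheme is `e`-flat if `0 → e^* ker f → e^* M → e^* N` is exact. -/
def IsFlatFor {Y Z : Scheme.{u}} (e : Y ⟶ Z) {M N : Z.Modules} (f : M ⟶ N) : Prop :=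
  Mono ((Scheme.Modules.pullback e).map (Limits.kernel.ι f)) ∧
  (ShortComplex.mk ((Scheme.Modules.pullback e).map (Limits.kernel.ι f))
    ((Scheme.Modules.pullback e).map f)
    (by rw [← Functor.map_comp, Limits.kernel.condition, Functor.map_zero])).Exact

/-- Normal morphisms of `𝒪_𝒳`-modules. -/
def IsNormal {M N : F1Module 𝒳} (f : M ⟶ N) : Prop :=
  OMod.IsNormal f.fst ∧ IsFlatFor 𝒳.e f.snd

/-- `k` is a kernel of `ψ`, i.e. an equalizer of `ψ` and `0`, in the category of
`𝒪_𝒳`-modules. -/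
def IsKernel {K M N : F1Module 𝒳} (k : K ⟶ M) (ψ : M ⟶ N) : Prop :=
  IsZeroHom (k ≫ ψ) ∧
    ∀ (T : F1Module 𝒳) (t : T ⟶ M), IsZeroHom (t ≫ ψ) → ∃! s : T ⟶ K, s ≫ k = t

/-- `k : K → M` exhibits `K` as the image `(im f̃, im f, ε|)` of `φ = (f̃, f)`: the morphism `φ`
factors through `k`, both components of `k` are monomorphisms, and both components of the first
factor are epimorphisms of sheaves. -/
def IsImage {L M K : F1Module 𝒳} (φ : L ⟶ M) (k : K ⟶ M) : Prop :=
  ∃ p : L ⟶ K, p ≫ k = φ ∧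
    (∀ U : 𝒳.tilde.Opn, Function.Injective (k.fst.app U)) ∧ Mono k.snd ∧
    (∀ (U : 𝒳.tilde.Opn) (m : K.fst.Γ U) (x : 𝒳.tilde.carrier), x ∈ U →
      ∃ (V : 𝒳.tilde.Opn) (h : V ≤ U) (l : L.fst.Γ V), x ∈ V ∧ p.fst.app V l = K.fst.res h m) ∧
    Epi p.snd

/-- The sequence `L → M → N` is exact at `M`: the kernel of `ψ` exists, and it is the image
of `φ`. -/
def ExactAt {L M N : F1Module 𝒳} (φ : L ⟶ M) (ψ : M ⟶ N) : Prop :=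
  ∃ (K : F1Module 𝒳) (k : K ⟶ M), IsKernel k ψ ∧ IsImage φ k

/-- Admissible short exact sequences `0 → M₁ → M₂ → M₃ → 0`. -/
def IsAdmissible {M₁ M₂ M₃ : F1Module 𝒳} (φ : M₁ ⟶ M₂) (ψ : M₂ ⟶ M₃) : Prop :=
  (∃ (O : F1Module 𝒳) (_ : Limits.IsZero O) (a : O ⟶ M₁) (b : M₃ ⟶ O),
    ExactAt a φ ∧ ExactAt φ ψ ∧ ExactAt ψ b) ∧
  IsNormal φ ∧ IsNormal ψ

variable (𝒳)

/-- Quasi-coherent sheaves on `𝒳`. -/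
def isQCoh : ObjectProperty (F1Module 𝒳) := fun M =>
  M.fst.IsQCoh ∧ SheafOfModules.IsQuasicoherent (R := 𝒳.base.ringCatSheaf) M.snd

/-- Coherent sheaves on `𝒳`. -/
def isCoh : ObjectProperty (F1Module 𝒳) := fun M =>
  M.fst.IsCoh ∧ SheafOfModules.IsQuasicoherent (R := 𝒳.base.ringCatSheaf) M.snd ∧
    SheafOfModules.IsFiniteType (R := 𝒳.base.ringCatSheaf) M.snd

end F1Module

open MonoidalCategory

variable (𝒳 : F1Scheme.{u})

/-- The category of quasi-coherent sheaves on `𝒳`. -/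
abbrev QCoh := (F1Module.isQCoh 𝒳).FullSubcategory

/-- Locally free sheaves on `𝒳`: the coherent sheaves whose first component is locally projective
and whose second component is locally free. -/
def isBun : ObjectProperty (QCoh 𝒳) := fun M =>
  F1Module.isCoh 𝒳 M.obj ∧ M.obj.fst.IsLocProj ∧
    SheafOfModules.IsLocallyFree (R := 𝒳.base.ringCatSheaf) M.obj.snd

/-- The category of locally free sheaves (of finite rank) on `𝒳`. -/
abbrev Bun := (isBun 𝒳).FullSubcategory

variable {𝒳}

/-- `K`-admissible monomorphisms. -/
def IsKAdmissibleMono {M N : Bun 𝒳} (f : M ⟶ N) : Prop :=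
  ∃ (P : Bun 𝒳) (g : N ⟶ P), F1Module.IsAdmissible f.hom.hom g.hom.hom

variable (𝒳)

/-- The canonical map `Γ(M, U) → Γ(e^* M, e⁻¹ U)`. -/
def pullSec {M : 𝒳.base.Modules} {U : 𝒳.base.Opens} (m : Γ(M, U)) :
    Γ((Scheme.Modules.pullback 𝒳.e).obj M, 𝒳.e ⁻¹ᵁ U) :=
  ((Scheme.Modules.pullbackPushforwardAdjunction 𝒳.e).unit.app M).app U m

/-- The symmetric monoidal structure on `QCoh 𝒳` is given by the componentwise tensor product
`(M̃, M, ε_M) ⊗ (Ñ, N, ε_N) = (M̃ ⊗ Ñ, M ⊗ N, ε_M ⊗ ε_N)`, with unit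
`(𝒪_X̃, 𝒪_X, ε)` and with the usual structure isomorphisms. -/
structure ComponentwiseTensor [MonoidalCategory (QCoh 𝒳)] [BraidedCategory (QCoh 𝒳)] where
  /-- The components of `M ⊗ N`. -/
  fstIso (M N : QCoh 𝒳) : OMod.tens M.obj.fst N.obj.fst ≅ (M ⊗ N).obj.fst
  sndIso (M N : QCoh 𝒳) : tensMod M.obj.snd N.obj.snd ≅ (M ⊗ N).obj.snd
  /-- The components of the unit object. -/
  fstUnit : OMod.unit 𝒳.tilde.toMonoidalSpace ≅ (𝟙_ (QCoh 𝒳)).obj.fst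
  sndUnit : unitMod 𝒳.base ≅ (𝟙_ (QCoh 𝒳)).obj.snd
  /-- The components of `f ⊗ g`. -/
  tensorHom_fst : ∀ {M M' N N' : QCoh 𝒳} (f : M ⟶ M') (g : N ⟶ N'),
    (fstIso M N).hom ≫ (f ⊗ₘ g).hom.fst =
      OMod.tensMap f.hom.fst g.hom.fst ≫ (fstIso M' N').hom
  tensorHom_snd : ∀ {M M' N N' : QCoh 𝒳} (f : M ⟶ M') (g : N ⟶ N'),
    (sndIso M N).hom ≫ (f ⊗ₘ g).hom.snd =
      tensModMap f.hom.snd g.hom.snd ≫ (sndIso M' N').hom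
  /-- The isomorphism of `M ⊗ N` is
  `(M̃ ⊗ Ñ)_ℤ ≅ M̃_ℤ ⊗ Ñ_ℤ ≅ e^* M ⊗ e^* N ≅ e^* (M ⊗ N)`,
  where the middle isomorphism is `ε_M ⊗ ε_N` and the other ones are the canonical ones. -/
  ε_tensor : ∀ M N : QCoh 𝒳,
    ∃ δ : (Scheme.Modules.pullback 𝒳.e).obj (M ⊗ N).obj.snd ≅
        tensMod ((Scheme.Modules.pullback 𝒳.e).obj M.obj.snd)
          ((Scheme.Modules.pullback 𝒳.e).obj N.obj.snd),
      (∀ (U : 𝒳.base.Opens) (m : Γ(M.obj.snd, U)) (n : Γ(N.obj.snd, U)),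
        δ.hom.app _ (pullSec 𝒳 ((sndIso M N).hom.app U (tmulMod m n))) =
          tmulMod (pullSec 𝒳 m) (pullSec 𝒳 n)) ∧
      ∀ (V : 𝒳.tilde.AffOpn) (m : M.obj.fst.Γ V.1) (n : N.obj.fst.Γ V.1),
        δ.hom.app _ ((M ⊗ N).obj.ε.hom.app _
          (MZScheme.zsec V ((fstIso M N).hom.app V.1 (OMod.tmul m n)))) =
        tmulMod (M.obj.ε.hom.app _ (MZScheme.zsec V m)) (N.obj.ε.hom.app _ (MZScheme.zsec V n))
  /-- The isomorphism of the unit object sends `1` to `1`. -/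
  ε_unit : ∀ V : 𝒳.tilde.AffOpn,
    (𝟙_ (QCoh 𝒳)).obj.ε.hom.app _
        (MZScheme.zsec V (fstUnit.hom.app V.1 (1 : 𝒳.tilde.Γ V.1))) =
      ((Scheme.Modules.pullback 𝒳.e).obj (𝟙_ (QCoh 𝒳)).obj.snd).presheaf.map
        (homOfLE (le_top : 𝒳.tilde.zOpen V ≤ 𝒳.e ⁻¹ᵁ ⊤)).op
        (pullSec 𝒳 (sndUnit.hom.app ⊤ (oneMod ⊤)))
  /-- The associator sends `(m ⊗ n) ⊗ p` to `m ⊗ (n ⊗ p)`. -/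
  associator_fst : ∀ (M N P : QCoh 𝒳) (U : 𝒳.tilde.Opn) (m : M.obj.fst.Γ U)
    (n : N.obj.fst.Γ U) (p : P.obj.fst.Γ U),
    (α_ M N P).hom.hom.fst.app U ((fstIso _ _).hom.app U
        (OMod.tmul ((fstIso _ _).hom.app U (OMod.tmul m n)) p)) =
      (fstIso _ _).hom.app U (OMod.tmul m ((fstIso _ _).hom.app U (OMod.tmul n p)))
  associator_snd : ∀ (M N P : QCoh 𝒳) (U : 𝒳.base.Opens) (m : Γ(M.obj.snd, U))
    (n : Γ(N.obj.snd, U)) (p : Γ(P.obj.snd, U)),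
    (α_ M N P).hom.hom.snd.app U ((sndIso _ _).hom.app U
        (tmulMod ((sndIso _ _).hom.app U (tmulMod m n)) p)) =
      (sndIso _ _).hom.app U (tmulMod m ((sndIso _ _).hom.app U (tmulMod n p)))
  /-- The braiding sends `m ⊗ n` to `n ⊗ m`. -/
  braiding_fst : ∀ (M N : QCoh 𝒳) (U : 𝒳.tilde.Opn) (m : M.obj.fst.Γ U) (n : N.obj.fst.Γ U),
    (β_ M N).hom.hom.fst.app U ((fstIso _ _).hom.app U (OMod.tmul m n)) =
      (fstIso _ _).hom.app U (OMod.tmul n m)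
  braiding_snd : ∀ (M N : QCoh 𝒳) (U : 𝒳.base.Opens) (m : Γ(M.obj.snd, U)) (n : Γ(N.obj.snd, U)),
    (β_ M N).hom.hom.snd.app U ((sndIso _ _).hom.app U (tmulMod m n)) =
      (sndIso _ _).hom.app U (tmulMod n m)
  /-- The unitors send `a ⊗ m` and `m ⊗ a` to `a m`. -/
  leftUnitor_fst : ∀ (M : QCoh 𝒳) (U : 𝒳.tilde.Opn) (a : 𝒳.tilde.Γ U) (m : M.obj.fst.Γ U),
    (λ_ M).hom.hom.fst.app U ((fstIso _ _).hom.app U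
      (OMod.tmul (fstUnit.hom.app U a) m)) = a • m
  leftUnitor_snd : ∀ (M : QCoh 𝒳) (U : 𝒳.base.Opens) (a : Γ(𝒳.base, U)) (m : Γ(M.obj.snd, U)),
    (λ_ M).hom.hom.snd.app U ((sndIso _ _).hom.app U
      (tmulMod (sndUnit.hom.app U (a • oneMod U)) m)) = a • m
  rightUnitor_fst : ∀ (M : QCoh 𝒳) (U : 𝒳.tilde.Opn) (a : 𝒳.tilde.Γ U) (m : M.obj.fst.Γ U),
    (ρ_ M).hom.hom.fst.app U ((fstIso _ _).hom.app U
      (OMod.tmul m (fstUnit.hom.app U a))) = a • m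
  rightUnitor_snd : ∀ (M : QCoh 𝒳) (U : 𝒳.base.Opens) (a : Γ(𝒳.base, U)) (m : Γ(M.obj.snd, U)),
    (ρ_ M).hom.hom.snd.app U ((sndIso _ _).hom.app U
      (tmulMod m (sndUnit.hom.app U (a • oneMod U)))) = a • m

/-- Bi-exactness of a tensor product on `Bun 𝒳`. -/
structure IsBiexact [MonoidalCategory (Bun 𝒳)] : Prop where
  /-- The tensor product with the zero object is zero. -/
  exists_zero : ∃ O : Bun 𝒳, Limits.IsZero O
  zero_tensor : ∀ O M : Bun 𝒳, Limits.IsZero O → Limits.IsZero (O ⊗ M)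
  tensor_zero : ∀ M O : Bun 𝒳, Limits.IsZero O → Limits.IsZero (M ⊗ O)
  /-- The functors `M ⊗ -` and `- ⊗ M` preserve isomorphisms. -/
  iso_left : ∀ (M : Bun 𝒳) {N P : Bun 𝒳} (f : N ⟶ P), IsIso f → IsIso (M ◁ f)
  iso_right : ∀ (M : Bun 𝒳) {N P : Bun 𝒳} (f : N ⟶ P), IsIso f → IsIso (f ▷ M)
  /-- The functors `M ⊗ -` and `- ⊗ M` preserve `K`-admissible monomorphisms. -/
  mono_left : ∀ (M : Bun 𝒳) {N P : Bun 𝒳} (f : N ⟶ P), IsKAdmissibleMono f →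
    IsKAdmissibleMono (M ◁ f)
  mono_right : ∀ (M : Bun 𝒳) {N P : Bun 𝒳} (f : N ⟶ P), IsKAdmissibleMono f →
    IsKAdmissibleMono (f ▷ M)
  /-- The functors `M ⊗ -` and `- ⊗ M` preserve push-outs along `K`-admissible monomorphisms. -/
  pushout_left : ∀ (M : Bun 𝒳) {N P Q R : Bun 𝒳} (i : N ⟶ P) (f : N ⟶ Q) (j : P ⟶ R)
    (k : Q ⟶ R), IsKAdmissibleMono i → IsPushout i f j k →
      IsPushout (M ◁ i) (M ◁ f) (M ◁ j) (M ◁ k)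
  pushout_right : ∀ (M : Bun 𝒳) {N P Q R : Bun 𝒳} (i : N ⟶ P) (f : N ⟶ Q) (j : P ⟶ R)
    (k : Q ⟶ R), IsKAdmissibleMono i → IsPushout i f j k →
      IsPushout (i ▷ M) (f ▷ M) (j ▷ M) (k ▷ M)
  /-- For `K`-admissible monomorphisms `f : M → M'` and `g : N → N'` the push-out of `M' ⊗ N` and
  `M ⊗ N'` under `M ⊗ N` exists, and its natural map to `M' ⊗ N'` is a `K`-admissible
  monomorphism. -/
  exists_pushout : ∀ {M M' N N' : Bun 𝒳} (f : M ⟶ M') (g : N ⟶ N'), IsKAdmissibleMono f →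
    IsKAdmissibleMono g → Limits.HasPushout (f ▷ N) (M ◁ g)
  pushoutProduct : ∀ {M M' N N' P : Bun 𝒳} (f : M ⟶ M') (g : N ⟶ N') (j : M' ⊗ N ⟶ P)
    (k : M ⊗ N' ⟶ P) (h : IsPushout (f ▷ N) (M ◁ g) j k), IsKAdmissibleMono f →
    IsKAdmissibleMono g →
      IsKAdmissibleMono (h.desc (M' ◁ g) (f ▷ N') (whisker_exchange f g).symm)

end F1

end

/-! The proof computes on affine open sets and on generators. An affine open set V of an M₀-scheme
is either empty or has a closed point, the prime ideal of nonunits, whose only open neighbourhood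
inside V is V itself (`exists_closed`). Hence sheafification does not change sections over V
(`toSh_bijective`), every section over V of a tensor product M̃ ⊗ Ñ is a pure tensor m ⊗ n, and
quasi-coherence, coherence and local projectivity, given locally, amount to conditions on all affine
open sets at once.

Over a scheme, the sections over U of the sheaf Hom(N, Z) are the morphisms N → j_* j^* Z, where j
is the inclusion of U. A bilinear map M × N → Z is a compatible linear family of such local
homomorphisms, indexed by the sections of M (`Bilin.ofFam`). This currying yields associativity,
shows that M ⊗ - preserves colimits, and produces the comparison isomorphisms e^*M ⊗ e^*N ≅ e^*(M ⊗
N) and M_ℤ ⊗ N_ℤ ≅ (M ⊗ N)_ℤ. The isomorphism ε of a tensor product is then known on the generators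
m ⊗ n (`tens_ε`), and the coherence laws become identities between pure tensors. Tensor products of
quasi-coherent modules are quasi-coherent because on Spec R the modules of the form Ã are closed
under colimits and every R-module has a free presentation.

Bi-exactness rests on `isKAdmissibleMono_iff`: in Bun a sequence M₁ → M₂ → M₃ is admissible exactly
when the first components form a wedge M̃₂ = M̃₁ ∨ M̃₃ and the second components form a short exact
sequence (`CompExact`). The reason for the wedge is that a surjective normal map onto a projective
set has a section over every affine open set, and normality makes this section unique away from the
base point; the local sections therefore glue, and the source is the wedge of the kernel and the
image of the section (`IsNrm.exists_isWedge`). Flatness of the second component makes e^* compatible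
with its kernel, so that kernels may be formed componentwise (`exists_kernel`). Conversely, a split
injection φ̃ forces e^*φ to be a monomorphism through ε, and right exactness of e^* gives the
flatness of ψ.

In this form the assertions are formal. Tensor products preserve wedges, and tensoring with a vector
bundle preserves short exact sequences. A push-out along an admissible monomorphism is
componentwise: the wedge Q̃ ∨ M̃₃ and the push-out of modules, joined by ε because base extension
turns wedges into direct sums and e^* is a left adjoint (`exists_compPO`); it stays in Bun because
its second component is an extension of vector bundles. For the push-out product of M → M' and N →
N' with quotients L and L', the first component of M' ⊗ N' is the wedge of M ⊗ N', L ⊗ N and L ⊗ L',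
of which the push-out is the first two summands; on second components a comparison of extensions
shows that the natural map is injective with cokernel L ⊗ L' (`shortExact_pushoutProduct`). -/

noncomputable section
namespace F1

/-! ### Sections of modules over a scheme and the associated sheaf. -/

section
variable {Y : Scheme.{u}} {P : Y.PresheafOfModules} {M N Z : Y.Modules}

/-- Restriction of sections of a module. -/
def rs (M : Y.Modules) {U V : Y.Opens} (h : V ≤ U) : Γ(M, U) →+ Γ(M, V) :=
  (M.presheaf.map (homOfLE h).op).hom

/-- Restriction of functions. -/
def rr {U V : Y.Opens} (h : V ≤ U) : Γ(Y, U) →+* Γ(Y, V) := (Y.presheaf.map (homOfLE h).op).hom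

lemma rs_rs {U V W : Y.Opens} (h : V ≤ U) (k : W ≤ V) (m : Γ(M, U)) :
    rs M k (rs M h m) = rs M (k.trans h) m := by
  change (M.presheaf.map (homOfLE h).op ≫ M.presheaf.map (homOfLE k).op).hom m = _
  rw [← Functor.map_comp]
  rfl

lemma rs_rfl {U : Y.Opens} (m : Γ(M, U)) : rs M le_rfl m = m := by
  change (M.presheaf.map (𝟙 _)).hom m = m
  simp

lemma rr_rr {U V W : Y.Opens} (h : V ≤ U) (k : W ≤ V) (m : Γ(Y, U)) :
    rr k (rr h m) = rr (k.trans h) m := by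
  change (Y.presheaf.map (homOfLE h).op ≫ Y.presheaf.map (homOfLE k).op).hom m = _
  rw [← Functor.map_comp]
  rfl

lemma rr_rfl {U : Y.Opens} (m : Γ(Y, U)) : rr le_rfl m = m := by
  change (Y.presheaf.map (𝟙 _)).hom m = m
  simp

lemma rs_smul {U V : Y.Opens} (h : V ≤ U) (r : Γ(Y, U)) (m : Γ(M, U)) :
    rs M h (r • m) = rr h r • rs M h m := M.map_smul _ _ _

/-- The map of sections of a morphism. -/
def ap (f : M ⟶ N) (U : Y.Opens) : Γ(M, U) →+ Γ(N, U) := (f.app U).hom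

lemma ap_smul (f : M ⟶ N) {U : Y.Opens} (r : Γ(Y, U)) (m : Γ(M, U)) :
    ap f U (r • m) = r • ap f U m := f.app_smul _ _

lemma ap_rs (f : M ⟶ N) {U V : Y.Opens} (h : V ≤ U) (m : Γ(M, U)) :
    ap f V (rs M h m) = rs N h (ap f U m) :=
  congrArg (fun t : Γ(M, U) ⟶ Γ(N, V) => t.hom m) (f.mapPresheaf.naturality (homOfLE h).op)

lemma ap_comp (f : M ⟶ N) (g : N ⟶ Z) (U : Y.Opens) (m : Γ(M, U)) :
    ap (f ≫ g) U m = ap g U (ap f U m) := rfl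

lemma ap_id (U : Y.Opens) (m : Γ(M, U)) : ap (𝟙 M) U m = m := rfl

lemma ap_add (f g : M ⟶ N) (U : Y.Opens) (m : Γ(M, U)) : ap (f + g) U m = ap f U m + ap g U m := rfl

lemma hom_ext_ap {f g : M ⟶ N} (h : ∀ U m, ap f U m = ap g U m) : f = g := by
  ext U m
  exact h U m

/-- A morphism from a compatible family of linear maps. -/
def mkHom (f : ∀ U, Γ(M, U) →+ Γ(N, U)) (hs : ∀ U (r : Γ(Y, U)) m, f U (r • m) = r • f U m)
    (hr : ∀ {U V : Y.Opens} (h : V ≤ U) m, f V (rs M h m) = rs N h (f U m)) : M ⟶ N :=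
  ⟨PresheafOfModules.homMk (M₁ := M.val) (M₂ := N.val)
    { app := fun W => AddCommGrpCat.ofHom (f W.unop)
      naturality := fun {W W'} i => by
        ext s
        exact hr (leOfHom i.unop) s }
    (fun W r s => hs W.unop r s)⟩

lemma sec_ext {ι : Type u} (W : ι → Y.Opens) {U : Y.Opens} (hW : ∀ i, W i ≤ U) (hU : U ≤ ⨆ i, W i)
    {s t : Γ(M, U)} (h : ∀ i, rs M (hW i) s = rs M (hW i) t) : s = t :=
  TopCat.Sheaf.eq_of_locally_eq' ⟨_, M.isSheaf⟩ W U (fun i => homOfLE (hW i)) hU s t h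

lemma sec_glue {ι : Type u} (W : ι → Y.Opens) {U : Y.Opens} (hW : ∀ i, W i ≤ U)
    (hU : U ≤ ⨆ i, W i) (s : ∀ i, Γ(M, W i))
    (h : ∀ i j, rs M (inf_le_left : W i ⊓ W j ≤ _) (s i) = rs M inf_le_right (s j)) :
    ∃ t : Γ(M, U), ∀ i, rs M (hW i) t = s i := by
  obtain ⟨t, ht, -⟩ := TopCat.Sheaf.existsUnique_gluing' ⟨_, M.isSheaf⟩ W U
    (fun i => homOfLE (hW i)) hU s h
  exact ⟨t, ht⟩

/-- The universal property of the sheaf associated with a presheaf of modules. -/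
def shLift (g : P ⟶ Z.val) : shMod P ⟶ Z :=
  (PresheafOfModules.sheafificationHomEquiv (𝟙 Y.ringCatSheaf.obj) (P := P) (F := Z)).symm g

lemma shLift_ap (g : P ⟶ Z.val) (W : Y.Opens) (m : P.obj (op W)) :
    ap (shLift g) W (toShMod P W m) = g.app (op W) m := by
  have e := (PresheafOfModules.sheafificationHomEquiv (𝟙 Y.ringCatSheaf.obj) (P := P)
    (F := Z)).apply_symm_apply g
  exact congrArg (fun t => (PresheafOfModules.Hom.app t (op W)).hom m) e

/-- By the sheafification adjunction a morphism out of the associated sheaf is the same as a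
morphism out of the presheaf. -/
lemma shMod_hom_ext {f g : shMod P ⟶ Z}
    (h : ∀ W m, ap f W (toShMod P W m) = ap g W (toShMod P W m)) : f = g := by
  apply (PresheafOfModules.sheafificationHomEquiv (𝟙 Y.ringCatSheaf.obj) (P := P) (F := Z)).injective
  refine PresheafOfModules.hom_ext fun W => ?_
  refine ModuleCat.hom_ext (LinearMap.ext fun m => ?_)
  exact h W.unop m

lemma toShMod_add (W : Y.Opens) (m n : P.obj (op W)) :
    toShMod P W (m + n) = toShMod P W m + toShMod P W n :=
  map_add ((CategoryTheory.toSheafify (Opens.grothendieckTopology Y) P.presheaf).app (op W)).hom m n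

/-- The canonical map corresponds to the identity of the associated sheaf under the adjunction,
hence underlies a morphism of presheaves of modules. -/
lemma toShMod_smul (W : Y.Opens) (r : Y.ringCatSheaf.obj.obj (op W)) (m : P.obj (op W)) :
    toShMod P W (r • m) = (show Γ(Y, W) from r) • toShMod P W m :=
  ((PresheafOfModules.sheafificationHomEquiv (𝟙 Y.ringCatSheaf.obj) (P := P) (F := shMod P)
    (𝟙 (shMod P))).app (op W)).hom.map_smul r m

lemma toShMod_rs {W W' : Y.Opens} (h : W' ≤ W) (m : P.obj (op W)) :
    rs (shMod P) h (toShMod P W m) = toShMod P W' (P.map (homOfLE h).op m) :=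
  (congrArg (fun t => t.hom m)
    ((CategoryTheory.toSheafify (Opens.grothendieckTopology Y) P.presheaf).naturality
      (homOfLE h).op)).symm

lemma shModMap_ap {P Q : Y.PresheafOfModules} (f : P ⟶ Q) (W : Y.Opens) (m : P.obj (op W)) :
    ap (shModMap f) W (toShMod P W m) = toShMod Q W (f.app (op W) m) :=
  (congrArg (fun t => (t.app (op W)).hom m) (CategoryTheory.toSheafify_naturality
    (Opens.grothendieckTopology Y) ((PresheafOfModules.toPresheaf _).map f))).symm

end

/-! ### Bilinear maps and the tensor product of modules over a scheme. -/

section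
variable {Y : Scheme.{u}} {M N Z M' N' : Y.Modules}

lemma tmulMod_add_left {U : Y.Opens} (m m' : Γ(M, U)) (n : Γ(N, U)) :
    tmulMod (m + m') n = tmulMod m n + tmulMod m' n :=
  (congrArg (toShMod (preTensMod M N) U)
    (show (TensorProduct.tmul Γ(Y, U) (m + m') n : TensorProduct Γ(Y, U) Γ(M, U) Γ(N, U)) = _
      from TensorProduct.add_tmul m m' n)).trans (toShMod_add _ _ _)

lemma tmulMod_add_right {U : Y.Opens} (m : Γ(M, U)) (n n' : Γ(N, U)) :
    tmulMod m (n + n') = tmulMod m n + tmulMod m n' :=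
  (congrArg (toShMod (preTensMod M N) U)
    (show (TensorProduct.tmul Γ(Y, U) m (n + n') : TensorProduct Γ(Y, U) Γ(M, U) Γ(N, U)) = _
      from TensorProduct.tmul_add m n n')).trans (toShMod_add _ _ _)

lemma tmulMod_smul_left {U : Y.Opens} (r : Γ(Y, U)) (m : Γ(M, U)) (n : Γ(N, U)) :
    tmulMod (r • m) n = r • tmulMod m n :=
  toShMod_smul (P := preTensMod M N) U r
    (TensorProduct.tmul Γ(Y, U) m n : TensorProduct Γ(Y, U) Γ(M, U) Γ(N, U))

lemma tmulMod_smul_right {U : Y.Opens} (r : Γ(Y, U)) (m : Γ(M, U)) (n : Γ(N, U)) :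
    tmulMod m (r • n) = r • tmulMod m n :=
  (congrArg (toShMod (preTensMod M N) U)
    (show (TensorProduct.tmul Γ(Y, U) m (r • n) : TensorProduct Γ(Y, U) Γ(M, U) Γ(N, U)) =
      TensorProduct.tmul Γ(Y, U) (r • m) n from
      (TensorProduct.tmul_smul r m n).trans (TensorProduct.smul_tmul' r m n))).trans
    (tmulMod_smul_left r m n)

lemma tmulMod_rs {U V : Y.Opens} (h : V ≤ U) (m : Γ(M, U)) (n : Γ(N, U)) :
    rs (tensMod M N) h (tmulMod m n) = tmulMod (rs M h m) (rs N h n) :=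
  toShMod_rs (P := preTensMod M N) h
    (TensorProduct.tmul Γ(Y, U) m n : TensorProduct Γ(Y, U) Γ(M, U) Γ(N, U))

variable (M N Z) in
/-- Bilinear maps of modules. -/
@[ext]
structure Bilin where
  toFun : ∀ U : Y.Opens, Γ(M, U) → Γ(N, U) → Γ(Z, U)
  add_left : ∀ U m m' n, toFun U (m + m') n = toFun U m n + toFun U m' n
  add_right : ∀ U m n n', toFun U m (n + n') = toFun U m n + toFun U m n'
  smul_left : ∀ U (r : Γ(Y, U)) m n, toFun U (r • m) n = r • toFun U m n
  smul_right : ∀ U (r : Γ(Y, U)) m n, toFun U m (r • n) = r • toFun U m n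
  res : ∀ {U V : Y.Opens} (h : V ≤ U) m n,
    toFun V (rs M h m) (rs N h n) = rs Z h (toFun U m n)

/-- The linear map on the tensor product of sections. -/
def Bilin.lin (b : Bilin M N Z) (U : Y.Opens) :
    TensorProduct Γ(Y, U) Γ(M, U) Γ(N, U) →ₗ[Γ(Y, U)] Γ(Z, U) :=
  TensorProduct.lift (LinearMap.mk₂ Γ(Y, U) (b.toFun U) (b.add_left U) (b.smul_left U)
    (b.add_right U) (b.smul_right U))

/-- The morphism on the presheaf tensor product. -/
def Bilin.pre (b : Bilin M N Z) : preTensMod M N ⟶ Z.val :=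
  PresheafOfModules.homMk (M₁ := preTensMod M N) (M₂ := Z.val)
    { app := fun W => AddCommGrpCat.ofHom (b.lin W.unop).toAddMonoidHom
      naturality := fun {W W'} i => by
        ext s
        refine TensorProduct.induction_on (motive := fun s => b.lin W'.unop
          (((preTensMod M N).presheaf.map i).hom s) = rs Z (leOfHom i.unop) (b.lin W.unop s))
          s ?_ ?_ ?_
        · erw [map_zero, map_zero]
        · intro m n
          exact b.res (leOfHom i.unop) m n
        · intro s t hs ht
          erw [map_add, map_add, hs, ht, map_add, map_add] }
    (fun W r s => (b.lin W.unop).map_smul r s)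

/-- The universal property of the tensor product. -/
def Bilin.lift (b : Bilin M N Z) : tensMod M N ⟶ Z := shLift b.pre

@[simp] lemma Bilin.lift_tmul (b : Bilin M N Z) {U : Y.Opens} (m : Γ(M, U)) (n : Γ(N, U)) :
    ap b.lift U (tmulMod m n) = b.toFun U m n :=
  shLift_ap (P := preTensMod M N) b.pre U
    (TensorProduct.tmul Γ(Y, U) m n : TensorProduct Γ(Y, U) Γ(M, U) Γ(N, U))

lemma tensMod_hom_ext {f g : tensMod M N ⟶ Z}
    (h : ∀ U (m : Γ(M, U)) (n : Γ(N, U)), ap f U (tmulMod m n) = ap g U (tmulMod m n)) :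
    f = g := by
  refine shMod_hom_ext (P := preTensMod M N) fun W s => ?_
  refine TensorProduct.induction_on (motive := fun s => ap f W (toShMod (preTensMod M N) W s) =
    ap g W (toShMod (preTensMod M N) W s)) s ?_ ?_ ?_
  · have : toShMod (preTensMod M N) W 0 = 0 :=
      map_zero ((CategoryTheory.toSheafify (Opens.grothendieckTopology Y)
        (preTensMod M N).presheaf).app (op W)).hom
    exact (congrArg (ap f W) this).trans ((map_zero _).trans ((map_zero _).symm.trans
      (congrArg (ap g W) this.symm)))
  · intro m n
    exact h W m n
  · intro s t hs ht
    have := toShMod_add (P := preTensMod M N) W s t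
    exact (congrArg (ap f W) this).trans ((map_add _ _ _).trans ((congrArg₂ (· + ·) hs ht).trans
      ((map_add _ _ _).symm.trans (congrArg (ap g W) this.symm))))

@[simp] lemma tensModMap_tmul (f : M ⟶ M') (g : N ⟶ N') {U : Y.Opens} (m : Γ(M, U))
    (n : Γ(N, U)) :
    ap (tensModMap f g) U (tmulMod m n) = tmulMod (ap f U m) (ap g U n) :=
  shModMap_ap (P := preTensMod M N) _ U
    (TensorProduct.tmul Γ(Y, U) m n : TensorProduct Γ(Y, U) Γ(M, U) Γ(N, U))

lemma tmulMod_zero_left {U : Y.Opens} (n : Γ(N, U)) : tmulMod (0 : Γ(M, U)) n = 0 := by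
  have := tmulMod_smul_left (0 : Γ(Y, U)) (0 : Γ(M, U)) n
  rwa [zero_smul, zero_smul] at this

lemma tmulMod_zero_right {U : Y.Opens} (m : Γ(M, U)) : tmulMod m (0 : Γ(N, U)) = 0 := by
  have := tmulMod_smul_right (0 : Γ(Y, U)) m (0 : Γ(N, U))
  rwa [zero_smul, zero_smul] at this
end

/-! ### Local homomorphisms, as morphisms into j_* j^* Z. -/

section
variable {Y : Scheme.{u}} {M N Z Z' : Y.Modules}

/-- The extension `j_* j^* Z` of the restriction of `Z` to an open set. -/
def onOpen (U : Y.Opens) (Z : Y.Modules) : Y.Modules :=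
  (Scheme.Modules.pushforward U.ι).obj (Z.restrict U.ι)

lemma onOpen_eq (U V : Y.Opens) : U.ι ''ᵁ U.ι ⁻¹ᵁ V = U ⊓ V := by
  rw [U.ι.image_preimage_eq_opensRange_inf, Scheme.Opens.opensRange_ι]

/-- The sections of `j_* j^* Z` over `V` as sections of `Z`. -/
def onTo {U V : Y.Opens} : Γ(onOpen U Z, V) →+ Γ(Z, U.ι ''ᵁ U.ι ⁻¹ᵁ V) where
  toFun z := z
  map_zero' := rfl
  map_add' _ _ := rfl

/-- The inverse of `onTo`. -/
def onOf {U V : Y.Opens} : Γ(Z, U.ι ''ᵁ U.ι ⁻¹ᵁ V) →+ Γ(onOpen U Z, V) where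
  toFun z := z
  map_zero' := rfl
  map_add' _ _ := rfl

lemma onTo_onOf {U V : Y.Opens} (z : Γ(Z, U.ι ''ᵁ U.ι ⁻¹ᵁ V)) : onTo (onOf z) = z := rfl

lemma onOf_onTo {U V : Y.Opens} (z : Γ(onOpen U Z, V)) : onOf (onTo z) = z := rfl

lemma onTo_rs {U V V' : Y.Opens} (h : V' ≤ V) (z : Γ(onOpen U Z, V)) :
    onTo (rs (onOpen U Z) h z) = rs Z (U := U.ι ''ᵁ U.ι ⁻¹ᵁ V) (V := U.ι ''ᵁ U.ι ⁻¹ᵁ V')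
      (by rw [onOpen_eq, onOpen_eq]; exact inf_le_inf_left _ h) (onTo z) := rfl

lemma onTo_smul {U V : Y.Opens} (r : Γ(Y, V)) (z : Γ(onOpen U Z, V)) :
    onTo (r • z) = rr (U.ι.image_preimage_le V) r • onTo z := by
  -- Functions on V act on j_* j^* Z through the open immersion of U; this identifies the action
  -- with that of their restriction.
  have h : (U.ι.appIso _).inv.hom ((U.ι.app V).hom r) = rr (U.ι.image_preimage_le V) r := by
    simp
    rfl
  rw [← h]
  rfl

attribute [irreducible] onOpen onTo onOf

/-- The sections of `j_* j^* Z` over `V` restrict to sections of `Z` over subsets of `U ⊓ V`. -/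
def onVal {U V W : Y.Opens} (hU : W ≤ U) (hV : W ≤ V) : Γ(onOpen U Z, V) →+ Γ(Z, W) :=
  (rs Z ((le_inf hU hV).trans (onOpen_eq U V).ge)).comp onTo

/-- The sections of `j_* j^* Z` over `V` are the sections of `Z` over `U ⊓ V`. -/
def onMk {U V : Y.Opens} : Γ(Z, U ⊓ V) →+ Γ(onOpen U Z, V) :=
  onOf.comp (rs Z (onOpen_eq U V).le)

lemma onVal_onMk {U V W : Y.Opens} (hU : W ≤ U) (hV : W ≤ V) (z : Γ(Z, U ⊓ V)) :
    onVal hU hV (onMk z) = rs Z (le_inf hU hV) z := by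
  simp only [onVal, onMk, AddMonoidHom.comp_apply, onTo_onOf, rs_rs]

lemma onMk_onVal {U V : Y.Opens} (z : Γ(onOpen U Z, V)) :
    onMk (onVal inf_le_left inf_le_right z) = z := by
  simp only [onVal, onMk, AddMonoidHom.comp_apply, rs_rs, rs_rfl, onOf_onTo]

lemma on_ext {U V : Y.Opens} {z z' : Γ(onOpen U Z, V)}
    (h : onVal (inf_le_left : U ⊓ V ≤ U) inf_le_right z = onVal inf_le_left inf_le_right z') :
    z = z' := by
  rw [← onMk_onVal z, h, onMk_onVal]

lemma rs_onVal {U V W W' : Y.Opens} (hU : W ≤ U) (hV : W ≤ V) (h : W' ≤ W)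
    (z : Γ(onOpen U Z, V)) : rs Z h (onVal hU hV z) = onVal (h.trans hU) (h.trans hV) z := by
  simp only [onVal, AddMonoidHom.comp_apply, rs_rs]

lemma onVal_rs {U V V' W : Y.Opens} (hU : W ≤ U) (hV : W ≤ V') (h : V' ≤ V)
    (z : Γ(onOpen U Z, V)) : onVal hU hV (rs _ h z) = onVal hU (hV.trans h) z := by
  simp only [onVal, AddMonoidHom.comp_apply, onTo_rs, rs_rs]

lemma onVal_smul {U V W : Y.Opens} (hU : W ≤ U) (hV : W ≤ V) (r : Γ(Y, V))
    (z : Γ(onOpen U Z, V)) : onVal hU hV (r • z) = rr hV r • onVal hU hV z := by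
  simp only [onVal, AddMonoidHom.comp_apply, onTo_smul, rs_smul, rr_rr]

/-- Morphisms to `j_* j^* Z`. -/
def onLift {U : Y.Opens} (f : ∀ V, Γ(N, V) →+ Γ(Z, U ⊓ V))
    (hs : ∀ V (r : Γ(Y, V)) (n : Γ(N, V)), f V (r • n) = rr (inf_le_right : U ⊓ V ≤ V) r • f V n)
    (hr : ∀ {V V' : Y.Opens} (h : V' ≤ V) (n : Γ(N, V)),
      f V' (rs N h n) = rs Z (inf_le_inf_left U h) (f V n)) : N ⟶ onOpen U Z :=
  mkHom (fun V => onMk.comp (f V))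
    (fun V r n => on_ext (by
      rw [onVal_smul]
      change onVal _ _ (onMk _) = _ • onVal _ _ (onMk _)
      rw [onVal_onMk, onVal_onMk, rs_rfl, rs_rfl, hs]))
    (fun h n => on_ext (by
      rw [onVal_rs]
      change onVal _ _ (onMk _) = onVal _ _ (onMk _)
      rw [onVal_onMk, onVal_onMk, rs_rfl, hr]))

lemma onVal_onLift {U : Y.Opens} (f : ∀ V, Γ(N, V) →+ Γ(Z, U ⊓ V)) (hs hr) {V W : Y.Opens}
    (hU : W ≤ U) (hV : W ≤ V) (n : Γ(N, V)) :
    onVal hU hV (ap (onLift f hs hr) V n) = rs Z (le_inf hU hV) (f V n) := onVal_onMk _ _ _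

/-- A section of j_* j^* Z over V is a section of Z over U ⊓ V. The value at n is therefore already
visible on the restriction of n to U ⊓ V, an open subset of U. -/
lemma hom_on_ext {U : Y.Opens} {f g : N ⟶ onOpen U Z} (h : ∀ V (hV : V ≤ U) (n : Γ(N, V)),
    onVal hV le_rfl (ap f V n) = onVal hV le_rfl (ap g V n)) : f = g := by
  refine hom_ext_ap fun V n => on_ext ?_
  have := h (U ⊓ V) inf_le_left (rs N inf_le_right n)
  rwa [ap_rs, ap_rs, onVal_rs, onVal_rs] at this

/-- Restriction to a smaller open set. -/
def onRes {U U' : Y.Opens} (h : U' ≤ U) : onOpen U Z ⟶ onOpen U' Z :=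
  onLift (fun V => onVal (inf_le_left.trans h) inf_le_right) (fun V r n => onVal_smul _ _ _ _)
    (fun h n => by rw [onVal_rs, rs_onVal])

lemma onVal_onRes {U U' : Y.Opens} (h : U' ≤ U) {V W : Y.Opens} (hU : W ≤ U') (hV : W ≤ V)
    (z : Γ(onOpen U Z, V)) : onVal hU hV (ap (onRes h) V z) = onVal (hU.trans h) hV z := by
  rw [onRes, onVal_onLift, rs_onVal]

/-- Multiplication with a function as an additive map. -/
def smulHom {V : Y.Opens} (r : Γ(Y, V)) : Γ(Z, V) →+ Γ(Z, V) where
  toFun z := r • z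
  map_zero' := smul_zero r
  map_add' := smul_add r

lemma smulHom_apply {V : Y.Opens} (r : Γ(Y, V)) (z : Γ(Z, V)) : smulHom r z = r • z := rfl

/-- The action of the functions on `U` on `j_* j^* Z`. -/
def onSmul {U : Y.Opens} (r : Γ(Y, U)) : onOpen U Z ⟶ onOpen U Z :=
  onLift (fun V => (smulHom (rr inf_le_left r)).comp (onVal inf_le_left inf_le_right))
    (fun V r' n => by
      simp only [AddMonoidHom.comp_apply, smulHom_apply]
      rw [onVal_smul, smul_comm])
    (fun h n => by
      simp only [AddMonoidHom.comp_apply, smulHom_apply]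
      rw [onVal_rs, rs_smul, rr_rr, rs_onVal])

lemma onVal_onSmul {U V W : Y.Opens} (r : Γ(Y, U)) (hU : W ≤ U) (hV : W ≤ V)
    (z : Γ(onOpen U Z, V)) : onVal hU hV (ap (onSmul r) V z) = rr hU r • onVal hU hV z := by
  rw [onSmul, onVal_onLift]
  simp only [AddMonoidHom.comp_apply, smulHom_apply]
  rw [rs_smul, rr_rr, rs_onVal]

/-- By adjunction N ⟶ j_* j^* Z is the module of sections over U of the sheaf Hom(N, Z). Its
structure over the functions on U lets m ↦ b(m, -) be stated as a linear map. -/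
instance (U : Y.Opens) : Module Γ(Y, U) (N ⟶ onOpen U Z) where
  smul r f := f ≫ onSmul r
  one_smul f := hom_on_ext fun V hV n => by
    change onVal _ _ (ap (onSmul 1) V (ap f V n)) = _
    rw [onVal_onSmul, map_one, one_smul]
  mul_smul r s f := hom_on_ext fun V hV n => by
    change onVal _ _ (ap (onSmul (r * s)) V (ap f V n)) =
      onVal _ _ (ap (onSmul r) V (ap (onSmul s) V (ap f V n)))
    rw [onVal_onSmul, onVal_onSmul, onVal_onSmul, map_mul, mul_smul]
  smul_zero r := Limits.zero_comp
  smul_add r f g := Preadditive.add_comp _ _ _ _ _ _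
  add_smul r s f := hom_on_ext fun V hV n => by
    change onVal _ _ (ap (onSmul (r + s)) V (ap f V n)) =
      onVal _ _ (ap (onSmul r) V (ap f V n) + ap (onSmul s) V (ap f V n))
    rw [map_add, onVal_onSmul, onVal_onSmul, onVal_onSmul, map_add, add_smul]
  zero_smul f := hom_on_ext fun V hV n => by
    change onVal _ _ (ap (onSmul 0) V (ap f V n)) = onVal _ _ 0
    rw [onVal_onSmul, map_zero, zero_smul, map_zero]

/-- The evaluation of a local homomorphism. -/
def ev {U W : Y.Opens} (f : N ⟶ onOpen U Z) (h : W ≤ U) : Γ(N, W) →+ Γ(Z, W) :=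
  (onVal h le_rfl).comp (ap f W)

lemma ev_ext {U : Y.Opens} {f g : N ⟶ onOpen U Z}
    (h : ∀ W (hW : W ≤ U) n, ev f hW n = ev g hW n) : f = g := hom_on_ext h

lemma ev_def {U W : Y.Opens} (f : N ⟶ onOpen U Z) (h : W ≤ U) (n : Γ(N, W)) :
    ev f h n = onVal h le_rfl (ap f W n) := rfl

lemma ev_rs {U W W' : Y.Opens} (f : N ⟶ onOpen U Z) (h : W ≤ U) (k : W' ≤ W) (n : Γ(N, W)) :
    ev f (k.trans h) (rs N k n) = rs Z k (ev f h n) := by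
  rw [ev_def, ev_def, ap_rs, onVal_rs, rs_onVal]

lemma ev_smul {U W : Y.Opens} (f : N ⟶ onOpen U Z) (h : W ≤ U) (r : Γ(Y, W)) (n : Γ(N, W)) :
    ev f h (r • n) = r • ev f h n := by
  rw [ev_def, ev_def, ap_smul, onVal_smul, rr_rfl]

lemma smul_ev {U W : Y.Opens} (f : N ⟶ onOpen U Z) (h : W ≤ U) (r : Γ(Y, U)) (n : Γ(N, W)) :
    ev (r • f) h n = rr h r • ev f h n := onVal_onSmul r h le_rfl (ap f W n)

lemma add_ev {U W : Y.Opens} (f g : N ⟶ onOpen U Z) (h : W ≤ U) (n : Γ(N, W)) :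
    ev (f + g) h n = ev f h n + ev g h n :=
  map_add (onVal h le_rfl) (ap f W n) (ap g W n)

lemma ev_onRes {U V W : Y.Opens} (f : N ⟶ onOpen U Z) (h : V ≤ U) (k : W ≤ V) (n : Γ(N, W)) :
    ev (f ≫ onRes h) k n = ev f (k.trans h) n :=
  onVal_onRes h k le_rfl (ap f W n)

lemma onVal_eq_ev {U V W : Y.Opens} (f : N ⟶ onOpen U Z) (hU : W ≤ U) (hV : W ≤ V) (n : Γ(N, V)) :
    onVal hU hV (ap f V n) = ev f hU (rs N hV n) := by
  rw [ev_def, ap_rs, onVal_rs]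

/-- A local homomorphism from a compatible family of linear maps. -/
def evMk {U : Y.Opens} (f : ∀ V, V ≤ U → (Γ(N, V) →+ Γ(Z, V)))
    (hs : ∀ V h (r : Γ(Y, V)) n, f V h (r • n) = r • f V h n)
    (hr : ∀ {V V' : Y.Opens} (h : V ≤ U) (k : V' ≤ V) n,
      f V' (k.trans h) (rs N k n) = rs Z k (f V h n)) : N ⟶ onOpen U Z :=
  onLift (fun V => (f (U ⊓ V) inf_le_left).comp (rs N inf_le_right))
    (fun V r n => by
      change f _ _ (rs _ _ _) = _ • f _ _ (rs _ _ _)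
      rw [rs_smul, hs])
    (fun {V V'} h n => by
      change f _ _ (rs _ _ (rs _ _ _)) = rs _ _ (f _ _ (rs _ _ _))
      rw [← hr, rs_rs, rs_rs])

lemma ev_evMk {U : Y.Opens} (f : ∀ V, V ≤ U → (Γ(N, V) →+ Γ(Z, V))) (hs hr) {V : Y.Opens}
    (h : V ≤ U) (n : Γ(N, V)) : ev (evMk f hs hr) h n = f V h n := by
  rw [ev_def, evMk, onVal_onLift]
  change rs _ _ (f _ _ (rs _ _ _)) = _
  rw [← hr, rs_rs, rs_rfl]
end

/-! ### Currying of bilinear maps; generators; associativity, unit and symmetry. -/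

section
variable {Y : Scheme.{u}} {M N Z M' N' P Q : Y.Modules}

lemma onMk_onRs {U V V' : Y.Opens} (h : V' ≤ V) (z : Γ(Z, U ⊓ V)) :
    rs _ h (onMk z) = onMk (rs Z (inf_le_inf_left U h) z) := on_ext (by
  rw [onVal_rs, onVal_onMk, onVal_onMk, rs_rs])

lemma smul_onMk {U V : Y.Opens} (r : Γ(Y, V)) (z : Γ(Z, U ⊓ V)) :
    onMk (rr (inf_le_right : U ⊓ V ≤ V) r • z) = r • onMk z := on_ext (by
  rw [onVal_smul, onVal_onMk, onVal_onMk, rs_rfl, rs_rfl])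

/-- A bilinear map with the arguments exchanged. -/
def Bilin.swap (b : Bilin M N Z) : Bilin N M Z where
  toFun U n m := b.toFun U m n
  add_left U n n' m := b.add_right U m n n'
  add_right U n m m' := b.add_left U m m' n
  smul_left U r n m := b.smul_right U r m n
  smul_right U r n m := b.smul_left U r m n
  res h n m := b.res h m n

/-- A bilinear map from a compatible family of local homomorphisms. -/
def Bilin.ofFam (c : ∀ U, Γ(M, U) → (N ⟶ onOpen U Z))
    (ha : ∀ U m m', c U (m + m') = c U m + c U m')
    (hs : ∀ U (r : Γ(Y, U)) m, c U (r • m) = r • c U m)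
    (hr : ∀ {U V : Y.Opens} (h : V ≤ U) m, c V (rs M h m) = c U m ≫ onRes h) :
    Bilin M N Z where
  toFun U m n := ev (c U m) le_rfl n
  add_left U m m' n := by rw [ha, add_ev]
  add_right U m n n' := map_add _ _ _
  smul_left U r m n := by rw [hs, smul_ev, rr_rfl]
  smul_right U r m n := ev_smul _ _ _ _
  res h m n := by rw [hr, ev_onRes, ← ev_rs]

/-- A morphism on a tensor product as a bilinear map. -/
def Bilin.ofHom (f : tensMod M N ⟶ Z) : Bilin M N Z where
  toFun U m n := ap f U (tmulMod m n)
  add_left U m m' n := by rw [tmulMod_add_left, map_add]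
  add_right U m n n' := by rw [tmulMod_add_right, map_add]
  smul_left U r m n := by rw [tmulMod_smul_left, ap_smul]
  smul_right U r m n := by rw [tmulMod_smul_right, ap_smul]
  res h m n := by rw [← tmulMod_rs, ap_rs]

/-- The local homomorphism defined by a bilinear map and a section in the first argument. -/
def Bilin.fix (b : Bilin M N Z) {U : Y.Opens} (m : Γ(M, U)) : N ⟶ onOpen U Z :=
  evMk (fun V h =>
      { toFun := fun n => b.toFun V (rs M h m) n
        map_zero' := by
          have := b.smul_right V 0 (rs M h m) 0
          rwa [zero_smul, zero_smul] at this
        map_add' := fun n n' => b.add_right V _ n n' })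
    (fun V h r n => b.smul_right V r _ n)
    (fun h k n => (congrArg (fun t => b.toFun _ t _) (rs_rs h k m).symm).trans (b.res k _ n))

lemma Bilin.ev_fix (b : Bilin M N Z) {U V : Y.Opens} (m : Γ(M, U)) (h : V ≤ U) (n : Γ(N, V)) :
    ev (b.fix m) h n = b.toFun V (rs M h m) n := ev_evMk _ _ _ h n

lemma Bilin.fix_add (b : Bilin M N Z) {U : Y.Opens} (m m' : Γ(M, U)) :
    b.fix (m + m') = b.fix m + b.fix m' := ev_ext fun W hW n => by
  rw [add_ev, ev_fix, ev_fix, ev_fix, map_add, b.add_left]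

lemma Bilin.fix_smul (b : Bilin M N Z) {U : Y.Opens} (r : Γ(Y, U)) (m : Γ(M, U)) :
    b.fix (r • m) = r • b.fix m := ev_ext fun W hW n => by
  rw [smul_ev, ev_fix, ev_fix, rs_smul, b.smul_left]

lemma Bilin.fix_rs (b : Bilin M N Z) {U V : Y.Opens} (h : V ≤ U) (m : Γ(M, U)) :
    b.fix (rs M h m) = b.fix m ≫ onRes h := ev_ext fun W hW n => by
  rw [ev_onRes, ev_fix, ev_fix, rs_rs]

/-- A family of sections that is closed under restriction and determines morphisms. -/
structure Gen (G : ∀ U, Γ(M, U) → Prop) : Prop where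
  res : ∀ {U V : Y.Opens} (h : V ≤ U) m, G U m → G V (rs M h m)
  ext : ∀ {Z : Y.Modules} (f g : M ⟶ Z), (∀ U m, G U m → ap f U m = ap g U m) → f = g

lemma Gen.all : Gen (M := M) (fun _ _ => True) :=
  ⟨fun _ _ _ => trivial, fun _ _ h => hom_ext_ap fun U m => h U m trivial⟩

/-- Generators may live over open sets that are not contained in U. Since the family is closed under
restriction, they can be replaced by their restrictions to U ⊓ V, which determine the value in j_*
j^* Z. -/
lemma Gen.ext_on {G : ∀ U, Γ(M, U) → Prop} (hG : Gen G) {U : Y.Opens} (f g : M ⟶ onOpen U Z)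
    (h : ∀ V (hV : V ≤ U) m, G V m → ev f hV m = ev g hV m) : f = g := by
  refine hG.ext f g fun V m hm => on_ext ?_
  rw [onVal_eq_ev, onVal_eq_ev]
  exact h _ _ _ (hG.res _ _ hm)

/-- Curry in each variable in turn: for a fixed generator m of M the two local homomorphisms on N
agree on the generators of N, hence on all n; for fixed n the two local homomorphisms on M then
agree on the generators of M. Fixing a section that is defined only over U is what requires local
homomorphisms. -/
lemma Gen.tens {G : ∀ U, Γ(M, U) → Prop} {H : ∀ U, Γ(N, U) → Prop} (hG : Gen G) (hH : Gen H) :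
    Gen (M := tensMod M N) (fun U s => ∃ m n, G U m ∧ H U n ∧ s = tmulMod m n) where
  res := by
    rintro U V h _ ⟨m, n, hm, hn, rfl⟩
    exact ⟨_, _, hG.res h m hm, hH.res h n hn, tmulMod_rs h m n⟩
  ext f g h := by
    have h1 : ∀ U (m : Γ(M, U)) (n : Γ(N, U)), G U m →
        ap f U (tmulMod m n) = ap g U (tmulMod m n) := fun U m n hm => by
      have := hH.ext_on ((Bilin.ofHom f).fix m) ((Bilin.ofHom g).fix m) fun V hV n hn => by
        rw [Bilin.ev_fix, Bilin.ev_fix]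
        exact h _ _ ⟨_, _, hG.res hV m hm, hn, rfl⟩
      have := congrArg (fun t => ev t le_rfl n) this
      rw [Bilin.ev_fix, Bilin.ev_fix, rs_rfl] at this
      exact this
    refine tensMod_hom_ext fun U m n => ?_
    have := hG.ext_on ((Bilin.ofHom f).swap.fix n) ((Bilin.ofHom g).swap.fix n) fun V hV m hm => by
      rw [Bilin.ev_fix, Bilin.ev_fix]
      exact h1 _ _ _ hm
    have := congrArg (fun t => ev t le_rfl m) this
    rw [Bilin.ev_fix, Bilin.ev_fix, rs_rfl] at this
    exact this

lemma tens3_ext {f g : tensMod (tensMod M N) P ⟶ Z}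
    (h : ∀ U (m : Γ(M, U)) (n : Γ(N, U)) (p : Γ(P, U)),
      ap f U (tmulMod (tmulMod m n) p) = ap g U (tmulMod (tmulMod m n) p)) : f = g :=
  ((Gen.all.tens Gen.all).tens Gen.all).ext f g (by
    rintro U _ ⟨_, p, ⟨m, n, -, -, rfl⟩, -, rfl⟩
    exact h U m n p)

lemma tens3_ext' {f g : tensMod M (tensMod N P) ⟶ Z}
    (h : ∀ U (m : Γ(M, U)) (n : Γ(N, U)) (p : Γ(P, U)),
      ap f U (tmulMod m (tmulMod n p)) = ap g U (tmulMod m (tmulMod n p))) : f = g :=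
  (Gen.all.tens (Gen.all.tens Gen.all)).ext f g (by
    rintro U _ ⟨m, _, -, ⟨n, p, -, -, rfl⟩, rfl⟩
    exact h U m n p)

lemma tens4_ext {f g : tensMod (tensMod (tensMod M N) P) Q ⟶ Z}
    (h : ∀ U (m : Γ(M, U)) (n : Γ(N, U)) (p : Γ(P, U)) (q : Γ(Q, U)),
      ap f U (tmulMod (tmulMod (tmulMod m n) p) q) =
        ap g U (tmulMod (tmulMod (tmulMod m n) p) q)) : f = g :=
  (((Gen.all.tens Gen.all).tens Gen.all).tens Gen.all).ext f g (by
    rintro U _ ⟨_, q, ⟨_, p, ⟨m, n, -, -, rfl⟩, -, rfl⟩, -, rfl⟩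
    exact h U m n p q)

/-- Symmetry. -/
def tensBraid (M N : Y.Modules) : tensMod M N ⟶ tensMod N M :=
  (Bilin.ofHom (𝟙 (tensMod N M))).swap.lift

@[simp] lemma tensBraid_tmul {U : Y.Opens} (m : Γ(M, U)) (n : Γ(N, U)) :
    ap (tensBraid M N) U (tmulMod m n) = tmulMod n m := Bilin.lift_tmul _ _ _

/-- The bilinear map defining the associator for a fixed third argument. -/
def assocBilin (M N : Y.Modules) {P : Y.Modules} {U : Y.Opens} (p : Γ(P, U)) :
    Bilin M N (onOpen U (tensMod M (tensMod N P))) where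
  toFun V m n := onMk (tmulMod (rs M inf_le_right m)
    (tmulMod (rs N inf_le_right n) (rs P inf_le_left p)))
  add_left V m m' n := by rw [map_add, tmulMod_add_left, map_add]
  add_right V m n n' := by rw [map_add, tmulMod_add_left, tmulMod_add_right, map_add]
  smul_left V r m n := by rw [rs_smul, tmulMod_smul_left, smul_onMk]
  smul_right V r m n := by rw [rs_smul, tmulMod_smul_left, tmulMod_smul_right, smul_onMk]
  res h m n := by
    rw [onMk_onRs, tmulMod_rs, tmulMod_rs, rs_rs, rs_rs, rs_rs, rs_rs, rs_rs]

lemma ev_assocBilin {U V : Y.Opens} (p : Γ(P, U)) (h : V ≤ U) (m : Γ(M, V)) (n : Γ(N, V)) :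
    ev (assocBilin M N p).lift h (tmulMod m n) = tmulMod m (tmulMod n (rs P h p)) := by
  rw [ev_def, Bilin.lift_tmul, assocBilin, onVal_onMk]
  simp only [tmulMod_rs, rs_rs, rs_rfl]

lemma tens_on_ext {U : Y.Opens} {f g : tensMod M N ⟶ onOpen U Z}
    (h : ∀ V (hV : V ≤ U) (m : Γ(M, V)) (n : Γ(N, V)), ev f hV (tmulMod m n) =
      ev g hV (tmulMod m n)) : f = g :=
  (Gen.all.tens Gen.all).ext_on f g (by
    rintro V hV _ ⟨m, n, -, -, rfl⟩
    exact h V hV m n)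

/-- Associativity. -/
def tensAssoc (M N P : Y.Modules) : tensMod (tensMod M N) P ⟶ tensMod M (tensMod N P) :=
  -- A trilinear map is a family, indexed by the sections p of P, of local homomorphisms on M ⊗ N;
  -- `swap` puts p back into the last place.
  (Bilin.ofFam (M := P) (N := tensMod M N) (fun U p => (assocBilin M N p).lift)
    (fun U p p' => tens_on_ext fun V hV m n => by
      rw [add_ev, ev_assocBilin, ev_assocBilin, ev_assocBilin, map_add, tmulMod_add_right,
        tmulMod_add_right])
    (fun U r p => tens_on_ext fun V hV m n => by
      rw [smul_ev, ev_assocBilin, ev_assocBilin, rs_smul, tmulMod_smul_right, tmulMod_smul_right])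
    (fun h p => tens_on_ext fun V hV m n => by
      rw [ev_onRes, ev_assocBilin, ev_assocBilin, rs_rs])).swap.lift

@[simp] lemma tensAssoc_tmul {U : Y.Opens} (m : Γ(M, U)) (n : Γ(N, U)) (p : Γ(P, U)) :
    ap (tensAssoc M N P) U (tmulMod (tmulMod m n) p) = tmulMod m (tmulMod n p) := by
  rw [tensAssoc, Bilin.lift_tmul]
  refine (ev_assocBilin p le_rfl m n).trans ?_
  rw [rs_rfl]

/-- The inverse of the associativity morphism. -/
def tensAssocInv (M N P : Y.Modules) : tensMod M (tensMod N P) ⟶ tensMod (tensMod M N) P :=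
  -- Conjugation by the symmetry turns the associativity morphism around: m ⊗ (n ⊗ p) ↦ (n ⊗ p) ⊗ m
  -- ↦ (p ⊗ n) ⊗ m ↦ p ⊗ (n ⊗ m) ↦ (n ⊗ m) ⊗ p ↦ (m ⊗ n) ⊗ p.
  tensBraid _ _ ≫ tensModMap (tensBraid _ _) (𝟙 _) ≫ tensAssoc _ _ _ ≫ tensBraid _ _ ≫
    tensModMap (tensBraid _ _) (𝟙 _)

@[simp] lemma tensAssocInv_tmul {U : Y.Opens} (m : Γ(M, U)) (n : Γ(N, U)) (p : Γ(P, U)) :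
    ap (tensAssocInv M N P) U (tmulMod m (tmulMod n p)) = tmulMod (tmulMod m n) p := by
  simp only [tensAssocInv, ap_comp, tensBraid_tmul, tensModMap_tmul, tensAssoc_tmul, ap_id]

lemma rs_one {U V : Y.Opens} (h : V ≤ U) (r : Γ(Y, U)) :
    rs (unitMod Y) h (r • oneMod U) = rr h r • oneMod V := by
  rw [rs_smul]
  congr 1
  exact map_one (rr h)

lemma eq_smul_one {U : Y.Opens} (r : Γ(unitMod Y, U)) :
    (show Γ(Y, U) from r) • oneMod U = r := mul_one (show Γ(Y, U) from r)

lemma rs_oneMod {U V : Y.Opens} (h : V ≤ U) : rs (unitMod Y) h (oneMod U) = oneMod V :=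
  map_one (rr h)

/-- The morphism from the structure sheaf defined by a global section. -/
def unitBilin (M : Y.Modules) : Bilin (unitMod Y) M M where
  toFun U r m := (show Γ(Y, U) from r) • m
  add_left U r r' m := add_smul (show Γ(Y, U) from r) (show Γ(Y, U) from r') m
  add_right U r m m' := smul_add _ _ _
  smul_left U r r' m := mul_smul r (show Γ(Y, U) from r') m
  smul_right U r r' m := smul_comm _ _ _
  res h r m := (rs_smul h (show Γ(Y, _) from r) m).symm

/-- The left unitor. -/
def tensUnit (M : Y.Modules) : tensMod (unitMod Y) M ⟶ M := (unitBilin M).lift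

@[simp] lemma tensUnit_tmul {U : Y.Opens} (r : Γ(Y, U)) (m : Γ(M, U)) :
    ap (tensUnit M) U (tmulMod (r • oneMod U) m) = r • m := by
  rw [tensUnit, Bilin.lift_tmul]
  exact congrArg (fun t : Γ(Y, U) => t • m) (mul_one r)

@[simp] lemma tensUnit_tmul_one {U : Y.Opens} (m : Γ(M, U)) :
    ap (tensUnit M) U (tmulMod (oneMod U) m) = m := by
  have := tensUnit_tmul 1 m
  rwa [one_smul, one_smul] at this

/-- The inverse of the left unitor. -/
def tensUnitInv (M : Y.Modules) : M ⟶ tensMod (unitMod Y) M :=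
  mkHom (fun U =>
      { toFun := fun m => tmulMod (oneMod U) m
        map_zero' := tmulMod_zero_right _
        map_add' := fun m m' => tmulMod_add_right _ _ _ })
    (fun U r m => tmulMod_smul_right _ _ _)
    (fun h m => by
      change tmulMod _ _ = rs _ h (tmulMod _ _)
      rw [tmulMod_rs, rs_oneMod])

@[simp] lemma tensUnitInv_ap {U : Y.Opens} (m : Γ(M, U)) :
    ap (tensUnitInv M) U m = tmulMod (oneMod U) m := rfl

lemma unit_tens_ext {f g : tensMod (unitMod Y) M ⟶ Z}
    (h : ∀ U (m : Γ(M, U)), ap f U (tmulMod (oneMod U) m) = ap g U (tmulMod (oneMod U) m)) :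
    f = g := tensMod_hom_ext fun U r m => by
  rw [← eq_smul_one r, tmulMod_smul_left, ap_smul, ap_smul, h]

instance : MonoidalCategoryStruct Y.Modules where
  tensorObj := tensMod
  tensorUnit := unitMod Y
  whiskerLeft M _ _ f := tensModMap (𝟙 M) f
  whiskerRight f M := tensModMap f (𝟙 M)
  tensorHom := tensModMap
  associator M N P := ⟨tensAssoc M N P, tensAssocInv M N P,
    tens3_ext fun U m n p => by
      rw [ap_comp, tensAssoc_tmul, tensAssocInv_tmul, ap_id],
    tens3_ext' fun U m n p => by
      rw [ap_comp, tensAssocInv_tmul, tensAssoc_tmul, ap_id]⟩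
  leftUnitor M := ⟨tensUnit M, tensUnitInv M,
    unit_tens_ext fun U m => by
      rw [ap_comp, tensUnit_tmul_one, tensUnitInv_ap, ap_id],
    hom_ext_ap fun U m => by rw [ap_comp, tensUnitInv_ap, tensUnit_tmul_one, ap_id]⟩
  rightUnitor M := ⟨tensBraid _ _ ≫ tensUnit M, tensUnitInv M ≫ tensBraid _ _,
    tensMod_hom_ext fun U m r => by
      rw [← eq_smul_one r, tmulMod_smul_right, ap_smul, ap_smul, ap_comp, ap_comp, ap_comp,
        tensBraid_tmul, tensUnit_tmul_one, tensUnitInv_ap, tensBraid_tmul, ap_id],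
    hom_ext_ap fun U m => by
      rw [ap_comp, ap_comp, ap_comp, tensUnitInv_ap, tensBraid_tmul, tensBraid_tmul,
        tensUnit_tmul_one, ap_id]⟩

end

/-! ### Coherence laws over a scheme; tensor products preserve colimits. -/

section
variable {Y : Scheme.{u}} {M N Z M' N' P P' Q M'' N'' : Y.Modules}

lemma tensModMap_id : tensModMap (𝟙 M) (𝟙 N) = 𝟙 _ :=
  tensMod_hom_ext fun U m n => tensModMap_tmul _ _ _ _

lemma tensModMap_comp (f : M ⟶ M') (f' : M' ⟶ M'') (g : N ⟶ N') (g' : N' ⟶ N'') :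
    tensModMap f g ≫ tensModMap f' g' = tensModMap (f ≫ f') (g ≫ g') :=
  tensMod_hom_ext fun U m n => by
    rw [ap_comp, tensModMap_tmul, tensModMap_tmul, tensModMap_tmul, ap_comp, ap_comp]

lemma tensAssoc_nat (f : M ⟶ M') (g : N ⟶ N') (h : P ⟶ P') :
    tensModMap (tensModMap f g) h ≫ tensAssoc _ _ _ =
      tensAssoc _ _ _ ≫ tensModMap f (tensModMap g h) := tens3_ext fun U m n p => by
  rw [ap_comp, ap_comp, tensModMap_tmul, tensModMap_tmul, tensAssoc_tmul, tensAssoc_tmul,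
    tensModMap_tmul, tensModMap_tmul]

lemma tensUnit_nat (f : M ⟶ N) :
    tensModMap (𝟙 (unitMod Y)) f ≫ tensUnit N = tensUnit M ≫ f := unit_tens_ext fun U m => by
  rw [ap_comp, ap_comp, tensModMap_tmul, ap_id, tensUnit_tmul_one, tensUnit_tmul_one]

lemma tensBraid_nat (f : M ⟶ M') (g : N ⟶ N') :
    tensModMap f g ≫ tensBraid _ _ = tensBraid _ _ ≫ tensModMap g f :=
  tensMod_hom_ext fun U m n => by
    rw [ap_comp, ap_comp, tensModMap_tmul, tensBraid_tmul, tensBraid_tmul, tensModMap_tmul]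

lemma tensBraid_tensUnit_nat (f : M ⟶ N) :
    tensModMap f (𝟙 (unitMod Y)) ≫ tensBraid _ _ ≫ tensUnit N =
      (tensBraid _ _ ≫ tensUnit M) ≫ f := by
  rw [← Category.assoc, tensBraid_nat, Category.assoc, tensUnit_nat, Category.assoc]

lemma tensMod_pentagon :
    tensModMap (tensAssoc M N P) (𝟙 Q) ≫ tensAssoc M (tensMod N P) Q ≫
      tensModMap (𝟙 M) (tensAssoc N P Q) =
    tensAssoc (tensMod M N) P Q ≫ tensAssoc M N (tensMod P Q) := tens4_ext fun U m n p q => by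
  rw [ap_comp, ap_comp, ap_comp, tensModMap_tmul, tensAssoc_tmul, ap_id, tensAssoc_tmul,
    tensModMap_tmul, tensAssoc_tmul, ap_id, tensAssoc_tmul, tensAssoc_tmul]

lemma tensMod_triangle :
    tensAssoc M (unitMod Y) N ≫ tensModMap (𝟙 M) (tensUnit N) =
      tensModMap (tensBraid _ _ ≫ tensUnit M) (𝟙 N) := tens3_ext fun U m r n => by
  rw [ap_comp, tensAssoc_tmul, tensModMap_tmul, tensModMap_tmul, ap_id, ap_id, ap_comp,
    tensBraid_tmul, ← eq_smul_one r, tensUnit_tmul, tensUnit_tmul, tmulMod_smul_left,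
    tmulMod_smul_right]

lemma tensBraid_tensBraid : tensBraid M N ≫ tensBraid N M = 𝟙 _ :=
  tensMod_hom_ext fun U m n => by rw [ap_comp, tensBraid_tmul, tensBraid_tmul, ap_id]

lemma tensMod_hexagon :
    tensAssoc M N P ≫ tensBraid M (tensMod N P) ≫ tensAssoc N P M =
      tensModMap (tensBraid M N) (𝟙 P) ≫ tensAssoc N M P ≫
        tensModMap (𝟙 N) (tensBraid M P) := tens3_ext fun U m n p => by
  rw [ap_comp, ap_comp, ap_comp, ap_comp, tensAssoc_tmul, tensBraid_tmul, tensAssoc_tmul,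
    tensModMap_tmul, tensBraid_tmul, ap_id, tensAssoc_tmul, tensModMap_tmul, tensBraid_tmul, ap_id]

lemma tensMod_hexagon' :
    tensAssocInv M N P ≫ tensBraid (tensMod M N) P ≫ tensAssocInv P M N =
      tensModMap (𝟙 M) (tensBraid N P) ≫ tensAssocInv M P N ≫
        tensModMap (tensBraid M P) (𝟙 N) := tens3_ext' fun U m n p => by
  rw [ap_comp, ap_comp, ap_comp, ap_comp, tensAssocInv_tmul, tensBraid_tmul, tensAssocInv_tmul,
    tensModMap_tmul, tensBraid_tmul, ap_id, tensAssocInv_tmul, tensModMap_tmul, tensBraid_tmul,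
    ap_id]

/-- The tensor product with a fixed module. -/
def tensL (M : Y.Modules) : Y.Modules ⥤ Y.Modules where
  obj N := tensMod M N
  map f := tensModMap (𝟙 M) f
  map_id N := tensModMap_id
  map_comp f g := by rw [tensModMap_comp, Category.comp_id]

lemma comp_fix_ofHom (f : tensMod M N ⟶ Z) (k : N' ⟶ N) {U : Y.Opens} (m : Γ(M, U)) :
    k ≫ (Bilin.ofHom f).fix m = (Bilin.ofHom (tensModMap (𝟙 M) k ≫ f)).fix m :=
  ev_ext fun W hW n => by
    have e : ev (k ≫ (Bilin.ofHom f).fix m) hW n = ev ((Bilin.ofHom f).fix m) hW (ap k W n) := rfl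
    rw [e, Bilin.ev_fix, Bilin.ev_fix]
    change ap f W (tmulMod _ _) = ap f W (ap (tensModMap (𝟙 M) k) W (tmulMod _ _))
    rw [tensModMap_tmul]
    rfl

lemma tensModMap_add_right (f g : N ⟶ N') :
    tensModMap (𝟙 M) (f + g) = tensModMap (𝟙 M) f + tensModMap (𝟙 M) g :=
  tensMod_hom_ext fun U m n => by
    rw [ap_add, tensModMap_tmul, tensModMap_tmul, tensModMap_tmul, ap_add, tmulMod_add_right]

section colim
variable {J : Type*} [Category J] {K : J ⥤ Y.Modules} {c : Limits.Cocone K}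

/-- The induced cocone under the diagram of second factors. -/
def fixCocone (s : Limits.Cocone (K ⋙ tensL M)) {U : Y.Opens} (m : Γ(M, U)) :
    Limits.Cocone K where
  pt := onOpen U s.pt
  ι :=
    { app := fun j => (Bilin.ofHom (M := M) (N := K.obj j) (s.ι.app j)).fix m
      naturality := fun j k f => ((comp_fix_ofHom (s.ι.app k) (K.map f) m).trans
        (congrArg (fun t => (Bilin.ofHom (M := M) (N := K.obj j) t).fix m) (s.w f))).trans
        (Category.comp_id _).symm }

/-- The local homomorphism induced by `fixCocone`. -/
def fixDesc (hc : Limits.IsColimit c) (s : Limits.Cocone (K ⋙ tensL M)) {U : Y.Opens}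
    (m : Γ(M, U)) : c.pt ⟶ onOpen U s.pt := hc.desc (fixCocone s m)

lemma fixDesc_fac (hc : Limits.IsColimit c) (s : Limits.Cocone (K ⋙ tensL M)) {U : Y.Opens}
    (m : Γ(M, U)) (j : J) : (show K.obj j ⟶ c.pt from c.ι.app j) ≫ fixDesc hc s m =
      (Bilin.ofHom (M := M) (N := K.obj j) (s.ι.app j)).fix m := hc.fac (fixCocone s m) j

lemma colim_ext (hc : Limits.IsColimit c) {f g : c.pt ⟶ Z}
    (h : ∀ j, (show K.obj j ⟶ c.pt from c.ι.app j) ≫ f =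
      (show K.obj j ⟶ c.pt from c.ι.app j) ≫ g) : f = g := hc.hom_ext h

/-- The descent morphism showing that tensor products preserve colimits. -/
def tensDesc (hc : Limits.IsColimit c) (s : Limits.Cocone (K ⋙ tensL M)) :
    tensMod M c.pt ⟶ s.pt :=
  (Bilin.ofFam (fun U m => fixDesc hc s m)
    (fun U m m' => colim_ext hc fun j => by
      rw [fixDesc_fac, Preadditive.comp_add, fixDesc_fac, fixDesc_fac]
      exact Bilin.fix_add _ _ _)
    (fun U r m => colim_ext hc fun j => by
      refine Eq.trans (fixDesc_fac hc s _ j) ?_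
      refine Eq.trans (Bilin.fix_smul _ _ _) ?_
      rw [← fixDesc_fac hc]
      exact Category.assoc _ _ (onSmul r))
    (fun h m => colim_ext hc fun j => by
      refine Eq.trans (fixDesc_fac hc s _ j) ?_
      refine Eq.trans (Bilin.fix_rs _ _ _) ?_
      rw [← fixDesc_fac hc]
      exact Category.assoc _ _ _)).lift

lemma fix_tensDesc (hc : Limits.IsColimit c) (s : Limits.Cocone (K ⋙ tensL M)) {U : Y.Opens}
    (m : Γ(M, U)) : (Bilin.ofHom (tensDesc hc s)).fix m = fixDesc hc s m :=
  ev_ext fun W hW n => by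
    rw [Bilin.ev_fix]
    change ap (tensDesc hc s) W _ = _
    rw [tensDesc, Bilin.lift_tmul]
    change ev (fixDesc hc s (rs M hW m)) le_rfl n = _
    have : fixDesc hc s (rs M hW m) = fixDesc hc s m ≫ onRes hW := colim_ext hc fun j => by
      refine Eq.trans (fixDesc_fac hc s _ j) ?_
      refine Eq.trans (Bilin.fix_rs _ _ _) ?_
      rw [← fixDesc_fac hc]
      exact Category.assoc _ _ _
    rw [this, ev_onRes]

lemma ofHom_fix_ext {f g : tensMod M N ⟶ Z}
    (h : ∀ (U : Y.Opens) (m : Γ(M, U)), (Bilin.ofHom f).fix m = (Bilin.ofHom g).fix m) : f = g :=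
  tensMod_hom_ext fun U m n => by
    have := congrArg (fun t => ev t le_rfl n) (h U m)
    rw [Bilin.ev_fix, Bilin.ev_fix, rs_rfl] at this
    exact this

lemma tensDesc_fac (hc : Limits.IsColimit c) (s : Limits.Cocone (K ⋙ tensL M)) (j : J) :
    tensModMap (𝟙 M) (show K.obj j ⟶ c.pt from c.ι.app j) ≫ tensDesc hc s =
      (show tensMod M (K.obj j) ⟶ s.pt from s.ι.app j) :=
  ofHom_fix_ext fun U m => by
    rw [← comp_fix_ofHom, fix_tensDesc, fixDesc_fac]

lemma tens_colim_ext (hc : Limits.IsColimit c) {f g : tensMod M c.pt ⟶ Z}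
    (h : ∀ j, tensModMap (𝟙 M) (show K.obj j ⟶ c.pt from c.ι.app j) ≫ f =
      tensModMap (𝟙 M) (show K.obj j ⟶ c.pt from c.ι.app j) ≫ g) : f = g :=
  ofHom_fix_ext fun U m => colim_ext hc fun j => by
    rw [comp_fix_ofHom, comp_fix_ofHom, h]

/-- This is the argument for a left adjoint, carried out with local homomorphisms. A cocone under M
⊗ K with vertex Z and a section m of M over U give a cocone under K with vertex j_* j^* Z. The
morphisms descended from these cocones depend linearly on m and are compatible with restriction, so
they form a bilinear map. -/
instance (M : Y.Modules) : Limits.PreservesColimits (tensL M) where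
  preservesColimitsOfShape {J} _ :=
    { preservesColimit := fun {K} => ⟨fun {c} hc => ⟨
        { desc := fun s => tensDesc hc s
          fac := fun s j => tensDesc_fac hc s j
          uniq := fun s m h => tens_colim_ext hc fun j =>
            (h j).trans (tensDesc_fac hc s j).symm }⟩⟩ }

end colim

instance (M : Y.Modules) : (tensL M).Additive where
  map_add {N N' f g} := tensModMap_add_right f g

end

/-! ### Pullback commutes with tensor products and with the unit. -/

section
variable {Y B : Scheme.{u}} (e : Y ⟶ B) {M N M' N' : B.Modules} {Z Z' : Y.Modules}

/-- The pullback of modules. -/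
abbrev pb (M : B.Modules) : Y.Modules := (Scheme.Modules.pullback e).obj M

/-- The pullback of morphisms. -/
abbrev pbMap (f : M ⟶ M') : pb e M ⟶ pb e M' := (Scheme.Modules.pullback e).map f

/-- The pullback of functions. -/
def pr (U : B.Opens) : Γ(B, U) →+* Γ(Y, e ⁻¹ᵁ U) := (e.app U).hom

lemma pr_rr {U V : B.Opens} (h : V ≤ U) (r : Γ(B, U)) :
    rr (e.preimage_mono h) (pr e U r) = pr e V (rr h r) :=
  congrArg (fun t => t.hom r) (e.naturality (homOfLE h).op).symm

/-- The pullback of sections. -/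
def psec {U : B.Opens} : Γ(M, U) →+ Γ(pb e M, e ⁻¹ᵁ U) :=
  (((Scheme.Modules.pullbackPushforwardAdjunction e).unit.app M).app U).hom

lemma psec_smul {U : B.Opens} (r : Γ(B, U)) (m : Γ(M, U)) :
    psec e (r • m) = pr e U r • psec e m :=
  ((Scheme.Modules.pullbackPushforwardAdjunction e).unit.app M).app_smul r m

lemma psec_rs {U V : B.Opens} (h : V ≤ U) (m : Γ(M, U)) :
    rs (pb e M) (e.preimage_mono h) (psec e m) = psec e (rs M h m) :=
  (ap_rs ((Scheme.Modules.pullbackPushforwardAdjunction e).unit.app M) h m).symm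

/-- Morphisms to a direct image. -/
def toPush (f : ∀ U : B.Opens, Γ(M, U) →+ Γ(Z, e ⁻¹ᵁ U))
    (hs : ∀ U (r : Γ(B, U)) m, f U (r • m) = pr e U r • f U m)
    (hr : ∀ {U V : B.Opens} (h : V ≤ U) m, f V (rs M h m) = rs Z (e.preimage_mono h) (f U m)) :
    M ⟶ (Scheme.Modules.pushforward e).obj Z :=
  mkHom (N := (Scheme.Modules.pushforward e).obj Z) f hs (fun h m => hr h m)

variable {e}

/-- The universal property of the inverse image. -/
def pullLift (f : ∀ U : B.Opens, Γ(M, U) →+ Γ(Z, e ⁻¹ᵁ U))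
    (hs : ∀ U (r : Γ(B, U)) m, f U (r • m) = pr e U r • f U m)
    (hr : ∀ {U V : B.Opens} (h : V ≤ U) m, f V (rs M h m) = rs Z (e.preimage_mono h) (f U m)) :
    pb e M ⟶ Z :=
  ((Scheme.Modules.pullbackPushforwardAdjunction e).homEquiv M Z).symm (toPush e f hs hr)

lemma homEquiv_ap (f : pb e M ⟶ Z) {U : B.Opens} (m : Γ(M, U)) :
    ap ((Scheme.Modules.pullbackPushforwardAdjunction e).homEquiv M Z f) U m =
      ap f _ (psec e m) := by
  rw [Adjunction.homEquiv_unit]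
  rfl

@[simp] lemma pullLift_psec (f : ∀ U : B.Opens, Γ(M, U) →+ Γ(Z, e ⁻¹ᵁ U)) (hs hr) {U : B.Opens}
    (m : Γ(M, U)) : ap (pullLift (e := e) f hs hr) _ (psec e m) = f U m := by
  rw [← homEquiv_ap, pullLift, Equiv.apply_symm_apply]
  rfl

lemma pull_hom_ext {f g : pb e M ⟶ Z}
    (h : ∀ U (m : Γ(M, U)), ap f _ (psec e m) = ap g _ (psec e m)) : f = g := by
  apply ((Scheme.Modules.pullbackPushforwardAdjunction e).homEquiv M Z).injective
  refine hom_ext_ap fun U m => ?_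
  rw [homEquiv_ap, homEquiv_ap, h]

@[simp] lemma pbMap_psec (f : M ⟶ M') {U : B.Opens} (m : Γ(M, U)) :
    ap (pbMap e f) _ (psec e m) = psec e (ap f U m) :=
  congrArg (fun t => ap t U m) ((Scheme.Modules.pullbackPushforwardAdjunction e).unit.naturality f).symm

/-- The restricted pullback of a section. -/
def ps {U : B.Opens} {W : Y.Opens} (h : W ≤ e ⁻¹ᵁ U) : Γ(M, U) →+ Γ(pb e M, W) :=
  (rs (pb e M) h).comp (psec e)

/-- The restricted pullback of a function. -/
def prr {U : B.Opens} {W : Y.Opens} (h : W ≤ e ⁻¹ᵁ U) : Γ(B, U) →+* Γ(Y, W) :=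
  (rr h).comp (pr e U)

lemma ps_rfl {U : B.Opens} (m : Γ(M, U)) : ps le_rfl m = psec e m := rs_rfl _

lemma ps_smul {U : B.Opens} {W : Y.Opens} (h : W ≤ e ⁻¹ᵁ U) (r : Γ(B, U)) (m : Γ(M, U)) :
    ps h (r • m) = prr h r • ps h m := by
  change rs _ _ (psec e _) = rr h (pr e U r) • rs _ _ _
  rw [psec_smul, rs_smul]

lemma rs_ps {U : B.Opens} {W W' : Y.Opens} (h : W ≤ e ⁻¹ᵁ U) (k : W' ≤ W) (m : Γ(M, U)) :
    rs _ k (ps h m) = ps (k.trans h) m := rs_rs _ _ _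

lemma ps_rs {U V : B.Opens} {W : Y.Opens} (k : V ≤ U) (h : W ≤ e ⁻¹ᵁ V) (m : Γ(M, U)) :
    ps h (rs M k m) = ps (h.trans (e.preimage_mono k)) m := by
  change rs _ _ (psec e _) = rs _ _ (psec e _)
  rw [← psec_rs, rs_rs]

lemma prr_rr {U V : B.Opens} {W : Y.Opens} (k : V ≤ U) (h : W ≤ e ⁻¹ᵁ V) (r : Γ(B, U)) :
    prr h (rr k r) = prr (h.trans (e.preimage_mono k)) r := by
  change rr _ (pr e _ _) = rr _ (pr e _ _)
  rw [← pr_rr, rr_rr]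

lemma ap_pbMap_ps (f : M ⟶ M') {U : B.Opens} {W : Y.Opens} (h : W ≤ e ⁻¹ᵁ U) (m : Γ(M, U)) :
    ap (pbMap e f) W (ps h m) = ps h (ap f U m) := by
  change ap _ _ (rs _ _ _) = rs _ _ _
  rw [ap_rs, pbMap_psec]

/-- By adjunction a morphism out of e^*M is determined by the pullbacks of sections of M. Their
restrictions to smaller open sets are included to make the family closed under restriction. -/
lemma Gen.pull : Gen (M := pb e M) (fun W x => ∃ (U : B.Opens) (h : W ≤ e ⁻¹ᵁ U) (m : Γ(M, U)),
    x = ps h m) where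
  res := by
    rintro W W' h _ ⟨U, k, m, rfl⟩
    exact ⟨U, h.trans k, m, rs_ps _ _ _⟩
  ext f g h := pull_hom_ext fun U m => h _ _ ⟨U, le_rfl, m, (ps_rfl _).symm⟩

lemma pull_on_ext {W : Y.Opens} {f g : pb e M ⟶ onOpen W Z}
    (h : ∀ (U : B.Opens) (m : Γ(M, U)) (W' : Y.Opens) (hW : W' ≤ W) (hU : W' ≤ e ⁻¹ᵁ U),
      ev f hW (ps hU m) = ev g hW (ps hU m)) : f = g :=
  Gen.pull.ext_on f g (by
    rintro W' hW _ ⟨U, hU, m, rfl⟩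
    exact h U m W' hW hU)

lemma le_pinf {U V : B.Opens} {W : Y.Opens} (hU : W ≤ e ⁻¹ᵁ U) (hV : W ≤ e ⁻¹ᵁ V) :
    W ≤ e ⁻¹ᵁ (U ⊓ V) := le_inf hU hV

/-- The local homomorphism given by a compatible family. -/
def pullOn {W : Y.Opens} (f : ∀ (U : B.Opens) (W' : Y.Opens), W' ≤ W → W' ≤ e ⁻¹ᵁ U →
      Γ(M, U) → Γ(Z, W'))
    (ha : ∀ U W' hW hU m m', f U W' hW hU (m + m') = f U W' hW hU m + f U W' hW hU m')
    (hs : ∀ U W' hW hU (r : Γ(B, U)) m, f U W' hW hU (r • m) = prr hU r • f U W' hW hU m)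
    (hr : ∀ (U U' : B.Opens) (h : U' ≤ U) (W') (hW : W' ≤ W) (hU : W' ≤ e ⁻¹ᵁ U') m,
      f U' W' hW hU (rs M h m) = f U W' hW (hU.trans (e.preimage_mono h)) m)
    (hr' : ∀ (U : B.Opens) (W' W'' : Y.Opens) (hW : W' ≤ W) (hU : W' ≤ e ⁻¹ᵁ U) (h : W'' ≤ W') m,
      rs Z h (f U W' hW hU m) = f U W'' (h.trans hW) (h.trans hU) m) :
    pb e M ⟶ onOpen W Z :=
  pullLift (fun U => onMk.comp (AddMonoidHom.mk' (f U _ inf_le_left inf_le_right) (ha _ _ _ _)))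
    (fun U r m => by
      change onMk (f _ _ _ _ _) = _ • onMk (f _ _ _ _ _)
      rw [hs, ← smul_onMk]
      rfl)
    (fun h m => by
      change onMk (f _ _ _ _ _) = rs _ _ (onMk (f _ _ _ _ _))
      rw [onMk_onRs, hr, hr'])

lemma ev_pullOn {W : Y.Opens} (f : ∀ (U : B.Opens) (W' : Y.Opens), W' ≤ W → W' ≤ e ⁻¹ᵁ U →
      Γ(M, U) → Γ(Z, W')) (ha hs hr hr') {U : B.Opens} {W' : Y.Opens} (hW : W' ≤ W)
    (hU : W' ≤ e ⁻¹ᵁ U) (m : Γ(M, U)) :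
    ev (pullOn f ha hs hr hr') hW (ps hU m) = f U W' hW hU m := by
  change ev _ _ (rs _ _ _) = _
  rw [← onVal_eq_ev (f := pullOn f ha hs hr hr') hW hU, pullOn, pullLift_psec]
  refine (onVal_onMk _ _ _).trans ?_
  exact hr' _ _ _ _ _ _ _

/-- The local homomorphism given by tensoring with a section in the first argument. -/
def pullFix {U : B.Opens} (m : Γ(M, U)) : pb e N ⟶ onOpen (e ⁻¹ᵁ U) (pb e (tensMod M N)) :=
  pullOn (fun V W' hU hV n => ps (le_pinf hU hV)
      (tmulMod (rs M (inf_le_left : U ⊓ V ≤ U) m) (rs N inf_le_right n)))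
    (fun V W' hU hV n n' => by rw [map_add, tmulMod_add_right, map_add])
    (fun V W' hU hV r n => by
      rw [rs_smul, tmulMod_smul_right, ps_smul, prr_rr])
    (fun V V' h W' hU hV n => by
      rw [← ps_rs (inf_le_inf_left U h) (le_pinf hU hV), tmulMod_rs, rs_rs, rs_rs,
        rs_rs])
    (fun V W W' hU hV h n => rs_ps _ _ _)

lemma ev_pullFix {U V : B.Opens} {W : Y.Opens} (m : Γ(M, U)) (n : Γ(N, V)) (hU : W ≤ e ⁻¹ᵁ U)
    (hV : W ≤ e ⁻¹ᵁ V) : ev (pullFix m) hU (ps hV n) =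
      ps (le_pinf hU hV) (tmulMod (rs M (inf_le_left : U ⊓ V ≤ U) m)
        (rs N inf_le_right n)) := ev_pullOn _ _ _ _ _ _ _ _

lemma pullFix_add {U : B.Opens} (m m' : Γ(M, U)) :
    pullFix (N := N) (e := e) (m + m') = pullFix m + pullFix m' := pull_on_ext fun V n W h k => by
  rw [add_ev, ev_pullFix, ev_pullFix, ev_pullFix, map_add, tmulMod_add_left, map_add]

lemma pullFix_smul {U : B.Opens} (r : Γ(B, U)) (m : Γ(M, U)) :
    pullFix (N := N) (e := e) (r • m) = pr e U r • pullFix m := pull_on_ext fun V n W h k => by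
  rw [smul_ev, ev_pullFix, ev_pullFix, rs_smul, tmulMod_smul_left, ps_smul, prr_rr]
  rfl

lemma pullFix_rs {U U' : B.Opens} (hU : U' ≤ U) (m : Γ(M, U)) :
    pullFix (N := N) (e := e) (rs M hU m) = pullFix m ≫ onRes (e.preimage_mono hU) :=
  pull_on_ext fun V n W h k => by
    rw [ev_onRes, ev_pullFix, ev_pullFix, ← ps_rs (inf_le_inf_right V hU) (le_pinf h k),
      tmulMod_rs, rs_rs, rs_rs, rs_rs]

/-- The local homomorphism given by tensoring with a section of `e^* N`. -/
def pullFix' {W : Y.Opens} (y : Γ(pb e N, W)) : pb e M ⟶ onOpen W (pb e (tensMod M N)) :=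
  pullOn (fun U W' hW hU m => ev (pullFix m) hU (rs _ hW y))
    (fun U W' hW hU m m' => by rw [pullFix_add, add_ev])
    (fun U W' hW hU r m => by
      rw [pullFix_smul, smul_ev]
      rfl)
    (fun U U' h W' hW hU m => by rw [pullFix_rs, ev_onRes])
    (fun U W' W'' hW hU h m => by rw [← ev_rs, rs_rs])

lemma ev_pullFix' {U : B.Opens} {W W' : Y.Opens} (m : Γ(M, U)) (y : Γ(pb e N, W))
    (hW : W' ≤ W) (hU : W' ≤ e ⁻¹ᵁ U) :
    ev (pullFix' y) hW (ps hU m) = ev (pullFix m) hU (rs _ hW y) := ev_pullOn _ _ _ _ _ _ _ _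

variable (e M N) in
/-- The comparison `e^* M ⊗ e^* N → e^* (M ⊗ N)`. -/
def pullTens : tensMod (pb e M) (pb e N) ⟶ pb e (tensMod M N) :=
  -- The map is built by currying twice. A section m of M gives the local homomorphism n ↦ m ⊗ n on
  -- e^*N; evaluating these at a section y of e^*N, for varying m, gives a local homomorphism on
  -- e^*M.
  (Bilin.ofFam (M := pb e N) (N := pb e M) (fun W y => pullFix' y)
    (fun W y y' => pull_on_ext fun U m W' h k => by
      rw [add_ev, ev_pullFix', ev_pullFix', ev_pullFix', map_add, map_add])
    (fun W r y => pull_on_ext fun U m W' h k => by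
      rw [smul_ev, ev_pullFix', ev_pullFix', rs_smul, ev_smul])
    (fun h y => pull_on_ext fun U m W' h k => by
      rw [ev_onRes, ev_pullFix', ev_pullFix', rs_rs])).swap.lift

@[simp] lemma pullTens_tmul {U : B.Opens} (m : Γ(M, U)) (n : Γ(N, U)) :
    ap (pullTens e M N) _ (tmulMod (psec e m) (psec e n)) = psec e (tmulMod m n) := by
  rw [pullTens, Bilin.lift_tmul]
  change ev (pullFix' _) le_rfl _ = _
  rw [← ps_rfl m, ev_pullFix', rs_rfl, ← ps_rfl n, ev_pullFix, ← ps_rfl,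
    ← ps_rs (le_inf le_rfl le_rfl : U ≤ U ⊓ U) le_rfl, tmulMod_rs, rs_rs, rs_rs, rs_rfl, rs_rfl]

variable (e M N) in
/-- The comparison `e^* (M ⊗ N) → e^* M ⊗ e^* N`. -/
def pullTensInv : pb e (tensMod M N) ⟶ tensMod (pb e M) (pb e N) :=
  ((Scheme.Modules.pullbackPushforwardAdjunction e).homEquiv _ _).symm
    (Bilin.lift (Z := (Scheme.Modules.pushforward e).obj (tensMod (pb e M) (pb e N)))
      { toFun := fun U m n => (tmulMod (psec e m) (psec e n) :)
        add_left := fun U m m' n => by rw [map_add]; exact tmulMod_add_left _ _ _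
        add_right := fun U m n n' => by rw [map_add]; exact tmulMod_add_right _ _ _
        smul_left := fun U r m n => by rw [psec_smul]; exact tmulMod_smul_left _ _ _
        smul_right := fun U r m n => by rw [psec_smul]; exact tmulMod_smul_right _ _ _
        res := fun {U V} h m n => by
          rw [← psec_rs, ← psec_rs]
          exact (tmulMod_rs (e.preimage_mono h) (psec e m) (psec e n)).symm })

@[simp] lemma pullTensInv_psec {U : B.Opens} (m : Γ(M, U)) (n : Γ(N, U)) :
    ap (pullTensInv e M N) _ (psec e (tmulMod m n)) = tmulMod (psec e m) (psec e n) := by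
  rw [← homEquiv_ap, pullTensInv, Equiv.apply_symm_apply]
  exact Bilin.lift_tmul _ _ _

lemma pull_tens_ext {f g : pb e (tensMod M N) ⟶ Z}
    (h : ∀ U (m : Γ(M, U)) (n : Γ(N, U)),
      ap f _ (psec e (tmulMod m n)) = ap g _ (psec e (tmulMod m n))) : f = g := by
  apply ((Scheme.Modules.pullbackPushforwardAdjunction e).homEquiv _ Z).injective
  refine tensMod_hom_ext fun U m n => ?_
  rw [homEquiv_ap, homEquiv_ap, h]

lemma tens_pull_ext {f g : tensMod (pb e M) (pb e N) ⟶ Z}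
    (h : ∀ U (m : Γ(M, U)) (n : Γ(N, U)),
      ap f _ (tmulMod (psec e m) (psec e n)) = ap g _ (tmulMod (psec e m) (psec e n))) : f = g :=
  (Gen.pull.tens Gen.pull).ext f g (by
    rintro W _ ⟨_, _, ⟨U, hU, m, rfl⟩, ⟨V, hV, n, rfl⟩, rfl⟩
    -- The two generators are pulled back from possibly different open sets U and V; both are also
    -- pulled back from U ⊓ V, where the hypothesis applies.
    have e3 := congrArg (rs _ (le_pinf hU hV)) (h (U ⊓ V) (rs M inf_le_left m) (rs N inf_le_right n))
    rw [← ap_rs, ← ap_rs, tmulMod_rs] at e3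
    have e1 : rs _ (le_pinf hU hV) (psec e (rs M (inf_le_left : U ⊓ V ≤ U) m)) = ps hU m :=
      ps_rs _ (le_pinf hU hV) _
    have e2 : rs _ (le_pinf hU hV) (psec e (rs N (inf_le_right : U ⊓ V ≤ V) n)) = ps hV n :=
      ps_rs _ (le_pinf hU hV) _
    rw [e1, e2] at e3
    exact e3)

variable (e M N) in
/-- Inverse images commute with tensor products. -/
def pullTensIso : pb e (tensMod M N) ≅ tensMod (pb e M) (pb e N) :=
  ⟨pullTensInv e M N, pullTens e M N,
    pull_tens_ext fun U m n => by rw [ap_comp, pullTensInv_psec, pullTens_tmul, ap_id],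
    tens_pull_ext fun U m n => by rw [ap_comp, pullTens_tmul, pullTensInv_psec, ap_id]⟩

lemma pullTensInv_nat (f : M ⟶ M') (g : N ⟶ N') :
    pbMap e (tensModMap f g) ≫ pullTensInv e M' N' =
      pullTensInv e M N ≫ tensModMap (pbMap e f) (pbMap e g) := pull_tens_ext fun U m n => by
  rw [ap_comp, ap_comp, pbMap_psec, tensModMap_tmul, pullTensInv_psec, pullTensInv_psec,
    tensModMap_tmul, pbMap_psec, pbMap_psec]

attribute [irreducible] pullTens pullTensInv

lemma exists_smul_one {U : Y.Opens} (r : Γ(unitMod Y, U)) : ∃ s : Γ(Y, U), s • oneMod U = r :=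
  ⟨r, eq_smul_one r⟩

lemma unit_hom_ext {f g : unitMod Y ⟶ Z} (h : ∀ U, ap f U (oneMod U) = ap g U (oneMod U)) :
    f = g := hom_ext_ap fun U r => by
  obtain ⟨s, rfl⟩ := exists_smul_one r
  rw [ap_smul, ap_smul, h]

lemma pull_unit_ext {f g : pb e (unitMod B) ⟶ Z}
    (h : ∀ U, ap f _ (psec e (oneMod U)) = ap g _ (psec e (oneMod U))) : f = g :=
  pull_hom_ext fun U r => by
    obtain ⟨s, rfl⟩ := exists_smul_one r
    rw [psec_smul, ap_smul, ap_smul, h]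

/-- The morphism from the structure sheaf given by a global section. -/
def unitHom (z : Γ(Z, ⊤)) : unitMod Y ⟶ Z :=
  mkHom (fun U =>
      { toFun := fun r => (show Γ(Y, U) from r) • rs Z le_top z
        map_zero' := zero_smul _ _
        map_add' := fun r s => add_smul (show Γ(Y, U) from r) (show Γ(Y, U) from s) _ })
    (fun U r s => mul_smul r (show Γ(Y, U) from s) _)
    (fun {U V} h r => by
      refine Eq.trans ?_ (rs_smul h (show Γ(Y, U) from r) _).symm
      exact congrArg (fun t => rr h (show Γ(Y, U) from r) • t) (rs_rs _ h _).symm)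

lemma unitHom_one (z : Γ(Z, ⊤)) (U : Y.Opens) : ap (unitHom z) U (oneMod U) = rs Z le_top z :=
  one_smul Γ(Y, U) _

variable (e) in
/-- The comparison `e^* 𝒪 → 𝒪`. -/
def pullUnit : pb e (unitMod B) ⟶ unitMod Y :=
  ((Scheme.Modules.pullbackPushforwardAdjunction e).homEquiv _ _).symm
    (unitHom (Z := (Scheme.Modules.pushforward e).obj (unitMod Y)) (oneMod (e ⁻¹ᵁ ⊤)))

lemma pullUnit_one (U : B.Opens) : ap (pullUnit e) _ (psec e (oneMod U)) = oneMod (e ⁻¹ᵁ U) := by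
  rw [← homEquiv_ap, pullUnit, Equiv.apply_symm_apply]
  exact (unitHom_one _ U).trans (rs_oneMod (e.preimage_mono le_top))

variable (e) in
/-- The comparison `𝒪 → e^* 𝒪`. -/
def pullUnitInv : unitMod Y ⟶ pb e (unitMod B) := unitHom (psec e (oneMod ⊤))

lemma pullUnitInv_one (U : B.Opens) : ap (pullUnitInv e) _ (oneMod (e ⁻¹ᵁ U)) = psec e (oneMod U) := by
  refine (unitHom_one _ _).trans ?_
  refine (psec_rs e le_top _).trans ?_
  rw [rs_oneMod]

variable (e) in
/-- The inverse image of the structure sheaf. -/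
def pullUnitIso : pb e (unitMod B) ≅ unitMod Y :=
  ⟨pullUnit e, pullUnitInv e,
    pull_unit_ext fun U => by rw [ap_comp, pullUnit_one, pullUnitInv_one, ap_id],
    unit_hom_ext fun U => by
      -- It suffices to treat the section 1 over the whole of Y, which is the preimage of the whole
      -- of B; its restrictions are the sections 1 over all U.
      have h1 : ap (pullUnitInv e ≫ pullUnit e) (e ⁻¹ᵁ ⊤) (oneMod _) = oneMod _ := by
        rw [ap_comp, pullUnitInv_one, pullUnit_one]
      have hU : U ≤ e ⁻¹ᵁ ⊤ := le_top
      have h2 := (ap_rs (pullUnitInv e ≫ pullUnit e) hU (oneMod _)).trans (congrArg (rs _ hU) h1)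
      rw [rs_oneMod] at h2
      exact h2⟩

end

/-! ### Affine open subsets of an M₀-scheme and sheafification over them. -/

section

namespace MonoidalSpace
variable {X : MonoidalSpace.{u}}

/-- An affine open set is empty, or it has a point whose only neighbourhood in it is the whole
set. -/
lemma IsAffineOpn.exists_closed {V : X.Opn} (hV : IsAffineOpn V) :
    ((0 : X.Γ V) = 1 ∧ ∀ x, x ∉ V) ∨ ∃ c ∈ V, ∀ W : X.Opn, c ∈ W → V ≤ W := by
  obtain ⟨ψ, -⟩ := hV
  by_cases h0 : IsUnit (0 : X.Γ V)
  · left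
    exact ⟨isUnit_zero_iff.1 h0,
      fun x hx => (ψ ⟨x, hx⟩).notMem_of_isUnit h0 (ψ ⟨x, hx⟩).zero_mem'⟩
  · right
    -- The closed point is the ideal of all nonunits. Multiplicativity alone makes it prime, since a
    -- product is a unit only if both factors are.
    let m : PrimeIdl (X.Γ V) :=
      { carrier := {a | ¬ IsUnit a}
        zero_mem' := h0
        mul_mem' := fun a b hb hab => hb (IsUnit.mul_iff.1 hab).2
        one_notMem := fun h => h isUnit_one
        mem_or_mem := fun {a b} hab => by
          by_contra! hc
          exact hab (IsUnit.mul_iff.2 ⟨not_not.1 hc.1, not_not.1 hc.2⟩) }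
    refine ⟨ψ.symm m, (ψ.symm m).2, fun W hW x hx => ?_⟩
    have hS : IsOpen {p : PrimeIdl (X.Γ V) | ((ψ.symm p : V) : X.carrier) ∈ W} :=
      W.isOpen.preimage (continuous_subtype_val.comp ψ.symm.continuous)
    -- A basic open set D_a that contains the closed point has a a unit, and so contains every prime
    -- ideal.
    obtain ⟨a, ha, haS⟩ := PrimeIdl.exists_basicSet hS (p := m) hW
    have hau : IsUnit a := not_not.1 ha
    have := haS ((ψ ⟨x, hx⟩).notMem_of_isUnit hau)
    simpa using this

end MonoidalSpace

/-- The affine open sets form a basis: inside an affine neighbourhood W of x there is a basic open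
set D_f that contains x and lies in U, and D_f is again affine. -/
lemma MZScheme.exists_aff {X : MZScheme.{u}} {U : X.Opn} {x : X.carrier} (hx : x ∈ U) :
    ∃ V : X.AffOpn, x ∈ V.1 ∧ V.1 ≤ U := by
  obtain ⟨W, ⟨φ, hφ⟩, hxW⟩ := X.exists_affine x
  have hS : IsOpen {p : PrimeIdl (X.Γ W) | ((φ.symm p : W) : X.carrier) ∈ U} :=
    U.isOpen.preimage (continuous_subtype_val.comp φ.symm.continuous)
  obtain ⟨f, hf, hfS⟩ := PrimeIdl.exists_basicSet hS (p := φ ⟨x, hxW⟩) (by simpa using hx)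
  let V : X.Opn := ⟨Subtype.val '' (φ ⁻¹' basicSet f),
    W.isOpen.isOpenMap_subtype_val _ ((PrimeIdl.isOpen_basicSet f).preimage φ.continuous)⟩
  have hV : V ≤ W := by
    rintro _ ⟨y, -, rfl⟩
    exact y.2
  refine ⟨⟨V, MonoidalSpace.isAffineOpn_basic φ hφ f V hV fun y => ?_⟩, ⟨⟨x, hxW⟩, hf, rfl⟩, ?_⟩
  · constructor
    · rintro ⟨z, hz, h⟩
      rwa [← Subtype.ext h]
    · exact fun h => ⟨y, h, rfl⟩
  · rintro _ ⟨y, hy, rfl⟩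
    simpa using hfS hy

namespace PreMod
variable {X : MonoidalSpace.{u}}

lemma subsingleton_of_zero_eq_one (M : PreMod X) {V : X.Opn} (h : (0 : X.Γ V) = 1) (m n : M.Γ V) :
    m = n := by
  rw [← one_smul (X.Γ V) m, ← one_smul (X.Γ V) n, ← h, zero_smul, zero_smul]

/-- The sections of the sheafification over an affine open set are the sections of the presheaf. -/
lemma toSh_bijective (M : PreMod X) {V : X.Opn} (hV : MonoidalSpace.IsAffineOpn V) :
    Function.Bijective (M.toSh.app V) := by
  rcases hV.exists_closed with ⟨h0, he⟩ | ⟨c, hc, h⟩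
  · exact ⟨fun m n _ => M.subsingleton_of_zero_eq_one h0 m n,
      fun s => ⟨0, M.shPre.subsingleton_of_zero_eq_one h0 _ _⟩⟩
  -- Every neighbourhood of the closed point c in V is all of V. Two sections with the same germ at
  -- c thus agree over V, and a presheaf section representing s near c represents it over V.
  · constructor
    · intro m n e
      have e1 : M.germ c hc m = M.germ c hc n := congrArg (fun s : M.ShΓ V => s.1 ⟨c, hc⟩) e
      obtain ⟨W, hW, i, j, e2⟩ := (M.germ_eq_iff _ _).1 e1
      obtain rfl : W = V := le_antisymm i (h W hW)
      rwa [M.res_rfl, M.res_rfl] at e2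
    · intro s
      obtain ⟨W, hW, i, m, hm⟩ := s.2 ⟨c, hc⟩
      obtain rfl : W = V := le_antisymm (leOfHom i) (h W hW)
      exact ⟨m, ShΓ.ext fun x => (hm x).symm⟩

end PreMod

/-! ### Modules over the sheaf of monoids: gluing and tensor products on affine open sets. -/

namespace OMod

section
variable {X : MonoidalSpace.{u}} {M N Z : OMod X}

lemma sec_ext {ι : Type u} (W : ι → X.Opn) {U : X.Opn} (hW : ∀ i, W i ≤ U) (hU : U ≤ ⨆ i, W i)
    {s t : M.Γ U} (h : ∀ i, M.res (hW i) s = M.res (hW i) t) : s = t :=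
  TopCat.Sheaf.eq_of_locally_eq' ⟨_, M.isSheaf⟩ W U (fun i => homOfLE (hW i)) hU s t h

lemma sec_glue {ι : Type u} (W : ι → X.Opn) {U : X.Opn} (hW : ∀ i, W i ≤ U)
    (hU : U ≤ ⨆ i, W i) (s : ∀ i, M.Γ (W i))
    (h : ∀ i j, M.res (inf_le_left : W i ⊓ W j ≤ _) (s i) = M.res inf_le_right (s j)) :
    ∃ t : M.Γ U, ∀ i, M.res (hW i) t = s i := by
  obtain ⟨t, ht, -⟩ := TopCat.Sheaf.existsUnique_gluing' ⟨_, M.isSheaf⟩ W U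
    (fun i => homOfLE (hW i)) hU (fun i => (s i : M.presheaf.obj (op (W i)))) (fun i j => h i j)
  exact ⟨t, ht⟩

lemma hom_smul (f : M ⟶ N) {U : X.Opn} (a : X.Γ U) (m : M.Γ U) :
    f.app U (a • m) = a • f.app U m := PreMod.Hom.map_smul f U a m

lemma hom_res (f : M ⟶ N) {U V : X.Opn} (h : V ≤ U) (m : M.Γ U) :
    f.app V (M.res h m) = N.res h (f.app U m) := PreMod.Hom.map_res f h m

lemma hom_zero (f : M ⟶ N) (U : X.Opn) : f.app U (0 : M.Γ U) = 0 := PreMod.Hom.map_zero f U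

lemma comp_app (f : M ⟶ N) (g : N ⟶ Z) (U : X.Opn) (m : M.Γ U) :
    (f ≫ g).app U m = g.app U (f.app U m) := rfl

lemma id_app (U : X.Opn) (m : M.Γ U) : PreMod.Hom.app (𝟙 M) U m = m := rfl

end

variable {X : MZScheme.{u}} {M N Z : OMod X.toMonoidalSpace}

lemma le_iSup_aff (U : X.Opn) : U ≤ ⨆ V : {V : X.AffOpn // V.1 ≤ U}, V.1.1 := fun x hx => by
  obtain ⟨V, hxV, hV⟩ := MZScheme.exists_aff hx
  exact Opens.mem_iSup.2 ⟨⟨V, hV⟩, hxV⟩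

lemma aff_ext {U : X.Opn} {s t : M.Γ U}
    (h : ∀ (V : X.AffOpn) (hV : V.1 ≤ U), M.res hV s = M.res hV t) : s = t :=
  sec_ext (fun V : {V : X.AffOpn // V.1 ≤ U} => V.1.1) (fun V => V.2) (le_iSup_aff U)
    fun V => h V.1 V.2

lemma hom_aff_ext {f g : M ⟶ N} (h : ∀ (V : X.AffOpn) m, f.app V.1 m = g.app V.1 m) : f = g := by
  refine PreMod.Hom.ext (funext fun U => funext fun m => ?_)
  refine aff_ext (M := N) fun V hV => ?_
  rw [← hom_res f, ← hom_res g, h]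

/-- Gluing over affine open subsets. -/
lemma aff_glue {U : X.Opn} (s : ∀ V : X.AffOpn, V.1 ≤ U → M.Γ V.1)
    (h : ∀ (V V' : X.AffOpn) (hV : V.1 ≤ U) (k : V'.1 ≤ V.1), M.res k (s V hV) =
      s V' (k.trans hV)) :
    ∃ t : M.Γ U, ∀ (V : X.AffOpn) (hV : V.1 ≤ U), M.res hV t = s V hV := by
  obtain ⟨t, ht⟩ := sec_glue (M := M) (fun V : {V : X.AffOpn // V.1 ≤ U} => V.1.1) (fun V => V.2)
    -- The intersection of two affine open sets need not be affine, so agreement on it is tested on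
    -- the affine open sets W that it contains.
    (le_iSup_aff U) (fun V => s V.1 V.2) (fun V V' => aff_ext (M := M) fun W hW => by
      rw [M.res_res, M.res_res, h V.1 W V.2 (hW.trans inf_le_left),
        h V'.1 W V'.2 (hW.trans inf_le_right)])
  exact ⟨t, fun V hV => ht ⟨V, hV⟩⟩

/-- A morphism from a compatible family of maps on affine open sets. -/
def homOfAff (f : ∀ V : X.AffOpn, M.Γ V.1 → N.Γ V.1)
    (hs : ∀ V (a : X.Γ V.1) m, f V (a • m) = a • f V m)
    (hr : ∀ (V V' : X.AffOpn) (h : V'.1 ≤ V.1) m, f V' (M.res h m) = N.res h (f V m)) : M ⟶ N :=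
  have h (U : X.Opn) (m : M.Γ U) := aff_glue (M := N) (U := U) (fun V hV => f V (M.res hV m))
    (fun V V' hV k => by rw [← hr, M.res_res])
  { app := fun U m => (h U m).choose
    map_smul := fun U a m => aff_ext (M := N) fun V hV => by
      rw [(h _ _).choose_spec, N.res_smul, (h _ _).choose_spec, M.res_smul, hs]
    map_res := fun {U U'} k m => aff_ext (M := N) fun V hV => by
      rw [(h _ _).choose_spec, N.res_res, (h _ _).choose_spec, M.res_res] }

lemma homOfAff_app (f : ∀ V : X.AffOpn, M.Γ V.1 → N.Γ V.1) (hs hr) (V : X.AffOpn) (m : M.Γ V.1) :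
    (homOfAff f hs hr).app V.1 m = f V m := by
  have h (U : X.Opn) (m : M.Γ U) := aff_glue (M := N) (U := U) (fun V hV => f V (M.res hV m))
    (fun V V' hV k => by rw [← hr, M.res_res])
  have := (h V.1 m).choose_spec V le_rfl
  rw [N.res_rfl, M.res_rfl] at this
  exact this

attribute [irreducible] homOfAff

/-- A morphism that is bijective on affine open sets is an isomorphism. -/
def isoOfAff (f : M ⟶ N) (hf : ∀ V : X.AffOpn, Function.Bijective (f.app V.1)) : M ≅ N where
  hom := f
  inv := homOfAff (fun V => (Equiv.ofBijective _ (hf V)).symm)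
    (fun V a n => (hf V).1 (by
      rw [hom_smul]
      exact ((Equiv.ofBijective _ (hf V)).apply_symm_apply _).trans
        (congrArg (a • ·) ((Equiv.ofBijective _ (hf V)).apply_symm_apply n).symm)))
    (fun V V' h n => (hf V').1 (by
      rw [hom_res]
      exact ((Equiv.ofBijective _ (hf V')).apply_symm_apply _).trans
        (congrArg (N.res h) ((Equiv.ofBijective _ (hf V)).apply_symm_apply n).symm)))
  hom_inv_id := hom_aff_ext fun V m => by
    rw [comp_app, homOfAff_app]
    exact (Equiv.ofBijective _ (hf V)).symm_apply_apply m
  inv_hom_id := hom_aff_ext fun V m => by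
    rw [comp_app, homOfAff_app]
    exact (Equiv.ofBijective _ (hf V)).apply_symm_apply m

lemma bijective_of_isIso (f : M ⟶ N) [IsIso f] (U : X.Opn) : Function.Bijective (f.app U) :=
  Function.bijective_iff_has_inverse.2 ⟨(inv f).app U,
    fun m => congrArg (fun t => PreMod.Hom.app t U m) (IsIso.hom_inv_id f),
    fun m => congrArg (fun t => PreMod.Hom.app t U m) (IsIso.inv_hom_id f)⟩

/-! ### Tensor products on affine open sets -/

lemma tmul_res {M N : OMod X.toMonoidalSpace} {U V : X.Opn} (h : V ≤ U) (m : M.Γ U) (n : N.Γ U) :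
    (tens M N).res h (tmul m n) = tmul (M.res h m) (N.res h n) :=
  (PreMod.Hom.map_res (preTens M.toPreMod N.toPreMod).toSh h (Quot.mk _ (m, n))).symm

lemma smul_tmul {U : X.Opn} (a : X.Γ U) (m : M.Γ U) (n : N.Γ U) :
    a • tmul m n = tmul (a • m) n :=
  (PreMod.Hom.map_smul (preTens M.toPreMod N.toPreMod).toSh U a (Quot.mk _ (m, n))).symm

lemma smul_tmul' {U : X.Opn} (a : X.Γ U) (m : M.Γ U) (n : N.Γ U) :
    tmul (a • m) n = tmul m (a • n) :=
  congrArg ((preTens M.toPreMod N.toPreMod).toSh.app U) (Tens.smul_mk a m n)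

lemma zero_tmul {U : X.Opn} (n : N.Γ U) : tmul (0 : M.Γ U) n = 0 := by
  rw [← zero_smul (X.Γ U) (0 : M.Γ U), ← smul_tmul, zero_smul]

lemma tmul_zero {U : X.Opn} (m : M.Γ U) : tmul m (0 : N.Γ U) = 0 := by
  rw [← zero_smul (X.Γ U) (0 : N.Γ U), ← smul_tmul', ← smul_tmul, zero_smul]

lemma tensMap_tmul {M' N' : OMod X.toMonoidalSpace} (f : M ⟶ M') (g : N ⟶ N') {U : X.Opn} (m : M.Γ U) (n : N.Γ U) :
    (tensMap f g).app U (tmul m n) = tmul (f.app U m) (g.app U n) :=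
  PreMod.ShΓ.ext (M := preTens M'.toPreMod N'.toPreMod) fun x =>
    (PreMod.Hom.stalkMap_germ (preTensMap (X := X.toMonoidalSpace) (M := M.toPreMod)
      (M' := M'.toPreMod) f g) (U := U) x.1 x.2 (Quot.mk _ (m, n)))

variable (M N) in
/-- The sections of a tensor product over an affine open set. -/
def tensEquiv (V : X.AffOpn) : Tens (X.Γ V.1) (M.Γ V.1) (N.Γ V.1) ≃ (tens M N).Γ V.1 :=
  Equiv.ofBijective _ ((preTens M.toPreMod N.toPreMod).toSh_bijective V.2)

lemma tensEquiv_symm_tmul (V : X.AffOpn) (m : M.Γ V.1) (n : N.Γ V.1) :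
    (tensEquiv M N V).symm (tmul m n) = Quot.mk _ (m, n) :=
  (Equiv.symm_apply_eq _).2 rfl

-- Sheafification changes nothing over an affine open set, and a tensor product of sets with action
-- consists of pure tensors, as there is no addition.
@[elab_as_elim]
lemma tens_ind {V : X.AffOpn} {p : (tens M N).Γ V.1 → Prop} (h : ∀ m n, p (tmul m n)) (t) :
    p t := by
  obtain ⟨⟨m, n⟩, rfl⟩ := (tensEquiv M N V).surjective t
  exact h m n

/-- Maps from the sections of a tensor product over an affine open set. -/
def tensRec {T : Sort*} (V : X.AffOpn) (f : M.Γ V.1 → N.Γ V.1 → T)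
    (h : ∀ (a : X.Γ V.1) m n, f (a • m) n = f m (a • n)) (t : (tens M N).Γ V.1) : T :=
  Quot.lift (fun p : M.Γ V.1 × N.Γ V.1 => f p.1 p.2) (by
    rintro _ _ ⟨a, m, n⟩
    exact h a m n) ((tensEquiv M N V).symm t)

@[simp] lemma tensRec_tmul {T : Sort*} (V : X.AffOpn) (f : M.Γ V.1 → N.Γ V.1 → T) (h) (m : M.Γ V.1)
    (n : N.Γ V.1) : tensRec V f h (tmul m n) = f m n := by
  rw [tensRec, tensEquiv_symm_tmul]

/-- Morphisms from a tensor product. -/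
def tensLift (f : ∀ V : X.AffOpn, M.Γ V.1 → N.Γ V.1 → Z.Γ V.1)
    (hl : ∀ V (a : X.Γ V.1) m n, f V (a • m) n = a • f V m n)
    (hr : ∀ V (a : X.Γ V.1) m n, f V m (a • n) = a • f V m n)
    (hres : ∀ (V V' : X.AffOpn) (h : V'.1 ≤ V.1) m n,
      f V' (M.res h m) (N.res h n) = Z.res h (f V m n)) : tens M N ⟶ Z :=
  homOfAff (fun V => tensRec V (f V) (fun a m n => by rw [hl, hr]))
    (fun V a t => by
      induction t using tens_ind with | _ m n
      rw [smul_tmul, tensRec_tmul, tensRec_tmul, hl])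
    (fun V V' h t => by
      induction t using tens_ind with | _ m n
      rw [tmul_res, tensRec_tmul, tensRec_tmul, hres])

lemma tensLift_tmul (f : ∀ V : X.AffOpn, M.Γ V.1 → N.Γ V.1 → Z.Γ V.1) (hl hr hres) (V : X.AffOpn)
    (m : M.Γ V.1) (n : N.Γ V.1) : (tensLift f hl hr hres).app V.1 (tmul m n) = f V m n := by
  rw [tensLift, homOfAff_app, tensRec_tmul]

lemma tens_hom_ext {f g : tens M N ⟶ Z} (h : ∀ (V : X.AffOpn) m n, f.app V.1 (tmul m n) =
    g.app V.1 (tmul m n)) : f = g := hom_aff_ext fun V t => by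
  induction t using tens_ind with | _ m n
  exact h V m n

end OMod
end

/-! ### Coherence laws for modules over the sheaf of monoids. -/

namespace OMod
section
variable {X : MZScheme.{u}} {M N Z P P' Q M' N' M'' N'' : OMod X.toMonoidalSpace}

lemma tens3_ext {f g : tens (tens M N) P ⟶ Z}
    (h : ∀ (V : X.AffOpn) m n p, f.app V.1 (tmul (tmul m n) p) = g.app V.1 (tmul (tmul m n) p)) :
    f = g := tens_hom_ext fun V t p => by
  induction t using tens_ind with | _ m n
  exact h V m n p

lemma tens3_ext' {f g : tens M (tens N P) ⟶ Z}
    (h : ∀ (V : X.AffOpn) m n p, f.app V.1 (tmul m (tmul n p)) = g.app V.1 (tmul m (tmul n p))) :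
    f = g := tens_hom_ext fun V m t => by
  induction t using tens_ind with | _ n p
  exact h V m n p

lemma tens4_ext {f g : tens (tens (tens M N) P) Q ⟶ Z}
    (h : ∀ (V : X.AffOpn) m n p q, f.app V.1 (tmul (tmul (tmul m n) p) q) =
      g.app V.1 (tmul (tmul (tmul m n) p) q)) : f = g := tens3_ext fun V t p q => by
  induction t using tens_ind with | _ m n
  exact h V m n p q

/-- Symmetry. -/
def braid (M N : OMod X.toMonoidalSpace) : tens M N ⟶ tens N M :=
  tensLift (fun V m n => tmul n m) (fun V a m n => by rw [← smul_tmul', smul_tmul])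
    (fun V a m n => (smul_tmul a n m).symm) (fun V V' h m n => (tmul_res h n m).symm)

lemma braid_tmul_aff (V : X.AffOpn) (m : M.Γ V.1) (n : N.Γ V.1) :
    (braid M N).app V.1 (tmul m n) = tmul n m := tensLift_tmul _ _ _ _ V m n

lemma braid_tmul {U : X.Opn} (m : M.Γ U) (n : N.Γ U) :
    (braid M N).app U (tmul m n) = tmul n m := aff_ext (M := tens N M) fun V hV => by
  rw [← hom_res, tmul_res, tmul_res, braid_tmul_aff]

/-- Associativity. -/
def assoc (M N P : OMod X.toMonoidalSpace) : tens (tens M N) P ⟶ tens M (tens N P) :=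
  tensLift (fun V t p => tensRec V (fun m n => tmul m (tmul n p))
      (fun a m n => by rw [smul_tmul', smul_tmul]) t)
    (fun V a t p => by
      induction t using tens_ind with | _ m n
      rw [smul_tmul, tensRec_tmul, tensRec_tmul, smul_tmul])
    (fun V a t p => by
      induction t using tens_ind with | _ m n
      rw [tensRec_tmul, tensRec_tmul, ← smul_tmul', ← smul_tmul, ← smul_tmul', smul_tmul])
    (fun V V' h t p => by
      induction t using tens_ind with | _ m n
      rw [tmul_res, tensRec_tmul, tensRec_tmul, tmul_res, tmul_res])

lemma assoc_tmul_aff (V : X.AffOpn) (m : M.Γ V.1) (n : N.Γ V.1) (p : P.Γ V.1) :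
    (assoc M N P).app V.1 (tmul (tmul m n) p) = tmul m (tmul n p) := by
  rw [assoc, tensLift_tmul, tensRec_tmul]

lemma assoc_tmul {U : X.Opn} (m : M.Γ U) (n : N.Γ U) (p : P.Γ U) :
    (assoc M N P).app U (tmul (tmul m n) p) = tmul m (tmul n p) :=
  aff_ext (M := tens M (tens N P)) fun V hV => by
    rw [← hom_res, tmul_res, tmul_res, tmul_res, tmul_res, assoc_tmul_aff]

/-- The inverse of the associativity morphism. -/
def assocInv (M N P : OMod X.toMonoidalSpace) : tens M (tens N P) ⟶ tens (tens M N) P :=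
  braid _ _ ≫ tensMap (braid _ _) (𝟙 _) ≫ assoc _ _ _ ≫ braid _ _ ≫ tensMap (braid _ _) (𝟙 _)

lemma assocInv_tmul {U : X.Opn} (m : M.Γ U) (n : N.Γ U) (p : P.Γ U) :
    (assocInv M N P).app U (tmul m (tmul n p)) = tmul (tmul m n) p := by
  simp only [assocInv, comp_app, braid_tmul, tensMap_tmul, assoc_tmul, id_app]

/-- The section `1` of the structure sheaf. -/
def uone (U : X.Opn) : (unit X.toMonoidalSpace).Γ U := (1 : X.Γ U)

/-- The sections of the structure sheaf as elements of the monoid of sections. -/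
def uval {U : X.Opn} (r : (unit X.toMonoidalSpace).Γ U) : X.Γ U := r

lemma exists_smul_uone {U : X.Opn} (r : (unit X.toMonoidalSpace).Γ U) :
    ∃ a : X.Γ U, a • uone U = r := ⟨r, mul_one (show X.Γ U from r)⟩

lemma res_uone {U V : X.Opn} (h : V ≤ U) : (unit X.toMonoidalSpace).res h (uone U) = uone V :=
  map_one (X.res h)

/-- The left unitor. -/
def lunit (M : OMod X.toMonoidalSpace) : tens (unit X.toMonoidalSpace) M ⟶ M :=
  tensLift (fun V r m => uval r • m)
    (fun V a r m => mul_smul (a : X.Γ V.1) (uval r) m)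
    (fun V a r m => by rw [smul_smul, mul_comm, mul_smul])
    (fun V V' h r m => (M.res_smul h (uval r) m).symm)

lemma lunit_tmul {U : X.Opn} (a : X.Γ U) (m : M.Γ U) :
    (lunit M).app U (tmul (a • uone U) m) = a • m := by
  rw [← smul_tmul, hom_smul]
  congr 1
  refine aff_ext (M := M) fun V hV => ?_
  rw [← hom_res, tmul_res, res_uone]
  exact (tensLift_tmul _ _ _ _ V _ _).trans (one_smul (X.Γ V.1) _)

lemma lunit_tmul_one {U : X.Opn} (m : M.Γ U) : (lunit M).app U (tmul (uone U) m) = m := by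
  have := lunit_tmul 1 m
  rwa [one_smul, one_smul] at this

/-- The inverse of the left unitor. -/
def lunitInv (M : OMod X.toMonoidalSpace) : M ⟶ tens (unit X.toMonoidalSpace) M where
  app U m := tmul (uone U) m
  map_smul U a m := by
    rw [← smul_tmul', smul_tmul]
  map_res {U V} h m := by rw [tmul_res, res_uone]

lemma lunitInv_app {U : X.Opn} (m : M.Γ U) : (lunitInv M).app U m = tmul (uone U) m := rfl

lemma unit_tens_ext {f g : tens (unit X.toMonoidalSpace) M ⟶ Z}
    (h : ∀ (V : X.AffOpn) m, f.app V.1 (tmul (uone V.1) m) = g.app V.1 (tmul (uone V.1) m)) :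
    f = g := tens_hom_ext fun V r m => by
  obtain ⟨a, rfl⟩ := exists_smul_uone r
  rw [smul_tmul', h]

lemma tensMap_id : tensMap (𝟙 M) (𝟙 N) = 𝟙 _ :=
  tens_hom_ext fun V m n => tensMap_tmul _ _ _ _

lemma tensMap_comp (f : M ⟶ M') (f' : M' ⟶ M'') (g : N ⟶ N') (g' : N' ⟶ N'') :
    tensMap f g ≫ tensMap f' g' = tensMap (f ≫ f') (g ≫ g') := tens_hom_ext fun V m n => by
  rw [comp_app, tensMap_tmul, tensMap_tmul, tensMap_tmul, comp_app, comp_app]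

lemma assoc_nat (f : M ⟶ M') (g : N ⟶ N') (h : P ⟶ P') :
    tensMap (tensMap f g) h ≫ assoc _ _ _ = assoc _ _ _ ≫ tensMap f (tensMap g h) :=
  tens3_ext fun V m n p => by
    rw [comp_app, comp_app, tensMap_tmul, tensMap_tmul, assoc_tmul, assoc_tmul, tensMap_tmul,
      tensMap_tmul]

lemma lunit_nat (f : M ⟶ N) : tensMap (𝟙 (unit X.toMonoidalSpace)) f ≫ lunit N = lunit M ≫ f :=
  unit_tens_ext fun V m => by
    rw [comp_app, comp_app, tensMap_tmul, id_app, lunit_tmul_one, lunit_tmul_one]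

lemma braid_nat (f : M ⟶ M') (g : N ⟶ N') :
    tensMap f g ≫ braid _ _ = braid _ _ ≫ tensMap g f := tens_hom_ext fun V m n => by
  rw [comp_app, comp_app, tensMap_tmul, braid_tmul, braid_tmul, tensMap_tmul]

lemma braid_lunit_nat (f : M ⟶ N) :
    tensMap f (𝟙 (unit X.toMonoidalSpace)) ≫ braid _ _ ≫ lunit N =
      (braid _ _ ≫ lunit M) ≫ f := by
  rw [← Category.assoc, braid_nat, Category.assoc, lunit_nat, Category.assoc]

lemma pentagon :
    tensMap (assoc M N P) (𝟙 Q) ≫ assoc M (tens N P) Q ≫ tensMap (𝟙 M) (assoc N P Q) =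
      assoc (tens M N) P Q ≫ assoc M N (tens P Q) := tens4_ext fun V m n p q => by
  rw [comp_app, comp_app, comp_app, tensMap_tmul, assoc_tmul, id_app, assoc_tmul,
    tensMap_tmul, assoc_tmul, id_app, assoc_tmul, assoc_tmul]

lemma triangle :
    assoc M (unit X.toMonoidalSpace) N ≫ tensMap (𝟙 M) (lunit N) =
      tensMap (braid _ _ ≫ lunit M) (𝟙 N) := tens3_ext fun V m r n => by
  obtain ⟨a, rfl⟩ := exists_smul_uone r
  rw [comp_app, assoc_tmul, tensMap_tmul, tensMap_tmul, id_app, id_app, comp_app,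
    braid_tmul, lunit_tmul, lunit_tmul, smul_tmul']

lemma braid_braid : braid M N ≫ braid N M = 𝟙 _ := tens_hom_ext fun V m n => by
  rw [comp_app, braid_tmul, braid_tmul, id_app]

lemma hexagon :
    assoc M N P ≫ braid M (tens N P) ≫ assoc N P M =
      tensMap (braid M N) (𝟙 P) ≫ assoc N M P ≫ tensMap (𝟙 N) (braid M P) :=
  tens3_ext fun V m n p => by
    rw [comp_app, comp_app, comp_app, comp_app, assoc_tmul, braid_tmul, assoc_tmul,
      tensMap_tmul, braid_tmul, id_app, assoc_tmul, tensMap_tmul, braid_tmul, id_app]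

lemma hexagon' :
    assocInv M N P ≫ braid (tens M N) P ≫ assocInv P M N =
      tensMap (𝟙 M) (braid N P) ≫ assocInv M P N ≫ tensMap (braid M P) (𝟙 N) :=
  tens3_ext' fun V m n p => by
    rw [comp_app, comp_app, comp_app, comp_app, assocInv_tmul, braid_tmul, assocInv_tmul,
      tensMap_tmul, braid_tmul, id_app, assocInv_tmul, tensMap_tmul, braid_tmul, id_app]

/-- The associator. -/
def assocIso (M N P : OMod X.toMonoidalSpace) : tens (tens M N) P ≅ tens M (tens N P) :=
  ⟨assoc M N P, assocInv M N P,
    tens3_ext fun V m n p => by rw [comp_app, assoc_tmul, assocInv_tmul, id_app],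
    tens3_ext' fun V m n p => by rw [comp_app, assocInv_tmul, assoc_tmul, id_app]⟩

/-- The left unitor. -/
def lunitIso (M : OMod X.toMonoidalSpace) : tens (unit X.toMonoidalSpace) M ≅ M :=
  ⟨lunit M, lunitInv M,
    unit_tens_ext fun V m => by rw [comp_app, lunit_tmul_one, lunitInv_app, id_app],
    hom_aff_ext fun V m => by rw [comp_app, lunitInv_app, lunit_tmul_one, id_app]⟩

/-- The braiding. -/
def braidIso (M N : OMod X.toMonoidalSpace) : tens M N ≅ tens N M :=
  ⟨braid M N, braid N M, braid_braid, braid_braid⟩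

end
end OMod

/-! ### The open cover of X_ℤ by the sets V_ℤ. -/

namespace MZScheme
section
variable {X : MZScheme.{u}} {M N : OMod X.toMonoidalSpace} {Z : X.zScheme.Modules}

lemma zOpen_mono {V V' : X.AffOpn} (h : V'.1 ≤ V.1) : X.zOpen V' ≤ X.zOpen V := by
  have : X.zι V' = X.zDiagram.map (homOfLE h : V' ⟶ V) ≫ X.zι V :=
    (Limits.colimit.w X.zDiagram (homOfLE h : V' ⟶ V)).symm
  rw [zOpen, zOpen]
  rintro _ ⟨x, rfl⟩
  refine ⟨X.zDiagram.map (homOfLE h : V' ⟶ V) x, ?_⟩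
  rw [this]
  rfl

/-- The open sets `V_ℤ` cover `X_ℤ`. -/
lemma exists_zOpen (x : X.zScheme) : ∃ V : X.AffOpn, x ∈ X.zOpen V := by
  obtain ⟨V, y, hy⟩ := Scheme.IsLocallyDirected.ι_jointly_surjective X.zDiagram x
  exact ⟨V, y, hy⟩

/-- The gluing diagram is locally directed, so two points of charts that become equal in the colimit
come from one point of a chart W contained in both. -/
lemma exists_zOpen_inf (V V' : X.AffOpn) (x : X.zScheme) (h : x ∈ X.zOpen V)
    (h' : x ∈ X.zOpen V') : ∃ W : X.AffOpn, W.1 ≤ V.1 ∧ W.1 ≤ V'.1 ∧ x ∈ X.zOpen W := by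
  obtain ⟨y, rfl⟩ := h
  obtain ⟨y', hy⟩ := h'
  obtain ⟨W, i, j, z, rfl, rfl⟩ := (Scheme.IsLocallyDirected.ι_eq_ι_iff X.zDiagram).1 hy
  refine ⟨W, leOfHom j, leOfHom i, z, ?_⟩
  have : X.zDiagram.map j ≫ X.zι V = X.zι W := Limits.colimit.w X.zDiagram j
  rw [← this]
  rfl

lemma le_iSup_zOpen : (⊤ : X.zScheme.Opens) ≤ ⨆ V : X.AffOpn, X.zOpen V := fun x _ => by
  obtain ⟨V, hV⟩ := exists_zOpen x
  exact Opens.mem_iSup.2 ⟨V, hV⟩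

lemma zOpen_inf_le (V V' : X.AffOpn) : X.zOpen V ⊓ X.zOpen V' ≤
    ⨆ W : {W : X.AffOpn // W.1 ≤ V.1 ∧ W.1 ≤ V'.1}, X.zOpen W.1 := fun x hx => by
  obtain ⟨W, h, h', hW⟩ := exists_zOpen_inf V V' x hx.1 hx.2
  exact Opens.mem_iSup.2 ⟨⟨W, h, h'⟩, hW⟩

lemma appIso_inv_map_appLE {S Y : Scheme.{u}} (f : S ⟶ Y) [IsOpenImmersion f]
    (h : ⊤ ≤ f ⁻¹ᵁ f.opensRange) :
    (f.appIso ⊤).inv ≫ Y.presheaf.map (eqToHom f.image_top_eq_opensRange.symm).op ≫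
      f.appLE f.opensRange ⊤ h = 𝟙 _ := by
  rw [Scheme.Hom.map_appLE, Scheme.Hom.appIso_inv_appLE]
  simp

lemma appLE_injective {S Y : Scheme.{u}} (f : S ⟶ Y) [IsOpenImmersion f]
    (h : ⊤ ≤ f ⁻¹ᵁ f.opensRange) : Function.Injective (f.appLE f.opensRange ⊤ h).hom := by
  have e := appIso_inv_map_appLE f h
  rw [← Category.assoc] at e
  have : IsIso (f.appLE f.opensRange ⊤ h) := by
    rw [IsIso.eq_inv_of_hom_inv_id e]
    infer_instance
  exact ((ConcreteCategory.isIso_iff_bijective _).1 this).1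

lemma map_appLE_comp {S S' Y : Scheme.{u}} (d : S' ⟶ S) (f : S ⟶ Y) (f' : S' ⟶ Y) (e : f' = d ≫ f)
    {W W' : Y.Opens} (h : W' ≤ W) (hW : ⊤ ≤ f ⁻¹ᵁ W) (hW' : ⊤ ≤ f' ⁻¹ᵁ W') :
    Y.presheaf.map (homOfLE h).op ≫ f'.appLE W' ⊤ hW' = f.appLE W ⊤ hW ≫ d.appTop := by
  subst e
  rw [Scheme.Hom.map_appLE, ← Scheme.Hom.appLE_comp_appLE d f W ⊤ ⊤ hW le_top]
  simp [Scheme.Hom.appLE, Scheme.Hom.appTop]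
  erw [Category.comp_id]
  exact (Category.assoc _ _ _).symm

lemma zι_app_zMap (V : X.AffOpn) (h : ⊤ ≤ X.zι V ⁻¹ᵁ X.zOpen V) (a : X.Γ V.1) :
    ((X.zι V).appLE (X.zOpen V) ⊤ h).hom (X.zMap V a) =
      (Scheme.ΓSpecIso (.of (ZRing (X.Γ V.1)))).inv.hom (zof a) :=
  congrArg (fun t => t.hom ((Scheme.ΓSpecIso (.of (ZRing (X.Γ V.1)))).inv.hom (zof a)))
    (appIso_inv_map_appLE (X.zι V) h)

lemma zι_appLE_injective (V : X.AffOpn) (h : ⊤ ≤ X.zι V ⁻¹ᵁ X.zOpen V) :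
    Function.Injective ((X.zι V).appLE (X.zOpen V) ⊤ h).hom := appLE_injective (X.zι V) h

lemma le_preimage_zOpen (V : X.AffOpn) : ⊤ ≤ X.zι V ⁻¹ᵁ X.zOpen V := fun x _ => ⟨x, rfl⟩

/-- Functions on V'_ℤ can be compared on Spec Γ(V')_ℤ, because the chart is an open immersion. There
both sides are the class of the restriction of a, since the transition map of the charts is induced
by Γ(V) → Γ(V'). -/
lemma rr_zMap {V V' : X.AffOpn} (h : V'.1 ≤ V.1) (a : X.Γ V.1) :
    rr (zOpen_mono h) (X.zMap V a) = X.zMap V' (X.res h a) := by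
  apply zι_appLE_injective V' (le_preimage_zOpen V')
  rw [zι_app_zMap]
  have e : X.zι V' = X.zDiagram.map (homOfLE h : V' ⟶ V) ≫ X.zι V :=
    (Limits.colimit.w X.zDiagram (homOfLE h : V' ⟶ V)).symm
  have e1 : X.zScheme.presheaf.map (homOfLE (zOpen_mono h)).op ≫
      (X.zι V').appLE (X.zOpen V') ⊤ (le_preimage_zOpen V') =
      (X.zι V).appLE (X.zOpen V) ⊤ (le_preimage_zOpen V) ≫
        (X.zDiagram.map (homOfLE h : V' ⟶ V)).appTop :=
    map_appLE_comp _ _ _ e (zOpen_mono h) _ _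
  have e2 := congrArg (fun t => t.hom (X.zMap V a)) e1
  refine e2.trans ((congrArg (X.zDiagram.map (homOfLE h : V' ⟶ V)).appTop.hom
    (zι_app_zMap V (le_preimage_zOpen V) a)).trans ?_)
  have e3 := Scheme.ΓSpecIso_inv_naturality (CommRingCat.ofHom (ZRing.map (X.res h)))
  have e4 := congrArg (fun t => t.hom (zof a)) e3
  refine e4.symm.trans ?_
  exact congrArg (Scheme.ΓSpecIso (.of (ZRing (X.Γ V'.1)))).inv.hom (ZRing.map_zof (X.res h) a)

end
end MZScheme

/-! ### The universal property of M_ℤ and its compatibility with tensor products. -/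

namespace MZScheme
section
variable {X : MZScheme.{u}} {M N M' N' : OMod X.toMonoidalSpace} {Z : X.zScheme.Modules}

lemma toShMod_zero (P : X.zScheme.PresheafOfModules) (W : X.zScheme.Opens) :
    toShMod P W 0 = 0 :=
  map_zero ((CategoryTheory.toSheafify (Opens.grothendieckTopology X.zScheme) P.presheaf).app
    (op W)).hom

lemma zMk_rel {W : X.zScheme.Opens} {s : ZGen M W →₀ Γ(X.zScheme, W)} (h : ZRel M W s) :
    (Submodule.Quotient.mk s : ZPre M W) = 0 :=
  (Submodule.Quotient.mk_eq_zero _).2 (Submodule.subset_span h)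

lemma zsec_zero (V : X.AffOpn) : zsec V (0 : M.Γ V.1) = 0 :=
  (congrArg (toShMod (zPresheafMod M) (X.zOpen V)) (zMk_rel (ZRel.zero V le_rfl))).trans
    (toShMod_zero _ _)

lemma zMk_single {W : X.zScheme.Opens} (g : ZGen M W) (r : Γ(X.zScheme, W)) :
    (Submodule.Quotient.mk (Finsupp.single g r) : ZPre M W) = r • zMk g := by
  rw [zMk, ← Submodule.Quotient.mk_smul, Finsupp.smul_single, smul_eq_mul, mul_one]

lemma zMk_smul {W : X.zScheme.Opens} (V : X.AffOpn) (h : W ≤ X.zOpen V) (a : X.Γ V.1)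
    (m : M.Γ V.1) : (zMk ⟨V, h, a • m⟩ : ZPre M W) = rr h (X.zMap V a) • zMk ⟨V, h, m⟩ := by
  have := zMk_rel (ZRel.smul (M := M) V h a m)
  rw [Submodule.Quotient.mk_sub, sub_eq_zero, zMk_single, zMk_single, one_smul] at this
  exact this

lemma zMk_res {W : X.zScheme.Opens} (V V' : X.AffOpn) (h : W ≤ X.zOpen V) (h' : W ≤ X.zOpen V')
    (k : V'.1 ≤ V.1) (m : M.Γ V.1) :
    (zMk ⟨V, h, m⟩ : ZPre M W) = zMk ⟨V', h', M.res k m⟩ := by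
  have := zMk_rel (ZRel.res (M := M) V V' h h' k m)
  rw [Submodule.Quotient.mk_sub, sub_eq_zero] at this
  exact this

lemma zsec_smul (V : X.AffOpn) (a : X.Γ V.1) (m : M.Γ V.1) :
    zsec V (a • m) = X.zMap V a • zsec V m := by
  have := zMk_smul V le_rfl a m
  rw [rr_rfl] at this
  exact (congrArg (toShMod (zPresheafMod M) (X.zOpen V)) this).trans
    (toShMod_smul (P := zPresheafMod M) _ _ _)

lemma zsec_res {V V' : X.AffOpn} (h : V'.1 ≤ V.1) (m : M.Γ V.1) :
    rs (X.zMod.obj M) (zOpen_mono h) (zsec V m) = zsec V' (M.res h m) := by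
  refine (toShMod_rs (P := zPresheafMod M) (zOpen_mono h) _).trans ?_
  have e : (zPresheafMod M).map (homOfLE (zOpen_mono h)).op (zMk ⟨V, le_rfl, m⟩) =
      (zMk ⟨V, zOpen_mono h, m⟩ : ZPre M (X.zOpen V')) := zPreMap_zMk (𝟙 M) _ _
  refine congrArg (toShMod (zPresheafMod M) (X.zOpen V')) (e.trans ?_)
  exact zMk_res V V' _ le_rfl h m

lemma toShMod_zMk {W : X.zScheme.Opens} (g : ZGen M W) :
    toShMod (zPresheafMod M) W (zMk g) = rs (X.zMod.obj M) g.le (zsec g.V g.m) := by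
  refine Eq.trans ?_ (toShMod_rs (P := zPresheafMod M) g.le _).symm
  have e : zPreMap (𝟙 M) g.le (zMk ⟨g.V, le_rfl, g.m⟩) = (zMk g : ZPre M W) := zPreMap_zMk (𝟙 M) g.le _
  exact congrArg (toShMod (zPresheafMod M) W) e.symm

/-- The presheaf behind M_ℤ is spanned by the classes of sections of M over affine V, and such a
class over W is the restriction of a class over V_ℤ. -/
lemma zMod_hom_ext {f g : X.zMod.obj M ⟶ Z}
    (h : ∀ V (m : M.Γ V.1), ap f _ (zsec V m) = ap g _ (zsec V m)) : f = g := by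
  refine shMod_hom_ext (P := zPresheafMod M) fun W s => ?_
  obtain ⟨s, rfl⟩ := Submodule.Quotient.mk_surjective _ s
  induction s using Finsupp.induction_linear with
  | zero =>
    exact (congrArg (ap f W) (toShMod_zero _ W)).trans ((map_zero _).trans ((map_zero _).symm.trans
      (congrArg (ap g W) (toShMod_zero _ W).symm)))
  | add s t hs ht =>
    have := toShMod_add (P := zPresheafMod M) W (Submodule.Quotient.mk s) (Submodule.Quotient.mk t)
    exact (congrArg (ap f W) this).trans ((map_add _ _ _).trans ((congrArg₂ (· + ·) hs ht).trans
      ((map_add _ _ _).symm.trans (congrArg (ap g W) this.symm))))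
  | single x c =>
    have e1 : toShMod (zPresheafMod M) W (Submodule.Quotient.mk (Finsupp.single x c)) =
        c • rs (X.zMod.obj M) x.le (zsec x.V x.m) :=
      (congrArg (toShMod (zPresheafMod M) W) (zMk_single x c)).trans
        ((toShMod_smul (P := zPresheafMod M) W c (zMk x)).trans (congrArg (c • ·) (toShMod_zMk x)))
    refine (congrArg (ap f W) e1).trans (Eq.trans ?_ (congrArg (ap g W) e1).symm)
    refine (ap_smul f c _).trans (Eq.trans ?_ (ap_smul g c _).symm)
    refine congrArg (c • ·) ?_
    exact (ap_rs f x.le _).trans ((congrArg _ (h _ _)).trans (ap_rs g x.le _).symm)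

lemma zMod_map_zsec (f : M ⟶ N) (V : X.AffOpn) (m : M.Γ V.1) :
    ap (X.zMod.map f) _ (zsec V m) = zsec V (f.app V.1 m) := by
  refine (shModMap_ap (P := zPresheafMod M) (zPresheafModMap f) _ _).trans ?_
  exact congrArg (toShMod (zPresheafMod N) (X.zOpen V)) (zPreMap_zMk f le_rfl _)

lemma Gen.zMod : Gen (M := X.zMod.obj M) (fun W x => ∃ (V : X.AffOpn) (h : W ≤ X.zOpen V)
    (m : M.Γ V.1), x = rs _ h (zsec V m)) where
  res := by
    rintro W W' h _ ⟨V, k, m, rfl⟩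
    exact ⟨V, h.trans k, m, rs_rs _ _ _⟩
  ext f g h := zMod_hom_ext fun V m => h _ _ ⟨V, le_rfl, m, (rs_rfl _).symm⟩

/-- The linear map on the presheaf defining the universal property of `M_ℤ`. -/
def zPreLift (f : ∀ V : X.AffOpn, M.Γ V.1 → Γ(Z, X.zOpen V)) (h0 : ∀ V, f V 0 = 0)
    (hs : ∀ V (a : X.Γ V.1) m, f V (a • m) = X.zMap V a • f V m)
    (hr : ∀ (V V' : X.AffOpn) (h : V'.1 ≤ V.1) m, rs Z (zOpen_mono h) (f V m) = f V' (M.res h m))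
    (W : X.zScheme.Opens) : ZPre M W →ₗ[Γ(X.zScheme, W)] Γ(Z, W) :=
  Submodule.liftQ _ (Finsupp.linearCombination Γ(X.zScheme, W)
    (fun g : ZGen M W => rs Z g.le (f g.V g.m))) (by
      rw [Submodule.span_le]
      intro s hs'
      rw [SetLike.mem_coe, LinearMap.mem_ker]
      induction hs' with
      | zero V k => rw [Finsupp.linearCombination_single, h0, map_zero, smul_zero]
      | smul V k a m =>
        rw [map_sub, Finsupp.linearCombination_single, Finsupp.linearCombination_single, hs,
          rs_smul, one_smul]
        exact sub_self _
      | res V V' k k' l m =>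
        rw [map_sub, Finsupp.linearCombination_single, Finsupp.linearCombination_single, ← hr, rs_rs,
          sub_self])

lemma zPreLift_zMk (f : ∀ V : X.AffOpn, M.Γ V.1 → Γ(Z, X.zOpen V)) (h0 hs hr)
    (W : X.zScheme.Opens) (g : ZGen M W) :
    zPreLift f h0 hs hr W (zMk g) = rs Z g.le (f g.V g.m) := by
  rw [zMk, zPreLift]
  refine (Submodule.liftQ_apply _ _ _).trans ?_
  rw [Finsupp.linearCombination_single, one_smul]

/-- The universal property of `M_ℤ`. -/
def zLift (f : ∀ V : X.AffOpn, M.Γ V.1 → Γ(Z, X.zOpen V)) (h0 : ∀ V, f V 0 = 0)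
    (hs : ∀ V (a : X.Γ V.1) m, f V (a • m) = X.zMap V a • f V m)
    (hr : ∀ (V V' : X.AffOpn) (h : V'.1 ≤ V.1) m, rs Z (zOpen_mono h) (f V m) = f V' (M.res h m)) :
    X.zMod.obj M ⟶ Z :=
  shLift (P := zPresheafMod M) (PresheafOfModules.homMk (M₁ := zPresheafMod M) (M₂ := Z.val)
    { app := fun W => AddCommGrpCat.ofHom (zPreLift f h0 hs hr W.unop).toAddMonoidHom
      naturality := fun {W W'} i => by
        ext s
        refine zPre_hom_ext (h := leOfHom i.unop)
          (f := ((zPreLift f h0 hs hr W'.unop).comp (zPreMap (𝟙 M) (leOfHom i.unop)) :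
            ZPre M W.unop →ₛₗ[zres (leOfHom i.unop)] Γ(Z, W'.unop)))
          (g := { (rs Z (leOfHom i.unop)).comp (zPreLift f h0 hs hr W.unop).toAddMonoidHom with
            map_smul' := fun r s => (congrArg (rs Z (leOfHom i.unop))
              ((zPreLift f h0 hs hr W.unop).map_smul r s)).trans (rs_smul _ _ _) })
          (fun g => ?_) s
        change zPreLift f h0 hs hr W'.unop (zPreMap (𝟙 M) (leOfHom i.unop) (zMk g)) =
          rs Z (leOfHom i.unop) (zPreLift f h0 hs hr W.unop (zMk g))
        rw [zPreMap_zMk, zPreLift_zMk, zPreLift_zMk, rs_rs]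
        rfl }
    (fun W r s => (zPreLift f h0 hs hr W.unop).map_smul r s))

lemma zLift_zsec (f : ∀ V : X.AffOpn, M.Γ V.1 → Γ(Z, X.zOpen V)) (h0 hs hr) (V : X.AffOpn)
    (m : M.Γ V.1) : ap (zLift f h0 hs hr) _ (zsec V m) = f V m := by
  refine (shLift_ap (P := zPresheafMod M) _ _ _).trans ?_
  refine (zPreLift_zMk f h0 hs hr _ _).trans ?_
  exact rs_rfl _

attribute [irreducible] zLift

/-- Gluing of sections over intersections. -/
lemma z_glue (V V' : X.AffOpn) (s : ∀ W : X.AffOpn, W.1 ≤ V.1 → W.1 ≤ V'.1 → Γ(Z, X.zOpen W))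
    (h : ∀ (W W' : X.AffOpn) (h : W.1 ≤ V.1) (h' : W.1 ≤ V'.1) (k : W'.1 ≤ W.1),
      rs Z (zOpen_mono k) (s W h h') = s W' (k.trans h) (k.trans h')) :
    ∃ t : Γ(Z, X.zOpen V ⊓ X.zOpen V'), ∀ (W : X.AffOpn) (h : W.1 ≤ V.1) (h' : W.1 ≤ V'.1),
      rs Z (le_inf (zOpen_mono h) (zOpen_mono h')) t = s W h h' := by
  obtain ⟨t, ht⟩ := sec_glue (M := Z)
    (fun W : {W : X.AffOpn // W.1 ≤ V.1 ∧ W.1 ≤ V'.1} => X.zOpen W.1)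
    (fun W => le_inf (zOpen_mono W.2.1) (zOpen_mono W.2.2)) (zOpen_inf_le V V')
    (fun W => s W.1 W.2.1 W.2.2) (fun W W' => by
      -- The overlap of W_ℤ and W'_ℤ is covered by the T_ℤ with T affine in both W and W', and there
      -- both sections are the prescribed section over T_ℤ.
      refine sec_ext (M := Z) (fun T : {T : X.AffOpn // T.1 ≤ W.1.1 ∧ T.1 ≤ W'.1.1} => X.zOpen T.1)
        (fun T => le_inf (zOpen_mono T.2.1) (zOpen_mono T.2.2)) (zOpen_inf_le W.1 W'.1) fun T => ?_
      rw [rs_rs, rs_rs, h W.1 T.1 _ _ T.2.1, h W'.1 T.1 _ _ T.2.2])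
  exact ⟨t, fun W h h' => ht ⟨W, h, h'⟩⟩

lemma z_ext (V V' : X.AffOpn) {W : X.zScheme.Opens} (hV : W ≤ X.zOpen V) (hV' : W ≤ X.zOpen V')
    {s t : Γ(Z, W)} (h : ∀ (T : X.AffOpn) (_ : T.1 ≤ V.1) (_ : T.1 ≤ V'.1),
      rs Z (inf_le_left : W ⊓ X.zOpen T ≤ W) s = rs Z inf_le_left t) : s = t := by
  refine sec_ext (M := Z) (fun T : {T : X.AffOpn // T.1 ≤ V.1 ∧ T.1 ≤ V'.1} => W ⊓ X.zOpen T.1)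
    (fun T => inf_le_left) ?_ (fun T => h T.1 T.2.1 T.2.2)
  rw [← inf_iSup_eq]
  exact le_inf le_rfl ((le_inf hV hV').trans (zOpen_inf_le V V'))

open OMod

/-- The sections m and n live over different affine open sets, whose intersection need not be
affine. The section m ⊗ n over V_ℤ ⊓ V'_ℤ is therefore glued from its values over the W_ℤ, with W
affine in both V and V'. -/
lemma exists_zFixVal {V : X.AffOpn} (m : M.Γ V.1) (V' : X.AffOpn) (n : N.Γ V'.1) :
    ∃ t : Γ(X.zMod.obj (tens M N), X.zOpen V ⊓ X.zOpen V'),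
      ∀ (W : X.AffOpn) (h : W.1 ≤ V.1) (h' : W.1 ≤ V'.1),
        rs _ (le_inf (zOpen_mono h) (zOpen_mono h')) t = zsec W (tmul (M.res h m) (N.res h' n)) :=
  z_glue (Z := X.zMod.obj (tens M N)) V V' (fun W h h' => zsec W (tmul (M.res h m) (N.res h' n)))
    (fun W W' h h' k => by rw [zsec_res k, tmul_res, M.res_res, N.res_res])

/-- The section `m ⊗ n` over the intersection of two affine open sets. -/
def zFixVal {V : X.AffOpn} (m : M.Γ V.1) (V' : X.AffOpn) (n : N.Γ V'.1) :
    Γ(X.zMod.obj (tens M N), X.zOpen V ⊓ X.zOpen V') := (exists_zFixVal m V' n).choose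

lemma rs_zFixVal {V : X.AffOpn} (m : M.Γ V.1) (V' : X.AffOpn) (n : N.Γ V'.1) {W : X.AffOpn}
    (h : W.1 ≤ V.1) (h' : W.1 ≤ V'.1) {T : X.zScheme.Opens} (hT : T ≤ X.zOpen W)
    (k : T ≤ X.zOpen V ⊓ X.zOpen V') :
    rs _ k (zFixVal m V' n) = rs _ hT (zsec W (tmul (M.res h m) (N.res h' n))) := by
  rw [← (exists_zFixVal m V' n).choose_spec W h h', rs_rs]
  rfl

lemma z_ext' {V V' : X.AffOpn} {W : X.zScheme.Opens} (hW : W ≤ X.zOpen V ⊓ X.zOpen V')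
    {s t : Γ(Z, W)} (h : ∀ (T : X.AffOpn) (_ : T.1 ≤ V.1) (_ : T.1 ≤ V'.1) (W' : X.zScheme.Opens)
      (k : W' ≤ W) (_ : W' ≤ X.zOpen T), rs Z k s = rs Z k t) : s = t :=
  z_ext V V' (hW.trans inf_le_left) (hW.trans inf_le_right) fun T h1 h2 =>
    h T h1 h2 _ inf_le_left inf_le_right

/-- The local homomorphism given by tensoring with a section in the first argument. -/
def zFix {V : X.AffOpn} (m : M.Γ V.1) :
    X.zMod.obj N ⟶ onOpen (X.zOpen V) (X.zMod.obj (tens M N)) :=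
  zLift (fun V' n => onMk (zFixVal m V' n))
    (fun V' => by
      have : zFixVal m V' (0 : N.Γ V'.1) = 0 := z_ext' le_rfl fun T h h' W k l => by
        rw [rs_zFixVal m V' 0 h h' l, N.res_zero, OMod.tmul_zero, zsec_zero, map_zero, map_zero]
      rw [this, map_zero])
    (fun V' a n => by
      rw [← smul_onMk]
      refine congrArg onMk (z_ext' le_rfl fun T h h' W k l => ?_)
      rw [rs_smul, rr_rr, rs_zFixVal m V' _ h h' l, rs_zFixVal m V' _ h h' l, N.res_smul,
        ← smul_tmul', ← smul_tmul, zsec_smul, rs_smul, ← rr_zMap h', rr_rr])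
    (fun V' V'' h n => by
      rw [onMk_onRs]
      refine congrArg onMk (z_ext' le_rfl fun T h1 h2 W k l => ?_)
      rw [rs_rs, rs_zFixVal m V' _ h1 (h2.trans h) l, rs_zFixVal m V'' _ h1 h2 l, N.res_res])

lemma ev_zFix {V V' : X.AffOpn} (m : M.Γ V.1) (n : N.Γ V'.1) {W : X.zScheme.Opens}
    (hV : W ≤ X.zOpen V) (hV' : W ≤ X.zOpen V') :
    ev (zFix m) hV (rs _ hV' (zsec V' n)) = rs _ (le_inf hV hV') (zFixVal m V' n) := by
  rw [← onVal_eq_ev (f := zFix m) hV hV', zFix, zLift_zsec]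
  exact onVal_onMk _ _ _

lemma z_on_ext {W : X.zScheme.Opens} {f g : X.zMod.obj M ⟶ onOpen W Z}
    (h : ∀ (V : X.AffOpn) (m : M.Γ V.1) (W' : X.zScheme.Opens) (hW : W' ≤ W) (hV : W' ≤ X.zOpen V),
      ev f hW (rs _ hV (zsec V m)) = ev g hW (rs _ hV (zsec V m))) : f = g :=
  Gen.zMod.ext_on f g (by
    rintro W' hW _ ⟨V, hV, m, rfl⟩
    exact h V m W' hW hV)

lemma zFix_smul {V : X.AffOpn} (a : X.Γ V.1) (m : M.Γ V.1) :
    zFix (N := N) (a • m) = X.zMap V a • zFix m := z_on_ext fun V' n W h k => by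
  rw [smul_ev, ev_zFix, ev_zFix]
  refine z_ext' (le_inf h k) fun T h1 h2 W' k' l => ?_
  rw [rs_rs, rs_smul, rs_rs, rr_rr, rs_zFixVal _ V' _ h1 h2 l, rs_zFixVal _ V' _ h1 h2 l, M.res_smul,
    ← smul_tmul, zsec_smul, rs_smul, ← rr_zMap h1, rr_rr]

lemma zFix_zero {V : X.AffOpn} : zFix (N := N) (0 : M.Γ V.1) = 0 := by
  rw [← zero_smul (X.Γ V.1) (0 : M.Γ V.1), zFix_smul, map_zero]
  exact zero_smul Γ(X.zScheme, X.zOpen V) _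

lemma zFix_res {V V' : X.AffOpn} (h : V'.1 ≤ V.1) (m : M.Γ V.1) :
    zFix (N := N) (M.res h m) = zFix m ≫ onRes (zOpen_mono h) := z_on_ext fun V'' n W k l => by
  rw [ev_onRes, ev_zFix, ev_zFix]
  refine z_ext' (le_inf k l) fun T h1 h2 W' k' l => ?_
  rw [rs_rs, rs_rs, rs_zFixVal _ V'' _ h1 h2 l, rs_zFixVal _ V'' _ (h1.trans h) h2 l, M.res_res]

/-- The local homomorphism given by tensoring with a section of `N_ℤ`. -/
def zFix' {W : X.zScheme.Opens} (y : Γ(X.zMod.obj N, W)) :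
    X.zMod.obj M ⟶ onOpen W (X.zMod.obj (tens M N)) :=
  zLift (fun V m => onMk (ev (zFix m) inf_le_right (rs _ inf_le_left y)))
    (fun V => by
      rw [zFix_zero]
      exact (congrArg onMk (map_zero (onVal inf_le_right le_rfl))).trans (map_zero _))
    (fun V a m => by rw [zFix_smul, smul_ev, smul_onMk])
    (fun V V' h m => by rw [onMk_onRs, zFix_res, ev_onRes, ← ev_rs, rs_rs])

lemma ev_zFix' {V : X.AffOpn} {W W' : X.zScheme.Opens} (m : M.Γ V.1) (y : Γ(X.zMod.obj N, W))
    (hW : W' ≤ W) (hV : W' ≤ X.zOpen V) :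
    ev (zFix' y) hW (rs _ hV (zsec V m)) = ev (zFix m) hV (rs _ hW y) := by
  rw [← onVal_eq_ev (f := zFix' y) hW hV, zFix', zLift_zsec]
  refine (onVal_onMk _ _ _).trans ?_
  rw [← ev_rs, rs_rs]

variable (M N) in
/-- The comparison `M_ℤ ⊗ N_ℤ → (M ⊗ N)_ℤ`. -/
def zTens : tensMod (X.zMod.obj M) (X.zMod.obj N) ⟶ X.zMod.obj (tens M N) :=
  -- The same double currying as for pullbacks, now with the generators of the base extensions in
  -- place of pulled back sections.
  (Bilin.ofFam (M := X.zMod.obj N) (N := X.zMod.obj M) (fun W y => zFix' y)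
    (fun W y y' => z_on_ext fun V m W' h k => by
      rw [add_ev, ev_zFix', ev_zFix', ev_zFix', map_add, map_add])
    (fun W r y => z_on_ext fun V m W' h k => by
      rw [smul_ev, ev_zFix', ev_zFix', rs_smul, ev_smul])
    (fun h y => z_on_ext fun V m W' h k => by
      rw [ev_onRes, ev_zFix', ev_zFix', rs_rs])).swap.lift

lemma zTens_tmul (V : X.AffOpn) (m : M.Γ V.1) (n : N.Γ V.1) :
    ap (zTens M N) _ (tmulMod (zsec V m) (zsec V n)) = zsec V (tmul m n) := by
  rw [zTens, Bilin.lift_tmul]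
  change ev (zFix' _) le_rfl _ = _
  have := ev_zFix' m (zsec V n) le_rfl le_rfl
  rw [rs_rfl, ev_zFix] at this
  refine this.trans ?_
  rw [rs_zFixVal m V n (le_refl V.1) (le_refl V.1) le_rfl, rs_rfl, M.res_rfl, N.res_rfl]

variable (M N) in
/-- The comparison `(M ⊗ N)_ℤ → M_ℤ ⊗ N_ℤ`. -/
def zTensInv : X.zMod.obj (tens M N) ⟶ tensMod (X.zMod.obj M) (X.zMod.obj N) :=
  zLift (fun V => tensRec V (fun m n => tmulMod (zsec V m) (zsec V n)) (fun a m n => by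
      rw [zsec_smul, zsec_smul, tmulMod_smul_left, tmulMod_smul_right]))
    (fun V => by rw [← OMod.zero_tmul (0 : N.Γ V.1), tensRec_tmul, zsec_zero, tmulMod_zero_left])
    (fun V a t => by
      induction t using tens_ind with | _ m n
      rw [smul_tmul, tensRec_tmul, tensRec_tmul, zsec_smul, tmulMod_smul_left])
    (fun V V' h t => by
      induction t using tens_ind with | _ m n
      rw [tmul_res, tensRec_tmul, tensRec_tmul, tmulMod_rs, zsec_res, zsec_res])

lemma zTensInv_zsec (V : X.AffOpn) (m : M.Γ V.1) (n : N.Γ V.1) :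
    ap (zTensInv M N) _ (zsec V (tmul m n)) = tmulMod (zsec V m) (zsec V n) := by
  rw [zTensInv, zLift_zsec, tensRec_tmul]

lemma z_tens_ext {f g : X.zMod.obj (tens M N) ⟶ Z}
    (h : ∀ (V : X.AffOpn) (m : M.Γ V.1) (n : N.Γ V.1),
      ap f _ (zsec V (tmul m n)) = ap g _ (zsec V (tmul m n))) : f = g :=
  zMod_hom_ext fun V t => by
    induction t using tens_ind with | _ m n
    exact h V m n

lemma tens_z_ext {f g : tensMod (X.zMod.obj M) (X.zMod.obj N) ⟶ Z}
    (h : ∀ (V : X.AffOpn) (m : M.Γ V.1) (n : N.Γ V.1),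
      ap f _ (tmulMod (zsec V m) (zsec V n)) = ap g _ (tmulMod (zsec V m) (zsec V n))) : f = g :=
  (Gen.zMod.tens Gen.zMod).ext f g (by
    rintro W _ ⟨_, _, ⟨V, hV, m, rfl⟩, ⟨V', hV', n, rfl⟩, rfl⟩
    -- The generators come from different affine sets V and V'; the equality is tested over the
    -- affine sets T contained in both, where they can be restricted to a common set.
    refine z_ext' (le_inf hV hV') fun T h1 h2 W' k l => ?_
    have e := congrArg (rs _ l) (h T (M.res h1 m) (N.res h2 n))
    rw [← ap_rs, ← ap_rs, tmulMod_rs, ← zsec_res, ← zsec_res, rs_rs, rs_rs] at e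
    rw [← ap_rs, ← ap_rs, tmulMod_rs, rs_rs, rs_rs]
    exact e)

variable (M N) in
/-- The base extension commutes with tensor products. -/
def zTensIso : X.zMod.obj (tens M N) ≅ tensMod (X.zMod.obj M) (X.zMod.obj N) :=
  ⟨zTensInv M N, zTens M N,
    z_tens_ext fun V m n => by rw [ap_comp, zTensInv_zsec, zTens_tmul, ap_id],
    tens_z_ext fun V m n => by rw [ap_comp, zTens_tmul, zTensInv_zsec, ap_id]⟩

lemma zTensInv_nat (f : M ⟶ M') (g : N ⟶ N') :
    X.zMod.map (tensMap f g) ≫ zTensInv M' N' =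
      zTensInv M N ≫ tensModMap (X.zMod.map f) (X.zMod.map g) := z_tens_ext fun V m n => by
  rw [ap_comp, ap_comp, zMod_map_zsec, tensMap_tmul, zTensInv_zsec, zTensInv_zsec,
    tensModMap_tmul, zMod_map_zsec, zMod_map_zsec]

attribute [irreducible] zTens zTensInv

lemma zMod_unit_ext {f g : X.zMod.obj (unit X.toMonoidalSpace) ⟶ Z}
    (h : ∀ V : X.AffOpn, ap f _ (zsec V (uone V.1)) = ap g _ (zsec V (uone V.1))) : f = g :=
  zMod_hom_ext fun V r => by
    obtain ⟨a, rfl⟩ := exists_smul_uone r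
    rw [zsec_smul, ap_smul, ap_smul, h]

lemma unitMod_ext {f g : unitMod X.zScheme ⟶ Z}
    (h : ∀ V : X.AffOpn, ap f _ (oneMod (X.zOpen V)) = ap g _ (oneMod (X.zOpen V))) : f = g :=
  unit_hom_ext fun U => by
    refine sec_ext (M := Z) (fun V : X.AffOpn => U ⊓ X.zOpen V) (fun V => inf_le_left) ?_ fun V => ?_
    · rw [← inf_iSup_eq]
      exact le_inf le_rfl (le_top.trans le_iSup_zOpen)
    · have e := congrArg (rs _ (inf_le_right : U ⊓ X.zOpen V ≤ X.zOpen V)) (h V)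
      rw [← ap_rs, ← ap_rs, rs_oneMod] at e
      rw [← ap_rs, ← ap_rs, rs_oneMod, e]

variable (X) in
/-- The comparison `(𝒪_X)_ℤ → 𝒪_{X_ℤ}`. -/
def zUnit : X.zMod.obj (unit X.toMonoidalSpace) ⟶ unitMod X.zScheme :=
  zLift (fun V r => X.zMap V (uval r) • oneMod (X.zOpen V))
    (fun V => by
      have : uval (0 : (unit X.toMonoidalSpace).Γ V.1) = 0 := rfl
      rw [this, map_zero, zero_smul])
    (fun V a r => by
      have : uval (a • r) = a * uval r := rfl
      rw [this, map_mul, mul_smul])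
    (fun V V' h r => by
      rw [rs_one, rr_zMap h]
      rfl)

lemma zUnit_one (V : X.AffOpn) : ap (zUnit X) _ (zsec V (uone V.1)) = oneMod (X.zOpen V) := by
  rw [zUnit, zLift_zsec]
  have : uval (uone (X := X) V.1) = 1 := rfl
  rw [this, map_one, one_smul]

variable (X) in
-- Generators of M_ℤ come only from affine open sets, so the global section 1 of the base extension
-- of the structure sheaf has to be glued.
lemma exists_zone : ∃ t : Γ(X.zMod.obj (unit X.toMonoidalSpace), ⊤), ∀ V : X.AffOpn,
    rs _ le_top t = zsec V (uone V.1) :=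
  sec_glue (M := X.zMod.obj (unit X.toMonoidalSpace)) (fun V : X.AffOpn => X.zOpen V)
    (fun V => le_top) le_iSup_zOpen (fun V => zsec V (uone V.1))
    (fun V V' => z_ext' le_rfl fun T h h' W k l => by
      have e := congrArg (rs _ l) (zsec_res h (uone V.1))
      have e' := congrArg (rs _ l) (zsec_res h' (uone V'.1))
      rw [rs_rs, res_uone] at e e'
      rw [rs_rs, rs_rs, e, e'])

variable (X) in
/-- The comparison `𝒪_{X_ℤ} → (𝒪_X)_ℤ`. -/
def zUnitInv : unitMod X.zScheme ⟶ X.zMod.obj (unit X.toMonoidalSpace) :=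
  unitHom (exists_zone X).choose

lemma zUnitInv_one (V : X.AffOpn) : ap (zUnitInv X) _ (oneMod (X.zOpen V)) = zsec V (uone V.1) :=
  (unitHom_one _ _).trans ((exists_zone X).choose_spec V)

variable (X) in
/-- The base extension of the structure sheaf. -/
def zUnitIso : X.zMod.obj (unit X.toMonoidalSpace) ≅ unitMod X.zScheme :=
  ⟨zUnit X, zUnitInv X,
    zMod_unit_ext fun V => by rw [ap_comp, zUnit_one, zUnitInv_one, ap_id],
    unitMod_ext fun V => by rw [ap_comp, zUnitInv_one, zUnit_one, ap_id]⟩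

end
end MZScheme

/-! ### Pullback is compatible with associativity, symmetry and unit. -/

section pull
variable {Y B : Scheme.{u}} {e : Y ⟶ B} {M N P M' N' : B.Modules} {Z : Y.Modules}

lemma pull3_ext {f g : pb e (tensMod (tensMod M N) P) ⟶ Z}
    (h : ∀ U (m : Γ(M, U)) (n : Γ(N, U)) (p : Γ(P, U)),
      ap f _ (psec e (tmulMod (tmulMod m n) p)) = ap g _ (psec e (tmulMod (tmulMod m n) p))) :
    f = g := by
  apply ((Scheme.Modules.pullbackPushforwardAdjunction e).homEquiv _ Z).injective
  refine tens3_ext fun U m n p => ?_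
  rw [homEquiv_ap, homEquiv_ap, h]

lemma pullTens_comp_inv : pullTens e M N ≫ pullTensInv e M N = 𝟙 _ := (pullTensIso e M N).inv_hom_id

lemma pullTensInv_comp : pullTensInv e M N ≫ pullTens e M N = 𝟙 _ := (pullTensIso e M N).hom_inv_id

lemma pullTens_nat (f : M ⟶ M') (g : N ⟶ N') :
    tensModMap (pbMap e f) (pbMap e g) ≫ pullTens e M' N' =
      pullTens e M N ≫ pbMap e (tensModMap f g) := by
  have h := congrArg (fun t => pullTens e M N ≫ t ≫ pullTens e M' N') (pullTensInv_nat (e := e) f g)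
  simp only [Category.assoc] at h
  rw [pullTensInv_comp, Category.comp_id, ← Category.assoc (pullTens e M N), pullTens_comp_inv,
    Category.id_comp] at h
  exact h.symm

lemma pullTensInv_assoc :
    pbMap e (tensAssoc M N P) ≫ pullTensInv e M (tensMod N P) ≫
      tensModMap (𝟙 _) (pullTensInv e N P) =
    pullTensInv e (tensMod M N) P ≫ tensModMap (pullTensInv e M N) (𝟙 _) ≫ tensAssoc _ _ _ :=
  pull3_ext fun U m n p => by
    rw [ap_comp, ap_comp, ap_comp, ap_comp, pbMap_psec, tensAssoc_tmul, pullTensInv_psec,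
      pullTensInv_psec, tensModMap_tmul, tensModMap_tmul, pullTensInv_psec, pullTensInv_psec, ap_id,
      ap_id, tensAssoc_tmul]

/-- The identity for the inverse comparison maps is tested on pullbacks of pure tensors; composing
it with the isomorphisms on both sides gives this form. It is the one that the associator needs,
since the ε of a tensor product ends with `pullTens`. -/
lemma pullTens_assoc :
    tensModMap (pullTens e M N) (𝟙 _) ≫ pullTens e (tensMod M N) P ≫ pbMap e (tensAssoc M N P) =
      tensAssoc _ _ _ ≫ tensModMap (𝟙 _) (pullTens e N P) ≫ pullTens e M (tensMod N P) := by
  have h := congrArg (fun t => (tensModMap (pullTens e M N) (𝟙 _) ≫ pullTens e (tensMod M N) P) ≫ t ≫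
    tensModMap (𝟙 _) (pullTens e N P) ≫ pullTens e M (tensMod N P)) (pullTensInv_assoc (e := e)
    (M := M) (N := N) (P := P))
  simp only [Category.assoc] at h
  rw [← Category.assoc (tensModMap (𝟙 _) (pullTensInv e N P)), tensModMap_comp, pullTensInv_comp,
    Category.comp_id, tensModMap_id, Category.id_comp, pullTensInv_comp, Category.comp_id,
    ← Category.assoc (pullTens e (tensMod M N) P), pullTens_comp_inv, Category.id_comp,
    ← Category.assoc (tensModMap (pullTens e M N) (𝟙 _)) (tensModMap (pullTensInv e M N) (𝟙 _)),
    tensModMap_comp, pullTens_comp_inv, Category.comp_id, tensModMap_id, Category.id_comp] at h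
  exact h

lemma pullTens_assoc_ap {U : Y.Opens} (x : Γ(pb e M, U)) (y : Γ(pb e N, U)) (z : Γ(pb e P, U)) :
    ap (pbMap e (tensAssoc M N P)) U (ap (pullTens e (tensMod M N) P) U
      (tmulMod (ap (pullTens e M N) U (tmulMod x y)) z)) =
    ap (pullTens e M (tensMod N P)) U (tmulMod x (ap (pullTens e N P) U (tmulMod y z))) := by
  have h := congrArg (fun t => ap t U (tmulMod (tmulMod x y) z)) (pullTens_assoc (e := e)
    (M := M) (N := N) (P := P))
  simp only [ap_comp] at h
  rw [tensModMap_tmul, tensAssoc_tmul, tensModMap_tmul, ap_id, ap_id] at h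
  exact h

lemma pullTens_braid : pullTens e M N ≫ pbMap e (tensBraid M N) =
    tensBraid _ _ ≫ pullTens e N M := tens_pull_ext fun U m n => by
  rw [ap_comp, ap_comp, pullTens_tmul, pbMap_psec, tensBraid_tmul, tensBraid_tmul, pullTens_tmul]

lemma pullTens_braid_ap {U : Y.Opens} (x : Γ(pb e M, U)) (y : Γ(pb e N, U)) :
    ap (pbMap e (tensBraid M N)) U (ap (pullTens e M N) U (tmulMod x y)) =
      ap (pullTens e N M) U (tmulMod y x) := by
  have h := congrArg (fun t => ap t U (tmulMod x y)) (pullTens_braid (e := e) (M := M) (N := N))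
  simp only [ap_comp] at h
  rw [tensBraid_tmul] at h
  exact h

lemma pull_unit_tens_ext {f g : pb e (tensMod (unitMod B) M) ⟶ Z}
    (h : ∀ U (m : Γ(M, U)), ap f _ (psec e (tmulMod (oneMod U) m)) =
      ap g _ (psec e (tmulMod (oneMod U) m))) : f = g := pull_tens_ext fun U r m => by
  obtain ⟨s, rfl⟩ := exists_smul_one r
  rw [tmulMod_smul_left, psec_smul, ap_smul, ap_smul, h]

lemma pullTensInv_unit : pullTensInv e (unitMod B) M ≫ tensModMap (pullUnit e) (𝟙 _) ≫ tensUnit _ =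
    pbMap e (tensUnit M) := pull_unit_tens_ext fun U m => by
  rw [ap_comp, ap_comp, pullTensInv_psec, tensModMap_tmul, pullUnit_one, ap_id, tensUnit_tmul_one,
    pbMap_psec, tensUnit_tmul_one]

lemma pullTens_unit : tensModMap (pullUnitInv e) (𝟙 _) ≫ pullTens e (unitMod B) M ≫
    pbMap e (tensUnit M) = tensUnit _ := by
  have e1 : pullUnitInv e ≫ pullUnit e = 𝟙 _ := (pullUnitIso e).inv_hom_id
  rw [← pullTensInv_unit, ← Category.assoc (pullTens e (unitMod B) M), pullTens_comp_inv,
    Category.id_comp, ← Category.assoc, tensModMap_comp, e1, Category.comp_id, tensModMap_id,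
    Category.id_comp]

lemma pullTens_unit_ap {U : Y.Opens} (x : Γ(pb e M, U)) :
    ap (pbMap e (tensUnit M)) U (ap (pullTens e (unitMod B) M) U
      (tmulMod (ap (pullUnitInv e) U (oneMod U)) x)) = x := by
  have h := congrArg (fun t => ap t U (tmulMod (oneMod U) x)) (pullTens_unit (e := e) (M := M))
  simp only [ap_comp] at h
  rw [tensModMap_tmul, ap_id, tensUnit_tmul_one] at h
  exact h

/-- The tensor product of isomorphisms. -/
def tensModIso {M N M' N' : Y.Modules} (f : M ≅ M') (g : N ≅ N') : tensMod M N ≅ tensMod M' N' :=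
  ⟨tensModMap f.hom g.hom, tensModMap f.inv g.inv,
    by rw [tensModMap_comp, f.hom_inv_id, g.hom_inv_id, tensModMap_id],
    by rw [tensModMap_comp, f.inv_hom_id, g.inv_hom_id, tensModMap_id]⟩

end pull

/-! ### The symmetric monoidal category of modules over an 𝔽₁-scheme. -/

namespace F1Module
section
open OMod MZScheme
variable {𝒳 : F1Scheme.{u}} {M N P Q M' N' P' M'' N'' : F1Module 𝒳}

lemma comp_fst (f : M ⟶ N) (g : N ⟶ P) : (f ≫ g).fst = f.fst ≫ g.fst := rfl
lemma comp_snd (f : M ⟶ N) (g : N ⟶ P) : (f ≫ g).snd = f.snd ≫ g.snd := rfl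

lemma hom_ext {f g : M ⟶ N} (h1 : f.fst = g.fst) (h2 : f.snd = g.snd) : f = g :=
  Hom.ext h1 h2

/-- An isomorphism from isomorphisms of the components. -/
def mkIso (a : M.fst ≅ N.fst) (b : M.snd ≅ N.snd)
    (h : 𝒳.tilde.zMod.map a.hom ≫ N.ε.hom = M.ε.hom ≫ pbMap 𝒳.e b.hom) : M ≅ N where
  hom := ⟨a.hom, b.hom, h⟩
  inv := ⟨a.inv, b.inv, by
    rw [← cancel_epi (𝒳.tilde.zMod.map a.hom), ← Category.assoc, ← Category.assoc, h,
      ← Functor.map_comp, a.hom_inv_id, CategoryTheory.Functor.map_id, Category.id_comp, Category.assoc,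
      ← Functor.map_comp, b.hom_inv_id, CategoryTheory.Functor.map_id, Category.comp_id]⟩
  hom_inv_id := hom_ext a.hom_inv_id b.hom_inv_id
  inv_hom_id := hom_ext a.inv_hom_id b.inv_hom_id

/-- The componentwise tensor product. -/
def tens (M N : F1Module 𝒳) : F1Module 𝒳 where
  fst := OMod.tens M.fst N.fst
  snd := tensMod M.snd N.snd
  ε := zTensIso M.fst N.fst ≪≫ tensModIso M.ε N.ε ≪≫ (pullTensIso 𝒳.e M.snd N.snd).symm

/-- The unit. -/
def unit (𝒳 : F1Scheme.{u}) : F1Module 𝒳 where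
  fst := OMod.unit 𝒳.tilde.toMonoidalSpace
  snd := unitMod 𝒳.base
  ε := zUnitIso 𝒳.tilde ≪≫ (pullUnitIso 𝒳.e).symm

/-- This value on the generators of the base extension of M̃ ⊗ Ñ is all that is needed of ε_M ⊗ ε_N
to check that associator, braiding and unitor are morphisms. -/
lemma tens_ε (V : 𝒳.tilde.AffOpn) (m : M.fst.Γ V.1) (n : N.fst.Γ V.1) :
    ap (tens M N).ε.hom _ (zsec V (tmul m n)) = ap (pullTens 𝒳.e M.snd N.snd) _
      (tmulMod (ap M.ε.hom _ (zsec V m)) (ap N.ε.hom _ (zsec V n))) := by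
  have h : ap (zTensInv M.fst N.fst ≫ tensModMap M.ε.hom N.ε.hom ≫ pullTens 𝒳.e M.snd N.snd) _
      (zsec V (tmul m n)) = ap (pullTens 𝒳.e M.snd N.snd) _
      (tmulMod (ap M.ε.hom _ (zsec V m)) (ap N.ε.hom _ (zsec V n))) := by
    refine (ap_comp _ _ _ _).trans ((ap_comp _ _ _ _).trans ?_)
    exact congrArg (ap (pullTens 𝒳.e M.snd N.snd) _)
      ((congrArg (ap (tensModMap M.ε.hom N.ε.hom) _) (zTensInv_zsec V m n)).trans
        (tensModMap_tmul _ _ _ _))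
  exact h

lemma unit_ε (V : 𝒳.tilde.AffOpn) : ap (unit 𝒳).ε.hom _ (zsec V (uone V.1)) =
    ap (pullUnitInv 𝒳.e) _ (oneMod _) :=
  congrArg (ap (pullUnitInv 𝒳.e) _) (zUnit_one V)

lemma tensHom_comm (f : M ⟶ M') (g : N ⟶ N') :
    𝒳.tilde.zMod.map (OMod.tensMap f.fst g.fst) ≫ zTensInv M'.fst N'.fst ≫
      tensModMap M'.ε.hom N'.ε.hom ≫ pullTens 𝒳.e M'.snd N'.snd =
    (zTensInv M.fst N.fst ≫ tensModMap M.ε.hom N.ε.hom ≫ pullTens 𝒳.e M.snd N.snd) ≫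
      pbMap 𝒳.e (tensModMap f.snd g.snd) := by
  have h1 : 𝒳.tilde.zMod.map f.fst ≫ M'.ε.hom = M.ε.hom ≫ pbMap 𝒳.e f.snd := f.comm
  have h2 : 𝒳.tilde.zMod.map g.fst ≫ N'.ε.hom = N.ε.hom ≫ pbMap 𝒳.e g.snd := g.comm
  have h3 : tensModMap (𝒳.tilde.zMod.map f.fst) (𝒳.tilde.zMod.map g.fst) ≫
      tensModMap M'.ε.hom N'.ε.hom = tensModMap M.ε.hom N.ε.hom ≫
      tensModMap (pbMap 𝒳.e f.snd) (pbMap 𝒳.e g.snd) := by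
    rw [tensModMap_comp, tensModMap_comp, h1, h2]
  refine ((Category.assoc _ _ _).symm.trans (congrArg (· ≫ tensModMap M'.ε.hom N'.ε.hom ≫
    pullTens 𝒳.e M'.snd N'.snd) (zTensInv_nat f.fst g.fst))).trans ?_
  refine (Category.assoc _ _ _).trans ((congrArg (zTensInv M.fst N.fst ≫ ·) ?_).trans
    (Category.assoc _ _ _).symm)
  refine ((Category.assoc _ _ _).symm.trans (congrArg (· ≫ pullTens 𝒳.e M'.snd N'.snd) h3)).trans ?_
  exact (Category.assoc _ _ _).trans ((congrArg (tensModMap M.ε.hom N.ε.hom ≫ ·)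
    (pullTens_nat f.snd g.snd)).trans (Category.assoc _ _ _).symm)

/-- The tensor product of morphisms. -/
def tensHom (f : M ⟶ M') (g : N ⟶ N') : tens M N ⟶ tens M' N' where
  fst := OMod.tensMap f.fst g.fst
  snd := tensModMap f.snd g.snd
  comm := tensHom_comm f g

/-- The associator. -/
def assoc (M N P : F1Module 𝒳) : tens (tens M N) P ≅ tens M (tens N P) :=
  mkIso (assocIso M.fst N.fst P.fst)
    ⟨tensAssoc M.snd N.snd P.snd, tensAssocInv M.snd N.snd P.snd,
      (MonoidalCategory.associator M.snd N.snd P.snd).hom_inv_id,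
      (MonoidalCategory.associator M.snd N.snd P.snd).inv_hom_id⟩
    (zMod_hom_ext fun V t => by
      revert t
      refine tens_ind (M := OMod.tens M.fst N.fst) (N := P.fst) fun t p => ?_
      revert t
      refine tens_ind fun m n => ?_
      refine ((ap_comp _ _ _ _).trans (congrArg _ (zMod_map_zsec _ V _))).trans ?_
      have e1 : (assocIso M.fst N.fst P.fst).hom.app V.1 (tmul (tmul m n) p) = tmul m (tmul n p) :=
        assoc_tmul m n p
      have e2 : ap (tens M (tens N P)).ε.hom _ (zsec V (tmul m (tmul n p))) = _ :=
        tens_ε (N := tens N P) V m (tmul n p)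
      have e3 := tens_ε (M := tens M N) (N := P) V (tmul m n) p
      refine (congrArg (fun t => ap (tens M (tens N P)).ε.hom _ (zsec V t)) e1).trans
        (e2.trans (Eq.trans ?_ (congrArg (ap (pbMap 𝒳.e (tensAssoc M.snd N.snd P.snd)) _) e3).symm))
      rw [tens_ε, tens_ε]
      exact (pullTens_assoc_ap _ _ _).symm)

/-- The braiding. -/
def braid (M N : F1Module 𝒳) : tens M N ≅ tens N M :=
  mkIso (braidIso M.fst N.fst)
    ⟨tensBraid M.snd N.snd, tensBraid N.snd M.snd, tensBraid_tensBraid, tensBraid_tensBraid⟩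
    (zMod_hom_ext fun V t => by
      revert t
      refine tens_ind fun m n => ?_
      refine ((ap_comp _ _ _ _).trans (congrArg _ (zMod_map_zsec _ V _))).trans ?_
      have e1 : (braidIso M.fst N.fst).hom.app V.1 (tmul m n) = tmul n m := braid_tmul m n
      have e3 := tens_ε (M := M) (N := N) V m n
      refine (congrArg (fun t => ap (tens N M).ε.hom _ (zsec V t)) e1).trans
        ((tens_ε V n m).trans (Eq.trans ?_
          (congrArg (ap (pbMap 𝒳.e (tensBraid M.snd N.snd)) _) e3).symm))
      exact (pullTens_braid_ap _ _).symm)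

/-- The left unitor. -/
def lunit (M : F1Module 𝒳) : tens (unit 𝒳) M ≅ M :=
  mkIso (lunitIso M.fst)
    ⟨tensUnit M.snd, tensUnitInv M.snd, (MonoidalCategory.leftUnitor M.snd).hom_inv_id,
      (MonoidalCategory.leftUnitor M.snd).inv_hom_id⟩
    (zMod_hom_ext fun V t => by
      revert t
      refine tens_ind (M := OMod.unit 𝒳.tilde.toMonoidalSpace) fun r m => ?_
      -- Moving the scalar a to the second factor leaves the tensors 1 ⊗ m, and the ε of the unit
      -- object is known on 1.
      obtain ⟨a, rfl⟩ := exists_smul_uone r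
      rw [OMod.smul_tmul']
      generalize a • m = m
      refine ((ap_comp _ _ _ _).trans (congrArg _ (zMod_map_zsec _ V _))).trans ?_
      have e1 : (lunitIso M.fst).hom.app V.1 (tmul (uone V.1) m) = m := lunit_tmul_one m
      have e3 := tens_ε (M := unit 𝒳) (N := M) V (uone V.1) m
      refine (congrArg (fun t => ap M.ε.hom _ (zsec V t)) e1).trans (Eq.trans ?_
          (congrArg (ap (pbMap 𝒳.e (tensUnit M.snd)) _) e3).symm)
      rw [unit_ε]
      exact (pullTens_unit_ap _).symm)

instance : MonoidalCategoryStruct (F1Module 𝒳) where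
  tensorObj := tens
  tensorUnit := unit 𝒳
  whiskerLeft M _ _ f := tensHom (𝟙 M) f
  whiskerRight f M := tensHom f (𝟙 M)
  tensorHom := tensHom
  associator := assoc
  leftUnitor := lunit
  rightUnitor M := braid M (unit 𝒳) ≪≫ lunit M

/-- A morphism is determined by its two components, so every law is the pair of the corresponding
laws for the components. The ε's enter only into the construction of the structure morphisms. -/
instance : MonoidalCategory (F1Module 𝒳) := MonoidalCategory.ofTensorHom
  (id_tensorHom_id := fun _ _ => hom_ext OMod.tensMap_id tensModMap_id)
  (id_tensorHom := fun _ _ _ _ => rfl)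
  (tensorHom_id := fun _ _ => rfl)
  (tensorHom_comp_tensorHom := fun f g f' g' => hom_ext (OMod.tensMap_comp f.fst f'.fst g.fst g'.fst)
    (tensModMap_comp f.snd f'.snd g.snd g'.snd))
  (associator_naturality := fun f g h => hom_ext (assoc_nat f.fst g.fst h.fst)
    (tensAssoc_nat f.snd g.snd h.snd))
  (leftUnitor_naturality := fun f => hom_ext (lunit_nat f.fst) (tensUnit_nat f.snd))
  (rightUnitor_naturality := fun f => hom_ext (braid_lunit_nat f.fst) (tensBraid_tensUnit_nat f.snd))
  (pentagon := fun _ _ _ _ => hom_ext pentagon tensMod_pentagon)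
  (triangle := fun _ _ => hom_ext triangle tensMod_triangle)

instance : SymmetricCategory (F1Module 𝒳) where
  braiding := braid
  braiding_naturality_right M _ _ f := hom_ext (braid_nat (𝟙 M.fst) f.fst) (tensBraid_nat (𝟙 M.snd) f.snd)
  braiding_naturality_left f M := hom_ext (braid_nat f.fst (𝟙 M.fst)) (tensBraid_nat f.snd (𝟙 M.snd))
  hexagon_forward _ _ _ := hom_ext hexagon tensMod_hexagon
  hexagon_reverse _ _ _ := hom_ext hexagon' tensMod_hexagon'
  symmetry _ _ := hom_ext braid_braid tensBraid_tensBraid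

end
end F1Module

/-! ### Quasi-coherence, finite generation and projectivity on all affine open sets. -/

namespace OMod
section
variable {X : MZScheme.{u}} {M N P Q S : OMod X.toMonoidalSpace}

/-- An open set that contains the closed point of V contains V, so a property given on the members
of a cover holds on an open set containing V. -/
lemma exists_le_of_cover (V : X.AffOpn) {R : X.Opn → Prop} (h : ∀ x, ∃ U : X.Opn, x ∈ U ∧ R U) :
    (0 : X.Γ V.1) = 1 ∨ ∃ U : X.Opn, V.1 ≤ U ∧ R U := by
  rcases V.2.exists_closed with ⟨h0, -⟩ | ⟨c, -, hc⟩
  · exact Or.inl h0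
  · obtain ⟨U, hU, hR⟩ := h c
    exact Or.inr ⟨U, hc U hU, hR⟩

lemma isUnit_res {U V : X.Opn} {h : V ≤ U} {f : X.Γ U}
    (hl : (Submonoid.powers f).IsLocalizationMap (X.res h)) : IsUnit (X.res h f) :=
  hl.map_units ⟨f, Submonoid.mem_powers f⟩

lemma smul_inj {A E : Type u} [CommMonoidWithZero A] [Zero E] [MulActionWithZero A E] {a : A}
    (ha : IsUnit a) {m n : E} (e : a • m = a • n) : m = n := by
  obtain ⟨b, hb⟩ := ha.exists_left_inv
  rw [← one_smul A m, ← one_smul A n, ← hb, mul_smul, e, mul_smul]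

lemma IsLocAt.of_isLocalizationMap {U V : X.Opn} {h : V ≤ U} {f : X.Γ U}
    (hl : (Submonoid.powers f).IsLocalizationMap (X.res h))
    (surj : ∀ n : M.Γ V, ∃ (k : ℕ) (m : M.Γ U), X.res h f ^ k • n = M.res h m)
    (eq : ∀ m m' : M.Γ U, M.res h m = M.res h m' → ∃ k : ℕ, f ^ k • m = f ^ k • m') :
    M.IsLocAt h f where
  bij := by
    refine ⟨fun m n e => smul_inj (isUnit_res hl) e, fun n => ?_⟩
    obtain ⟨b, hb⟩ := (isUnit_res hl).exists_right_inv
    exact ⟨b • n, by simp only [smul_smul, hb, one_smul]⟩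
  surj := surj
  eq := eq

lemma IsLocAt.of_subsingleton {U V : X.Opn} (h : V ≤ U) (f : X.Γ U) (h0 : (0 : X.Γ U) = 1) :
    M.IsLocAt h f := by
  have h1 : (0 : X.Γ V) = 1 := by rw [← map_zero (X.res h), h0, map_one]
  refine ⟨⟨fun m n _ => M.subsingleton_of_zero_eq_one h1 m n,
    fun s => ⟨0, M.subsingleton_of_zero_eq_one h1 _ _⟩⟩,
    fun n => ⟨0, 0, M.subsingleton_of_zero_eq_one h1 _ _⟩,
    fun m n _ => ⟨0, M.subsingleton_of_zero_eq_one h0 _ _⟩⟩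

/-- Sections over V have denominators that are powers of g', while powers of f are wanted. Both
become invertible over V, so one kind of denominator can be exchanged for the other; equalities over
V are pulled back to U' and hold there up to a power of g'. -/
lemma IsLocAt.of_le {U' U V : X.Opn} {hU : U ≤ U'} {h : V ≤ U} {g g' : X.Γ U'} {f : X.Γ U}
    (hg : (Submonoid.powers g).IsLocalizationMap (X.res hU))
    (hg' : (Submonoid.powers g').IsLocalizationMap (X.res (h.trans hU)))
    (hf : (Submonoid.powers f).IsLocalizationMap (X.res h))
    (H : M.IsLocAt hU g) (H' : M.IsLocAt (h.trans hU) g') : M.IsLocAt h f := by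
  -- Writing the inverse of g' ^ k over V as a fraction a / f ^ j shows that a power of f is a
  -- multiple of g' ^ k.
  have key (k : ℕ) : ∃ (j : ℕ) (a : X.Γ U), X.res h a * X.res (h.trans hU) g' ^ k = X.res h f ^ j := by
    obtain ⟨b, hb⟩ := ((isUnit_res hg').pow k).exists_left_inv
    obtain ⟨⟨a, _, j, rfl⟩, ha⟩ := hf.surj b
    simp only at ha
    refine ⟨j, a, ?_⟩
    rw [← ha, mul_right_comm, hb, one_mul, map_pow]
  refine .of_isLocalizationMap hf (fun n => ?_) fun m m' e => ?_
  · obtain ⟨k, m, hm⟩ := H'.surj n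
    obtain ⟨j, a, ha⟩ := key k
    exact ⟨j, a • M.res hU m, by rw [← ha, mul_smul, hm, M.res_smul, M.res_res]⟩
  · obtain ⟨k, m₁, h₁⟩ := H.surj m
    obtain ⟨k', m₁', h₁'⟩ := H.surj m'
    have h2 : M.res (h.trans hU) (g ^ k' • m₁) = M.res (h.trans hU) (g ^ k • m₁') := by
      rw [← M.res_res hU h, ← M.res_res hU h, M.res_smul hU, M.res_smul hU, ← h₁, ← h₁', map_pow,
        map_pow, smul_smul, smul_smul, ← pow_add, ← pow_add, add_comm, M.res_smul, M.res_smul, e]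
    obtain ⟨l, hl⟩ := H'.eq _ _ h2
    have h3 : X.res hU g' ^ l • m = X.res hU g' ^ l • m' := by
      refine smul_inj ((isUnit_res hg).pow (k + k')) ?_
      have h4 := congrArg (M.res hU) hl
      simp only [M.res_smul, map_pow, ← h₁, ← h₁', smul_smul] at h4
      rw [smul_smul, smul_smul]
      rw [map_mul, map_mul, map_pow, map_pow, map_pow] at h4
      have e1 : X.res hU g ^ (k + k') * X.res hU g' ^ l =
        X.res hU g' ^ l * X.res hU g ^ k' * X.res hU g ^ k := by
        rw [pow_add]; ac_rfl
      have e2 : X.res hU g' ^ l * X.res hU g ^ k' * X.res hU g ^ k =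
        X.res hU g' ^ l * X.res hU g ^ k * X.res hU g ^ k' := by ac_rfl
      rw [e1, h4, e2]
    obtain ⟨j, a, ha⟩ := key l
    have h5 : X.res h (a * X.res hU g' ^ l) = X.res h (f ^ j) := by
      rw [map_mul, map_pow, X.res_res, ha, map_pow]
    obtain ⟨⟨_, i, rfl⟩, hi⟩ := hf.exists_of_eq h5
    simp only at hi
    refine ⟨i + j, ?_⟩
    rw [pow_add, ← hi, mul_smul, mul_smul, mul_smul, mul_smul, h3]

variable (M) in
/-- The restriction maps between affine open sets are localizations. -/
def IsQC : Prop := ∀ ⦃V V' : X.AffOpn⦄ (h : V'.1 ≤ V.1) (f : X.Γ V.1),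
  (Submonoid.powers f).IsLocalizationMap (X.res h) → M.IsLocAt h f

/-- A nonempty affine V lies in a single set U on which M is associated with M(U). Then V and V' are
basic open subsets of U, and localization of M(U) at the corresponding elements yields the
localization from V to V'. -/
lemma isQCoh_iff : M.IsQCoh ↔ M.IsQC := by
  constructor
  · intro H V V' h f hf
    rcases exists_le_of_cover V H with h0 | ⟨U, hU, φ, hφ, HU⟩
    · exact .of_subsingleton h f h0
    · obtain ⟨g, hg⟩ := MonoidalSpace.exists_basic_of_le φ V.2 hU
      obtain ⟨g', hg'⟩ := MonoidalSpace.exists_basic_of_le φ V'.2 (h.trans hU)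
      exact .of_le (hφ g _ hU hg) (hφ g' _ _ hg') hf (HU g _ hU hg) (HU g' _ _ hg')
  · intro H x
    obtain ⟨U, hU, hx⟩ := X.exists_affine x
    obtain ⟨φ, hφ⟩ := hU
    exact ⟨U, hx, φ, hφ, fun f V h hV => H (V := ⟨U, φ, hφ⟩)
      (V' := ⟨V, MonoidalSpace.isAffineOpn_basic φ hφ f V h hV⟩) h f (hφ f V h hV)⟩

variable (M) in
/-- The sections over affine open sets are finitely generated. -/
def IsFG : Prop := ∀ V : X.AffOpn, ∃ s : Finset (M.Γ V.1), ∀ m : M.Γ V.1, ∃ n ∈ s, ∃ a : X.Γ V.1,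
  m = a • n

/-- Generators over an affine U ⊇ V restrict to generators over V, because M(V) is a localization of
M(U). -/
lemma isCoh_iff : M.IsCoh ↔ M.IsQC ∧ M.IsFG := by
  classical
  constructor
  · intro H
    have hq : M.IsQC := isQCoh_iff.1 fun x => (H x).imp fun U h => ⟨h.1, h.2.1⟩
    refine ⟨hq, fun V => ?_⟩
    rcases exists_le_of_cover V H with h0 | ⟨U, hU, ⟨φ, hφ, -⟩, s, hs⟩
    · exact ⟨{0}, fun m => ⟨0, by simp, 0, M.subsingleton_of_zero_eq_one h0 _ _⟩⟩
    · obtain ⟨g, hg⟩ := MonoidalSpace.exists_localization_of_le ⟨φ, hφ⟩ V.2 hU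
      refine ⟨s.image (M.res hU), fun m => ?_⟩
      obtain ⟨k, m', hm⟩ := (hq (V := ⟨U, φ, hφ⟩) hU g hg).surj m
      obtain ⟨n, hn, a, rfl⟩ := hs m'
      obtain ⟨b, hb⟩ := ((isUnit_res hg).pow k).exists_left_inv
      refine ⟨_, Finset.mem_image_of_mem _ hn, b * X.res hU a, ?_⟩
      rw [mul_smul, ← M.res_smul, ← hm, smul_smul, hb, one_smul]
  · rintro ⟨hq, H⟩ x
    obtain ⟨U, hU, hx⟩ := X.exists_affine x
    obtain ⟨φ, hφ⟩ := hU
    exact ⟨U, hx, ⟨φ, hφ, fun f V h hV => hq (V := ⟨U, φ, hφ⟩)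
      (V' := ⟨V, MonoidalSpace.isAffineOpn_basic φ hφ f V h hV⟩) h f (hφ f V h hV)⟩,
      H ⟨U, φ, hφ⟩⟩

variable (M) in
/-- The sections over affine open sets are projective. -/
def IsProj : Prop := ∀ V : X.AffOpn, IsProjectiveSet (X.Γ V.1) (M.Γ V.1)

/-- Regard E and F as Γ(U)-sets and lift the composite M(U) → M(V) → F to E. As f acts invertibly on
E, the lift extends to the localization M(V). -/
lemma isProjectiveSet_res {U V : X.Opn} {h : V ≤ U} {f : X.Γ U}
    (hf : (Submonoid.powers f).IsLocalizationMap (X.res h)) (H : M.IsLocAt h f)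
    (hp : IsProjectiveSet (X.Γ U) (M.Γ U)) : IsProjectiveSet (X.Γ V) (M.Γ V) := by
  intro E F _ _ _ _ p g hsurj
  let : MulActionWithZero (X.Γ U) E := MulActionWithZero.compHom E (X.res h)
  let : MulActionWithZero (X.Γ U) F := MulActionWithZero.compHom F (X.res h)
  have hE (a : X.Γ U) (x : E) : a • x = X.res h a • x := rfl
  have hF (a : X.Γ U) (x : F) : a • x = X.res h a • x := rfl
  obtain ⟨l, hl⟩ := hp E F ⟨p, fun a x => map_smul p (X.res h a) x⟩
    ⟨fun m => g (M.res h m), fun a m => by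
      change g (M.res h (a • m)) = X.res h a • g (M.res h m)
      rw [M.res_smul, map_smul]⟩ hsurj
  have hl' (m : M.Γ U) : p (l m) = g (M.res h m) := congrArg (fun t => t m) hl
  have hle (m m' : M.Γ U) (e : M.res h m = M.res h m') : l m = l m' := by
    obtain ⟨k, hk⟩ := H.eq m m' e
    have := congrArg l hk
    rw [map_smul, map_smul, hE, hE, map_pow] at this
    exact smul_inj ((isUnit_res hf).pow k) this
  -- The value is l m / f ^ k for a fraction n = m / f ^ k; requiring the defining equation for all
  -- such fractions includes independence of the choice.
  have hex (n : M.Γ V) : ∃ y : E, ∀ (k : ℕ) (m : M.Γ U), X.res h f ^ k • n = M.res h m →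
      X.res h f ^ k • y = l m := by
    obtain ⟨k, m, hm⟩ := H.surj n
    obtain ⟨b, hb⟩ := ((isUnit_res hf).pow k).exists_right_inv
    refine ⟨b • l m, fun k' m' hm' => smul_inj ((isUnit_res hf).pow k) ?_⟩
    have : l (f ^ k' • m) = l (f ^ k • m') := hle _ _ (by
      rw [M.res_smul, M.res_smul, ← hm, ← hm', map_pow, map_pow, smul_smul, smul_smul, mul_comm])
    rw [map_smul, map_smul, hE, hE, map_pow, map_pow] at this
    rw [← this, smul_smul, smul_smul, mul_comm, ← mul_assoc b,
      mul_comm b, hb, one_mul]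
  choose y hy using hex
  have hsm (a : X.Γ V) (n : M.Γ V) : y (a • n) = a • y n := by
    obtain ⟨k, m, hm⟩ := H.surj n
    obtain ⟨⟨b, _, j, rfl⟩, hb⟩ := hf.surj a
    simp only [map_pow] at hb
    refine smul_inj ((isUnit_res hf).pow (j + k)) ?_
    rw [hy (a • n) (j + k) (b • m), map_smul, hE, ← hy n k m hm, ← hb, smul_smul, smul_smul, pow_add]
    · congr 1
      ac_rfl
    · rw [M.res_smul, ← hm, ← hb, smul_smul, smul_smul, pow_add]
      congr 1
      ac_rfl
  refine ⟨⟨y, hsm⟩, ?_⟩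
  ext n
  obtain ⟨k, m, hm⟩ := H.surj n
  refine smul_inj ((isUnit_res hf).pow k) ?_
  change _ • p (y n) = _ • g n
  rw [← map_smul, hy n k m hm, hl', ← hm, map_smul]

lemma isLocProj_iff : M.IsLocProj ↔ M.IsQC ∧ M.IsProj := by
  rw [IsLocProj, isQCoh_iff]
  refine and_congr_right fun hq => ⟨fun H V => ?_, fun H x => ?_⟩
  · rcases exists_le_of_cover V H with h0 | ⟨U, hU, ha, hp⟩
    · intro E F _ _ _ _ p g hp
      have hE (x y : E) : x = y := by
        rw [← one_smul (X.Γ V.1) x, ← one_smul (X.Γ V.1) y, ← h0, zero_smul, zero_smul]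
      refine ⟨⟨fun _ => 0, fun _ _ => hE _ _⟩, ?_⟩
      ext n
      obtain ⟨x, hx⟩ := hp (g n)
      rw [← hx]
      exact congrArg p (hE _ _)
    · obtain ⟨g, hg⟩ := MonoidalSpace.exists_localization_of_le ha V.2 hU
      exact isProjectiveSet_res hg (hq (V := ⟨U, ha⟩) hU g hg) hp
  · obtain ⟨U, hU, hx⟩ := X.exists_affine x
    exact ⟨U, hx, hU, H ⟨U, hU⟩⟩

end
end OMod

/-! ### Subobjects and products of presheaves with action. -/

namespace PreMod
section
variable {X : MonoidalSpace.{u}}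

variable (M N : PreMod X) (p : ∀ U, Set (M.Γ U))

/-- The presheaf of sets given by sets of sections that are stable under restriction. -/
def subPresheaf (hr : ∀ {U V : X.Opn} (h : V ≤ U) m, m ∈ p U → M.res h m ∈ p V) :
    TopCat.Presheaf (Type u) X.carrier where
  obj U := p U.unop
  map {U V} i := ↾fun m => ⟨M.res (leOfHom i.unop) m.1, hr _ _ m.2⟩
  map_id U := by
    ext m
    exact M.res_rfl _
  map_comp i j := by
    ext m
    exact (M.res_res _ _ _).symm

/-- The sub-presheaf given by sets of sections that are stable under the action and restriction. -/
def ofSub (h0 : ∀ U, 0 ∈ p U) (hs : ∀ U (a : X.Γ U) m, m ∈ p U → a • m ∈ p U)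
    (hr : ∀ {U V : X.Opn} (h : V ≤ U) m, m ∈ p U → M.res h m ∈ p V) : PreMod X where
  presheaf := M.subPresheaf p hr
  zero U := ⟨(⟨0, h0 U⟩ : p U)⟩
  act U :=
    let z : Zero (p U) := ⟨⟨0, h0 U⟩⟩
    let act : MulActionWithZero (X.Γ U) (p U) :=
      { smul := fun a m => ⟨a • m.1, hs U a _ m.2⟩
        one_smul := fun m => Subtype.ext (one_smul _ m.1)
        mul_smul := fun a b m => Subtype.ext (mul_smul a b m.1)
        smul_zero := fun a => Subtype.ext (smul_zero a)
        zero_smul := fun m => Subtype.ext (zero_smul _ m.1) }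
    act
  map_smul' h a m := Subtype.ext (M.res_smul h a m.1)

/-- The product of two presheaves of sets. -/
def prodPresheaf : TopCat.Presheaf (Type u) X.carrier where
  obj U := M.Γ U.unop × N.Γ U.unop
  map {U V} i := ↾fun m => (M.res (leOfHom i.unop) m.1, N.res (leOfHom i.unop) m.2)
  map_id U := by
    ext m
    exacts [M.res_rfl _, N.res_rfl _]
  map_comp i j := by
    ext m
    exacts [(M.res_res _ _ _).symm, (N.res_res _ _ _).symm]

/-- The product of two presheaves. -/
def prod : PreMod X where
  presheaf := prodPresheaf M N
  zero U := inferInstanceAs (Zero (M.Γ U × N.Γ U))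
  act U :=
    let act : MulActionWithZero (X.Γ U) (M.Γ U × N.Γ U) :=
      { smul := fun a m => (a • m.1, a • m.2)
        one_smul := fun m => Prod.ext (one_smul _ m.1) (one_smul _ m.2)
        mul_smul := fun a b m => Prod.ext (mul_smul a b m.1) (mul_smul a b m.2)
        smul_zero := fun a => Prod.ext (smul_zero a) (smul_zero a)
        zero_smul := fun m => Prod.ext (zero_smul _ m.1) (zero_smul _ m.2) }
    act
  map_smul' h a m := Prod.ext (M.res_smul h a m.1) (N.res_smul h a m.2)

end
end PreMod

/-! ### Tensor products of projective, quasi-coherent and finitely generated modules. -/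

namespace OMod
section sets
variable {A P Q : Type u} [CommMonoidWithZero A] [Zero P] [MulActionWithZero A P] [Zero Q]
  [MulActionWithZero A Q]

lemma IsProjectiveSet.of_retract (h : IsProjectiveSet A P) (i : Q →[A] P) (r : P →[A] Q)
    (e : ∀ q, r (i q) = q) : IsProjectiveSet A Q := by
  intro E F _ _ _ _ p g hp
  obtain ⟨l, hl⟩ := h E F p (g.comp r) hp
  refine ⟨l.comp i, ?_⟩
  ext q
  exact (congrArg (fun t => t (i q)) hl).trans (congrArg g (e q))

lemma IsProjectiveSet.self : IsProjectiveSet A A := by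
  intro E F _ _ _ _ p g hp
  obtain ⟨x, hx⟩ := hp (g 1)
  refine ⟨⟨fun a => a • x, fun a b => mul_smul a b x⟩, ?_⟩
  ext a
  change p (a • x) = g a
  rw [map_smul, hx, ← map_smul, smul_eq_mul, mul_one]

/-- Maps P ⊗ Q → E correspond to maps from P to the A-set Hom(Q, E). Projectivity of Q makes Hom(Q,
E) → Hom(Q, F) surjective, and projectivity of P then provides the lift. -/
lemma IsProjectiveSet.tens (h : IsProjectiveSet A P) (h' : IsProjectiveSet A Q) :
    IsProjectiveSet A (Tens A P Q) := by
  intro E F _ _ _ _ p g hp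
  let mk (x : P) (y : Q) : Tens A P Q := Quot.mk _ (x, y)
  let z (E : Type u) [Zero E] [MulActionWithZero A E] : Zero (Q →[A] E) :=
    ⟨⟨fun _ => 0, fun a _ => (smul_zero a).symm⟩⟩
  let act (E : Type u) [Zero E] [MulActionWithZero A E] : MulActionWithZero A (Q →[A] E) :=
    { smul := fun a f => ⟨fun q => a • f q, fun b q => by
        rw [map_smul, smul_smul, id, smul_smul, mul_comm]⟩
      one_smul := fun f => by ext q; exact one_smul A (f q)
      mul_smul := fun a b f => by ext q; exact mul_smul a b (f q)
      smul_zero := fun a => by ext q; exact smul_zero a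
      zero_smul := fun f => by ext q; exact zero_smul A (f q) }
  obtain ⟨l, hl⟩ := h (Q →[A] E) (Q →[A] F) ⟨fun f => p.comp f, fun a f => by
      ext q
      exact map_smul p a (f q)⟩
    ⟨fun x => ⟨fun y => g (Quot.mk _ (x, y)), fun a y => by
      rw [← Tens.smul_mk]
      exact map_smul g a (mk x y)⟩, fun a x => by
      ext y
      exact map_smul g a (mk x y)⟩ (fun f => by
        obtain ⟨f', hf⟩ := h' E F p f hp
        exact ⟨f', hf⟩)
  refine ⟨⟨Quot.lift (fun x => l x.1 x.2) ?_, ?_⟩, ?_⟩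
  · rintro _ _ ⟨a, x, y⟩
    change l (a • x) y = l x (a • y)
    rw [map_smul, map_smul]
    rfl
  · rintro a ⟨x, y⟩
    change l (a • x) y = a • l x y
    rw [map_smul]
    rfl
  · ext ⟨x, y⟩
    exact congrArg (fun t => t x y) hl

end sets

section
variable {X : MZScheme.{u}} {M N P Q S T : OMod X.toMonoidalSpace}

/-- If m and n are written as fractions with powers of f as denominators, the statement that m ⊗ n
equals t up to a power of f does not depend on the numerators and exponents chosen. -/
lemma tens_frac {U V : X.AffOpn} {h : V.1 ≤ U.1} {f : X.Γ U.1} (hM : M.IsLocAt h f)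
    (hN : N.IsLocAt h f) {m : M.Γ V.1} {n : N.Γ V.1} {m₀ m₁ : M.Γ U.1} {n₀ n₁ : N.Γ U.1}
    {k k' l l' j : ℕ} {t : (tens M N).Γ U.1}
    (hm₀ : X.res h f ^ k • m = M.res h m₀) (hm₁ : X.res h f ^ k' • m = M.res h m₁)
    (hn₀ : X.res h f ^ l • n = N.res h n₀) (hn₁ : X.res h f ^ l' • n = N.res h n₁)
    (e : f ^ j • tmul m₀ n₀ = f ^ (j + k + l) • t) :
    ∃ j, f ^ j • tmul m₁ n₁ = f ^ (j + k' + l') • t := by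
  obtain ⟨i, hi⟩ := hM.eq (f ^ k' • m₀) (f ^ k • m₁) (by
    rw [M.res_smul, M.res_smul, ← hm₀, ← hm₁, map_pow, map_pow, smul_smul, smul_smul, mul_comm])
  obtain ⟨i', hi'⟩ := hN.eq (f ^ l' • n₀) (f ^ l • n₁) (by
    rw [N.res_smul, N.res_smul, ← hn₀, ← hn₁, map_pow, map_pow, smul_smul, smul_smul, mul_comm])
  have key (a b : X.Γ U.1) (m : M.Γ U.1) (n : N.Γ U.1) : tmul (a • m) (b • n) =
      (a * b) • tmul m n := by
    rw [mul_smul, smul_tmul, smul_tmul, smul_tmul', smul_tmul', smul_tmul', smul_smul, smul_smul,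
      mul_comm]
  have h1 := congrArg₂ (fun x y => f ^ j • tmul x y) hi hi'
  simp only [smul_smul, key, ← pow_add] at h1
  refine ⟨j + (i + k + (i' + l)), ?_⟩
  have h2 := congrArg (fun x => f ^ (i + k' + (i' + l')) • x) e
  simp only [smul_smul, ← pow_add] at h2
  rw [← h1, add_comm j, h2]
  congr 2
  ring

lemma IsQC.tens (hM : M.IsQC) (hN : N.IsQC) : (OMod.tens M N).IsQC := by
  intro U V h f hf
  have hM := hM h f hf
  have hN := hN h f hf
  refine .of_isLocalizationMap hf (fun t => ?_) fun t t' => ?_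
  · induction t using tens_ind with | _ m n
    obtain ⟨k, m₀, hm⟩ := hM.surj m
    obtain ⟨l, n₀, hn⟩ := hN.surj n
    exact ⟨l + k, tmul m₀ n₀, by rw [tmul_res, ← hm, ← hn, pow_add, mul_smul, smul_tmul, smul_tmul,
      smul_tmul', smul_tmul']⟩
  · let c : (OMod.tens M N).Γ V.1 → (OMod.tens M N).Γ U.1 → Prop := tensRec V
      (fun m n t => ∃ (k l : ℕ) (m₀ : M.Γ U.1) (n₀ : N.Γ U.1), X.res h f ^ k • m = M.res h m₀ ∧
        X.res h f ^ l • n = N.res h n₀ ∧ ∃ j, f ^ j • tmul m₀ n₀ = f ^ (j + k + l) • t)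
      (fun a m n => by
        obtain ⟨⟨b, _, i, rfl⟩, hb⟩ := hf.surj a
        obtain ⟨k, m₀, hm⟩ := hM.surj m
        obtain ⟨l, n₀, hn⟩ := hN.surj n
        simp only [map_pow] at hb
        have h1 : X.res h f ^ (k + i) • a • m = M.res h (b • m₀) := by
          rw [M.res_smul, ← hb, ← hm, smul_smul, smul_smul, pow_add]
          congr 1
          ac_rfl
        have h2 : X.res h f ^ (l + i) • a • n = N.res h (b • n₀) := by
          rw [N.res_smul, ← hb, ← hn, smul_smul, smul_smul, pow_add]
          congr 1
          ac_rfl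
        ext t
        constructor
        · rintro ⟨k', l', m', n', h3, h4, j, h5⟩
          obtain ⟨j, h6⟩ := tens_frac hM hN h3 h1 h4 hn h5
          exact ⟨k, l + i, m₀, b • n₀, hm, h2, j, by
            rw [← smul_tmul', h6]
            congr 2
            ring⟩
        · rintro ⟨k', l', m', n', h3, h4, j, h5⟩
          obtain ⟨j, h6⟩ := tens_frac hM hN h3 hm h4 h2 h5
          exact ⟨k + i, l, b • m₀, n₀, h1, hn, j, by
            rw [smul_tmul', h6]
            congr 2
            ring⟩)
    induction t using tens_ind with | _ m n
    induction t' using tens_ind with | _ m' n'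
    rw [tmul_res, tmul_res]
    intro e
    -- The predicate holds trivially between a tensor over U and its own restriction. Substituting
    -- the equality of the restrictions moves it to the other tensor.
    have h1 : c (tmul (M.res h m') (N.res h n')) (tmul m' n') := by
      simp only [c, tensRec_tmul]
      exact ⟨0, 0, m', n', by simp, by simp, 0, by simp⟩
    rw [← e] at h1
    simp only [c, tensRec_tmul] at h1
    obtain ⟨k, l, m₀, n₀, h3, h4, j, h5⟩ := h1
    obtain ⟨j, h6⟩ := tens_frac hM hN (m₁ := m) (n₁ := n) (k' := 0) (l' := 0) h3 (by simp) h4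
      (by simp) h5
    exact ⟨j, by simpa using h6⟩

lemma IsFG.tens (hM : M.IsFG) (hN : N.IsFG) : (OMod.tens M N).IsFG := by
  classical
  intro V
  obtain ⟨s, hs⟩ := hM V
  obtain ⟨t, ht⟩ := hN V
  refine ⟨Finset.image₂ tmul s t, fun x => ?_⟩
  induction x using tens_ind with | _ m n
  obtain ⟨m, hm, a, rfl⟩ := hs m
  obtain ⟨n, hn, b, rfl⟩ := ht n
  refine ⟨_, Finset.mem_image₂_of_mem hm hn, b * a, ?_⟩
  rw [mul_smul, smul_tmul, smul_tmul, smul_tmul', smul_tmul', smul_tmul']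

lemma IsProj.tens (hM : M.IsProj) (hN : N.IsProj) : (OMod.tens M N).IsProj := fun V =>
  ((hM V).tens (hN V)).of_retract
    ⟨(tensEquiv M N V).symm, fun a t => by
      induction t using tens_ind with | _ m n
      rw [smul_tmul, tensEquiv_symm_tmul, tensEquiv_symm_tmul]
      rfl⟩
    ⟨tensEquiv M N V, by
      rintro a ⟨m, n⟩
      exact (smul_tmul a m n).symm⟩ (fun t => (tensEquiv M N V).apply_symm_apply t)

lemma isQC_unit : (unit X.toMonoidalSpace).IsQC := fun U V h f hf =>
  .of_isLocalizationMap hf (fun n => by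
      obtain ⟨⟨a, _, k, rfl⟩, ha⟩ := hf.surj n
      refine ⟨k, a, ?_⟩
      rw [← map_pow]
      exact (mul_comm _ _).trans ha)
    (fun m m' e => by
      obtain ⟨⟨_, k, rfl⟩, hk⟩ := hf.exists_of_eq e
      exact ⟨k, hk⟩)

lemma isFG_unit : (unit X.toMonoidalSpace).IsFG := fun V =>
  ⟨{uone V.1}, fun m => ⟨_, Finset.mem_singleton_self _, (exists_smul_uone m).imp fun _ h => h.symm⟩⟩

lemma isProj_unit : (unit X.toMonoidalSpace).IsProj := fun _ => IsProjectiveSet.self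

end
end OMod

/-! ### Zero modules, wedges and normal morphisms. -/

namespace OMod
section
variable {X : MZScheme.{u}} {M N P Q S T : OMod X.toMonoidalSpace}

variable (M N) in
/-- The zero morphism. -/
def zeroHom : M ⟶ N where
  app U _ := 0
  map_smul U a _ := (smul_zero a).symm
  map_res h _ := (N.res_zero h).symm

lemma zeroHom_app (U : X.Opn) (m : M.Γ U) : (zeroHom M N).app U m = 0 := rfl

lemma comp_zeroHom (f : M ⟶ N) : f ≫ zeroHom N P = zeroHom M P := rfl

lemma zeroHom_comp (f : N ⟶ P) : zeroHom M N ≫ f = zeroHom M P :=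
  PreMod.Hom.ext (funext fun U => funext fun _ => hom_zero f U)

variable (M N P) in
lemma tensMap_zeroHom : tensMap (𝟙 M) (zeroHom N P) = zeroHom _ _ := tens_hom_ext fun V m n => by
  rw [tensMap_tmul, zeroHom_app, zeroHom_app, tmul_zero]

variable (X) in
/-- The zero module. -/
def zeroMod : OMod X.toMonoidalSpace := sheafify ((unit X.toMonoidalSpace).toPreMod.ofSub
  (fun _ => {0}) (fun _ => rfl) (fun U a m hm => (congrArg (a • ·) hm).trans (smul_zero a))
  (fun h m hm => (congrArg (PreMod.res _ h) hm).trans (PreMod.res_zero _ h)))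

variable (M) in
/-- The zero section is the only section. -/
def IsZ : Prop := ∀ (V : X.AffOpn) (m : M.Γ V.1), m = 0

lemma IsZ.eq_zero (h : M.IsZ) {U : X.Opn} (m : M.Γ U) : m = 0 :=
  aff_ext fun V _ => (h V _).trans (h V _).symm

lemma isZ_zeroMod : (zeroMod X).IsZ := fun V m => by
  have hb := ((unit X.toMonoidalSpace).toPreMod.ofSub
    (fun _ => {0}) (fun _ => rfl) (fun U a m hm => (congrArg (a • ·) hm).trans (smul_zero a))
    (fun h m hm => (congrArg (PreMod.res _ h) hm).trans (PreMod.res_zero _ h))).toSh_bijective V.2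
  obtain ⟨x, hx⟩ := hb.2 m
  obtain ⟨y, hy⟩ := hb.2 0
  exact hx.symm.trans ((congrArg _ (Subtype.ext (x.2.trans y.2.symm))).trans hy)

lemma IsZ.isQC (h : M.IsZ) : M.IsQC := fun U V i _ hf => .of_isLocalizationMap hf
  (fun n => ⟨0, 0, (h V _).trans (h V _).symm⟩) (fun _ _ _ => ⟨0, (h U _).trans (h U _).symm⟩)

lemma IsZ.isFG (h : M.IsZ) : M.IsFG := fun V =>
  ⟨{0}, fun m => ⟨0, Finset.mem_singleton_self _, 1, (h V _).trans (h V _).symm⟩⟩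

lemma IsZ.isProj (h : M.IsZ) : M.IsProj := fun V E F _ _ _ _ p g hp => by
  refine ⟨⟨fun _ => 0, fun a _ => (smul_zero a).symm⟩, ?_⟩
  ext m
  change p 0 = g m
  rw [h V m, ← zero_smul (X.Γ V.1) (0 : E), ← zero_smul (X.Γ V.1) (0 : M.Γ V.1), map_smul, map_smul,
    zero_smul, zero_smul]

lemma IsZ.tens_right (h : N.IsZ) : (tens M N).IsZ := fun V t => by
  induction t using tens_ind with | _ m n
  rw [h V n, tmul_zero]

/-- The module `P` is the wedge of `N` and `S`. -/
structure IsWedge (i : N ⟶ P) (s : S ⟶ P) : Prop where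
  inl_inj : ∀ V : X.AffOpn, Function.Injective (i.app V.1)
  inr_inj : ∀ V : X.AffOpn, Function.Injective (s.app V.1)
  cover : ∀ (V : X.AffOpn) (p : P.Γ V.1), (∃ n, i.app V.1 n = p) ∨ ∃ t, s.app V.1 t = p
  disj : ∀ (V : X.AffOpn) n t, i.app V.1 n = s.app V.1 t → i.app V.1 n = 0

namespace IsWedge
variable {i : N ⟶ P} {s : S ⟶ P}

lemma symm (H : IsWedge i s) : IsWedge s i where
  inl_inj := H.inr_inj
  inr_inj := H.inl_inj
  cover V p := (H.cover V p).symm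
  disj V n t e := e.trans (H.disj V t n e.symm)

lemma eq_zero_left (H : IsWedge i s) {V : X.AffOpn} {n t} (e : i.app V.1 n = s.app V.1 t) : n = 0 :=
  H.inl_inj V ((H.disj V n t e).trans (hom_zero i V.1).symm)

lemma eq_zero_right (H : IsWedge i s) {V : X.AffOpn} {n t} (e : i.app V.1 n = s.app V.1 t) :
    t = 0 := H.symm.eq_zero_left e.symm

lemma hom_ext (H : IsWedge i s) {f g : P ⟶ T} (h : i ≫ f = i ≫ g) (h' : s ≫ f = s ≫ g) : f = g :=
  hom_aff_ext fun V p => by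
    rcases H.cover V p with ⟨n, rfl⟩ | ⟨t, rfl⟩
    · exact congrArg (fun q => PreMod.Hom.app q V.1 n) h
    · exact congrArg (fun q => PreMod.Hom.app q V.1 t) h'

/-- A wedge is a coproduct of pointed objects: over an affine open set every section lies in one of
the summands, and only the base point lies in both, where all morphisms agree. -/
lemma exists_desc (H : IsWedge i s) (f : N ⟶ T) (g : S ⟶ T) :
    ∃ d : P ⟶ T, i ≫ d = f ∧ s ≫ d = g := by
  have hex (V : X.AffOpn) (p : P.Γ V.1) : ∃ x : T.Γ V.1, (∀ n, i.app V.1 n = p → x = f.app V.1 n) ∧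
      ∀ t, s.app V.1 t = p → x = g.app V.1 t := by
    rcases H.cover V p with ⟨n, rfl⟩ | ⟨t, rfl⟩
    · refine ⟨f.app V.1 n, fun n' h => by rw [H.inl_inj V h], fun t h => ?_⟩
      rw [H.eq_zero_left h.symm, H.eq_zero_right h.symm, hom_zero, hom_zero]
    · refine ⟨g.app V.1 t, fun n h => ?_, fun n' h => by rw [H.inr_inj V h]⟩
      rw [H.eq_zero_left h, H.eq_zero_right h, hom_zero, hom_zero]
  choose d hd using hex
  refine ⟨homOfAff d (fun V a p => ?_) (fun V V' h p => ?_), hom_aff_ext fun V n => ?_,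
    hom_aff_ext fun V t => ?_⟩
  · rcases H.cover V p with ⟨n, rfl⟩ | ⟨t, rfl⟩
    · rw [(hd V (a • i.app V.1 n)).1 (a • n) (hom_smul i a n), (hd V _).1 n rfl, hom_smul]
    · rw [(hd V (a • s.app V.1 t)).2 (a • t) (hom_smul s a t), (hd V _).2 t rfl, hom_smul]
  · rcases H.cover V p with ⟨n, rfl⟩ | ⟨t, rfl⟩
    · rw [(hd V' _).1 (N.res h n) (hom_res i h n), (hd V _).1 n rfl, hom_res]
    · rw [(hd V' _).2 (S.res h t) (hom_res s h t), (hd V _).2 t rfl, hom_res]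
  · rw [comp_app, homOfAff_app, (hd V _).1 n rfl]
  · rw [comp_app, homOfAff_app, (hd V _).2 t rfl]

lemma exists_retr (H : IsWedge i s) : ∃ r : P ⟶ N, i ≫ r = 𝟙 N ∧ s ≫ r = zeroHom S N :=
  H.exists_desc _ _

/-- Injectivity and disjointness are expressed by equations between morphisms, which functors
preserve; only the covering condition has to be verified on sections. -/
lemma of_retr {r : P ⟶ N} {r' : P ⟶ S} (h1 : i ≫ r = 𝟙 N) (h2 : s ≫ r' = 𝟙 S)
    (h3 : s ≫ r = zeroHom S N)
    (cover : ∀ (V : X.AffOpn) (p : P.Γ V.1), (∃ n, i.app V.1 n = p) ∨ ∃ t, s.app V.1 t = p) :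
    IsWedge i s where
  inl_inj V n n' e := by
    have := congrArg (r.app V.1) e
    exact (congrArg (fun q => PreMod.Hom.app q V.1 n) h1).symm.trans
      (this.trans (congrArg (fun q => PreMod.Hom.app q V.1 n') h1))
  inr_inj V n n' e := by
    have := congrArg (r'.app V.1) e
    exact (congrArg (fun q => PreMod.Hom.app q V.1 n) h2).symm.trans
      (this.trans (congrArg (fun q => PreMod.Hom.app q V.1 n') h2))
  cover := cover
  disj V n t e := by
    have h4 : n = 0 := (congrArg (fun q => PreMod.Hom.app q V.1 n) h1).symm.trans
      ((congrArg (r.app V.1) e).trans (congrArg (fun q => PreMod.Hom.app q V.1 t) h3))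
    rw [h4, hom_zero]

/-- Tensoring preserves the retractions onto the summands, and a section over an affine open set is
a pure tensor m ⊗ p with p in one of the two summands. -/
lemma tens_left (H : IsWedge i s) (M : OMod X.toMonoidalSpace) :
    IsWedge (tensMap (𝟙 M) i) (tensMap (𝟙 M) s) := by
  obtain ⟨r, hr, hr'⟩ := H.exists_retr
  obtain ⟨q, hq, hq'⟩ := H.symm.exists_retr
  refine of_retr (r := tensMap (𝟙 M) r) (r' := tensMap (𝟙 M) q) ?_ ?_ ?_ fun V t => ?_
  · rw [tensMap_comp, hr, Category.comp_id, tensMap_id]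
  · rw [tensMap_comp, hq, Category.comp_id, tensMap_id]
  · rw [tensMap_comp, hr', Category.comp_id, tensMap_zeroHom]
  · induction t using tens_ind with | _ m p
    rcases H.cover V p with ⟨n, rfl⟩ | ⟨t, rfl⟩
    · exact Or.inl ⟨tmul m n, by rw [tensMap_tmul, id_app]⟩
    · exact Or.inr ⟨tmul m t, by rw [tensMap_tmul, id_app]⟩

lemma of_iso (H : IsWedge i s) {P' N' S' : OMod X.toMonoidalSpace} {i' : N' ⟶ P'} {s' : S' ⟶ P'}
    (a : N' ≅ N) (b : P' ≅ P) (c : S' ≅ S) (h : i' ≫ b.hom = a.hom ≫ i)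
    (h' : s' ≫ b.hom = c.hom ≫ s) : IsWedge i' s' := by
  have ha (V : X.AffOpn) (n : N'.Γ V.1) : b.hom.app V.1 (i'.app V.1 n) = i.app V.1 (a.hom.app V.1 n) :=
    congrArg (fun q => PreMod.Hom.app q V.1 n) h
  have hc (V : X.AffOpn) (n : S'.Γ V.1) : b.hom.app V.1 (s'.app V.1 n) = s.app V.1 (c.hom.app V.1 n) :=
    congrArg (fun q => PreMod.Hom.app q V.1 n) h'
  have bi {M N : OMod X.toMonoidalSpace} (f : M ≅ N) (V : X.AffOpn) : Function.Bijective (f.hom.app V.1) :=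
    bijective_of_isIso f.hom V.1
  refine ⟨fun V n n' e => ?_, fun V n n' e => ?_, fun V p => ?_, fun V n t e => ?_⟩
  · refine (bi a V).1 (H.inl_inj V ?_)
    rw [← ha, ← ha, e]
  · refine (bi c V).1 (H.inr_inj V ?_)
    rw [← hc, ← hc, e]
  · rcases H.cover V (b.hom.app V.1 p) with ⟨n, hn⟩ | ⟨t, ht⟩
    · obtain ⟨n, rfl⟩ := (bi a V).2 n
      exact Or.inl ⟨n, (bi b V).1 ((ha V n).trans hn)⟩
    · obtain ⟨t, rfl⟩ := (bi c V).2 t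
      exact Or.inr ⟨t, (bi b V).1 ((hc V t).trans ht)⟩
  · refine (bi b V).1 ?_
    rw [ha, hom_zero]
    refine H.disj V _ (c.hom.app V.1 t) ?_
    rw [← ha, ← hc, e]

lemma isQC (H : IsWedge i s) (hN : N.IsQC) (hS : S.IsQC) : P.IsQC := fun U V h f hf =>
  .of_isLocalizationMap hf (fun p => by
      rcases H.cover V p with ⟨n, rfl⟩ | ⟨t, rfl⟩
      · obtain ⟨k, m, hm⟩ := (hN h f hf).surj n
        exact ⟨k, i.app _ m, by rw [← hom_res i, ← hm, hom_smul]⟩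
      · obtain ⟨k, m, hm⟩ := (hS h f hf).surj t
        exact ⟨k, s.app _ m, by rw [← hom_res s, ← hm, hom_smul]⟩)
    (fun p p' e => by
      -- Sections from different summands that agree over V both vanish there, so both are killed by
      -- a power of f.
      have key {n : N.Γ U.1} {t : S.Γ U.1} (e : P.res h (i.app _ n) = P.res h (s.app _ t)) :
          ∃ k : ℕ, f ^ k • i.app _ n = f ^ k • s.app _ t := by
        rw [← hom_res i, ← hom_res s] at e
        obtain ⟨k, hk⟩ := (hN h f hf).eq n 0 (by rw [N.res_zero, H.eq_zero_left e])
        obtain ⟨l, hl⟩ := (hS h f hf).eq t 0 (by rw [S.res_zero, H.eq_zero_right e])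
        refine ⟨k + l, ?_⟩
        rw [← hom_smul, ← hom_smul, pow_add, mul_smul _ _ t, hl, smul_zero, smul_zero, mul_comm,
          mul_smul, hk, smul_zero, smul_zero, hom_zero, hom_zero]
      rcases H.cover U p with ⟨n, rfl⟩ | ⟨t, rfl⟩ <;> rcases H.cover U p' with ⟨n', rfl⟩ | ⟨t', rfl⟩
      · rw [← hom_res i, ← hom_res i] at e
        obtain ⟨k, hk⟩ := (hN h f hf).eq n n' (H.inl_inj V e)
        exact ⟨k, by rw [← hom_smul, ← hom_smul, hk]⟩
      · exact key e
      · exact (key e.symm).imp fun k hk => hk.symm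
      · rw [← hom_res s, ← hom_res s] at e
        obtain ⟨k, hk⟩ := (hS h f hf).eq t t' (H.inr_inj V e)
        exact ⟨k, by rw [← hom_smul, ← hom_smul, hk]⟩)

lemma isQC_left (H : IsWedge i s) (hP : P.IsQC) : N.IsQC := fun U V h f hf =>
  .of_isLocalizationMap hf (fun n => by
      obtain ⟨r, hr, -⟩ := H.exists_retr
      obtain ⟨k, p, hp⟩ := (hP h f hf).surj (i.app _ n)
      refine ⟨k, r.app _ p, ?_⟩
      rw [← hom_res r, ← hp, hom_smul]
      exact congrArg _ (congrArg (fun q => PreMod.Hom.app q V.1 n) hr).symm)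
    (fun m m' e => by
      obtain ⟨k, hk⟩ := (hP h f hf).eq (i.app _ m) (i.app _ m') (by
        rw [← hom_res i, ← hom_res i, e])
      exact ⟨k, H.inl_inj U (by rw [hom_smul, hom_smul, hk])⟩)

lemma isFG (H : IsWedge i s) (hN : N.IsFG) (hS : S.IsFG) : P.IsFG := by
  classical
  intro V
  obtain ⟨a, ha⟩ := hN V
  obtain ⟨b, hb⟩ := hS V
  refine ⟨a.image (i.app V.1) ∪ b.image (s.app V.1), fun p => ?_⟩
  rcases H.cover V p with ⟨n, rfl⟩ | ⟨t, rfl⟩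
  · obtain ⟨n, hn, x, rfl⟩ := ha n
    exact ⟨_, Finset.mem_union_left _ (Finset.mem_image_of_mem _ hn), x, hom_smul i x n⟩
  · obtain ⟨n, hn, x, rfl⟩ := hb t
    exact ⟨_, Finset.mem_union_right _ (Finset.mem_image_of_mem _ hn), x, hom_smul s x n⟩

lemma isProj (H : IsWedge i s) (hN : N.IsProj) (hS : S.IsProj) : P.IsProj := by
  intro V E F _ _ _ _ p g hp
  obtain ⟨a, ha⟩ := hN V E F p ⟨fun n => g (i.app V.1 n), fun x n => by
    rw [hom_smul, map_smul]; rfl⟩ hp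
  obtain ⟨b, hb⟩ := hS V E F p ⟨fun n => g (s.app V.1 n), fun x n => by
    rw [hom_smul, map_smul]; rfl⟩ hp
  have a0 : a 0 = 0 := by rw [← zero_smul (X.Γ V.1) (0 : N.Γ V.1), map_smul, zero_smul]
  have b0 : b 0 = 0 := by rw [← zero_smul (X.Γ V.1) (0 : S.Γ V.1), map_smul, zero_smul]
  have hex (q : P.Γ V.1) : ∃ x : E, (∀ n, i.app V.1 n = q → x = a n) ∧
      ∀ t, s.app V.1 t = q → x = b t := by
    rcases H.cover V q with ⟨n, rfl⟩ | ⟨t, rfl⟩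
    · refine ⟨a n, fun n' h => by rw [H.inl_inj V h], fun t h => ?_⟩
      rw [H.eq_zero_left h.symm, H.eq_zero_right h.symm, a0, b0]
    · refine ⟨b t, fun n h => ?_, fun n' h => by rw [H.inr_inj V h]⟩
      rw [H.eq_zero_left h, H.eq_zero_right h, a0, b0]
  choose d hd using hex
  refine ⟨⟨d, fun x q => ?_⟩, ?_⟩
  · rcases H.cover V q with ⟨n, rfl⟩ | ⟨t, rfl⟩
    · rw [(hd (x • i.app V.1 n)).1 (x • n) (hom_smul i x n), (hd _).1 n rfl, map_smul, id]
    · rw [(hd (x • s.app V.1 t)).2 (x • t) (hom_smul s x t), (hd _).2 t rfl, map_smul, id]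
  · ext q
    change p (d q) = g q
    rcases H.cover V q with ⟨n, rfl⟩ | ⟨t, rfl⟩
    · rw [(hd _).1 n rfl]
      exact congrArg (fun q => q n) ha
    · rw [(hd _).2 t rfl]
      exact congrArg (fun q => q t) hb

lemma isProj_left (H : IsWedge i s) (hP : P.IsProj) : N.IsProj := fun V => by
  obtain ⟨r, hr, -⟩ := H.exists_retr
  exact (hP V).of_retract ⟨i.app V.1, hom_smul i⟩ ⟨r.app V.1, hom_smul r⟩
    fun n => congrArg (fun q => PreMod.Hom.app q V.1 n) hr

end IsWedge

variable (N S) in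
-- The wedge is the part of the product where one coordinate is zero. Sheafifying it does not affect
-- the sections over affine open sets.
lemma exists_wedge : ∃ (P : OMod X.toMonoidalSpace) (i : N ⟶ P) (s : S ⟶ P), IsWedge i s := by
  let W : PreMod X.toMonoidalSpace := (PreMod.prod N.toPreMod S.toPreMod).ofSub
    (fun U => {p : N.Γ U × S.Γ U | p.1 = 0 ∨ p.2 = 0}) (fun _ => Or.inl rfl)
    (fun U a (p : N.Γ U × S.Γ U) hp => hp.imp
      (fun h => (congrArg (a • ·) h).trans (smul_zero a))
      (fun h => (congrArg (a • ·) h).trans (smul_zero a)))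
    (fun {U V} h (p : N.Γ U × S.Γ U) hp => hp.imp
      (fun e => (congrArg (N.res h) e).trans (N.res_zero h))
      (fun e => (congrArg (S.res h) e).trans (S.res_zero h)))
  let i : N.toPreMod ⟶ W :=
    { app := fun U n => ⟨(n, 0), Or.inr rfl⟩
      map_smul := fun U a n => Subtype.ext (Prod.ext rfl (smul_zero a).symm)
      map_res := fun h n => Subtype.ext (Prod.ext rfl (S.res_zero h).symm) }
  let s : S.toPreMod ⟶ W :=
    { app := fun U n => ⟨(0, n), Or.inl rfl⟩
      map_smul := fun U a n => Subtype.ext (Prod.ext (smul_zero a).symm rfl)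
      map_res := fun h n => Subtype.ext (Prod.ext (N.res_zero h).symm rfl) }
  have hb (V : X.AffOpn) := W.toSh_bijective V.2
  let i' : N ⟶ sheafify W := CategoryStruct.comp (obj := PreMod X.toMonoidalSpace) i W.toSh
  let s' : S ⟶ sheafify W := CategoryStruct.comp (obj := PreMod X.toMonoidalSpace) s W.toSh
  refine ⟨sheafify W, i', s', fun V n n' e => ?_, fun V n n' e => ?_, fun V p => ?_,
    fun V n t e => ?_⟩
  · exact congrArg (fun t => t.1.1) ((hb V).1 e)
  · exact congrArg (fun t => t.1.2) ((hb V).1 e)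
  · obtain ⟨⟨⟨n, t⟩, h | h⟩, rfl⟩ := (hb V).2 p
    · exact Or.inr ⟨t, congrArg (W.toSh.app V.1) (Subtype.ext (Prod.ext h.symm rfl))⟩
    · exact Or.inl ⟨n, congrArg (W.toSh.app V.1) (Subtype.ext (Prod.ext rfl h.symm))⟩
  · have h : n = 0 := congrArg (fun t => t.1.1) ((hb V).1 e)
    rw [h]
    exact hom_zero i' V.1

/-- Normality on the sections over affine open sets. -/
def IsNrm (f : M ⟶ N) : Prop := ∀ (V : X.AffOpn) (m m' : M.Γ V.1), f.app V.1 m = f.app V.1 m' →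
  m = m' ∨ f.app V.1 m = 0

/-- At the closed point of an affine V the map from sections over V to germs is injective, so
normality of the stalk there gives normality on sections. Conversely two germs at any point, and an
equality of their images, are realized over one affine neighbourhood. -/
lemma isNormal_iff {f : M ⟶ N} : IsNormal f ↔ IsNrm f := by
  constructor
  · intro H V m m' e
    rcases V.2.exists_closed with ⟨h0, -⟩ | ⟨c, hc, hV⟩
    · exact Or.inl (M.subsingleton_of_zero_eq_one h0 _ _)
    · have inj {M : OMod X.toMonoidalSpace} {m m' : M.Γ V.1} (e : M.germ c hc m = M.germ c hc m') :
          m = m' := by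
        obtain ⟨W, hW, h, k, e⟩ := (M.germ_eq_iff _ _).1 e
        have hl := hV W hW
        have := congrArg (M.res hl) e
        rwa [M.res_res, M.res_res, M.res_rfl, M.res_rfl] at this
      refine (H c (M.germ c hc m) (M.germ c hc m') ?_).imp inj fun h => ?_
      · rw [PreMod.Hom.stalkMap_germ, PreMod.Hom.stalkMap_germ, e]
      · rw [PreMod.Hom.stalkMap_germ, ← N.germ_res le_top c hc, N.res_zero] at h
        exact inj h
  · intro H x a b e
    obtain ⟨⟨U, h₁, hU, m⟩, rfl⟩ := M.exists_germ a (U := ⊤) trivial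
    obtain ⟨⟨U', h₂, hU', m'⟩, rfl⟩ := M.exists_germ b (U := ⊤) trivial
    simp only at e ⊢
    rw [PreMod.Hom.stalkMap_germ, PreMod.Hom.stalkMap_germ] at e
    obtain ⟨W, hW, h, k, e⟩ := (N.germ_eq_iff _ _).1 e
    obtain ⟨V, hxV, hV⟩ := MZScheme.exists_aff hW
    rw [← M.germ_res (hV.trans h) x hxV, ← M.germ_res (hV.trans k) x hxV, PreMod.Hom.stalkMap_germ,
      ← N.germ_res le_top x hxV, N.res_zero]
    refine (H V (M.res (hV.trans h) m) (M.res (hV.trans k) m') ?_).imp (congrArg _) (congrArg _)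
    rw [hom_res f, hom_res f, ← N.res_res h hV, e, N.res_res]

/-- A normal epimorphism onto a locally projective module splits off its kernel. -/
lemma IsNrm.exists_isWedge {f : M ⟶ N} (H : IsNrm f)
    (hf : ∀ V : X.AffOpn, Function.Surjective (f.app V.1)) (hq : N.IsQC) (hp : N.IsProj) :
    ∃ (K : OMod X.toMonoidalSpace) (k : K ⟶ M) (s : N ⟶ M), IsWedge k s ∧ k ≫ f = zeroHom _ _ ∧
      s ≫ f = 𝟙 N := by
  -- The kernel is the sheaf associated with the sections that f sends to zero; over affine open
  -- sets it consists of exactly these sections.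
  let W : PreMod X.toMonoidalSpace := M.toPreMod.ofSub (fun U => {m | f.app U m = 0})
    (fun U => hom_zero f U)
    (fun U a m hm => (hom_smul f a m).trans ((congrArg (a • ·) hm).trans (smul_zero a)))
    (fun h m hm => (hom_res f h m).trans ((congrArg (N.res h) hm).trans (N.res_zero h)))
  have hb (V : X.AffOpn) := W.toSh_bijective V.2
  let k : sheafify W ⟶ M := homOfAff (M := sheafify W)
    (fun V x => ((Equiv.ofBijective _ (hb V)).symm x).1) (fun V a x => by
      obtain ⟨y, rfl⟩ := (hb V).2 x
      have e1 : (Equiv.ofBijective _ (hb V)).symm (W.toSh.app V.1 y) = y :=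
        (Equiv.ofBijective _ (hb V)).symm_apply_apply y
      have e2 : (Equiv.ofBijective _ (hb V)).symm (a • W.toSh.app V.1 y) = a • y :=
        (congrArg _ (W.toSh.map_smul V.1 a y).symm).trans
          ((Equiv.ofBijective _ (hb V)).symm_apply_apply (a • y))
      exact (congrArg Subtype.val e2).trans (congrArg (fun t : W.Γ V.1 => a • t.1) e1.symm))
    (fun V V' h x => by
      obtain ⟨y, rfl⟩ := (hb V).2 x
      have e1 : (Equiv.ofBijective _ (hb V)).symm (W.toSh.app V.1 y) = y :=
        (Equiv.ofBijective _ (hb V)).symm_apply_apply y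
      have e2 : (Equiv.ofBijective _ (hb V')).symm ((sheafify W).res h (W.toSh.app V.1 y)) =
        W.res h y := (congrArg _ (W.toSh.map_res h y).symm).trans
          ((Equiv.ofBijective _ (hb V')).symm_apply_apply (W.res h y))
      exact (congrArg Subtype.val e2).trans (congrArg (fun t : W.Γ V.1 => M.res h t.1) e1.symm))
  have hk (V : X.AffOpn) (y : W.Γ V.1) : k.app V.1 (W.toSh.app V.1 y) = y.1 :=
    (homOfAff_app _ _ _ V _).trans (congrArg Subtype.val
      ((Equiv.ofBijective _ (hb V)).symm_apply_apply y))
  have hs (V : X.AffOpn) : ∃ l : N.Γ V.1 →[X.Γ V.1] M.Γ V.1, ∀ n, f.app V.1 (l n) = n := by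
    obtain ⟨l, hl⟩ := hp V _ _ ⟨f.app V.1, hom_smul f⟩ ⟨id, fun _ _ => rfl⟩ (hf V)
    exact ⟨l, fun n => congrArg (fun t => t n) hl⟩
  choose l hl using hs
  have l0 (V : X.AffOpn) : l V 0 = 0 := by
    rw [← zero_smul (X.Γ V.1) (0 : N.Γ V.1), map_smul, zero_smul]
  -- The sections l V obtained from projectivity are compatible with restriction. Where the
  -- restriction of n is nonzero, normality allows only one preimage. Where it is zero,
  -- quasi-coherence shows that a power of the localizing element kills n, hence also l V n, and
  -- this power acts invertibly over V'.
  let s : N ⟶ M := homOfAff (fun V => l V) (fun V a n => map_smul (l V) a n) (fun V V' h n => by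
    by_cases h0 : N.res h n = 0
    · rw [h0, l0]
      obtain ⟨g, hg⟩ := MonoidalSpace.exists_localization_of_le V.2 V'.2 h
      obtain ⟨j, hj⟩ := (hq h g hg).eq n 0 (by rw [h0, N.res_zero])
      have := congrArg (fun t => M.res h (l V t)) hj
      simp only [map_smul, l0, smul_zero, M.res_smul, map_pow, M.res_zero] at this
      exact (smul_inj ((isUnit_res hg).pow j) (this.trans (smul_zero _).symm)).symm
    · refine (H V' (l V' (N.res h n)) (M.res h (l V n)) ?_).resolve_right ?_
      · rw [hl, hom_res f, hl]
      · rwa [hl])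
  have hs (V : X.AffOpn) (n : N.Γ V.1) : s.app V.1 n = l V n := homOfAff_app _ _ _ V n
  refine ⟨sheafify W, k, s, ⟨fun V x y e => ?_, fun V n n' e => ?_, fun V m => ?_, fun V x n e => ?_⟩,
    hom_aff_ext fun V x => ?_, hom_aff_ext fun V n => ?_⟩
  · obtain ⟨x, rfl⟩ := (hb V).2 x
    obtain ⟨y, rfl⟩ := (hb V).2 y
    exact congrArg _ (Subtype.ext (by rw [← hk V x, ← hk V y, e]))
  · rw [hs, hs] at e
    rw [← hl V n, e, hl]
  -- A section outside the kernel has nonzero image, so by normality it equals the value of s at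
  -- that image.
  · by_cases h0 : f.app V.1 m = 0
    · exact Or.inl ⟨W.toSh.app V.1 ⟨m, h0⟩, hk V ⟨m, h0⟩⟩
    · refine Or.inr ⟨f.app V.1 m, ?_⟩
      rw [hs]
      exact ((H V m _ (hl V _).symm).resolve_right h0).symm
  · obtain ⟨x, rfl⟩ := (hb V).2 x
    have h1 : f.app V.1 (k.app V.1 (W.toSh.app V.1 x)) = 0 := (congrArg _ (hk V x)).trans x.2
    rw [e, hs, hl] at h1
    rw [e, h1, hs, l0]
  · obtain ⟨x, rfl⟩ := (hb V).2 x
    exact (congrArg _ (hk V x)).trans x.2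
  · exact (congrArg _ (hs V n)).trans (hl V n)

end
end OMod

/-! ### Base extension turns wedges into direct sums. -/

namespace MZScheme
section
open OMod Limits
variable {X : MZScheme.{u}} {N P S : OMod X.toMonoidalSpace}

lemma zMod_zeroHom : X.zMod.map (zeroHom N P) = 0 := zMod_hom_ext fun V n => by
  rw [zMod_map_zsec, zeroHom_app, zsec_zero]
  rfl

lemma isZero_zMod (h : N.IsZ) : IsZero (X.zMod.obj N) := by
  rw [IsZero.iff_id_eq_zero]
  refine zMod_hom_ext fun V n => ?_
  rw [h V n, zsec_zero, map_zero, map_zero]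

/-- On a generator that comes from one summand, the projection to the other one gives the base
point, which is 0 in the base extension. The two idempotents therefore add up to the identity on
every generator. -/
lemma zMod_wedge {i : N ⟶ P} {s : S ⟶ P} (H : IsWedge i s) {r : P ⟶ N} {q : P ⟶ S}
    (hr : i ≫ r = 𝟙 N) (hr' : s ≫ r = zeroHom S N) (hq : s ≫ q = 𝟙 S) (hq' : i ≫ q = zeroHom N S) :
    X.zMod.map r ≫ X.zMod.map i + X.zMod.map q ≫ X.zMod.map s = 𝟙 _ := by
  rw [← X.zMod.map_comp, ← X.zMod.map_comp]
  refine zMod_hom_ext fun V p => ?_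
  rw [ap_add, zMod_map_zsec, zMod_map_zsec, ap_id, comp_app, comp_app]
  rcases H.cover V p with ⟨n, rfl⟩ | ⟨t, rfl⟩
  · have e1 : r.app V.1 (i.app V.1 n) = n := congrArg (fun q => PreMod.Hom.app q V.1 n) hr
    have e2 : q.app V.1 (i.app V.1 n) = 0 := congrArg (fun q => PreMod.Hom.app q V.1 n) hq'
    rw [e1, e2, hom_zero, zsec_zero, add_zero]
  · have e1 : q.app V.1 (s.app V.1 t) = t := congrArg (fun q => PreMod.Hom.app q V.1 t) hq
    have e2 : r.app V.1 (s.app V.1 t) = 0 := congrArg (fun q => PreMod.Hom.app q V.1 t) hr'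
    rw [e1, e2, hom_zero, zsec_zero, zero_add]

/-- The base extension of a wedge is a split exact sequence. -/
lemma zMod_splitting {i : N ⟶ P} {s : S ⟶ P} (H : IsWedge i s) {q : P ⟶ S} (hq : s ≫ q = 𝟙 S)
    (hq' : i ≫ q = zeroHom N S) : ∃ w : X.zMod.map i ≫ X.zMod.map q = 0,
      Nonempty (ShortComplex.mk (X.zMod.map i) (X.zMod.map q) w).Splitting := by
  obtain ⟨r, hr, hr'⟩ := H.exists_retr
  refine ⟨by rw [← X.zMod.map_comp, hq', zMod_zeroHom], ⟨⟨X.zMod.map r, X.zMod.map s, ?_, ?_, ?_⟩⟩⟩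
  · exact (X.zMod.map_comp _ _).symm.trans ((congrArg _ hr).trans (X.zMod.map_id _))
  · exact (X.zMod.map_comp _ _).symm.trans ((congrArg _ hq).trans (X.zMod.map_id _))
  · exact zMod_wedge H hr hr' hq hq'

end
end MZScheme

/-! ### Locally free modules: restriction to U as a module on the scheme U. -/

section
open Limits

variable {X : Scheme.{u}} (M : X.Modules) (U : X.Opens)

/-- The category of modules, as a category of sheaves of modules. -/
abbrev SM (X : Scheme.{u}) := SheafOfModules.{u} X.ringCatSheaf

/-- Modules over the site of open subsets of `U`, as modules on the scheme `U`. -/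
def overToPb : SheafOfModules.{u} (X.ringCatSheaf.over U) ⥤ SM U.toScheme := (Scheme.Modules.overEquiv U).functor

instance : (overToPb U).IsEquivalence := 
  inferInstanceAs (Scheme.Modules.overEquiv U).functor.IsEquivalence

/-- The inverse of `overToPb`. -/
def pbToOver : SM U.toScheme ⥤ SheafOfModules.{u} (X.ringCatSheaf.over U) := (overToPb U).inv

instance : (pbToOver U).IsEquivalence := inferInstanceAs (overToPb U).inv.IsEquivalence

/-- `overToPb` sends `M|_U` to the pullback of `M`. -/
def overIso : (overToPb U).obj (SheafOfModules.over (R := X.ringCatSheaf) M U) ≅ (pb U.ι M : SM U.toScheme) :=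
  (Scheme.Modules.overFunctorEquiv U).app M ≪≫ (Scheme.Modules.restrictFunctorIsoPullback U.ι).app M

/-- `overToPb` preserves the unit. -/
def overUnit : SheafOfModules.unit U.toScheme.ringCatSheaf ≅ (overToPb U).obj (SheafOfModules.unit (X.ringCatSheaf.over U)) :=
  (pullUnitIso U.ι).symm ≪≫ (overIso (unitMod X) U).symm

/-- `pbToOver` sends the pullback of `M` to `M|_U`. -/
def overIso' : (pbToOver U).obj (pb U.ι M : SM U.toScheme) ≅ SheafOfModules.over (R := X.ringCatSheaf) M U :=
  (overToPb U).inv.mapIso (overIso M U).symm ≪≫ (overToPb U).asEquivalence.unitIso.symm.app _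

/-- `pbToOver` preserves the unit. -/
def overUnit' : SheafOfModules.unit (X.ringCatSheaf.over U) ≅ (pbToOver U).obj (SheafOfModules.unit U.toScheme.ringCatSheaf) :=
  (overToPb U).asEquivalence.unitIso.app _ ≪≫ (overToPb U).inv.mapIso (overUnit U).symm

section
variable {C : Type*} [Category* C] {J : GrothendieckTopology C} {R : Sheaf J RingCat.{u}}
  [HasWeakSheafify J AddCommGrpCat.{u}] [J.WEqualsLocallyBijective AddCommGrpCat.{u}]
  {M N : SheafOfModules.{u} R}

/-- Generating sections of an isomorphic module. -/
def genOfIso (e : M ≅ N) (G : M.GeneratingSections) : N.GeneratingSections := G.ofEpi e.hom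

lemma genOfIso_isIso (e : M ≅ N) (G : M.GeneratingSections) (h : IsIso G.π) :
    IsIso (genOfIso e G).π := by
  have : (genOfIso e G).π = G.π ≫ e.hom := SheafOfModules.GeneratingSections.ofEpi_π _ _
  rw [this]
  exact (asIso G.π ≪≫ e).isIso_hom

lemma genMap_isIso {D : Type*} [Category* D] {K : GrothendieckTopology D} {S : Sheaf K RingCat.{u}}
    [HasSheafify K AddCommGrpCat.{u}] [K.WEqualsLocallyBijective AddCommGrpCat.{u}]
    (G : M.GeneratingSections) (F : SheafOfModules.{u} R ⥤ SheafOfModules.{u} S)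
    [PreservesColimitsOfSize.{u, u} F] (η : SheafOfModules.unit S ≅ F.obj (SheafOfModules.unit R))
    (h : IsIso G.π) : IsIso (G.map F η).π := inferInstance

/-- Generating sections of a free module. -/
def genOfFree {I : Type u} (e : SheafOfModules.free I ≅ M) : M.GeneratingSections :=
  genOfIso e (SheafOfModules.free.generatingSections I)

lemma genOfFree_isIso {I : Type u} (e : SheafOfModules.free I ≅ M) : IsIso (genOfFree e).π :=
  genOfIso_isIso _ _ inferInstance

end

/-- Generating sections of `M|_U` on the scheme `U`. -/
def genToPb (G : (SheafOfModules.over (R := X.ringCatSheaf) M U).GeneratingSections) :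
   SheafOfModules.GeneratingSections (R := U.toScheme.ringCatSheaf) (pb U.ι M) :=
  genOfIso (overIso M U) (G.map (overToPb U) (overUnit U))

/-- Generating sections on the scheme `U` as generating sections of `M|_U`. -/
def genToOver (G : SheafOfModules.GeneratingSections (R := U.toScheme.ringCatSheaf) (pb U.ι M)) :
  (SheafOfModules.over (R := X.ringCatSheaf) M U).GeneratingSections :=
  genOfIso (overIso' M U) (G.map (pbToOver U) (overUnit' U))

lemma genToPb_iso (G : (SheafOfModules.over (R := X.ringCatSheaf) M U).GeneratingSections)
    (h : IsIso G.π) : IsIso (genToPb M U G).π :=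
  genOfIso_isIso _ (G.map (overToPb U) (overUnit U)) (genMap_isIso _ _ _ h)

lemma genToOver_iso (G : SheafOfModules.GeneratingSections (R := U.toScheme.ringCatSheaf) (pb U.ι M))
    (h : IsIso G.π) : IsIso (genToOver M U G).π :=
  genOfIso_isIso _ (G.map (pbToOver U) (overUnit' U)) (genMap_isIso _ _ _ h)

lemma exists_free_of_lf (h : SheafOfModules.IsLocallyFree (R := X.ringCatSheaf) M) (x : X) :
   ∃ (U : X.Opens) (I : Type u), x ∈ U ∧ Nonempty (SheafOfModules.free I ≅ (pb U.ι M : SM U.toScheme)) := by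
  obtain ⟨q, hq⟩ := h.exists_isLocallyFreeData
  have hc := (Opens.coversTop_iff _ _).1 q.coversTop
  obtain ⟨i, hi⟩ := Opens.mem_iSup.1 (hc.symm ▸ (trivial : x ∈ (⊤ : X.Opens)) : x ∈ ⨆ i, q.X i)
  have := genToPb_iso M (q.X i) (q.generators i) (hq.isIso i)
  exact ⟨q.X i, _, hi, ⟨asIso (genToPb M (q.X i) (q.generators i)).π⟩⟩

lemma exists_epi_of_ft (h : SheafOfModules.IsFiniteType (R := X.ringCatSheaf) M) (x : X) :
   ∃ (U : X.Opens) (I : Type u) (f : SheafOfModules.free I ⟶ (pb U.ι M : SM U.toScheme)), x ∈ U ∧ Finite I ∧ Epi f := by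
  obtain ⟨q, hq⟩ := h.exists_localGeneratorsData
  have hc := (Opens.coversTop_iff _ _).1 q.coversTop
  obtain ⟨i, hi⟩ := Opens.mem_iSup.1 (hc.symm ▸ (trivial : x ∈ (⊤ : X.Opens)) : x ∈ ⨆ i, q.X i)
  exact ⟨q.X i, _, (genToPb M (q.X i) (q.generators i)).π, hi, (hq.isFiniteType i).finite,
     (genToPb M (q.X i) (q.generators i)).epi⟩

/-- Local generators from local bases. -/
def localGen (U : X → X.Opens) (hx : ∀ x, x ∈ U x)
    (G : ∀ x, SheafOfModules.GeneratingSections (R := (U x).toScheme.ringCatSheaf) (pb (U x).ι M)) :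
    SheafOfModules.LocalGeneratorsData.{u} (R := X.ringCatSheaf) M where
  I := X
  X := U
  coversTop := (Opens.coversTop_iff _ _).2 (top_le_iff.1 fun x _ => Opens.mem_iSup.2 ⟨x, hx x⟩)
  generators x := genToOver M (U x) (G x)

lemma localGen_isLocallyFreeData (U : X → X.Opens) (hx : ∀ x, x ∈ U x)
    (G : ∀ x, SheafOfModules.GeneratingSections (R := (U x).toScheme.ringCatSheaf) (pb (U x).ι M))
    (h : ∀ x, IsIso (G x).π) : (localGen M U hx G).IsLocallyFreeData where
  isIso x := genToOver_iso M (U x) (G x) (h x)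

lemma localGen_isFiniteType (U : X → X.Opens) (hx : ∀ x, x ∈ U x)
    (G : ∀ x, SheafOfModules.GeneratingSections (R := (U x).toScheme.ringCatSheaf) (pb (U x).ι M))
    (h : ∀ x, Finite (G x).I) : (localGen M U hx G).IsFiniteType where
  isFiniteType x := SheafOfModules.GeneratingSections.IsFiniteType.mk (h x)

lemma isLocallyFree_localGen (U : X → X.Opens) (hx : ∀ x, x ∈ U x)
    (G : ∀ x, SheafOfModules.GeneratingSections (R := (U x).toScheme.ringCatSheaf) (pb (U x).ι M))
    (h : ∀ x, IsIso (G x).π) : SheafOfModules.IsLocallyFree (R := X.ringCatSheaf) M :=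
  @SheafOfModules.IsLocallyFree.mk _ _ _ X.ringCatSheaf _ _ M
    ⟨localGen M U hx G, localGen_isLocallyFreeData M U hx G h⟩

lemma isFiniteType_localGen (U : X → X.Opens) (hx : ∀ x, x ∈ U x)
    (G : ∀ x, SheafOfModules.GeneratingSections (R := (U x).toScheme.ringCatSheaf) (pb (U x).ι M))
    (h : ∀ x, Finite (G x).I) : SheafOfModules.IsFiniteType (R := X.ringCatSheaf) M :=
  @SheafOfModules.IsFiniteType.mk _ _ _ X.ringCatSheaf _ _ M
    ⟨localGen M U hx G, localGen_isFiniteType M U hx G h⟩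

lemma lf_of_free (h : ∀ x : X, ∃ (U : X.Opens) (I : Type u), x ∈ U ∧ Finite I ∧
      Nonempty (SheafOfModules.free I ≅ (pb U.ι M : SM U.toScheme))) :
    SheafOfModules.IsLocallyFree (R := X.ringCatSheaf) M ∧
      SheafOfModules.IsFiniteType (R := X.ringCatSheaf) M := by
  choose U I hx hI e using h
  exact ⟨isLocallyFree_localGen M U hx (fun x => genOfFree (e x).some) fun x => genOfFree_isIso _,
    isFiniteType_localGen M U hx (fun x => genOfFree (e x).some) hI⟩

end

/-! ### Quasi-coherence of the unit and of tensor products. -/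

section
open Limits
variable {Y Z X : Scheme.{u}}

/-- The pullback functor, on sheaves of modules. -/
def pbFun (g : Y ⟶ Z) : SM Z ⥤ SM Y := Scheme.Modules.pullback g

instance (g : Y ⟶ Z) : (pbFun g).IsLeftAdjoint :=
  inferInstanceAs (Scheme.Modules.pullback g).IsLeftAdjoint

instance (g : Y ⟶ Z) : PreservesColimitsOfSize.{u, u} (pbFun g) := inferInstance

/-- The pullback of a presentation. -/
def presPb (g : Y ⟶ Z) (M : Z.Modules) (P : SheafOfModules.Presentation (R := Z.ringCatSheaf) M) :
    SheafOfModules.Presentation (R := Y.ringCatSheaf) (pb g M) :=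
  P.map (pbFun g) (pullUnitIso g).symm

/-- Presentations and isomorphisms. -/
def presOfIso {M N : SM Y} (e : M ≅ N) (P : M.Presentation) : N.Presentation := P.ofIsIso e.hom

/-- presentation -/
def presToOver (M : X.Modules) (U : X.Opens)
    (P : SheafOfModules.Presentation (R := U.toScheme.ringCatSheaf) (pb U.ι M)) :
    (SheafOfModules.over (R := X.ringCatSheaf) M U).Presentation :=
  (P.map (pbToOver U) (overUnit' U)).ofIsIso (overIso' M U).hom

lemma isQuasicoherent_of_local (M : X.Modules) (h : ∀ x : X, ∃ U : X.Opens, x ∈ U ∧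
    Nonempty (SheafOfModules.Presentation (R := U.toScheme.ringCatSheaf) (pb U.ι M))) :
    SheafOfModules.IsQuasicoherent (R := X.ringCatSheaf) M := by
  choose U hU P using h
  exact SheafOfModules.QuasicoherentData.isQuasicoherent (R := X.ringCatSheaf) (M := M)
    { I := X
      X := U
      coversTop := (Opens.coversTop_iff _ _).2 (top_le_iff.1 fun x _ => Opens.mem_iSup.2 ⟨x, hU x⟩)
      presentation := fun x => presToOver M (U x) (P x).some }

lemma isQuasicoherent_of_iso {M N : X.Modules} (e : M ≅ N)
    (h : SheafOfModules.IsQuasicoherent (R := X.ringCatSheaf) M) :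
    SheafOfModules.IsQuasicoherent (R := X.ringCatSheaf) N :=
  (SheafOfModules.isQuasicoherent X.ringCatSheaf).prop_of_iso e h

lemma isQuasicoherent_pb (f : Y ⟶ X) [IsOpenImmersion f] {M : X.Modules}
    (h : SheafOfModules.IsQuasicoherent (R := X.ringCatSheaf) M) :
    SheafOfModules.IsQuasicoherent (R := Y.ringCatSheaf) (pb f M) :=
  isQuasicoherent_of_iso ((Scheme.Modules.restrictFunctorIsoPullback f).app M)
    (@Scheme.Modules.isQuasicoherent_restrictFunctor _ _ f _ M h)

variable {R : CommRingCat.{u}}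

lemma isQuasicoherent_spec_iff (M : (Spec R).Modules) :
    SheafOfModules.IsQuasicoherent (R := (Spec R).ringCatSheaf) M ↔ (tilde.functor R).essImage M := by
  rw [essImage_tilde]

/-- A quasi-coherent module on an affine scheme is associated with a module, hence has a global
presentation; pulling this back along U ≅ Spec Γ(X, U) gives the local presentations on X. -/
lemma isQuasicoherent_of_spec (M : X.Modules) (h : ∀ (U : X.Opens) (hU : IsAffineOpen U),
    SheafOfModules.IsQuasicoherent (R := (Spec Γ(X, U)).ringCatSheaf) (pb hU.fromSpec M)) :
    SheafOfModules.IsQuasicoherent (R := X.ringCatSheaf) M := by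
  refine isQuasicoherent_of_local M fun x => ?_
  obtain ⟨U, hU, hx⟩ := exists_isAffineOpen_mem_and_subset (X := X) (U := ⊤) (x := x) trivial
  obtain ⟨A, ⟨e⟩⟩ := (isQuasicoherent_spec_iff _).1 (h U hU)
  refine ⟨U, hx.1, ⟨?_⟩⟩
  have P : SheafOfModules.Presentation (R := (Spec Γ(X, U)).ringCatSheaf) (pb hU.fromSpec M) :=
    presOfIso e (presentationTilde.{u} (M := A) .univ (by simp) _ (Submodule.span_eq _))
  have e' : pb hU.isoSpec.hom (pb hU.fromSpec M) ≅ pb U.ι M :=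
    (Scheme.Modules.pullbackComp _ _).app M ≪≫
      (Scheme.Modules.pullbackCongr (by rw [← hU.isoSpec_inv_ι, Iso.hom_inv_id_assoc])).app M
  exact presOfIso e' (presPb hU.isoSpec.hom _ P)

lemma isQuasicoherent_unitMod : SheafOfModules.IsQuasicoherent (R := X.ringCatSheaf) (unitMod X) :=
  isQuasicoherent_of_spec _ fun U hU => (isQuasicoherent_spec_iff _).2
    ⟨ModuleCat.of _ _, ⟨tildeSelf ≪≫ (pullUnitIso hU.fromSpec).symm⟩⟩

variable (A : ModuleCat.{u} R)

/-- Tensor products of quasi-coherent sheaves on affine schemes. -/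
def tildeTens : ModuleCat.{u} R ⥤ (Spec R).Modules := tilde.functor R ⋙ tensL (tilde A)

instance : PreservesColimits (tildeTens A) :=
  inferInstanceAs (PreservesColimits (tilde.functor R ⋙ tensL (tilde A)))

lemma tildeTens_self : (tilde.functor R).essImage ((tildeTens A).obj (ModuleCat.of R R)) :=
  ⟨A, ⟨((MonoidalCategory.rightUnitor (C := (Spec R).Modules) (tilde A)).symm :)⟩⟩

lemma tildeTens_finsupp (I : Type u) :
    (tilde.functor R).essImage ((tildeTens A).obj (ModuleCat.of R (I →₀ R))) :=
  ((tilde.functor R).essImage.prop_of_isColimit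
    (isColimitOfPreserves (tildeTens A) (ModuleCat.finsuppCoconeIsColimit R R I))
    fun _ => tildeTens_self A)

/-- The functor B ↦ Ã ⊗ B̃ preserves colimits, and the modules of the form C̃ are closed under
colimits. For B = R the value is Ã, so the claim follows for free modules and then for the cokernel
B of a map of free modules. -/
lemma tildeTens_obj (B : ModuleCat.{u} R) :
    (tilde.functor R).essImage ((tildeTens A).obj B) := by
  let g : ModuleCat.of R (B →₀ R) ⟶ B := ModuleCat.ofHom (Finsupp.linearCombination R id)
  let f : ModuleCat.of R (LinearMap.ker g.hom →₀ R) ⟶ ModuleCat.of R (B →₀ R) :=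
    ModuleCat.ofHom (Finsupp.linearCombination R Subtype.val)
  have hg : Function.Surjective g.hom := Finsupp.linearCombination_id_surjective R B
  have hf : Function.Exact f.hom g.hom := LinearMap.exact_iff.2 <|
    ((Finsupp.range_linearCombination (R := R) (v := (Subtype.val : LinearMap.ker g.hom → _))).trans
      (by rw [Subtype.range_coe_subtype]; exact Submodule.span_eq (LinearMap.ker g.hom))).symm
  refine (tilde.functor R).essImage.prop_of_isColimit
    (isColimitOfPreserves (tildeTens A) (ModuleCat.isColimitCokernelCofork f g hf hg)) ?_
  rintro (_ | _) <;> exact tildeTens_finsupp A _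

lemma isQuasicoherent_tens {M N : X.Modules}
    (hM : SheafOfModules.IsQuasicoherent (R := X.ringCatSheaf) M)
    (hN : SheafOfModules.IsQuasicoherent (R := X.ringCatSheaf) N) :
    SheafOfModules.IsQuasicoherent (R := X.ringCatSheaf) (tensMod M N) := by
  refine isQuasicoherent_of_spec _ fun U hU => ?_
  obtain ⟨A, ⟨a⟩⟩ := (isQuasicoherent_spec_iff _).1 (isQuasicoherent_pb hU.fromSpec hM)
  obtain ⟨B, ⟨b⟩⟩ := (isQuasicoherent_spec_iff _).1 (isQuasicoherent_pb hU.fromSpec hN)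
  obtain ⟨C, ⟨c⟩⟩ := tildeTens_obj A B
  exact (isQuasicoherent_spec_iff _).2
    ⟨C, ⟨c ≪≫ tensModIso a b ≪≫ (pullTensIso hU.fromSpec M N).symm⟩⟩

end

/-! ### Finite direct sums of copies of an object, described by equations. -/

section FinFree
variable {C : Type*} [Category* C] [Preadditive C] {D : Type*} [Category* D] [Preadditive D]

/-- `M` is a finite direct sum of copies of `E`. -/
def FinFree (E M : C) : Prop :=
  ∃ (I : Type u) (_ : Fintype I) (ι : I → (E ⟶ M)) (π : I → (M ⟶ E)),
    (∀ i, ι i ≫ π i = 𝟙 E) ∧ (∀ i j, i ≠ j → ι i ≫ π j = 0) ∧ ∑ i, π i ≫ ι i = 𝟙 M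

variable {E M N : C}

lemma FinFree.map (h : FinFree.{u} E M) (F : C ⥤ D) [F.Additive] :
    FinFree.{u} (F.obj E) (F.obj M) := by
  obtain ⟨I, _, ι, π, h₁, h₂, h₃⟩ := h
  refine ⟨I, inferInstance, fun i => F.map (ι i), fun i => F.map (π i), fun i => ?_,
    fun i j hij => ?_, ?_⟩
  · rw [← F.map_comp, h₁, F.map_id]
  · rw [← F.map_comp, h₂ i j hij, F.map_zero]
  · rw [← F.map_id, ← h₃, F.map_sum]
    simp only [F.map_comp]

lemma FinFree.of_iso {E' : C} (h : FinFree.{u} E M) (e : E ≅ E') (f : M ≅ N) :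
    FinFree.{u} E' N := by
  obtain ⟨I, _, ι, π, h₁, h₂, h₃⟩ := h
  refine ⟨I, inferInstance, fun i => e.inv ≫ ι i ≫ f.hom, fun i => f.inv ≫ π i ≫ e.hom, fun i => ?_,
    fun i j hij => ?_, ?_⟩
  · simp [reassoc_of% (h₁ i)]
  · simp [reassoc_of% (h₂ i j hij)]
  · have := congrArg (fun t => f.inv ≫ t ≫ f.hom) h₃
    simpa [Preadditive.sum_comp, Preadditive.comp_sum] using this

lemma FinFree.trans {E' : C} (h : FinFree.{u} E' E) (h' : FinFree.{u} E M) : FinFree.{u} E' M := by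
  obtain ⟨I, _, ι, π, h₁, h₂, h₃⟩ := h
  obtain ⟨J, _, ι', π', h₁', h₂', h₃'⟩ := h'
  refine ⟨I × J, inferInstance, fun i => ι i.1 ≫ ι' i.2, fun i => π' i.2 ≫ π i.1, fun i => ?_,
    fun i j hij => ?_, ?_⟩
  · simp [reassoc_of% (h₁' i.2), h₁]
  · by_cases h : i.2 = j.2
    · have h' : i.1 ≠ j.1 := fun h' => hij (Prod.ext h' h)
      simp [← h, reassoc_of% (h₁' i.2), h₂ _ _ h']
    · simp [reassoc_of% (h₂' _ _ h)]
  · rw [Fintype.sum_prod_type_right, ← h₃']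
    refine Finset.sum_congr rfl fun j _ => ?_
    have := congrArg (fun t => π' j ≫ t ≫ ι' j) h₃
    simpa [Preadditive.sum_comp, Preadditive.comp_sum] using this

lemma FinFree.self (E : C) : FinFree.{u} E E :=
  ⟨PUnit, inferInstance, fun _ => 𝟙 _, fun _ => 𝟙 _, by simp, fun _ _ h => (h rfl).elim, by simp⟩

lemma FinFree.of_isZero (h : Limits.IsZero M) : FinFree.{u} E M :=
  ⟨PEmpty, inferInstance, fun _ => 0, fun _ => 0, nofun, nofun, h.eq_of_src _ _⟩

lemma FinFree.of_splitting {S : ShortComplex C} (s : S.Splitting) (h₁ : FinFree.{u} E S.X₁)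
    (h₃ : FinFree.{u} E S.X₃) : FinFree.{u} E S.X₂ := by
  obtain ⟨I, _, ι, π, hi₁, hi₂, hi₃⟩ := h₁
  obtain ⟨J, _, ι', π', hj₁, hj₂, hj₃⟩ := h₃
  have hz : s.s ≫ s.r = 0 := s.s_r
  refine ⟨I ⊕ J, inferInstance, Sum.elim (fun i => ι i ≫ S.f) (fun j => ι' j ≫ s.s),
    Sum.elim (fun i => s.r ≫ π i) (fun j => S.g ≫ π' j), ?_, ?_, ?_⟩
  · rintro (i | j)
    · simp [hi₁]
    · simp [hj₁]
  · rintro (i | i) (j | j) hij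
    · simp [hi₂ i j (fun h => hij (congrArg _ h))]
    · simp
    · simp [reassoc_of% hz]
    · simp [hj₂ i j (fun h => hij (congrArg _ h))]
  · rw [Fintype.sum_sum_type, ← s.id]
    congr 1
    · have := congrArg (fun t => s.r ≫ t ≫ S.f) hi₃
      simpa [Preadditive.sum_comp, Preadditive.comp_sum] using this
    · have := congrArg (fun t => S.g ≫ t ≫ s.s) hj₃
      simpa [Preadditive.sum_comp, Preadditive.comp_sum] using this

end FinFree

/-! ### Flatness of finite free modules; monomorphisms are local. -/

section
open Limits
variable {X Y Z : Scheme.{u}} {M N M' N' : X.Modules}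

lemma tensModMap_add_left (f g : M ⟶ M') :
    tensModMap (f + g) (𝟙 N) = tensModMap f (𝟙 N) + tensModMap g (𝟙 N) :=
  tensMod_hom_ext fun U m n => by
    rw [ap_add, tensModMap_tmul, tensModMap_tmul, tensModMap_tmul, ap_add, tmulMod_add_left]

variable (N) in
/-- The functor `- ⊗ N`. -/
def tensR : X.Modules ⥤ X.Modules where
  obj M := tensMod M N
  map f := tensModMap f (𝟙 N)
  map_id _ := tensModMap_id
  map_comp f g := by rw [tensModMap_comp, Category.comp_id]

instance : (tensR N).Additive where
  map_add {_ _ f g} := tensModMap_add_left f g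

lemma FinFree.tens (hM : FinFree.{u} (unitMod X) M) (hN : FinFree.{u} (unitMod X) N) :
    FinFree.{u} (unitMod X) (tensMod M N) :=
  hM.trans ((hN.map (tensL M)).of_iso
    (MonoidalCategory.rightUnitor (C := X.Modules) M) (Iso.refl _))

/-- The morphism M ⊗ f is a direct sum of copies of f: the projections π i ⊗ N jointly detect
morphisms to M ⊗ N, and tensoring f with the structure sheaf gives f up to the unitors. -/
lemma FinFree.mono_tens (hM : FinFree.{u} (unitMod X) M) (f : N ⟶ N') [Mono f] :
    Mono (tensModMap (𝟙 M) f) := by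
  obtain ⟨I, _, ι, π, -, -, h⟩ := hM
  have h1 : Mono (tensModMap (𝟙 (unitMod X)) f) := by
    have e := tensUnit_nat f
    have e1 : IsIso (tensUnit N) := (MonoidalCategory.leftUnitor (C := X.Modules) N).isIso_hom
    have : Mono (tensModMap (𝟙 (unitMod X)) f ≫ tensUnit N') := by
      rw [e]; infer_instance
    exact mono_of_mono _ (tensUnit N')
  refine ⟨fun {T} x y hxy => ?_⟩
  have h2 (i : I) : x ≫ tensModMap (π i) (𝟙 N) = y ≫ tensModMap (π i) (𝟙 N) := by
    rw [← cancel_mono (tensModMap (𝟙 (unitMod X)) f), Category.assoc, Category.assoc,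
      tensModMap_comp, Category.id_comp, Category.comp_id]
    have := congrArg (· ≫ tensModMap (π i) (𝟙 N')) hxy
    simpa only [Category.assoc, tensModMap_comp, Category.id_comp, Category.comp_id] using this
  have h3 : ∑ i, tensModMap (π i) (𝟙 N) ≫ tensModMap (ι i) (𝟙 N) = 𝟙 _ := by
    have := congrArg (tensR N).map h
    rw [Functor.map_sum, CategoryTheory.Functor.map_id] at this
    simp only [Functor.map_comp] at this
    exact this
  rw [← Category.comp_id x, ← Category.comp_id y, ← h3, Preadditive.comp_sum, Preadditive.comp_sum]
  refine Finset.sum_congr rfl fun i _ => ?_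
  rw [← Category.assoc, h2, Category.assoc]

lemma mono_iff_ap (f : M ⟶ N) : Mono f ↔ ∀ U, Function.Injective (ap f U) := by
  constructor
  · intro h U
    have h1 : Mono ((Scheme.Modules.toPresheaf X).map f) := inferInstance
    have h2 : Mono (((Scheme.Modules.toPresheaf X).map f).app (op U)) := inferInstance
    exact (AddCommGrpCat.mono_iff_injective _).1 h2
  · intro h
    refine ⟨fun x y hxy => hom_ext_ap fun U t => h U ?_⟩
    rw [← ap_comp, ← ap_comp, hxy]

lemma mono_pbMap_iff (j : Y ⟶ X) [IsOpenImmersion j] (f : M ⟶ N) :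
    Mono (pbMap j f) ↔ ∀ V : Y.Opens, Function.Injective (ap f (j ''ᵁ V)) := by
  have h : Mono (pbMap j f) ↔ Mono ((Scheme.Modules.restrictFunctor j).map f) :=
    ((MorphismProperty.monomorphisms _).arrow_mk_iso_iff
      (Arrow.isoMk ((Scheme.Modules.restrictFunctorIsoPullback j).app M)
        ((Scheme.Modules.restrictFunctorIsoPullback j).app N)
        ((Scheme.Modules.restrictFunctorIsoPullback j).hom.naturality f).symm)).symm
  rw [h, mono_iff_ap]
  rfl

lemma mono_pbMap (j : Y ⟶ X) [IsOpenImmersion j] (f : M ⟶ N) [Mono f] : Mono (pbMap j f) :=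
  (mono_pbMap_iff j f).2 fun V => (mono_iff_ap f).1 ‹_› _

/-- A monomorphism is injective on sections, and a section vanishes if its restrictions to the
members of an open cover do. -/
lemma mono_of_local (f : M ⟶ N) (h : ∀ x : X, ∃ (Y : Scheme.{u}) (j : Y ⟶ X)
    (_ : IsOpenImmersion j), x ∈ j.opensRange ∧ Mono (pbMap j f)) : Mono f := by
  rw [mono_iff_ap]
  refine fun U => (injective_iff_map_eq_zero _).2 fun m hm => ?_
  choose Y j hj hx hf using h
  refine sec_ext (fun x : X => U ⊓ (j x).opensRange) (fun x => inf_le_left)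
    (fun x hxU => Opens.mem_iSup.2 ⟨x, hxU, hx x⟩) fun x => ?_
  have e : (j x) ''ᵁ (j x) ⁻¹ᵁ U = (j x).opensRange ⊓ U := (j x).image_preimage_eq_opensRange_inf U
  have := (mono_pbMap_iff (j x) f).1 (hf x) ((j x) ⁻¹ᵁ U)
  rw [e] at this
  have h2 : rs M (inf_le_right : (j x).opensRange ⊓ U ≤ U) m = 0 :=
    this (by rw [ap_rs, hm, map_zero, map_zero])
  rw [map_zero, ← map_zero (rs M (inf_comm U _).le), ← h2, rs_rs]

end

/-! ### Vector bundles: local lifting, tensor products and flatness. -/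

section
open Limits
variable {X Y Z : Scheme.{u}} {M N P : X.Modules}

lemma exists_toShMod_zero {P : X.PresheafOfModules} {U : X.Opens} (s : P.obj (op U))
    (h : toShMod P U s = 0) {x : X} (hx : x ∈ U) :
    ∃ (V : X.Opens) (i : V ≤ U), x ∈ V ∧ P.map (homOfLE i).op s = 0 := by
  have h0 : toShMod P U s = toShMod P U 0 := by
    rw [h]
    exact (map_zero ((toSheafify (Opens.grothendieckTopology X) P.presheaf).app (op U)).hom).symm
  obtain ⟨V, i, hi, hV⟩ := Presheaf.equalizerSieve_mem (Opens.grothendieckTopology X)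
    (toSheafify (Opens.grothendieckTopology X) P.presheaf) (X := op U) s (0 : P.obj (op U)) h0 x hx
  exact ⟨V, leOfHom i, hV, hi.trans (map_zero (P.presheaf.map i.op).hom)⟩

/-- An epimorphism of sheaves is locally surjective. The map from N to the sheaf associated with the
presheaf cokernel C vanishes after composition with f, hence vanishes. So the class of n in C is
locally zero, which means that n is locally an image. -/
lemma exists_lift_of_epi (f : M ⟶ N) [Epi f] {U : X.Opens} (n : Γ(N, U)) {x : X} (hx : x ∈ U) :
    ∃ (V : X.Opens) (i : V ≤ U) (m : Γ(M, V)), x ∈ V ∧ ap f V m = rs N i n := by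
  let C := cokernel f.val
  let c : N.val ⟶ C := cokernel.π f.val
  let k : N ⟶ shMod C := mkHom (fun U => AddMonoidHom.mk' (fun n => toShMod C U (c.app (op U) n))
      fun n n' => (congrArg (toShMod C U) (map_add (c.app (op U)).hom n n')).trans
        (toShMod_add _ _ _))
    (fun U r n => (congrArg (toShMod C U) ((c.app (op U)).hom.map_smul r n)).trans
      (toShMod_smul U r _))
    (fun {U V} h n => (congrArg (toShMod C V)
      (PresheafOfModules.naturality_apply c (homOfLE h).op n)).trans (toShMod_rs h _).symm)
  have hc : f.val ≫ c = 0 := cokernel.condition f.val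
  have hk : k = 0 := by
    rw [← cancel_epi f, comp_zero]
    refine hom_ext_ap fun U m => ?_
    have h1 : c.app (op U) (f.val.app (op U) m) = 0 :=
      congrArg (fun t => (PresheafOfModules.Hom.app t (op U)).hom m) hc
    exact (congrArg (toShMod C U) h1).trans
      (map_zero ((toSheafify (Opens.grothendieckTopology X) C.presheaf).app (op U)).hom)
  obtain ⟨V, i, hV, h⟩ := exists_toShMod_zero (P := C) (c.app (op U) n)
    (show ap k U n = 0 by rw [hk]; rfl) hx
  have ex : (ShortComplex.mk f.val c hc).Exact := ShortComplex.exact_cokernel f.val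
  have ex' := (ex.map_of_epi_of_preservesCokernel (PresheafOfModules.evaluation _ (op V))
    inferInstance inferInstance)
  obtain ⟨m, hm⟩ := (ShortComplex.moduleCat_exact_iff _).1 ex' (rs N i n)
    ((PresheafOfModules.naturality_apply c (homOfLE i).op n).trans h)
  exact ⟨V, i, m, hV, hm⟩

/-- Composition of pullbacks. -/
def pbComp (i : Y ⟶ Z) (j : Z ⟶ X) (M : X.Modules) : pb i (pb j M) ≅ pb (i ≫ j) M :=
  (Scheme.Modules.pullbackComp i j).app M

lemma FinFree.pb {M : Z.Modules} (h : FinFree.{u} (unitMod Z) M) (i : Y ⟶ Z) :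
    FinFree.{u} (unitMod Y) (pb i M) :=
  (h.map (Scheme.Modules.pullback i)).of_iso (pullUnitIso i) (Iso.refl _)

/-- Vector bundles: modules that are locally finite direct sums of copies of the structure
sheaf. -/
def IsVB (M : X.Modules) : Prop := ∀ x : X, ∃ (Y : Scheme.{u}) (j : Y ⟶ X) (_ : IsOpenImmersion j),
  x ∈ j.opensRange ∧ FinFree.{u} (unitMod Y) (pb j M)

lemma IsVB.exists_opens (h : IsVB M) (x : X) :
    ∃ U : X.Opens, x ∈ U ∧ FinFree.{u} (unitMod U.toScheme) (pb U.ι M) := by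
  obtain ⟨Y, j, _, hx, hj⟩ := h x
  refine ⟨j.opensRange, hx, (hj.pb j.isoOpensRange.inv).of_iso (Iso.refl _) (pbComp _ _ _ ≪≫
    (Scheme.Modules.pullbackCongr ?_).app M)⟩
  rw [Iso.inv_comp_eq, Scheme.Hom.isoOpensRange_hom_ι]

lemma FinFree.pb_le {U V : X.Opens} (h : FinFree.{u} (unitMod U.toScheme) (F1.pb U.ι M))
    (i : V ≤ U) : FinFree.{u} (unitMod V.toScheme) (F1.pb V.ι M) :=
  (h.pb (X.homOfLE i)).of_iso (Iso.refl _) (pbComp _ _ _ ≪≫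
    (Scheme.Modules.pullbackCongr (X.homOfLE_ι i)).app M)

lemma IsVB.exists_opens₂ (h : IsVB M) (h' : IsVB N) (x : X) : ∃ U : X.Opens, x ∈ U ∧
    FinFree.{u} (unitMod U.toScheme) (pb U.ι M) ∧ FinFree.{u} (unitMod U.toScheme) (pb U.ι N) := by
  obtain ⟨U, hU, h⟩ := h.exists_opens x
  obtain ⟨V, hV, h'⟩ := h'.exists_opens x
  exact ⟨U ⊓ V, ⟨hU, hV⟩, h.pb_le inf_le_left, h'.pb_le inf_le_right⟩

lemma isVB_of_opens (h : ∀ x, ∃ U : X.Opens, x ∈ U ∧ FinFree.{u} (unitMod U.toScheme) (pb U.ι M)) :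
    IsVB M := fun x => by
  obtain ⟨U, hU, h⟩ := h x
  exact ⟨U, U.ι, inferInstance, by rwa [Scheme.Opens.opensRange_ι], h⟩

lemma IsVB.tens (h : IsVB M) (h' : IsVB N) : IsVB (tensMod M N) := isVB_of_opens fun x => by
  obtain ⟨U, hU, h, h'⟩ := h.exists_opens₂ h' x
  exact ⟨U, hU, (h.tens h').of_iso (Iso.refl _) (pullTensIso U.ι M N).symm⟩

lemma isVB_unitMod : IsVB (unitMod X) := isVB_of_opens fun x =>
  ⟨⊤, trivial, (FinFree.self _).of_iso (Iso.refl _) (pullUnitIso _).symm⟩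

lemma isVB_of_isZero (h : IsZero M) : IsVB M := isVB_of_opens fun x =>
  ⟨⊤, trivial, .of_isZero ((Scheme.Modules.pullback _).map_isZero h)⟩

/-- Vector bundles are flat: being a monomorphism is local, pullback to an open subscheme commutes
with the tensor product, and there M is finite free. -/
lemma IsVB.mono_tens (h : IsVB M) (f : N ⟶ P) [Mono f] : Mono (tensModMap (𝟙 M) f) :=
  mono_of_local _ fun x => by
    obtain ⟨Y, j, hj, hx, h⟩ := h x
    have := mono_pbMap j f
    have h1 := h.mono_tens (pbMap j f)
    have h2 := pullTensInv_nat (e := j) (𝟙 M) f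
    rw [show pbMap j (𝟙 M) = 𝟙 (pb j M) from CategoryTheory.Functor.map_id _ _] at h2
    refine ⟨Y, j, hj, hx, ?_⟩
    have h3 : Mono (pullTensInv j M N) := (inferInstance : Mono (pullTensIso j M N).hom)
    have h4 : Mono (pbMap j (tensModMap (𝟙 M) f) ≫ pullTensInv j M P) := by
      rw [h2]
      infer_instance
    exact mono_of_mono _ (pullTensInv j M P)

end

/-! ### Extensions of vector bundles; locally free modules of finite type. -/

section
open Limits
variable {X Y Z : Scheme.{u}} {M N P : X.Modules}

lemma unitHom_ap {z : Γ(M, ⊤)} (g : M ⟶ N) : unitHom z ≫ g = unitHom (ap g ⊤ z) :=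
  unit_hom_ext fun U => by rw [ap_comp, unitHom_one, unitHom_one, ap_rs]

lemma pbMap_unit (j : Y ⟶ X) (f : unitMod X ⟶ M) :
    pbMap j f = pullUnit j ≫ unitHom (ps (W := ⊤) (U := ⊤) le_top (ap f ⊤ (oneMod ⊤))) :=
  pull_unit_ext fun U => by
    rw [ap_comp, pullUnit_one, pbMap_psec, unitHom_one, ← rs_oneMod le_top, ap_rs]
    exact (psec_rs j le_top _).symm.trans (rs_rs _ _ _).symm

/-- Each basis section of N lifts in a neighbourhood of x. Since there are finitely many of them,
the intersection of these neighbourhoods is open, and the lifts define a section of f over it. -/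
lemma exists_section_of_epi (f : M ⟶ N) [Epi f] (h : FinFree.{u} (unitMod X) N) (x : X) :
    ∃ V : X.Opens, x ∈ V ∧ ∃ σ : pb V.ι N ⟶ pb V.ι M, σ ≫ pbMap V.ι f = 𝟙 _ := by
  obtain ⟨I, _, ι, π, -, -, h⟩ := h
  choose V hV m hx hm using fun i => exists_lift_of_epi f (ap (ι i) ⊤ (oneMod ⊤))
    (x := x) trivial
  let W : X.Opens := ⟨⋂ i, V i, isOpen_iInter_of_finite fun i => (V i).2⟩
  have hW (i) : W ≤ V i := Set.iInter_subset (fun i => (V i : Set X)) i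
  have ht (i) : (⊤ : W.toScheme.Opens) ≤ W.ι ⁻¹ᵁ V i := fun y _ => hW i y.2
  refine ⟨W, Set.mem_iInter.2 hx, ∑ i, pbMap W.ι (π i) ≫ pullUnit W.ι ≫ unitHom (ps (ht i) (m i)),
    ?_⟩
  rw [Preadditive.sum_comp, ← (Scheme.Modules.pullback W.ι).map_id N, ← h, Functor.map_sum]
  refine Finset.sum_congr rfl fun i _ => ?_
  rw [Category.assoc, Category.assoc, unitHom_ap, ap_pbMap_ps, hm, ps_rs, Functor.map_comp]
  exact congrArg (pbMap W.ι (π i) ≫ ·) (pbMap_unit W.ι (ι i)).symm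

/-- Where the outer terms are free, the epimorphism has a section near every point, so the sequence
splits there and the middle term is a finite direct sum. -/
lemma IsVB.of_shortExact {S : ShortComplex X.Modules} (hS : S.ShortExact) (h₁ : IsVB S.X₁)
    (h₃ : IsVB S.X₃) : IsVB S.X₂ := fun x => by
  obtain ⟨U, hU, h₁, h₃⟩ := h₁.exists_opens₂ h₃ x
  have := hS.epi_g
  have := hS.mono_f
  have hg : Epi (pbMap U.ι S.g) := inferInstance
  obtain ⟨V, hV, σ, hσ⟩ := exists_section_of_epi (pbMap U.ι S.g) h₃ ⟨x, hU⟩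
  let F := Scheme.Modules.pullback U.ι ⋙ Scheme.Modules.pullback V.ι
  have hf : Mono (F.map S.f) := by
    have := mono_pbMap U.ι S.f
    exact mono_pbMap V.ι (pbMap U.ι S.f)
  have hF : F.Additive := inferInstance
  have hE : (S.map F).Exact := hS.exact.map_of_epi_of_preservesCokernel F inferInstance inferInstance
  let s := ShortComplex.Splitting.ofExactOfSection (S.map F) hE σ hσ hf
  have h := FinFree.of_splitting s (h₁.pb V.ι) (h₃.pb V.ι)
  refine ⟨V, V.ι ≫ U.ι, inferInstance, ⟨⟨⟨x, hU⟩, hV⟩, rfl⟩, h.of_iso (Iso.refl _) (pbComp _ _ _)⟩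

/-- The free module. -/
def freeMod (X : Scheme.{u}) (I : Type u) : X.Modules :=
  SheafOfModules.free (R := X.ringCatSheaf) I

/-- The inclusions of the summands of a free module. -/
def freeι {I : Type u} (i : I) : unitMod X ⟶ freeMod X I :=
  SheafOfModules.ιFree (R := X.ringCatSheaf) i

/-- Morphisms from a free module. -/
def freeDesc {I : Type u} (f : I → (unitMod X ⟶ M)) : freeMod X I ⟶ M :=
  Cofan.IsColimit.desc (SheafOfModules.isColimitFreeCofan (R := X.ringCatSheaf) I) f

lemma freeι_desc {I : Type u} (f : I → (unitMod X ⟶ M)) (i : I) : freeι i ≫ freeDesc f = f i :=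
  Cofan.IsColimit.fac (SheafOfModules.isColimitFreeCofan (R := X.ringCatSheaf) I) f i

lemma free_hom_ext {I : Type u} {f g : freeMod X I ⟶ M} (h : ∀ i, freeι i ≫ f = freeι i ≫ g) :
    f = g :=
  Cofan.IsColimit.hom_ext (SheafOfModules.isColimitFreeCofan (R := X.ringCatSheaf) I) _ _ h

lemma finFree_freeMod (I : Type u) [Finite I] : FinFree.{u} (unitMod X) (freeMod X I) := by
  classical
  have := Fintype.ofFinite I
  have h (i j : I) : freeι i ≫ freeDesc (fun i => if i = j then 𝟙 (unitMod X) else 0) =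
    if i = j then 𝟙 (unitMod X) else 0 := freeι_desc _ _
  refine ⟨I, inferInstance, freeι, fun j => freeDesc fun i => if i = j then 𝟙 _ else 0, fun i => ?_,
    fun i j hij => ?_, free_hom_ext fun i => ?_⟩
  · rw [h, if_pos rfl]
  · rw [h, if_neg hij]
  · rw [Preadditive.comp_sum]
    simp only [reassoc_of% h, ite_comp, zero_comp, Finset.sum_ite_eq, Finset.mem_univ, if_true,
      Category.id_comp, Category.comp_id]

lemma FinFree.exists_iso (h : FinFree.{u} (unitMod X) M) :
    ∃ I : Type u, Finite I ∧ Nonempty (freeMod X I ≅ M) := by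
  obtain ⟨I, _, ι, π, h₁, h₂, h₃⟩ := h
  refine ⟨I, inferInstance, ⟨⟨freeDesc ι, ∑ i, π i ≫ freeι i, free_hom_ext fun i => ?_, ?_⟩⟩⟩
  · rw [← Category.assoc, freeι_desc, Preadditive.comp_sum, Category.comp_id,
      Finset.sum_eq_single i, ← Category.assoc, h₁, Category.id_comp]
    · intro j _ hj
      rw [← Category.assoc, h₂ i j hj.symm, zero_comp]
    · simp
  · rw [Preadditive.sum_comp, ← h₃]
    refine Finset.sum_congr rfl fun i _ => ?_
    rw [Category.assoc, freeι_desc]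

lemma IsVB.isLocallyFree (h : IsVB M) : SheafOfModules.IsLocallyFree (R := X.ringCatSheaf) M ∧
    SheafOfModules.IsFiniteType (R := X.ringCatSheaf) M := lf_of_free M fun x => by
  obtain ⟨U, hU, h⟩ := h.exists_opens x
  obtain ⟨I, hI, ⟨e⟩⟩ := h.exists_iso
  exact ⟨U, I, hU, hI, ⟨e⟩⟩

/-- Pullbacks of free modules. -/
def pbFree (j : Y ⟶ X) (I : Type u) : freeMod Y I ≅ pb j (freeMod X I) :=
  SheafOfModules.mapFreeIso (pbFun j) I (pullUnitIso j).symm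

/-- The functor from modules to sheaves on Spec R is full and reflects epimorphisms, so the
statement is that a vector space spanned by finitely many elements has only finite bases. -/
lemma finite_of_epi_free {R : CommRingCat.{u}} (hR : IsField R) {I J : Type u} [Finite J]
    (f : freeMod (Spec R) J ⟶ freeMod (Spec R) I) [Epi f] : Finite I := by
  let _ := hR.toField
  let a (J : Type u) : (tilde.functor R).obj (ModuleCat.of R (J →₀ R)) ≅ freeMod (Spec R) J :=
    tildeFinsupp J
  obtain ⟨g, hg⟩ := (tilde.functor R).map_surjective ((a J).hom ≫ f ≫ (a I).inv)
  have h1 : Epi ((tilde.functor R).map g) := by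
    rw [hg]
    infer_instance
  have h2 : Epi g := (tilde.functor R).epi_of_epi_map h1
  have h3 := (ModuleCat.epi_iff_surjective g).1 h2
  have h4 : Module.Finite R (I →₀ R) := Module.Finite.of_surjective g.hom h3
  exact Module.Finite.finite_basis (Finsupp.basisSingleOne (R := R) (ι := I))

/-- Local freeness alone allows an infinite basis I. Finite type gives an epimorphism from a finite
free module near x; after pullback to the residue field of x it maps onto the free module on I, so I
is finite. -/
lemma isVB_of_isLocallyFree (h : SheafOfModules.IsLocallyFree (R := X.ringCatSheaf) M)
    (h' : SheafOfModules.IsFiniteType (R := X.ringCatSheaf) M) : IsVB M :=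
  isVB_of_opens fun x => by
  obtain ⟨U, I, hU, ⟨e⟩⟩ := exists_free_of_lf M h x
  obtain ⟨V, J, f, hV, hJ, hf⟩ := exists_epi_of_ft M h' x
  let c := X.fromSpecResidueField x
  have hc {W : X.Opens} (hW : x ∈ W) : Set.range c ⊆ Set.range W.ι := by
    rw [Scheme.range_fromSpecResidueField]
    simpa using hW
  let a := IsOpenImmersion.lift U.ι c (hc hU)
  let b := IsOpenImmersion.lift V.ι c (hc hV)
  have ha : a ≫ U.ι = c := IsOpenImmersion.lift_fac _ _ _
  have hb : b ≫ V.ι = c := IsOpenImmersion.lift_fac _ _ _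
  let e' : freeMod U I ≅ pb U.ι M := e
  let f' : freeMod V J ⟶ pb V.ι M := f
  have hf' : Epi f' := hf
  let i := pbComp a U.ι M ≪≫ (Scheme.Modules.pullbackCongr (ha.trans hb.symm)).app M ≪≫
    (pbComp b V.ι M).symm
  have := finite_of_epi_free (R := X.residueField x) (Field.toIsField _) ((pbFree b J).hom ≫ pbMap b f' ≫ i.inv ≫
    pbMap a e'.inv ≫ (pbFree a I).inv)
  exact ⟨U, hU, (finFree_freeMod I).of_iso (Iso.refl _) e'⟩

end

/-! ### The monoidal structure on quasi-coherent modules and on Bun. -/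

section
open MonoidalCategory OMod MZScheme
variable (𝒳 : F1Scheme.{u})

instance : (F1Module.isQCoh 𝒳).IsMonoidal where
  prop_unit := ⟨isQCoh_iff.2 isQC_unit, isQuasicoherent_unitMod⟩
  prop_tensor M N hM hN := ⟨isQCoh_iff.2 ((isQCoh_iff.1 hM.1).tens (isQCoh_iff.1 hN.1)),
    isQuasicoherent_tens hM.2 hN.2⟩

/-- This form is convenient for closure properties: conditions on all affine open sets for the first
component, and local finite direct sums for the second. -/
lemma isBun_iff (M : QCoh 𝒳) : isBun 𝒳 M ↔ M.obj.fst.IsFG ∧ M.obj.fst.IsProj ∧ IsVB M.obj.snd := by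
  constructor
  · rintro ⟨⟨h1, -, h2⟩, h3, h4⟩
    exact ⟨(isCoh_iff.1 h1).2, (isLocProj_iff.1 h3).2, isVB_of_isLocallyFree h4 h2⟩
  · rintro ⟨h1, h2, h3⟩
    have := isQCoh_iff.1 M.property.1
    exact ⟨⟨isCoh_iff.2 ⟨this, h1⟩, M.property.2, h3.isLocallyFree.2⟩, isLocProj_iff.2 ⟨this, h2⟩,
      h3.isLocallyFree.1⟩

instance : (isBun 𝒳).IsMonoidal where
  prop_unit := (isBun_iff 𝒳 _).2 ⟨isFG_unit, isProj_unit, isVB_unitMod⟩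
  prop_tensor M N hM hN := by
    have hM := (isBun_iff 𝒳 _).1 hM
    have hN := (isBun_iff 𝒳 _).1 hN
    exact (isBun_iff 𝒳 _).2 ⟨hM.1.tens hN.1, hM.2.1.tens hN.2.1, hM.2.2.tens hN.2.2⟩

/-- The componentwise tensor product. -/
def componentwiseTensor : ComponentwiseTensor 𝒳 where
  fstIso _ _ := Iso.refl _
  sndIso _ _ := Iso.refl _
  fstUnit := Iso.refl _
  sndUnit := Iso.refl _
  tensorHom_fst f g := (Category.id_comp _).trans (Category.comp_id _).symm
  tensorHom_snd f g := (Category.id_comp _).trans (Category.comp_id _).symm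
  ε_tensor M N := ⟨pullTensIso 𝒳.e M.obj.snd N.obj.snd,
    fun U m n => pullTensInv_psec m n,
    fun V m n => (congrArg (ap (pullTensInv 𝒳.e M.obj.snd N.obj.snd) _) (F1Module.tens_ε V m n)).trans
      (congrArg (fun t => ap t _ _) (pullTensIso 𝒳.e M.obj.snd N.obj.snd).inv_hom_id)⟩
  ε_unit V := (F1Module.unit_ε V).trans (unitHom_one _ _)
  associator_fst M N P U m n p := assoc_tmul m n p
  associator_snd M N P U m n p := tensAssoc_tmul m n p
  braiding_fst M N U m n := braid_tmul m n
  braiding_snd M N U m n := tensBraid_tmul m n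
  leftUnitor_fst M U a m := (congrArg (fun t : (unit 𝒳.tilde.toMonoidalSpace).Γ U =>
    (lunit M.obj.fst).app U (tmul t m)) (mul_one a).symm).trans (lunit_tmul a m)
  leftUnitor_snd M U a m := tensUnit_tmul a m
  rightUnitor_fst M U a m := ((congrArg ((lunit M.obj.fst).app U)
      (braid_tmul m (show (unit 𝒳.tilde.toMonoidalSpace).Γ U from a))).trans
    (congrArg (fun t : (unit 𝒳.tilde.toMonoidalSpace).Γ U => (lunit M.obj.fst).app U (tmul t m))
      (mul_one a).symm)).trans (lunit_tmul a m)
  rightUnitor_snd M U a m :=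
    (congrArg (ap (tensUnit M.obj.snd) U) (tensBraid_tmul _ _)).trans (tensUnit_tmul a m)

end

/-! ### Kernels of morphisms of modules over an 𝔽₁-scheme. -/

section
open Limits
variable {C : Type*} [Category* C] [Abelian C]

/-- As i and δ are monomorphisms, the kernel of S.g is also the kernel of S.g ≫ i ≫ δ, which β
identifies with T.g. The retraction of the splitting provides the inverse. -/
lemma exists_kernel_iso {S : ShortComplex C} (σ : S.Splitting) {D : C} (i : S.X₃ ⟶ D) [Mono i]
    {T : ShortComplex C} (hT : T.Exact) [Mono T.f] (β : S.X₂ ≅ T.X₂) (δ : D ⟶ T.X₃) [Mono δ]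
    (h : S.g ≫ i ≫ δ = β.hom ≫ T.g) : ∃ α : S.X₁ ≅ T.X₁, α.hom ≫ T.f = S.f ≫ β.hom := by
  have h1 : (S.f ≫ β.hom) ≫ T.g = 0 := by rw [Category.assoc, ← h, S.zero_assoc, zero_comp]
  have h2 : (T.f ≫ β.inv) ≫ S.g = 0 := by
    rw [← cancel_mono i, ← cancel_mono δ, Category.assoc, Category.assoc, h, Category.assoc,
      Iso.inv_hom_id_assoc, T.zero, zero_comp, zero_comp]
  have h3 : (T.f ≫ β.inv ≫ σ.r) ≫ S.f = T.f ≫ β.inv := by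
    have := congrArg ((T.f ≫ β.inv) ≫ ·) σ.id
    rw [Preadditive.comp_add, ← Category.assoc _ S.g, h2, zero_comp, add_zero,
      Category.comp_id] at this
    simpa using this
  have h4 : hT.lift (S.f ≫ β.hom) h1 ≫ T.f = S.f ≫ β.hom := hT.lift_f _ _
  have : Mono S.f := σ.mono_f
  refine ⟨⟨hT.lift (S.f ≫ β.hom) h1, T.f ≫ β.inv ≫ σ.r, ?_, ?_⟩, h4⟩
  · rw [← cancel_mono S.f, Category.assoc, h3, reassoc_of% h4, Iso.hom_inv_id, Category.id_comp,
      Category.comp_id]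
  · rw [← cancel_mono T.f, Category.assoc, h4, ← Category.assoc, h3, Category.assoc,
      Iso.inv_hom_id, Category.comp_id, Category.id_comp]

end

namespace OMod
variable {X : MZScheme.{u}} {M N P S T : OMod X.toMonoidalSpace}

lemma app_congr {f g : M ⟶ N} (h : f = g) (U : X.Opn) (m : M.Γ U) : f.app U m = g.app U m := by
  rw [h]

/-- A preimage near the closed point of V is already defined over all of V. -/
lemma surjective_of_locally (f : M ⟶ N) (hf : ∀ (U : X.Opn) (n : N.Γ U) (x : X.carrier), x ∈ U →
      ∃ (V : X.Opn) (h : V ≤ U) (m : M.Γ V), x ∈ V ∧ f.app V m = N.res h n) (V : X.AffOpn) :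
    Function.Surjective (f.app V.1) := fun n => by
  rcases V.2.exists_closed with ⟨h0, -⟩ | ⟨c, hc, hV⟩
  · exact ⟨0, N.subsingleton_of_zero_eq_one h0 _ _⟩
  · obtain ⟨W, h, m, hW, e⟩ := hf V.1 n c hc
    obtain rfl : W = V.1 := le_antisymm h (hV W hW)
    refine ⟨m, e.trans ?_⟩
    exact PreMod.res_rfl _ _

/-- The inclusion k is a kernel of q: a value of t that lies in the summand S is recovered from its
image under q, which is zero, so all values lie in N. -/
lemma IsWedge.factor {k : N ⟶ P} {s : S ⟶ P} (H : IsWedge k s) {q : P ⟶ S} (hq : s ≫ q = 𝟙 S)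
    {r : P ⟶ N} (hr : k ≫ r = 𝟙 N) (t : T ⟶ P) (ht : t ≫ q = zeroHom T S) : (t ≫ r) ≫ k = t :=
  hom_aff_ext fun V m => by
    change k.app V.1 (r.app V.1 (t.app V.1 m)) = t.app V.1 m
    rcases H.cover V (t.app V.1 m) with ⟨n, hn⟩ | ⟨x, hx⟩
    · rw [← hn]
      exact congrArg _ (app_congr hr V.1 n)
    · have h0 : x = 0 := by
        refine (app_congr hq V.1 x).symm.trans ?_
        change q.app V.1 (s.app V.1 x) = 0
        rw [hx]
        exact app_congr ht V.1 m
      rw [← hx, h0, hom_zero, hom_zero, hom_zero]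

lemma IsWedge.mono {k : N ⟶ P} {s : S ⟶ P} (H : IsWedge k s) {f g : T ⟶ N} (h : f ≫ k = g ≫ k) :
    f = g := hom_aff_ext fun V m => H.inl_inj V (app_congr h V.1 m)

lemma injective_of_aff {f : M ⟶ N} (h : ∀ V : X.AffOpn, Function.Injective (f.app V.1))
    (U : X.Opn) : Function.Injective (f.app U) := fun m m' e =>
  aff_ext fun V hV => h V (by rw [hom_res, hom_res, e])

end OMod

namespace F1Module
open Limits ZeroObject OMod MZScheme
variable {𝒳 : F1Scheme.{u}} {L M N P T : F1Module 𝒳}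

variable (M N) in
/-- The zero morphism. -/
def zeroF : M ⟶ N where
  fst := zeroHom M.fst N.fst
  snd := 0
  comm := by rw [zMod_zeroHom, zero_comp, Functor.map_zero, comp_zero]

lemma isZeroHom_iff {f : M ⟶ N} : IsZeroHom f ↔ f = zeroF M N :=
  ⟨fun h => hom_ext (PreMod.Hom.ext (funext fun U => funext fun m => h.1 U m)) h.2,
    fun h => h ▸ ⟨fun _ _ => rfl, rfl⟩⟩

variable (𝒳) in
/-- The zero module. -/
def zeroObj : F1Module 𝒳 where
  fst := zeroMod 𝒳.tilde
  snd := 0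
  ε := (isZero_zMod isZ_zeroMod).iso ((Scheme.Modules.pullback 𝒳.e).map_isZero (isZero_zero _))

lemma isZero_of (h : M.fst.IsZ) (h' : IsZero M.snd) : IsZero M where
  unique_to T := ⟨⟨⟨zeroF _ _⟩, fun f => hom_ext
    (hom_aff_ext fun V m => by rw [h V m, hom_zero, hom_zero]) (h'.eq_of_src _ _)⟩⟩
  unique_from T := ⟨⟨⟨zeroF _ _⟩, fun f => hom_ext
    (hom_aff_ext fun V m => h V _ |>.trans (h V _).symm) (h'.eq_of_tgt _ _)⟩⟩

lemma isZero_zeroObj : IsZero (zeroObj 𝒳) := isZero_of isZ_zeroMod (isZero_zero _)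

lemma isZ_fst (h : IsZero M) : M.fst.IsZ := fun V m =>
  app_congr (congrArg Hom.fst (h.eq_of_src (𝟙 M) (zeroF M M))) V.1 m

lemma isZero_snd (h : IsZero M) : IsZero M.snd :=
  (IsZero.iff_id_eq_zero _).2 (congrArg Hom.snd (h.eq_of_src (𝟙 M) (zeroF M M)))

/-- By flatness, e^* of the kernel of the second component is the kernel of e^*M → e^*N. On the
other side the split sequence of base extensions makes K_ℤ the kernel of M_ℤ → S_ℤ, hence of M_ℤ →
N_ℤ. So ε_M restricts to an isomorphism of kernels, and the componentwise kernel is a module with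
the universal property. Factoring ψ̃ through a split injection i covers morphisms that are not
surjective. -/
lemma exists_kernel {ψ : M ⟶ N} (hf : IsFlatFor 𝒳.e ψ.snd) {K S : OMod 𝒳.tilde.toMonoidalSpace}
    {k : K ⟶ M.fst} {s : S ⟶ M.fst} (H : IsWedge k s) {q : M.fst ⟶ S} (hq : s ≫ q = 𝟙 S)
    (hq' : k ≫ q = zeroHom K S) {i : S ⟶ N.fst} {ρ : N.fst ⟶ S} (hi : i ≫ ρ = 𝟙 S)
    (hψ : ψ.fst = q ≫ i) :
    ∃ α : 𝒳.tilde.zMod.obj K ≅ pb 𝒳.e (kernel ψ.snd), ∃ κ : (⟨K, kernel ψ.snd, α⟩ : F1Module 𝒳) ⟶ M,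
      κ.fst = k ∧ κ.snd = kernel.ι ψ.snd ∧ IsKernel κ ψ := by
  obtain ⟨hm, he⟩ := hf
  obtain ⟨w, ⟨σ⟩⟩ := zMod_splitting H hq hq'
  have hi' : 𝒳.tilde.zMod.map i ≫ 𝒳.tilde.zMod.map ρ = 𝟙 _ :=
    (𝒳.tilde.zMod.map_comp _ _).symm.trans ((congrArg _ hi).trans (𝒳.tilde.zMod.map_id _))
  have : Mono (𝒳.tilde.zMod.map i) := (SplitMono.mk _ hi').mono
  have hc : 𝒳.tilde.zMod.map q ≫ 𝒳.tilde.zMod.map i ≫ N.ε.hom =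
      M.ε.hom ≫ (Scheme.Modules.pullback 𝒳.e).map ψ.snd := by
    rw [← Category.assoc, ← Functor.map_comp, ← hψ]
    exact ψ.comm
  obtain ⟨α, hα⟩ := @exists_kernel_iso _ _ _ _ σ _ (𝒳.tilde.zMod.map i) this _ he hm M.ε N.ε.hom
    inferInstance hc
  refine ⟨α, ⟨k, kernel.ι ψ.snd, hα.symm⟩, rfl, rfl, isZeroHom_iff.2 (hom_ext ?_ ?_), fun T t ht => ?_⟩
  · change k ≫ ψ.fst = _
    rw [hψ, ← Category.assoc, hq']
    exact zeroHom_comp _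
  · exact kernel.condition ψ.snd
  · have ht := isZeroHom_iff.1 ht
    have h1 : t.fst ≫ q = zeroHom _ _ := by
      have e : (t.fst ≫ q) ≫ i = zeroHom _ _ := by
        rw [Category.assoc, ← hψ]
        exact congrArg Hom.fst ht
      have := congrArg (· ≫ ρ) e
      simp only [Category.assoc, hi, zeroHom_comp] at this
      rwa [Category.comp_id] at this
    have h2 : t.snd ≫ ψ.snd = 0 := congrArg Hom.snd ht
    obtain ⟨r, hr, -⟩ := H.exists_retr
    have h3 := H.factor hq hr t.fst h1
    refine ⟨⟨t.fst ≫ r, kernel.lift ψ.snd t.snd h2, ?_⟩, hom_ext h3 (kernel.lift_ι _ _ _), fun s' hs' => ?_⟩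
    · have h4 : α.hom ≫ (Scheme.Modules.pullback 𝒳.e).map (kernel.ι ψ.snd) =
        𝒳.tilde.zMod.map k ≫ M.ε.hom := hα
      have h5 : 𝒳.tilde.zMod.map t.fst ≫ M.ε.hom =
        T.ε.hom ≫ (Scheme.Modules.pullback 𝒳.e).map t.snd := t.comm
      -- Compatibility of the factorization with ε is checked inside e^*M, into which the pullback
      -- of the kernel embeds by flatness.
      rw [← cancel_mono ((Scheme.Modules.pullback 𝒳.e).map (kernel.ι ψ.snd)), Category.assoc,
        Category.assoc, h4, ← Category.assoc, ← Functor.map_comp, h3, ← Functor.map_comp,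
        kernel.lift_ι, h5]
    · refine hom_ext (H.mono ?_) ((cancel_mono (kernel.ι ψ.snd)).1 ?_)
      · exact (congrArg Hom.fst hs').trans h3.symm
      · exact (congrArg Hom.snd hs').trans (kernel.lift_ι _ _ _).symm

end F1Module

section
open Limits

/-- The first term of a short exact sequence is a kernel of the second map, so the condition on the
chosen kernel can be read off from the sequence itself. -/
lemma isFlat_of_exact {C D : Type*} [Category* C] [Abelian C] [Category* D] [Abelian D]
    {S : ShortComplex C} (hS : S.ShortExact) (F : C ⥤ D) [F.Additive] (hm : Mono (F.map S.f))
    (hE : (S.map F).Exact) : Mono (F.map (kernel.ι S.g)) ∧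
      (ShortComplex.mk (F.map (kernel.ι S.g)) (F.map S.g)
        (by rw [← F.map_comp, kernel.condition, F.map_zero])).Exact := by
  let e : S.X₁ ≅ kernel S.g := IsLimit.conePointUniqueUpToIso hS.fIsKernel (limit.isLimit _)
  have he : e.inv ≫ S.f = kernel.ι S.g :=
    IsLimit.conePointUniqueUpToIso_inv_comp hS.fIsKernel (limit.isLimit _) WalkingParallelPair.zero
  have h0 : F.map (kernel.ι S.g) ≫ F.map S.g = 0 := by
    rw [← F.map_comp, kernel.condition, F.map_zero]
  refine ⟨?_, ShortComplex.exact_of_iso (S₁ := S.map F) (S₂ := ShortComplex.mk _ _ h0)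
    (ShortComplex.isoMk (F.mapIso e) (Iso.refl _) (Iso.refl _) ?_ ?_) hE⟩
  · rw [← he, F.map_comp]
    infer_instance
  · refine Eq.trans ?_ (Category.comp_id (F.map S.f)).symm
    change F.map e.hom ≫ F.map (kernel.ι S.g) = F.map S.f
    rw [← F.map_comp, ← he, Iso.hom_inv_id_assoc]
  · exact (Category.id_comp (F.map S.g)).trans (Category.comp_id (F.map S.g)).symm

end

/-! ### Admissible sequences are componentwise wedges and short exact sequences. -/

namespace F1Module
open Limits OMod MZScheme
variable {𝒳 : F1Scheme.{u}} {L M N P T K K' : F1Module 𝒳}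

/-- Componentwise split or short exact sequences. -/
structure CompExact (φ : L ⟶ M) (ψ : M ⟶ N) : Prop where
  exists_wedge : ∃ s : N.fst ⟶ M.fst, IsWedge φ.fst s ∧ φ.fst ≫ ψ.fst = zeroHom _ _ ∧
    s ≫ ψ.fst = 𝟙 _
  exists_shortExact : ∃ w : φ.snd ≫ ψ.snd = 0, (ShortComplex.mk φ.snd ψ.snd w).ShortExact

lemma IsKernel.exists_iso {k : K ⟶ M} {k' : K' ⟶ M} {ψ : M ⟶ N} (h : IsKernel k ψ)
    (h' : IsKernel k' ψ) : ∃ e : K ≅ K', e.hom ≫ k' = k := by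
  obtain ⟨a, ha, -⟩ := h'.2 K k h.1
  obtain ⟨b, hb, -⟩ := h.2 K' k' h'.1
  obtain ⟨c, -, hc⟩ := h.2 K k h.1
  obtain ⟨d, -, hd⟩ := h'.2 K' k' h'.1
  refine ⟨⟨a, b, ?_, ?_⟩, ha⟩
  · exact (hc _ (by change _ ≫ _ = _; rw [Category.assoc, hb, ha])).trans (hc _ (Category.id_comp _)).symm
  · exact (hd _ (by change _ ≫ _ = _; rw [Category.assoc, ha, hb])).trans (hd _ (Category.id_comp _)).symm

/-- Kernels are unique up to isomorphism, so the kernel that occurs in the definition of exactness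
may be replaced by an explicit one. -/
lemma ExactAt.exists_fac {φ : L ⟶ M} {ψ : M ⟶ N} (h : ExactAt φ ψ) {κ : K ⟶ M}
    (hκ : IsKernel κ ψ) : ∃ p : L ⟶ K, p ≫ κ = φ ∧
      (∀ V : 𝒳.tilde.AffOpn, Function.Surjective (p.fst.app V.1)) ∧ Epi p.snd := by
  obtain ⟨K', k', hk', p, hp, -, -, hs, he⟩ := h
  obtain ⟨e, h⟩ := hk'.exists_iso hκ
  have e1 : IsIso e.hom.snd := ⟨e.inv.snd, congrArg Hom.snd e.hom_inv_id,
    congrArg Hom.snd e.inv_hom_id⟩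
  refine ⟨p ≫ e.hom, by rw [Category.assoc, h, hp], fun V x => ?_, ?_⟩
  · obtain ⟨l, hl⟩ := surjective_of_locally p.fst hs V (e.inv.fst.app V.1 x)
    refine ⟨l, ?_⟩
    change e.hom.fst.app V.1 (p.fst.app V.1 l) = x
    rw [hl]
    exact app_congr (congrArg Hom.fst e.inv_hom_id) V.1 x
  · rw [comp_snd]
    infer_instance

lemma isKernel_id_zero (hO : IsZero T) (b : M ⟶ T) : IsKernel (𝟙 M) b :=
  ⟨isZeroHom_iff.2 (hO.eq_of_tgt _ _), fun S t _ => ⟨t, Category.comp_id _, fun s hs => by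
    rw [← hs, Category.comp_id]⟩⟩

/-- Exactness is evaluated from right to left. At the third term it makes ψ surjective in both
components, so that the kernel of ψ̃ splits off; at the middle term it makes φ an epimorphism p onto
this kernel; at the first term it makes the kernel of p vanish. -/
lemma IsAdmissible.compExact {φ : L ⟶ M} {ψ : M ⟶ N} (h : IsAdmissible φ ψ) (hM : M.fst.IsQC)
    (hMp : M.fst.IsProj) (hN : N.fst.IsQC) (hNp : N.fst.IsProj) : CompExact φ ψ := by
  obtain ⟨⟨O, hO, a, b, ha, hφψ, hb⟩, hφ, hψ⟩ := h
  -- The kernel of a morphism to a zero object is the identity, so exactness at the last term says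
  -- that ψ itself is surjective in both components.
  obtain ⟨ψ', hψ', hψs, hψe⟩ := hb.exists_fac (isKernel_id_zero hO b)
  obtain rfl : ψ' = ψ := (Category.comp_id _).symm.trans hψ'
  obtain ⟨K, k, s, H, hk, hs⟩ := (isNormal_iff.1 hψ.1).exists_isWedge hψs hN hNp
  obtain ⟨α, κ, rfl, hκ2, hκ⟩ := exists_kernel hψ.2 H hs hk (Category.comp_id (𝟙 N.fst))
    (Category.comp_id _).symm
  obtain ⟨p, hp, hps, hpe⟩ := hφψ.exists_fac hκ
  have hp1 : p.fst ≫ κ.fst = φ.fst := congrArg Hom.fst hp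
  have hp2 : p.snd ≫ kernel.ι ψ'.snd = φ.snd := (congrArg (p.snd ≫ ·) hκ2).symm.trans (congrArg Hom.snd hp)
  have hpn : IsNrm p.fst := fun V m m' e => by
    refine ((isNormal_iff.1 hφ.1) V m m' ?_).imp_right fun h => ?_
    · rw [← hp1]
      exact congrArg (κ.fst.app V.1) e
    · rw [← hp1] at h
      exact H.inl_inj V (h.trans (hom_zero κ.fst V.1).symm)
  -- The kernel of ψ̃ is a wedge summand of the middle term, hence quasi-coherent and projective,
  -- and the splitting argument applies to p as well. Since φ̃ is p̃ followed by a split injection,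
  -- the kernel of φ is also componentwise.
  obtain ⟨L', l, σ, H', hl, hσ⟩ := hpn.exists_isWedge hps (H.isQC_left hM) (H.isProj_left hMp)
  obtain ⟨r, hr, -⟩ := H.exists_retr
  obtain ⟨α', κ', hκ1', hκ2', hκ'⟩ := exists_kernel hφ.2 H' hσ hl hr hp1.symm
  obtain ⟨z, hz, hzs, hze⟩ := ha.exists_fac hκ'
  -- The kernel of φ is the image of a zero object, so both of its components vanish.
  have hL' : L'.IsZ := fun V m => by
    obtain ⟨o, rfl⟩ := hzs V m
    rw [isZ_fst hO V o, hom_zero]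
  have hk0 : IsZero (kernel φ.snd) := (isZero_snd hO).of_epi z.snd
  have hmono : Mono φ.snd := Preadditive.mono_of_kernel_iso_zero (hk0.iso (isZero_zero _))
  have hpi (V : 𝒳.tilde.AffOpn) : Function.Injective (p.fst.app V.1) := fun m m' e => by
    have key (m : L.fst.Γ V.1) : σ.app V.1 (p.fst.app V.1 m) = m := by
      rcases H'.cover V m with ⟨n, rfl⟩ | ⟨t, rfl⟩
      · rw [hL' V n, hom_zero, hom_zero, hom_zero]
      · exact congrArg _ (app_congr hσ V.1 t)
    rw [← key m, e, key]
  have hw : φ.snd ≫ ψ'.snd = 0 := by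
    rw [← hp2, Category.assoc, kernel.condition, comp_zero]
  refine ⟨⟨s, H.of_iso (isoOfAff p.fst fun V => ⟨hpi V, hps V⟩) (Iso.refl _) (Iso.refl _) ?_ ?_, ?_, hs⟩,
    hw, ⟨?_⟩⟩
  · exact (Category.comp_id _).trans hp1.symm
  · exact (Category.comp_id _).trans (Category.id_comp _).symm
  · rw [← hp1, Category.assoc, hk]
    rfl
  · rw [ShortComplex.exact_iff_epi_kernel_lift]
    have : kernel.lift ψ'.snd φ.snd hw = p.snd := by
      rw [← cancel_mono (kernel.ι ψ'.snd), kernel.lift_ι, hp2]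
    change Epi (kernel.lift ψ'.snd φ.snd hw)
    rw [this]
    exact hpe

/-- A split injection of first components stays split after base extension, and ε identifies its
base extension with e^*φ. In this way injectivity after pullback follows without exactness of e^*.
-/
lemma mono_pull_snd {φ : L ⟶ M} {r : M.fst ⟶ L.fst} (hr : φ.fst ≫ r = 𝟙 _) :
    Mono ((Scheme.Modules.pullback 𝒳.e).map φ.snd) := by
  have hr' : 𝒳.tilde.zMod.map φ.fst ≫ 𝒳.tilde.zMod.map r = 𝟙 _ :=
    (𝒳.tilde.zMod.map_comp _ _).symm.trans ((congrArg _ hr).trans (𝒳.tilde.zMod.map_id _))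
  have h1 : Mono (𝒳.tilde.zMod.map φ.fst) := (SplitMono.mk _ hr').mono
  have h2 : Mono (L.ε.hom ≫ (Scheme.Modules.pullback 𝒳.e).map φ.snd) := by
    rw [← φ.comm]
    infer_instance
  rw [← L.ε.inv_hom_id_assoc ((Scheme.Modules.pullback 𝒳.e).map φ.snd)]
  infer_instance

lemma CompExact.isKernel {φ : L ⟶ M} {ψ : M ⟶ N} (h : CompExact φ ψ) : IsKernel φ ψ := by
  obtain ⟨⟨s, H, h1, h2⟩, w, hS⟩ := h
  have hm := hS.mono_f
  refine ⟨isZeroHom_iff.2 (hom_ext h1 w), fun T t ht => ?_⟩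
  have ht := isZeroHom_iff.1 ht
  obtain ⟨r, hr, -⟩ := H.exists_retr
  have h3 := H.factor h2 hr t.fst (congrArg Hom.fst ht)
  have h4 : hS.exact.lift t.snd (congrArg Hom.snd ht) ≫ φ.snd = t.snd := hS.exact.lift_f _ _
  have hφm : Mono ((Scheme.Modules.pullback 𝒳.e).map φ.snd) := mono_pull_snd hr
  refine ⟨⟨t.fst ≫ r, hS.exact.lift t.snd (congrArg Hom.snd ht), ?_⟩, hom_ext h3 h4, fun s' hs' => ?_⟩
  · have h5 : 𝒳.tilde.zMod.map t.fst ≫ M.ε.hom =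
        T.ε.hom ≫ (Scheme.Modules.pullback 𝒳.e).map t.snd := t.comm
    rw [← cancel_mono ((Scheme.Modules.pullback 𝒳.e).map φ.snd), Category.assoc, Category.assoc,
      ← φ.comm, ← Category.assoc, ← Functor.map_comp, h3, ← Functor.map_comp, h4, h5]
  · refine hom_ext (H.mono ?_) ((cancel_mono φ.snd).1 ?_)
    · exact (congrArg Hom.fst hs').trans h3.symm
    · exact (congrArg Hom.snd hs').trans h4.symm

/-- The morphism φ is the kernel of ψ. Flatness of ψ holds because e^* is right exact and e^*φ is a
monomorphism; flatness of φ holds because the kernel of its second component is zero. Normality of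
ψ̃ says that it is injective on the complementary summand and zero on the other. -/
lemma CompExact.isAdmissible {φ : L ⟶ M} {ψ : M ⟶ N} (h : CompExact φ ψ) : IsAdmissible φ ψ := by
  have hk := h.isKernel
  obtain ⟨⟨s, H, h1, h2⟩, w, hS⟩ := h
  have hm : Mono φ.snd := hS.mono_f
  have he : Epi ψ.snd := hS.epi_g
  obtain ⟨r, hr, -⟩ := H.exists_retr
  have hpm := mono_pull_snd hr
  have hlz : kernel.ι φ.snd = 0 := kernel.ι_of_mono φ.snd
  have hl0 : IsZero (kernel φ.snd) := isZero_kernel_of_mono _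
  have hO := isZero_zeroObj (𝒳 := 𝒳)
  have hex : (ShortComplex.mk φ.snd ψ.snd w).Exact := hS.exact
  have hpex := hex.map_of_epi_of_preservesCokernel (Scheme.Modules.pullback 𝒳.e)
    (inferInstanceAs (Epi ψ.snd)) inferInstance
  refine ⟨⟨zeroObj 𝒳, hO, zeroF _ _, zeroF _ _, ⟨_, zeroF (zeroObj 𝒳) L, ⟨?_, fun T t ht => ?_⟩, 𝟙 _,
    Category.id_comp _, fun U m m' _ => ?_, ?_, fun U m x hx => ⟨U, le_rfl, m, hx, ?_⟩, ?_⟩,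
    ⟨_, φ, hk, 𝟙 _, Category.id_comp _, injective_of_aff H.inl_inj, hm,
      fun U m x hx => ⟨U, le_rfl, m, hx, ?_⟩, ?_⟩,
    ⟨_, 𝟙 _, isKernel_id_zero hO _, ψ, Category.comp_id _, fun U m m' e => e, ?_,
      fun U m x hx => ⟨U, le_rfl, s.app U m, hx, ?_⟩, he⟩⟩, ⟨?_, ?_, ?_⟩, ⟨?_, ?_, ?_⟩⟩
  · exact isZeroHom_iff.2 (hO.eq_of_src _ _)
  · have e1 : t = zeroF _ _ := by
      have ht := isZeroHom_iff.1 ht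
      refine hom_ext (H.mono ?_) ((cancel_mono φ.snd).1 ?_)
      · exact (congrArg Hom.fst ht).trans (zeroHom_comp _).symm
      · exact (congrArg Hom.snd ht).trans zero_comp.symm
    exact ⟨zeroF _ _, by rw [e1]; exact hom_ext rfl zero_comp, fun _ _ => hO.eq_of_tgt _ _⟩
  · exact (isZ_zeroMod.eq_zero m).trans (isZ_zeroMod.eq_zero m').symm
  · exact ⟨fun _ _ _ => (isZero_snd hO).eq_of_tgt _ _⟩
  · exact (PreMod.res_rfl _ _).symm
  · exact inferInstanceAs (Epi (𝟙 _))
  · exact (PreMod.res_rfl _ _).symm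
  · exact inferInstanceAs (Epi (𝟙 _))
  · exact inferInstanceAs (Mono (𝟙 _))
  · exact (app_congr h2 U m).trans (PreMod.res_rfl _ _).symm
  · exact isNormal_iff.2 fun V m m' e => Or.inl (H.inl_inj V e)
  · exact ⟨fun _ _ _ => ((Scheme.Modules.pullback 𝒳.e).map_isZero hl0).eq_of_tgt _ _⟩
  · rw [ShortComplex.exact_iff_mono]
    · exact hpm
    · exact ((Scheme.Modules.pullback 𝒳.e).map_isZero hl0).eq_of_src _ _
  · refine isNormal_iff.2 fun V m m' e => ?_
    have key (n : L.fst.Γ V.1) : ψ.fst.app V.1 (φ.fst.app V.1 n) = 0 := app_congr h1 V.1 n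
    have key' (n : N.fst.Γ V.1) : ψ.fst.app V.1 (s.app V.1 n) = n := app_congr h2 V.1 n
    rcases H.cover V m with ⟨n, rfl⟩ | ⟨t, rfl⟩
    · exact Or.inr (key n)
    · rcases H.cover V m' with ⟨n, rfl⟩ | ⟨t', rfl⟩
      · exact Or.inr (e.trans (key n))
      · rw [key', key'] at e
        exact Or.inl (by rw [e])
  · exact (isFlat_of_exact hS _ hpm hpex).1
  · exact (isFlat_of_exact hS _ hpm hpex).2

end F1Module

/-! ### Push-outs along admissible monomorphisms. -/

section
open Limits

lemma isPushout_of_exists {C : Type*} [Category* C] {A B D E : C} {i : A ⟶ B} {f : A ⟶ D} {j : B ⟶ E}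
    {k : D ⟶ E} (w : i ≫ j = f ≫ k)
    (h : ∀ (T : C) (a : B ⟶ T) (b : D ⟶ T), i ≫ a = f ≫ b → ∃ d : E ⟶ T, j ≫ d = a ∧ k ≫ d = b)
    (h' : ∀ (T : C) (d d' : E ⟶ T), j ≫ d = j ≫ d' → k ≫ d = k ≫ d' → d = d') :
    IsPushout i f j k := by
  refine ⟨⟨w⟩, ⟨PushoutCocone.IsColimit.mk w (fun s => (h _ s.inl s.inr s.condition).choose)
    (fun s => (h _ s.inl s.inr s.condition).choose_spec.1)
    (fun s => (h _ s.inl s.inr s.condition).choose_spec.2) fun s m h₁ h₂ => ?_⟩⟩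
  have := (h _ s.inl s.inr s.condition).choose_spec
  exact h' _ _ _ (h₁.trans this.1.symm) (h₂.trans this.2.symm)

end

namespace MZScheme
open OMod
variable {X : MZScheme.{u}} {N P S : OMod X.toMonoidalSpace}

lemma zMod_wedge_ext {i : N ⟶ P} {s : S ⟶ P} (H : IsWedge i s) {Y : X.zScheme.Modules}
    {f g : X.zMod.obj P ⟶ Y} (h : X.zMod.map i ≫ f = X.zMod.map i ≫ g)
    (h' : X.zMod.map s ≫ f = X.zMod.map s ≫ g) : f = g := by
  obtain ⟨r, hr, hr'⟩ := H.exists_retr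
  obtain ⟨q, hq, hq'⟩ := H.symm.exists_retr
  have := zMod_wedge H hr hr' hq hq'
  rw [← Category.id_comp f, ← Category.id_comp g, ← this, Preadditive.add_comp,
    Preadditive.add_comp, Category.assoc, Category.assoc, h, h', Category.assoc, Category.assoc]

lemma exists_zMod_desc {i : N ⟶ P} {s : S ⟶ P} (H : IsWedge i s) {Y : X.zScheme.Modules}
    (f : X.zMod.obj N ⟶ Y) (g : X.zMod.obj S ⟶ Y) :
    ∃ d : X.zMod.obj P ⟶ Y, X.zMod.map i ≫ d = f ∧ X.zMod.map s ≫ d = g := by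
  obtain ⟨r, hr, hr'⟩ := H.exists_retr
  obtain ⟨q, hq, hq'⟩ := H.symm.exists_retr
  have key {A B D : OMod X.toMonoidalSpace} (x : A ⟶ B) (y : B ⟶ D) :
    X.zMod.map x ≫ X.zMod.map y = X.zMod.map (x ≫ y) := (X.zMod.map_comp _ _).symm
  refine ⟨X.zMod.map r ≫ f + X.zMod.map q ≫ g, ?_, ?_⟩
  · rw [Preadditive.comp_add, ← Category.assoc, ← Category.assoc, key, key, hr, hq', zMod_zeroHom,
      Limits.zero_comp, add_zero, CategoryTheory.Functor.map_id, Category.id_comp]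
  · rw [Preadditive.comp_add, ← Category.assoc, ← Category.assoc, key, key, hr', hq, zMod_zeroHom,
      Limits.zero_comp, zero_add, CategoryTheory.Functor.map_id, Category.id_comp]

end MZScheme

namespace F1Module
open Limits OMod MZScheme
variable {𝒳 : F1Scheme.{u}} {N P Q R T : F1Module 𝒳}

/-- Componentwise push-outs along the inclusion of a wedge summand. -/
structure CompPO {S : OMod 𝒳.tilde.toMonoidalSpace} (s : S ⟶ P.fst) (i : N ⟶ P) (f : N ⟶ Q)
    (j : P ⟶ R) (k : Q ⟶ R) : Prop where
  w : i ≫ j = f ≫ k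
  wedge : IsWedge i.fst s
  wedge' : IsWedge k.fst (s ≫ j.fst)
  snd : IsPushout i.snd f.snd j.snd k.snd

lemma precomp_comm (h : Q ⟶ R) (g : Q ⟶ T) {d : R.fst ⟶ T.fst} {d' : R.snd ⟶ T.snd}
    (h1 : h.fst ≫ d = g.fst) (h2 : h.snd ≫ d' = g.snd) :
    𝒳.tilde.zMod.map h.fst ≫ (𝒳.tilde.zMod.map d ≫ T.ε.hom) =
      𝒳.tilde.zMod.map h.fst ≫ (R.ε.hom ≫ (Scheme.Modules.pullback 𝒳.e).map d') := by
  rw [← Category.assoc, ← Category.assoc, ← Functor.map_comp, h1, h.comm, Category.assoc,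
    ← Functor.map_comp, h2, g.comm]

/-- The first component of R is the wedge of that of Q and the complement S, which gives the
required morphism on first components. Its compatibility with ε is tested on the two summands of the
base extension, where it follows from that of the morphisms on Q and P. -/
lemma CompPO.isPushout {S : OMod 𝒳.tilde.toMonoidalSpace} {s : S ⟶ P.fst} {i : N ⟶ P} {f : N ⟶ Q}
    {j : P ⟶ R} {k : Q ⟶ R} (h : CompPO s i f j k) : IsPushout i f j k := by
  obtain ⟨w, H, H', hs⟩ := h
  refine isPushout_of_exists w (fun T a b e => ?_) fun T d d' h₁ h₂ => ?_
  · obtain ⟨d, hd, hd'⟩ := H'.exists_desc b.fst (s ≫ a.fst)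
    have hj : j.fst ≫ d = a.fst := by
      refine H.hom_ext ?_ ((Category.assoc _ _ _).symm.trans hd')
      rw [← Category.assoc]
      refine (congrArg (· ≫ d) (congrArg Hom.fst w)).trans ?_
      rw [comp_fst, Category.assoc, hd]
      exact (congrArg Hom.fst e).symm
    have h1 := hs.inl_desc a.snd b.snd (congrArg Hom.snd e)
    have h2 := hs.inr_desc a.snd b.snd (congrArg Hom.snd e)
    refine ⟨⟨d, hs.desc a.snd b.snd (congrArg Hom.snd e), zMod_wedge_ext H' ?_ ?_⟩,
      hom_ext hj h1, hom_ext hd h2⟩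
    · exact precomp_comm k b hd h2
    · rw [Functor.map_comp, Category.assoc, precomp_comm j a hj h1, Category.assoc]
  · refine hom_ext (H'.hom_ext (congrArg Hom.fst h₂) ?_)
      (hs.hom_ext (congrArg Hom.snd h₁) (congrArg Hom.snd h₂))
    rw [Category.assoc, Category.assoc]
    exact congrArg (s ≫ ·) (congrArg Hom.fst h₁)

/-- The first component is the wedge of Q̃ and Z̃, the second the push-out of modules. Base
extension turns the wedge square into a push-out square, and e^* preserves push-outs as a left
adjoint. Through the ε's of N, P and Q both are push-outs of the same diagram, and the resulting
isomorphism is the ε of R; by construction it is compatible with j and k. -/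
lemma exists_compPO {Z : F1Module 𝒳} {i : N ⟶ P} {p : P ⟶ Z} (h : CompExact i p) {s : Z.fst ⟶ P.fst}
    (H : IsWedge i.fst s) (f : N ⟶ Q) :
    ∃ (R : F1Module 𝒳) (j : P ⟶ R) (k : Q ⟶ R), CompPO s i f j k := by
  obtain ⟨W, b, c, HW⟩ := exists_wedge Q.fst Z.fst
  obtain ⟨a, ha, ha'⟩ := H.exists_desc (f.fst ≫ b) c
  have key {A B D : OMod 𝒳.tilde.toMonoidalSpace} (x : A ⟶ B) (y : B ⟶ D) :
    𝒳.tilde.zMod.map x ≫ 𝒳.tilde.zMod.map y = 𝒳.tilde.zMod.map (x ≫ y) :=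
    (𝒳.tilde.zMod.map_comp _ _).symm
  have h1 : IsPushout (𝒳.tilde.zMod.map i.fst) (𝒳.tilde.zMod.map f.fst) (𝒳.tilde.zMod.map a)
      (𝒳.tilde.zMod.map b) := by
    refine isPushout_of_exists (by rw [key, key, ha]) (fun T x y e => ?_) fun T d d' h₁ h₂ =>
      zMod_wedge_ext HW h₂ ?_
    · obtain ⟨d, hd, hd'⟩ := exists_zMod_desc HW y (𝒳.tilde.zMod.map s ≫ x)
      refine ⟨d, zMod_wedge_ext H ?_ ?_, hd⟩
      · rw [← Category.assoc, key, ha, ← key, Category.assoc, hd, e]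
      · rw [← Category.assoc, key, ha', hd']
    · rw [← ha', ← key, Category.assoc, Category.assoc, h₁]
  have h2 : IsPushout i.snd f.snd (pushout.inl i.snd f.snd) (pushout.inr i.snd f.snd) :=
    IsPushout.of_hasPushout _ _
  have h3 := h2.map (Scheme.Modules.pullback 𝒳.e)
  have h4 : IsPushout (𝒳.tilde.zMod.map i.fst) (𝒳.tilde.zMod.map f.fst)
      (P.ε.hom ≫ (Scheme.Modules.pullback 𝒳.e).map (pushout.inl i.snd f.snd))
      (Q.ε.hom ≫ (Scheme.Modules.pullback 𝒳.e).map (pushout.inr i.snd f.snd)) :=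
    h3.of_iso N.ε.symm P.ε.symm Q.ε.symm (Iso.refl _)
      (by simp only [Iso.symm_hom]; rw [Iso.eq_inv_comp, ← Category.assoc, ← i.comm, Category.assoc, Iso.hom_inv_id, Category.comp_id])
      (by simp only [Iso.symm_hom]; rw [Iso.eq_inv_comp, ← Category.assoc, ← f.comm, Category.assoc, Iso.hom_inv_id, Category.comp_id])
      (by simp) (by simp)
  let ε := h1.isoIsPushout _ _ h4
  refine ⟨⟨W, pushout i.snd f.snd, ε⟩, ⟨a, pushout.inl _ _, ?_⟩, ⟨b, pushout.inr _ _, ?_⟩, ⟨?_, H, ?_, h2⟩⟩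
  · exact h1.inl_isoIsPushout_hom _ _ h4
  · exact h1.inr_isoIsPushout_hom _ _ h4
  · exact hom_ext ha h2.w
  · change IsWedge b (s ≫ a)
    rw [ha']
    exact HW

end F1Module

/-! ### Push-out products of short exact sequences and of wedges. -/

section
open Limits
variable {C : Type*} [Category* C] [Abelian C]

/-- In an abelian category the push-out of a monomorphism is a monomorphism with the same cokernel.
-/
lemma exists_shortExact_of_isPushout {S : ShortComplex C} (hS : S.ShortExact) {Q R : C} {f : S.X₁ ⟶ Q}
    {j : S.X₂ ⟶ R} {k : Q ⟶ R} (h : IsPushout S.f f j k) :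
    ∃ (π : R ⟶ S.X₃) (w : k ≫ π = 0), j ≫ π = S.g ∧ (ShortComplex.mk k π w).ShortExact := by
  have e : S.f ≫ S.g = f ≫ 0 := by rw [S.zero, comp_zero]
  have h1 : j ≫ h.desc S.g 0 e = S.g := h.inl_desc _ _ e
  have h2 : k ≫ h.desc S.g 0 e = 0 := h.inr_desc _ _ e
  have := hS.mono_f
  have hg := hS.epi_g
  have hk : Mono k := Abelian.mono_inr_of_isColimit _ _ h.isColimit
  have he : Epi (h.desc S.g 0 e) := by
    have : Epi (j ≫ h.desc S.g 0 e) := by rw [h1]; exact hg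
    exact epi_of_epi j _
  refine ⟨_, h2, h1, ⟨ShortComplex.exact_of_g_is_cokernel _
    (CokernelCofork.IsColimit.ofπ' _ _ fun {T} x hx => ?_)⟩⟩
  have hx' : k ≫ x = 0 := hx
  have hj : S.f ≫ j ≫ x = 0 := by rw [h.w_assoc, hx', comp_zero]
  have hd : S.g ≫ hS.exact.desc (j ≫ x) hj = j ≫ x := hS.exact.g_desc _ _
  refine ⟨hS.exact.desc (j ≫ x) hj, h.hom_ext ?_ ?_⟩
  · refine (Category.assoc _ _ _).symm.trans ((congrArg (· ≫ _) h1).trans hd)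
  · refine (Category.assoc _ _ _).symm.trans ((congrArg (· ≫ _) h2).trans ?_)
    rw [zero_comp, hx']

/-- P is an extension of E by C', and D is an extension of F by C'. The map d is the identity on C'
and induces the monomorphism ef on the quotients. Hence it is a monomorphism whose cokernel is the
cokernel G of ef. In the application A = M ⊗ N, B = M' ⊗ N, C' = M ⊗ N', D = M' ⊗ N', and E, F, G
are L ⊗ N, L ⊗ N', L ⊗ L'. -/
lemma shortExact_pushoutProduct {A B E C' F D G P : C} {ab : A ⟶ B} {be : B ⟶ E} {cd : C' ⟶ D}
    {df : D ⟶ F} {ef : E ⟶ F} {fg : F ⟶ G} {ac : A ⟶ C'} {bd : B ⟶ D} {w₁ : ab ≫ be = 0}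
    {w₂ : cd ≫ df = 0} {w₃ : ef ≫ fg = 0} (h₁ : (ShortComplex.mk ab be w₁).ShortExact)
    (h₂ : (ShortComplex.mk cd df w₂).ShortExact) (h₃ : (ShortComplex.mk ef fg w₃).ShortExact)
    (e : be ≫ ef = bd ≫ df) {j : B ⟶ P} {k : C' ⟶ P} (h : IsPushout ab ac j k) {d : P ⟶ D}
    (hj : j ≫ d = bd) (hk : k ≫ d = cd) :
    ∃ w : d ≫ df ≫ fg = 0, (ShortComplex.mk d (df ≫ fg) w).ShortExact := by
  obtain ⟨π, w, hπ, hS⟩ := exists_shortExact_of_isPushout h₁ h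
  have hπ : j ≫ π = be := hπ
  have : Epi be := h₁.epi_g
  have : Epi df := h₂.epi_g
  have : Epi fg := h₃.epi_g
  have : Mono ef := h₃.mono_f
  have : Mono cd := h₂.mono_f
  have e1 : π ≫ ef = d ≫ df := by
    refine h.hom_ext ?_ ?_
    · rw [reassoc_of% hπ, reassoc_of% hj, e]
    · rw [reassoc_of% w, reassoc_of% hk, w₂, zero_comp]
  have w₀ : d ≫ df ≫ fg = 0 := by
    rw [← Category.assoc, ← e1, Category.assoc, w₃, comp_zero]
  have hd : Mono d := by
    -- A morphism killed by d has zero image in E, because ef is a monomorphism; so it factors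
    -- through C', which embeds into D.
    refine Preadditive.mono_of_cancel_zero _ fun {T} x hx => ?_
    have hx1 : x ≫ π = 0 := by
      rw [← cancel_mono ef, Category.assoc, e1, reassoc_of% hx, zero_comp, zero_comp]
    obtain ⟨y, hy⟩ : ∃ y : T ⟶ C', y ≫ k = x :=
      ⟨_, (KernelFork.IsLimit.lift' hS.fIsKernel x hx1).2⟩
    have h0 : y = 0 := by rw [← cancel_mono cd, ← hk, reassoc_of% hy, hx, zero_comp]
    rw [← hy, h0, zero_comp]
  refine ⟨w₀, ⟨ShortComplex.exact_of_g_is_cokernel _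
    (CokernelCofork.IsColimit.ofπ' _ _ fun {T} x hx => ?_)⟩⟩
  have hx : d ≫ x = 0 := hx
  have hc : cd ≫ x = 0 := by rw [← hk, Category.assoc, hx, comp_zero]
  have h4 : df ≫ h₂.exact.desc x hc = x := h₂.exact.g_desc _ _
  have h5 : ef ≫ h₂.exact.desc x hc = 0 := by
    rw [← cancel_epi be, reassoc_of% e, h4, ← hj, Category.assoc, hx, comp_zero, comp_zero]
  have h6 : fg ≫ h₃.exact.desc _ h5 = h₂.exact.desc x hc := h₃.exact.g_desc _ _
  exact ⟨h₃.exact.desc _ h5, (Category.assoc _ _ _).trans ((congrArg (df ≫ ·) h6).trans h4)⟩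

end

namespace OMod
variable {X : MZScheme.{u}} {M N P S T A B C D E F : OMod X.toMonoidalSpace}

lemma tensMap_braid (f : N ⟶ P) :
    tensMap f (𝟙 M) ≫ (braidIso P M).hom = (braidIso N M).hom ≫ tensMap (𝟙 M) f :=
  tens_hom_ext fun V n m => by
    change (braidIso P M).hom.app V.1 ((tensMap f (𝟙 M)).app V.1 (tmul n m)) =
      (tensMap (𝟙 M) f).app V.1 ((braidIso N M).hom.app V.1 (tmul n m))
    rw [tensMap_tmul]
    refine (braid_tmul _ _).trans ?_
    refine Eq.trans ?_ (congrArg _ (braid_tmul n m).symm)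
    rw [tensMap_tmul]

lemma IsWedge.tens_right {i : N ⟶ P} {s : S ⟶ P} (H : IsWedge i s) :
    IsWedge (tensMap i (𝟙 M)) (tensMap s (𝟙 M)) :=
  (H.tens_left M).of_iso (braidIso _ _) (braidIso _ _) (braidIso _ _) (tensMap_braid i)
    (tensMap_braid s)

/-- Here D is the wedge of A and B, and B is the wedge of C and E. As P is the wedge of A and C, the
complement of P in D is E. -/
lemma IsWedge.pushoutProduct {a : A ⟶ D} {b : B ⟶ D} (H : IsWedge a b) {c : C ⟶ B} {e : E ⟶ B}
    (H' : IsWedge c e) {k : A ⟶ P} {l : C ⟶ P} (H'' : IsWedge k l) {d : P ⟶ D} (hk : k ≫ d = a)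
    (hl : l ≫ d = c ≫ b) : IsWedge d (e ≫ b) := by
  obtain ⟨r, hr, hr'⟩ := H.exists_retr
  obtain ⟨q, hq, hq'⟩ := H.symm.exists_retr
  obtain ⟨ρ, hρ, hρ'⟩ := H'.exists_retr
  obtain ⟨σ, hσ, hσ'⟩ := H'.symm.exists_retr
  obtain ⟨x, hx, hx'⟩ := H.exists_desc k (ρ ≫ l)
  refine IsWedge.of_retr (r := x) (r' := q ≫ σ) (H''.hom_ext ?_ ?_) ?_ ?_ fun V y => ?_
  · rw [← Category.assoc, hk, hx, Category.comp_id]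
  · rw [← Category.assoc, hl, Category.assoc, hx', ← Category.assoc, hρ, Category.comp_id,
      Category.id_comp]
  · rw [Category.assoc, ← Category.assoc b, hq, Category.id_comp, hσ]
  · rw [Category.assoc, hx', ← Category.assoc, hρ', zeroHom_comp]
  · rcases H.cover V y with ⟨n, rfl⟩ | ⟨t, rfl⟩
    · exact Or.inl ⟨k.app V.1 n, app_congr hk V.1 n⟩
    · rcases H'.cover V t with ⟨m, rfl⟩ | ⟨m, rfl⟩
      · exact Or.inl ⟨l.app V.1 m, app_congr hl V.1 m⟩
      · exact Or.inr ⟨m, rfl⟩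

end OMod

/-! ### Tensor products of componentwise exact sequences and push-outs. -/

namespace F1Module
open Limits OMod MZScheme MonoidalCategory
variable {𝒳 : F1Scheme.{u}} {L M N P Q R T L' M' N' : F1Module 𝒳}

lemma CompExact.of_iso {φ : L ⟶ M} {ψ : M ⟶ N} (h : CompExact φ ψ) {φ' : L' ⟶ M'} {ψ' : M' ⟶ N'}
    (a : L' ≅ L) (b : M' ≅ M) (c : N' ≅ N) (h₁ : φ' ≫ b.hom = a.hom ≫ φ)
    (h₂ : ψ' ≫ c.hom = b.hom ≫ ψ) : CompExact φ' ψ' := by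
  obtain ⟨⟨s, H, h3, h4⟩, w, hS⟩ := h
  let F : F1Module 𝒳 ⥤ OMod 𝒳.tilde.toMonoidalSpace :=
    { obj M := M.fst, map f := f.fst, map_id _ := rfl, map_comp _ _ := rfl }
  let G : F1Module 𝒳 ⥤ 𝒳.base.Modules :=
    { obj M := M.snd, map f := f.snd, map_id _ := rfl, map_comp _ _ := rfl }
  have f1 : φ'.fst ≫ (F.mapIso b).hom = (F.mapIso a).hom ≫ φ.fst := congrArg Hom.fst h₁
  have f2 : ψ'.fst ≫ (F.mapIso c).hom = (F.mapIso b).hom ≫ ψ.fst := congrArg Hom.fst h₂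
  have g1 : φ'.snd ≫ (G.mapIso b).hom = (G.mapIso a).hom ≫ φ.snd := congrArg Hom.snd h₁
  have g2 : ψ'.snd ≫ (G.mapIso c).hom = (G.mapIso b).hom ≫ ψ.snd := congrArg Hom.snd h₂
  have w' : φ'.snd ≫ ψ'.snd = 0 := by
    rw [← cancel_mono (G.mapIso c).hom, Category.assoc, g2, ← Category.assoc, g1, Category.assoc, w,
      comp_zero, zero_comp]
  refine ⟨⟨(F.mapIso c).hom ≫ s ≫ (F.mapIso b).inv, H.of_iso (F.mapIso a) (F.mapIso b) (F.mapIso c)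
    f1 ?_, ?_, ?_⟩, w', ?_⟩
  · rw [Category.assoc, Category.assoc, Iso.inv_hom_id, Category.comp_id]
  · rw [← cancel_mono (F.mapIso c).hom, Category.assoc, f2, ← Category.assoc, f1, Category.assoc, h3]
    exact (zeroHom_comp _).symm
  · rw [← cancel_mono (F.mapIso c).hom, Category.assoc, f2, Category.assoc, Category.assoc,
      Iso.inv_hom_id_assoc, h4, Category.comp_id, Category.id_comp]
  · exact ShortComplex.shortExact_of_iso (S₁ := ShortComplex.mk φ.snd ψ.snd w)
      (S₂ := ShortComplex.mk φ'.snd ψ'.snd w')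
      (ShortComplex.isoMk (G.mapIso a) (G.mapIso b) (G.mapIso c) g1.symm g2.symm).symm hS

end F1Module

namespace F1Module
open Limits OMod MZScheme MonoidalCategory
variable {𝒳 : F1Scheme.{u}} {L M N P Q R T L' M' N' : F1Module 𝒳}

/-- Wedges survive tensoring with any module. On second components the tensor product is right
exact, and it preserves monomorphisms because T.snd is a vector bundle. -/
lemma CompExact.tens_left {φ : L ⟶ M} {ψ : M ⟶ N} (h : CompExact φ ψ) (hT : IsVB T.snd) :
    CompExact (T ◁ φ) (T ◁ ψ) := by
  obtain ⟨⟨s, H, h1, h2⟩, w, hS⟩ := h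
  have hm : Mono φ.snd := hS.mono_f
  have he : Epi ψ.snd := hS.epi_g
  have w' : (tensL T.snd).map φ.snd ≫ (tensL T.snd).map ψ.snd = 0 := by
    rw [← Functor.map_comp, w, Functor.map_zero]
  refine ⟨⟨tensMap (𝟙 _) s, H.tens_left T.fst, ?_, ?_⟩, w', ?_⟩
  · exact (tensMap_comp _ _ _ _).trans ((congrArg₂ tensMap (Category.comp_id _) h1).trans (tensMap_zeroHom _ _ _))
  · exact (tensMap_comp _ _ _ _).trans ((congrArg₂ tensMap (Category.comp_id _) h2).trans tensMap_id)
  · have hex := hS.exact.map_of_epi_of_preservesCokernel (tensL T.snd)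
      (inferInstanceAs (Epi ψ.snd)) inferInstance
    have h1 : Mono ((tensL T.snd).map φ.snd) := hT.mono_tens φ.snd
    have h2 : Epi ((tensL T.snd).map ψ.snd) := inferInstance
    exact @ShortComplex.ShortExact.mk _ _ _ (ShortComplex.mk _ _ w') hex h1 h2

lemma CompExact.tens_right {φ : L ⟶ M} {ψ : M ⟶ N} (h : CompExact φ ψ) (hT : IsVB T.snd) :
    CompExact (φ ▷ T) (ψ ▷ T) :=
  (h.tens_left hT).of_iso (β_ L T) (β_ M T) (β_ N T) (BraidedCategory.braiding_naturality_left φ T)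
    (BraidedCategory.braiding_naturality_left ψ T)

lemma CompPO.tens_left {S : OMod 𝒳.tilde.toMonoidalSpace} {s : S ⟶ P.fst} {i : N ⟶ P} {f : N ⟶ Q}
    {j : P ⟶ R} {k : Q ⟶ R} (h : CompPO s i f j k) :
    CompPO (P := T ⊗ P) (tensMap (𝟙 T.fst) s) (T ◁ i) (T ◁ f) (T ◁ j) (T ◁ k) := by
  refine ⟨?_, h.wedge.tens_left T.fst, ?_, h.snd.map (tensL T.snd)⟩
  · rw [← whiskerLeft_comp, h.w, whiskerLeft_comp]
  · have := h.wedge'.tens_left T.fst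
    have e : tensMap (𝟙 T.fst) s ≫ tensMap (𝟙 T.fst) j.fst = tensMap (𝟙 T.fst) (s ≫ j.fst) :=
      (tensMap_comp _ _ _ _).trans (congrArg₂ tensMap (Category.comp_id _) rfl)
    rw [← e] at this
    exact this

lemma CompPO.of_iso {S : OMod 𝒳.tilde.toMonoidalSpace} {s : S ⟶ P.fst} {i : N ⟶ P} {f : N ⟶ Q}
    {j : P ⟶ R} {k : Q ⟶ R} (h : CompPO s i f j k) {j' : P ⟶ T} {k' : Q ⟶ T} (e : R ≅ T)
    (hj : j ≫ e.hom = j') (hk : k ≫ e.hom = k') : CompPO s i f j' k' := by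
  let F : F1Module 𝒳 ⥤ OMod 𝒳.tilde.toMonoidalSpace :=
    { obj M := M.fst, map f := f.fst, map_id _ := rfl, map_comp _ _ := rfl }
  let G : F1Module 𝒳 ⥤ 𝒳.base.Modules :=
    { obj M := M.snd, map f := f.snd, map_id _ := rfl, map_comp _ _ := rfl }
  subst hj hk
  refine ⟨by rw [reassoc_of% h.w], h.wedge, h.wedge'.of_iso (Iso.refl _) (F.mapIso e).symm (Iso.refl _)
    ?_ ?_, h.snd.of_iso (Iso.refl _) (Iso.refl _) (Iso.refl _) (G.mapIso e) ?_ ?_ ?_ ?_⟩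
  · rw [Iso.symm_hom, Iso.comp_inv_eq]
    exact congrArg (· ≫ e.hom.fst) (Category.id_comp k.fst).symm
  · rw [Iso.symm_hom, Iso.comp_inv_eq, Iso.refl_hom, Category.id_comp, Category.assoc]
    rfl
  · exact (Category.comp_id _).trans (Category.id_comp _).symm
  · exact (Category.comp_id _).trans (Category.id_comp _).symm
  · exact (Category.id_comp _).symm
  · exact (Category.id_comp _).symm

/-- The quotient of the push-out product is L ⊗ L', reached through M' ⊗ N' → L ⊗ N' → L ⊗ L'. On
first components M' ⊗ N' is the wedge of M ⊗ N' and L ⊗ N', the latter is the wedge of L ⊗ N and L ⊗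
L', and the push-out is the wedge of M ⊗ N' and L ⊗ N. -/
lemma CompPO.compExact {f : M ⟶ M'} {ψ : M' ⟶ L} {g : N ⟶ N'} {χ : N' ⟶ L'} (hf : CompExact f ψ)
    (hg : CompExact g χ) {s : L.fst ⟶ M'.fst} (hs : IsWedge f.fst s) (hs' : s ≫ ψ.fst = 𝟙 _)
    (hN : IsVB N.snd) (hN' : IsVB N'.snd) (hL : IsVB L.snd) {j : M' ⊗ N ⟶ P} {k : M ⊗ N' ⟶ P}
    (h : CompPO (P := M' ⊗ N) (tensMap s (𝟙 N.fst)) (f ▷ N) (M ◁ g) j k) {d : P ⟶ M' ⊗ N'}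
    (hj : j ≫ d = M' ◁ g) (hk : k ≫ d = f ▷ N') : CompExact d (ψ ▷ N' ≫ L ◁ χ) := by
  obtain ⟨t, Ht, ht, ht'⟩ := hg.exists_wedge
  have H₁ : IsWedge (tensMap f.fst (𝟙 N'.fst)) (tensMap s (𝟙 N'.fst)) := hs.tens_right
  have H₂ : IsWedge (tensMap (𝟙 L.fst) g.fst) (tensMap (𝟙 L.fst) t) := Ht.tens_left L.fst
  have e1 : (tensMap s (𝟙 N.fst) ≫ j.fst) ≫ d.fst =
      tensMap (𝟙 L.fst) g.fst ≫ tensMap s (𝟙 N'.fst) := by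
    refine (Category.assoc _ _ _).trans ((congrArg (tensMap s (𝟙 N.fst) ≫ ·)
      (congrArg Hom.fst hj)).trans ?_)
    refine (tensMap_comp _ _ _ _).trans (Eq.trans ?_ (tensMap_comp _ _ _ _).symm)
    exact congrArg₂ tensMap ((Category.comp_id s).trans (Category.id_comp s).symm)
      ((Category.id_comp g.fst).trans (Category.comp_id g.fst).symm)
  have H := H₁.pushoutProduct H₂ h.wedge' (congrArg Hom.fst hk) e1
  have e2 : (tensMap (𝟙 L.fst) t ≫ tensMap s (𝟙 N'.fst)) ≫ tensMap ψ.fst (𝟙 N'.fst) ≫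
      tensMap (𝟙 L.fst) χ.fst = 𝟙 _ := by
    rw [Category.assoc, ← Category.assoc (tensMap s _), tensMap_comp, hs', Category.comp_id,
      tensMap_id, Category.id_comp, tensMap_comp, ht', Category.comp_id, tensMap_id]
  obtain ⟨⟨s₁, -, e3, -⟩, w₁, S₁⟩ := hf.tens_right hN'
  obtain ⟨⟨s₂, -, e4, -⟩, w₂, S₂⟩ := hg.tens_left hL
  obtain ⟨-, w₃, S₃⟩ := hf.tens_right hN
  refine ⟨⟨_, H, h.wedge'.hom_ext ?_ ?_, e2⟩, ?_⟩
  · rw [← Category.assoc]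
    refine (congrArg (· ≫ _) (congrArg Hom.fst hk)).trans ?_
    refine (Category.assoc _ _ _).symm.trans ((congrArg (· ≫ (L ◁ χ).fst) e3).trans ?_)
    rw [zeroHom_comp, comp_zeroHom]
  · rw [← Category.assoc]
    refine (congrArg (· ≫ _) e1).trans ?_
    refine (Category.assoc _ _ _).trans ?_
    refine (congrArg (tensMap (𝟙 L.fst) g.fst ≫ ·) ?_).trans (e4.trans (comp_zeroHom _).symm)
    refine (Category.assoc _ _ _).symm.trans ?_
    refine (congrArg (· ≫ (L ◁ χ).fst) ((tensMap_comp _ _ _ _).trans ?_)).trans (Category.id_comp _)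
    exact (congrArg₂ tensMap hs' (Category.comp_id _)).trans tensMap_id
  · exact shortExact_pushoutProduct S₃ S₁ S₂ (congrArg Hom.snd (whisker_exchange ψ g)).symm h.snd
      (congrArg Hom.snd hj) (congrArg Hom.snd hk)

end F1Module

/-! ### Bi-exactness of the tensor product on Bun. -/

open F1Module OMod MZScheme
namespace F1Module
open Limits MonoidalCategory
variable {𝒳 : F1Scheme.{u}} {L M N P Q R Z : F1Module 𝒳}

lemma isQuasicoherent_of_isLocallyFree {X : Scheme.{u}} (M : SheafOfModules.{u} X.ringCatSheaf)
    (_ : M.IsLocallyFree) : M.IsQuasicoherent := inferInstance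

/-- Locally projective and locally free components. -/
structure IsB (M : F1Module 𝒳) : Prop where
  qc : M.fst.IsQC
  fg : M.fst.IsFG
  proj : M.fst.IsProj
  vb : IsVB M.snd

lemma isB (M : Bun 𝒳) : IsB M.obj.obj :=
  have h := (isBun_iff 𝒳 M.obj).1 M.property
  ⟨isQCoh_iff.1 M.obj.property.1, h.1, h.2.1, h.2.2⟩

/-- The object of `Bun 𝒳`. -/
def IsB.bun (h : IsB M) : Bun 𝒳 :=
  ⟨⟨M, isQCoh_iff.2 h.qc, isQuasicoherent_of_isLocallyFree _ h.vb.isLocallyFree.1⟩, (isBun_iff 𝒳 _).2 ⟨h.fg, h.proj, h.vb⟩⟩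

/-- The morphism of `Bun 𝒳`. -/
def bunHom {M N : Bun 𝒳} (f : M.obj.obj ⟶ N.obj.obj) : M ⟶ N :=
  ObjectProperty.homMk (ObjectProperty.homMk f)

lemma isB_zeroObj : IsB (zeroObj 𝒳) :=
  ⟨isZ_zeroMod.isQC, isZ_zeroMod.isFG, isZ_zeroMod.isProj, isVB_of_isZero (isZero_zero _)⟩

/-- The first component of R is the wedge of Q̃ and Z̃, and its second component is an extension of
Z by Q, hence again a vector bundle. -/
lemma CompPO.isB {s : Z.fst ⟶ P.fst} {i : N ⟶ P} {f : N ⟶ Q}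
    {j : P ⟶ R} {k : Q ⟶ R} (h : CompPO s i f j k) {p : P ⟶ Z} (hp : CompExact i p) (hQ : IsB Q) (hZ : IsB Z) : IsB R := by
  obtain ⟨w, hS⟩ := hp.exists_shortExact
  obtain ⟨π, w', -, h'⟩ := exists_shortExact_of_isPushout hS h.snd
  exact ⟨h.wedge'.isQC hQ.qc hZ.qc,
    h.wedge'.isFG hQ.fg hZ.fg, h.wedge'.isProj hQ.proj hZ.proj,
    IsVB.of_shortExact h' hQ.vb hZ.vb⟩

end F1Module

section
open MonoidalCategory
variable {𝒳 : F1Scheme.{u}} {M N P Q R Z : Bun 𝒳}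

/-- Projectivity of the first components of objects of Bun is what makes admissible sequences split
there. -/
lemma isKAdmissibleMono_iff {f : M ⟶ N} :
    IsKAdmissibleMono f ↔ ∃ (P : Bun 𝒳) (g : N ⟶ P), CompExact f.hom.hom g.hom.hom :=
  ⟨fun ⟨P, g, h⟩ => ⟨P, g, h.compExact (isB N).qc (isB N).proj (isB P).qc (isB P).proj⟩,
    fun ⟨P, g, h⟩ => ⟨P, g, h.isAdmissible⟩⟩

lemma isPushout_bun {i : N ⟶ P} {f : N ⟶ Q} {j : P ⟶ R} {k : Q ⟶ R}
    (h : IsPushout i.hom.hom f.hom.hom j.hom.hom k.hom.hom) : IsPushout i f j k :=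
  IsPushout.of_map ((isBun 𝒳).ι ⋙ (isQCoh 𝒳).ι)
    (ObjectProperty.hom_ext _ (ObjectProperty.hom_ext _ h.w)) h

lemma exists_compPO_bun {i : N ⟶ P} {p : P ⟶ Z} (h : CompExact i.hom.hom p.hom.hom)
    {s : Z.obj.obj.fst ⟶ P.obj.obj.fst} (H : IsWedge i.hom.hom.fst s) (f : N ⟶ Q) :
    ∃ (R : Bun 𝒳) (j : P ⟶ R) (k : Q ⟶ R), CompPO s i.hom.hom f.hom.hom j.hom.hom k.hom.hom := by
  obtain ⟨R, j, k, hR⟩ := exists_compPO h H f.hom.hom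
  exact ⟨(hR.isB h (isB Q) (isB Z)).bun, bunHom j, bunHom k, hR⟩

/-- The componentwise push-out lies in Bun and is a push-out there, so any other push-out in Bun is
isomorphic to it and has the same componentwise description. -/
lemma compPO_of_isPushout {i : N ⟶ P} {p : P ⟶ Z} (h : CompExact i.hom.hom p.hom.hom)
    {s : Z.obj.obj.fst ⟶ P.obj.obj.fst} (H : IsWedge i.hom.hom.fst s) {f : N ⟶ Q} {j : P ⟶ R}
    {k : Q ⟶ R} (h' : IsPushout i f j k) :
    CompPO s i.hom.hom f.hom.hom j.hom.hom k.hom.hom := by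
  obtain ⟨R', j', k', hR⟩ := exists_compPO_bun h H f
  have h'' := isPushout_bun hR.isPushout
  let e := ((isBun 𝒳).ι ⋙ (isQCoh 𝒳).ι).mapIso (h''.isoIsPushout _ _ h')
  exact hR.of_iso e (congrArg (fun t => t.hom.hom) (h''.inl_isoIsPushout_hom _ _ h'))
    (congrArg (fun t => t.hom.hom) (h''.inr_isoIsPushout_hom _ _ h'))

/-- The zero module lies in Bun, so a zero object of Bun is isomorphic to it. -/
lemma isZero_bun_iff {O : Bun 𝒳} :
    Limits.IsZero O ↔ O.obj.obj.fst.IsZ ∧ Limits.IsZero O.obj.obj.snd := by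
  have h0 : Limits.IsZero (isB_zeroObj (𝒳 := 𝒳)).bun :=
    Limits.IsZero.of_full_of_faithful_of_isZero ((isBun 𝒳).ι ⋙ (isQCoh 𝒳).ι) _ isZero_zeroObj
  refine ⟨fun h => ?_, fun h => Limits.IsZero.of_full_of_faithful_of_isZero
    ((isBun 𝒳).ι ⋙ (isQCoh 𝒳).ι) _ (isZero_of h.1 h.2)⟩
  have h1 : Limits.IsZero O.obj.obj :=
    isZero_zeroObj.of_iso (((isBun 𝒳).ι ⋙ (isQCoh 𝒳).ι).mapIso (h.iso h0))
  exact ⟨isZ_fst h1, isZero_snd h1⟩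

lemma isBiexact : IsBiexact 𝒳 where
  exists_zero := ⟨isB_zeroObj.bun, isZero_bun_iff.2 ⟨isZ_zeroMod, Limits.isZero_zero _⟩⟩
  tensor_zero M O h := by
    have h := isZero_bun_iff.1 h
    exact isZero_bun_iff.2 ⟨h.1.tens_right, (tensL M.obj.obj.snd).map_isZero h.2⟩
  zero_tensor O M h := by
    have h := isZero_bun_iff.1 h
    have h' : Limits.IsZero (M ⊗ O) :=
      isZero_bun_iff.2 ⟨h.1.tens_right, (tensL M.obj.obj.snd).map_isZero h.2⟩
    exact h'.of_iso (β_ O M)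
  iso_left M N P f _ := inferInstance
  iso_right M N P f _ := inferInstance
  mono_left M N P f h := by
    obtain ⟨Z, p, h⟩ := isKAdmissibleMono_iff.1 h
    exact isKAdmissibleMono_iff.2 ⟨M ⊗ Z, M ◁ p, h.tens_left (isB M).vb⟩
  mono_right M N P f h := by
    obtain ⟨Z, p, h⟩ := isKAdmissibleMono_iff.1 h
    exact isKAdmissibleMono_iff.2 ⟨Z ⊗ M, p ▷ M, h.tens_right (isB M).vb⟩
  pushout_left M N P Q R i f j k hi h := by
    obtain ⟨Z, p, hp⟩ := isKAdmissibleMono_iff.1 hi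
    obtain ⟨s, H, -⟩ := hp.exists_wedge
    exact isPushout_bun (compPO_of_isPushout hp H h).tens_left.isPushout
  pushout_right M N P Q R i f j k hi h := by
    obtain ⟨Z, p, hp⟩ := isKAdmissibleMono_iff.1 hi
    obtain ⟨s, H, -⟩ := hp.exists_wedge
    have h' : IsPushout (M ◁ i) (M ◁ f) (M ◁ j) (M ◁ k) :=
      isPushout_bun (compPO_of_isPushout hp H h).tens_left.isPushout
    exact h'.of_iso (β_ _ _) (β_ _ _) (β_ _ _) (β_ _ _)
      (BraidedCategory.braiding_naturality_right _ _) (BraidedCategory.braiding_naturality_right _ _)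
      (BraidedCategory.braiding_naturality_right _ _) (BraidedCategory.braiding_naturality_right _ _)
  exists_pushout {M M' N N'} f g hf hg := by
    obtain ⟨L, ψ, hψ⟩ := isKAdmissibleMono_iff.1 hf
    obtain ⟨s, H, -⟩ := hψ.exists_wedge
    obtain ⟨R, j, k, h⟩ := exists_compPO_bun (i := f ▷ N) (p := ψ ▷ N) (hψ.tens_right (isB N).vb)
      H.tens_right (M ◁ g)
    exact (isPushout_bun h.isPushout).hasPushout
  pushoutProduct {M M' N N' P} f g j k h hf hg := by
    obtain ⟨L, ψ, hψ⟩ := isKAdmissibleMono_iff.1 hf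
    obtain ⟨L', χ, hχ⟩ := isKAdmissibleMono_iff.1 hg
    obtain ⟨s, H, -, hs⟩ := hψ.exists_wedge
    have h' := compPO_of_isPushout (i := f ▷ N) (p := ψ ▷ N) (hψ.tens_right (isB N).vb) H.tens_right h
    -- The quotient of the push-out product is the tensor product of the two quotients.
    refine isKAdmissibleMono_iff.2 ⟨L ⊗ L', ψ ▷ N' ≫ L ◁ χ, CompPO.compExact hψ hχ H hs (isB N).vb
      (isB N').vb (isB L).vb h' ?_ ?_⟩
    · exact congrArg (fun t : _ ⟶ M' ⊗ N' => t.hom.hom) (h.inl_desc _ _ (whisker_exchange f g).symm)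
    · exact congrArg (fun t : _ ⟶ M' ⊗ N' => t.hom.hom) (h.inr_desc _ _ (whisker_exchange f g).symm)

end

end F1
end

theorem mainTheorem10 (𝒳 : F1.F1Scheme.{u}) :
    ∃ (_ : MonoidalCategory (F1.QCoh 𝒳)) (_ : SymmetricCategory (F1.QCoh 𝒳)),
      Nonempty (F1.ComponentwiseTensor 𝒳) ∧
      ∃ _ : (F1.isBun 𝒳).IsMonoidal, F1.IsBiexact 𝒳 := by
  exact ⟨inferInstance, inferInstance, ⟨F1.componentwiseTensor 𝒳⟩, inferInstance, F1.isBiexact⟩
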